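/- Let $d\ge 2$ and let $\Omega\subset\mathbb R^d$ be a polytopal (for $d=2$ polygonal, for $d=3$ polyhedral) domain, i.e. a connected open set that is the interior of a finite union of $d$-dimensional convex polytopes. Let $a=(a_{ij}):\Omega\to\mathbb R^{d\times d}$ be measurable and symmetric with $\alpha|\xi|^2\le \xi^Ta(x)\xi\le\beta|\xi|^2$ for all $x\in\Omega$, $\xi\in\mathbb R^d$ and some constants $\alpha,\beta>0$. Let $p\in(1,\infty)$ and assume that $\mathcal L=\sum_{i,j}a_{ij}\partial^2_{ij}$ with the homogeneous Dirichlet condition has $W^{2,p}$-regularity: there is a constant $C$ such that for every $f\in L^p(\Omega)$ the equation $\mathcal L\psi=f$ a.e. in $\Omega$ has a solution $\psi\in W^{2,p}(\Omega)\cap W^{1,p}_0(\Omega)$, and every such solution satisfies $\|\psi\|_{2,p}\le C\|f\|_{0,p}$. Let $\mathcal T_h$ denote a finite partition of $\Omega$ into closed polytopal elements $T$ (not necessarily convex, with connected interiors), whose boundaries are unions of flat faces $e$ (edges if $d=2$); distinct faces do not overlap, so that each interior face is shared by two elements. Let $h_T$ be the diameter of $T$ and $h=\max_T h_T$ the mesh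 size. Let $k\ge2$ and $l\in\{k-2,k-1\}$. Let $V_h^0$ be the space of triplets $v=\{v_0,v_b,\mathbf v_g\}$ with $v_0|_T\in P_k(T)$ for each element $T$, and with $v_b|_e\in P_k(e)$ and $\mathbf v_g|_e\in[P_{k-1}(e)]^d$ single-valued on each face $e$, such that $v_b=0$ on the faces $e\subset\partial\Omega$. Let $W_h$ be the space of piecewise polynomials $w$ with $w|_T\in P_l(T)$. For $v\in V_h^0$ let $\partial^2_{ij,w}v\in W_h$ be given on each $T$, with outward unit normal $\mathbf n$, by $$(\partial_{ij,w}^2v,\psi)_T=(v_0,\partial_{ji}^2\psi)_T-\langle v_bn_i,\partial_j\psi\rangle_{\partial T}+\langle v_{gi},\psi n_j\rangle_{\partial T}\qquad\forall\psi\in P_l(T),$$ and let $\mathcal L_wv=\sum_{i,j}a_{ij}\partial^2_{ij,w}v$. For $f\in L^p(\Omega)$ put $$S_h=\{v\in V_h^0:\ (\mathcal L_wv,w)=(f,w)\ \ \forall w\in W_h\},$$ $$s(v)=\frac1p\sum_{T}\int_{\partial T}\left(h_T^{1-2p}|v_0-v_b|^p+h_T^{1-p}|\nabla v_0-\mathbf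 v_g|^p\right)ds,$$ where $|\cdot|$ on vectors is either the Euclidean norm or the $\ell^p$ norm (so that $|\mathbf w|^p=\sum_i|w_i|^p$). Then for every $\rho>0$ there is $h_0>0$, depending only on $\Omega,a,p,k,l,\rho$ and the choice of $|\cdot|$, such that the following holds for every partition $\mathcal T_h$ with $h<h_0$ for which each $a_{ij}$ is continuous on each element up to its boundary (i.e. uniformly continuous in the interior of each $T$) and which is shape regular with parameter $\rho$ (for each $T$ there is an invertible affine map $A$ of $\mathbb R^d$ with $B(0,\rho)\subset A(T)\subset \overline{B(0,1)}$): for every $f\in L^p(\Omega)$ the constrained minimization problem $u_h=\operatorname{arg\,min}_{v\in S_h}s(v)$ has one and only one solution. -/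

import Mathlib

open MeasureTheory Filter Topology
open scoped ENNReal NNReal ContDiff

noncomputable section

namespace LpWG

/-- Euclidean space `ℝ^d`. -/
abbrev E (d : ℕ) : Type := EuclideanSpace ℝ (Fin d)

/-! ### Sobolev functions on an open set -/

/-- Lebesgue measure on `Ω`. -/
abbrev vol {d : ℕ} (Ω : Set (E d)) : Measure (E d) := volume.restrict Ω

/-- The classical partial derivative `∂_i φ`. -/
def partialD {d : ℕ} (i : Fin d) (φ : E d → ℝ) (x : E d) : ℝ :=
  fderiv ℝ φ x (EuclideanSpace.single i 1)

/-- `φ ∈ C_c^∞(Ω)`. -/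
def IsTestFunction {d : ℕ} (Ω : Set (E d)) (φ : E d → ℝ) : Prop :=
  ContDiff ℝ ∞ φ ∧ HasCompactSupport φ ∧ tsupport φ ⊆ Ω

/-- `g` is the weak derivative `∂_i u` on `Ω`. -/
def HasWeakPartial {d : ℕ} (Ω : Set (E d)) (i : Fin d) (u g : E d → ℝ) : Prop :=
  ∀ φ : E d → ℝ, IsTestFunction Ω φ →
    ∫ x in Ω, u x * partialD i φ x = - ∫ x in Ω, g x * φ x

/-- `u ∈ W^{2,p}(Ω)`, with weak gradient `G` and weak Hessian `H`. -/
structure IsW2p {d : ℕ} (Ω : Set (E d)) (p : ℝ) (u : E d → ℝ) (G : Fin d → E d → ℝ)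
    (H : Fin d → Fin d → E d → ℝ) : Prop where
  memLp_fun : MemLp u (ENNReal.ofReal p) (vol Ω)
  memLp_grad : ∀ i, MemLp (G i) (ENNReal.ofReal p) (vol Ω)
  memLp_hess : ∀ i j, MemLp (H i j) (ENNReal.ofReal p) (vol Ω)
  weak_grad : ∀ i, HasWeakPartial Ω i u (G i)
  weak_hess : ∀ i j, HasWeakPartial Ω j (G i) (H i j)

/-- `u`, with weak gradient `G`, belongs to `W_0^{1,p}(Ω)`, the closure of `C_c^∞(Ω)` for the
`W^{1,p}` norm. -/
def IsW01p {d : ℕ} (Ω : Set (E d)) (p : ℝ) (u : E d → ℝ) (G : Fin d → E d → ℝ) : Prop :=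
  ∃ φ : ℕ → E d → ℝ, (∀ n, IsTestFunction Ω (φ n)) ∧
    Tendsto (fun n => eLpNorm (fun x => u x - φ n x) (ENNReal.ofReal p) (vol Ω)) atTop (𝓝 0) ∧
    ∀ i, Tendsto (fun n => eLpNorm (fun x => G i x - partialD i (φ n) x)
      (ENNReal.ofReal p) (vol Ω)) atTop (𝓝 0)

/-- The norm `‖u‖_{2,p}`, for `u` with weak gradient `G` and weak Hessian `H`. -/
def normW2p {d : ℕ} (Ω : Set (E d)) (p : ℝ) (u : E d → ℝ) (G : Fin d → E d → ℝ)
    (H : Fin d → Fin d → E d → ℝ) : ℝ≥0∞ :=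
  (eLpNorm u (ENNReal.ofReal p) (vol Ω) ^ p
    + ∑ i, eLpNorm (G i) (ENNReal.ofReal p) (vol Ω) ^ p
    + ∑ i, ∑ j, eLpNorm (H i j) (ENNReal.ofReal p) (vol Ω) ^ p) ^ (1 / p)

/-- `𝓛 = ∑ a_ij ∂²_ij` with the homogeneous Dirichlet condition has the `W^{2,p}` regularity:
for each `f ∈ L^p(Ω)` the problem `𝓛 ψ = f` a.e. in `Ω` has a solution
`ψ ∈ W^{2,p}(Ω) ∩ W_0^{1,p}(Ω)`, and solutions obey `‖ψ‖_{2,p} ≤ C ‖f‖_{0,p}` with `C`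
independent of `f`. -/
def W2pRegular {d : ℕ} (Ω : Set (E d)) (a : E d → Matrix (Fin d) (Fin d) ℝ) (p : ℝ) : Prop :=
  ∃ C : ℝ≥0, ∀ f : E d → ℝ, MemLp f (ENNReal.ofReal p) (vol Ω) →
    (∃ u G H, IsW2p Ω p u G H ∧ IsW01p Ω p u G ∧
      ∀ᵐ x ∂(vol Ω), ∑ i, ∑ j, a x i j * H i j x = f x) ∧
    ∀ u G H, IsW2p Ω p u G H → IsW01p Ω p u G →
      (∀ᵐ x ∂(vol Ω), ∑ i, ∑ j, a x i j * H i j x = f x) →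
      normW2p Ω p u G H ≤ C * eLpNorm f (ENNReal.ofReal p) (vol Ω)

/-! ### Polytopes and polytopal partitions -/

/-- `S` is a (not necessarily convex) closed polytope of pure dimension `m`: it is a finite
nonempty union of `m`-dimensional convex polytopes, all in the same `m`-dimensional affine
subspace. -/
def IsPolytope {d : ℕ} (m : ℕ) (S : Set (E d)) : Prop :=
  ∃ A : AffineSubspace ℝ (E d), Module.finrank ℝ A.direction = m ∧
    ∃ F : Finset (Finset (E d)), F.Nonempty ∧
      (∀ V ∈ F, affineSpan ℝ (V : Set (E d)) = A) ∧
      S = ⋃ V ∈ F, convexHull ℝ (V : Set (E d))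

/-- A polygonal (`d = 2`), polyhedral (`d = 3`), … domain: a connected open set which is the
interior of a `d`-dimensional polytope. -/
def IsPolytopalDomain {d : ℕ} (Ω : Set (E d)) : Prop :=
  IsConnected Ω ∧ ∃ P : Set (E d), IsPolytope d P ∧ Ω = interior P

/-- Surface measure: the `(d-1)`-dimensional Hausdorff measure, normalised so that it agrees
with Lebesgue measure on hyperplanes. -/
abbrev surf (d : ℕ) : Measure (E d) := Measure.euclideanHausdorffMeasure (d - 1)

/-- `n` is the outward unit normal to `T` on the flat piece `e` of its boundary. -/
def IsOutwardNormal {d : ℕ} (T e : Set (E d)) (n : E d) : Prop :=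
  ‖n‖ = 1 ∧ (∀ x ∈ e, ∀ y ∈ e, inner ℝ n (x - y) = 0) ∧
    ∀ᵐ x ∂((surf d).restrict e), ∀ᶠ t : ℝ in 𝓝[>] 0, x + t • n ∉ T ∧ x - t • n ∈ T

/-- A finite partition of `Ω` into polytopal elements, together with the set of its faces
(edges if `d = 2`). The boundary of each element is a union of faces, and distinct faces do not
overlap; so an interior face belongs to two elements. -/
structure Mesh {d : ℕ} (Ω : Set (E d)) where
  numElems : ℕ
  numFaces : ℕ
  elem : Fin numElems → Set (E d)
  face : Fin numFaces → Set (E d)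
  isPolytope_elem : ∀ t, IsPolytope d (elem t)
  isConnected_elem : ∀ t, IsConnected (interior (elem t))
  disjoint_elem : Pairwise fun s t => Disjoint (interior (elem s)) (interior (elem t))
  iUnion_elem : ⋃ t, elem t = closure Ω
  isPolytope_face : ∀ e, IsPolytope (d - 1) (face e)
  isConnected_face : ∀ e, IsConnected (face e)
  overlap_face : Pairwise fun e e' => surf d (face e ∩ face e') = 0
  exists_elem : ∀ e, ∃ t, face e ⊆ frontier (elem t)
  frontier_elem : ∀ t, frontier (elem t) = ⋃ e ∈ {e | face e ⊆ frontier (elem t)}, face e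
  /-- `normal t e` is the outward normal of the element `t` on its face `e`
  (and is not used if `e` is not a face of `t`). -/
  normal : Fin numElems → Fin numFaces → E d
  normal_spec : ∀ t e, face e ⊆ frontier (elem t) →
    IsOutwardNormal (elem t) (face e) (normal t e)

namespace Mesh

variable {d : ℕ} {Ω : Set (E d)}

/-- The diameter `h_T` of an element. -/
def diam (M : Mesh Ω) (t : Fin M.numElems) : ℝ := Metric.diam (M.elem t)

/-- The mesh size `h = max_T h_T`. -/
def meshSize (M : Mesh Ω) : ℝ := ⨆ t, M.diam t

open Classical in
/-- The faces of an element. -/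
def facesOf (M : Mesh Ω) (t : Fin M.numElems) : Finset (Fin M.numFaces) :=
  Finset.univ.filter fun e => M.face e ⊆ frontier (M.elem t)

/-- Shape regularity with parameter `ρ`: up to an affine change of variables (possibly a
different one for each element) the element lies in the unit ball and contains the ball of radius
`ρ`. It follows from the usual condition that the element contains a ball of radius comparable to
its diameter, and it holds for every convex element if `ρ ≤ 1 / d`. -/
def ShapeRegular (M : Mesh Ω) (ρ : ℝ) : Prop :=
  ∀ t, ∃ A : E d ≃ᵃ[ℝ] E d,
    Metric.ball 0 ρ ⊆ A '' M.elem t ∧ A '' M.elem t ⊆ Metric.closedBall 0 1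

end Mesh

/-! ### Weak finite element functions -/

/-- The value of a polynomial at a point. -/
def ev {d : ℕ} (P : MvPolynomial (Fin d) ℝ) (x : E d) : ℝ :=
  MvPolynomial.eval (fun i => x i) P

/-- `P_m`: polynomials of total degree at most `m`. -/
abbrev Poly (d m : ℕ) : Submodule ℝ (MvPolynomial (Fin d) ℝ) :=
  MvPolynomial.restrictTotalDegree (Fin d) ℝ m

/-- Restriction of a polynomial to `S`, as a function extended by zero outside `S`. -/
def restrictTo {d : ℕ} (S : Set (E d)) : MvPolynomial (Fin d) ℝ →ₗ[ℝ] (E d → ℝ) where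
  toFun P := S.indicator (ev P)
  map_add' P Q := by
    funext x; by_cases hx : x ∈ S <;> simp [hx, ev]
  map_smul' c P := by
    funext x; by_cases hx : x ∈ S <;> simp [hx, ev, MvPolynomial.smul_eval]

/-- `P_m(S)`: functions on `S` (extended by zero) that are the restriction to `S` of a polynomial
of degree at most `m`. -/
def PolyOn {d : ℕ} (m : ℕ) (S : Set (E d)) : Submodule ℝ (E d → ℝ) :=
  (Poly d m).map (restrictTo S)

/-- Triplets `v = {v_0, v_b, v_g}`: a polynomial on each element, a function on each face, and a
vector field on each face. The face functions are single-valued, that is, common to the two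
elements sharing the face. -/
abbrev WeakFun {d : ℕ} {Ω : Set (E d)} (M : Mesh Ω) : Type :=
  (Fin M.numElems → MvPolynomial (Fin d) ℝ) × (Fin M.numFaces → E d → ℝ) ×
    (Fin M.numFaces → Fin d → E d → ℝ)

namespace Mesh

variable {d : ℕ} {Ω : Set (E d)} (M : Mesh Ω)

/-- The weak finite element space `V_h`. -/
def Vh (k : ℕ) : Submodule ℝ (WeakFun M) where
  carrier := {v | (∀ t, v.1 t ∈ Poly d k) ∧ (∀ e, v.2.1 e ∈ PolyOn k (M.face e)) ∧
    ∀ e i, v.2.2 e i ∈ PolyOn (k - 1) (M.face e)}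
  add_mem' := fun hv hw => ⟨fun t => Submodule.add_mem _ (hv.1 t) (hw.1 t),
    fun e => Submodule.add_mem _ (hv.2.1 e) (hw.2.1 e),
    fun e i => Submodule.add_mem _ (hv.2.2 e i) (hw.2.2 e i)⟩
  zero_mem' := ⟨fun _ => Submodule.zero_mem _, fun _ => Submodule.zero_mem _,
    fun _ _ => Submodule.zero_mem _⟩
  smul_mem' := fun c _ hv => ⟨fun t => Submodule.smul_mem _ c (hv.1 t),
    fun e => Submodule.smul_mem _ c (hv.2.1 e),
    fun e i => Submodule.smul_mem _ c (hv.2.2 e i)⟩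

/-- `V_h^0`: the functions of `V_h` with `v_b = 0` on the faces on `∂Ω`. -/
def Vh0 (k : ℕ) : Submodule ℝ (WeakFun M) where
  carrier := {v | v ∈ M.Vh k ∧ ∀ e, M.face e ⊆ frontier Ω → v.2.1 e = 0}
  add_mem' := fun hv hw => ⟨Submodule.add_mem _ hv.1 hw.1, fun e he => by
    simp [hv.2 e he, hw.2 e he]⟩
  zero_mem' := ⟨Submodule.zero_mem _, fun _ _ => rfl⟩
  smul_mem' := fun c _ hv => ⟨Submodule.smul_mem _ c hv.1, fun e he => by
    simp [hv.2 e he]⟩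

/-- `H t i j ∈ P_l(T)` is the discrete weak second derivative `∂²_{ij,w} v` on each element
`T = elem t`. -/
def IsWeakHessian (l : ℕ) (v : WeakFun M)
    (H : Fin M.numElems → Fin d → Fin d → MvPolynomial (Fin d) ℝ) : Prop :=
  ∀ t i j, H t i j ∈ Poly d l ∧ ∀ ψ ∈ Poly d l,
    ∫ x in M.elem t, ev (H t i j) x * ev ψ x =
      (∫ x in M.elem t, ev (v.1 t) x * ev (MvPolynomial.pderiv j (MvPolynomial.pderiv i ψ)) x)
      - (∑ e ∈ M.facesOf t, ∫ x in M.face e,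
          v.2.1 e x * M.normal t e i * ev (MvPolynomial.pderiv j ψ) x ∂(surf d))
      + ∑ e ∈ M.facesOf t, ∫ x in M.face e,
          v.2.2 e i x * (ev ψ x * M.normal t e j) ∂(surf d)

/-- The admissible set `S_h`: those `v ∈ V_h^0` with `(𝓛_w v, w) = (f, w)` for all `w ∈ W_h`,
where `W_h` consists of the piecewise polynomials of degree at most `l`. -/
def admissible (k l : ℕ) (a : E d → Matrix (Fin d) (Fin d) ℝ) (f : E d → ℝ) :
    Set (WeakFun M) :=
  {v | v ∈ M.Vh0 k ∧ ∃ H, M.IsWeakHessian l v H ∧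
    ∀ w : Fin M.numElems → MvPolynomial (Fin d) ℝ, (∀ t, w t ∈ Poly d l) →
      ∑ t, ∫ x in M.elem t, (∑ i, ∑ j, a x i j * ev (H t i j) x) * ev (w t) x =
        ∑ t, ∫ x in M.elem t, f x * ev (w t) x}

/-- The `L^p` stabilizer `s(v)`. The size of the vector `∇v_0 - v_g` is measured in the `ℓ^r`
norm of `ℝ^d`: `r = 2` is the Euclidean norm, while `r = p` gives
`|∇v_0 - v_g|^p = ∑_i |∂_i v_0 - v_{g,i}|^p`. -/
def stabilizer (p r : ℝ) (v : WeakFun M) : ℝ :=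
  (1 / p) * ∑ t, ∑ e ∈ M.facesOf t, ∫ x in M.face e,
    (M.diam t ^ (1 - 2 * p) * |ev (v.1 t) x - v.2.1 e x| ^ p
      + M.diam t ^ (1 - p) *
        (∑ i, |ev (MvPolynomial.pderiv i (v.1 t)) x - v.2.2 e i x| ^ r) ^ (p / r)) ∂(surf d)

end Mesh

end LpWG

end

open MeasureTheory Filter Topology
open scoped ENNReal NNReal ContDiff

noncomputable section

namespace LpWG

/-! ### Hyperplanes and their surface measure -/

/-! The constraint is a linear equation on the finite-dimensional space `Vh0`, and the stabilizer is
convex and homogeneous of degree `p`. So there is exactly one minimizer as soon as (i) the discrete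
operator is onto and (ii) the stabilizer is strictly convex along its kernel
(`existsUnique_forall_le`). Since the `p`-th powers are strictly convex, (ii) can only fail along a
kernel element without jumps, that is with `v_b = v_0` and `v_g = ∇v_0` on all faces
(`Mesh.Compatible`). Both points are perturbations of the case of piecewise constant coefficients:
on a fine partition `a` oscillates by at most `ε` on each element, and the `W^{2,p}` regularity
absorbs the resulting errors.

For (ii), `Mesh.eq_zero_of_compatible`: a compatible `v_0` lies in `W^{2,p} ∩ W_0^{1,p}` and its
weak Hessian is the classical one, so `𝓛 v_0` is orthogonal to `W_h`. With frozen coefficients `𝓛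
v_0` would itself belong to `W_h`, because `k - 2 ≤ l`. Hence `‖𝓛 v_0‖_p ≤ Cε ‖D²v_0‖_p ≤ C'ε ‖𝓛
v_0‖_p`, and `v_0 = 0` for small `ε`.

For (i), `Mesh.eq_zero_of_orthogonal`: let `σ ∈ W_h` be orthogonal to the range, and let `τ_ij` be
the elementwise `L²` projection of `a_ij σ`. Then `∑ (∂²_{ij,w} v, τ_ij) = 0` for all `v`. As `l + 1
≤ k`, `v` can be chosen so that this sum is a sum of squares (`Mesh.jump_eq_zero_of_orthogonal`):
the normal components of `τ` have no jumps, even at the boundary, and `div τ` is weakly divergence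
free. Two integrations by parts show that `τ` is orthogonal to `D²ψ` for every `ψ ∈ W^{2,p} ∩
W_0^{1,p}`. For the solution of `𝓛 ψ = sign(σ) |σ|^{q-1}`, with `q` the conjugate exponent, this
gives `‖σ‖_q^q = ∫ D²ψ : (aσ - τ)`, which is a small multiple of `‖σ‖_q^q`.

The threshold `h₀` may not depend on the partition, although the discontinuities of `a` are only
known to be resolved by each partition separately. In `Mesh.oscillation_le` the partition is
compared with one fixed reference partition, using that a continuous image of a connected element is
an interval.

The rest is analysis on polytopes, where neither the domain nor the elements need be Lipschitz.
Integration by parts is proved near points that lie on at most one face hyperplane, where the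
geometry is that of a half-space; the exceptional set has codimension two and is removed by cutoffs
(`firstOrder_eq_zero_of_locally_off_hypSing`). Membership in `W_0^{1,p}` comes from vanishing
outside a regular open set (`isW01p_of_vanishing`). -/

/-- The hyperplane `{x | ⟪ν, x⟫ = c}`. -/
def hyp {d : ℕ} (ν : E d) (c : ℝ) : Set (E d) := {x | inner ℝ ν x = c}

theorem isClosed_hyp {d : ℕ} (ν : E d) (c : ℝ) : IsClosed (hyp ν c) :=
  isClosed_eq (by fun_prop) continuous_const

/-- The isometric parametrization of a hyperplane by the orthogonal complement of its normal. -/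
def hypParam {d : ℕ} (ν : E d) (c : ℝ) (y : (ℝ ∙ ν)ᗮ) : E d := c • ν + y

theorem isometry_hypParam {d : ℕ} (ν : E d) (c : ℝ) : Isometry (hypParam ν c) :=
  Isometry.of_dist_eq fun x y => by simp [hypParam]; rfl

theorem range_hypParam {d : ℕ} {ν : E d} (hν : ‖ν‖ = 1) (c : ℝ) :
    Set.range (hypParam ν c) = hyp ν c := by
  ext x
  constructor
  · rintro ⟨y, rfl⟩
    have := Submodule.mem_orthogonal_singleton_iff_inner_right.1 y.2
    simp [hyp, hypParam, inner_add_right, inner_smul_right, this, hν]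
  · intro hx
    refine ⟨⟨x - c • ν, Submodule.mem_orthogonal_singleton_iff_inner_right.2 ?_⟩, ?_⟩
    · rw [inner_sub_right, inner_smul_right, real_inner_self_eq_norm_sq, hν, hx]; simp
    · simp [hypParam]

theorem finrank_orthogonal_span {d : ℕ} {ν : E d} (hν : ‖ν‖ = 1) :
    Module.finrank ℝ (ℝ ∙ ν)ᗮ = d - 1 := by
  have h := Submodule.finrank_add_finrank_orthogonal (ℝ ∙ ν)
  have h1 : Module.finrank ℝ (ℝ ∙ ν) = 1 :=
    finrank_span_singleton (by rintro rfl; simp at hν)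
  rw [h1, finrank_euclideanSpace_fin] at h
  omega

/-- Hausdorff measure is preserved by isometries and is Lebesgue measure on an inner product space
of the right dimension, here `d - 1`. Surface integrals over hyperplanes thereby become ordinary
integrals. -/
theorem map_hypParam {d : ℕ} {ν : E d} (hν : ‖ν‖ = 1) (c : ℝ) :
    (volume : Measure (ℝ ∙ ν)ᗮ).map (hypParam ν c) = (surf d).restrict (hyp ν c) := by
  rw [← range_hypParam hν, ← (isometry_hypParam ν c).map_euclideanHausdorffMeasure,
    ← InnerProductSpace.euclideanHausdorffMeasure_eq_volume, finrank_orthogonal_span hν]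

theorem measurableEmbedding_hypParam {d : ℕ} (ν : E d) (c : ℝ) :
    MeasurableEmbedding (hypParam ν c) :=
  (isometry_hypParam ν c).isClosedEmbedding.measurableEmbedding

theorem integral_hyp {d : ℕ} {ν : E d} (hν : ‖ν‖ = 1) (c : ℝ) (ψ : E d → ℝ) :
    ∫ x in hyp ν c, ψ x ∂(surf d) = ∫ y : (ℝ ∙ ν)ᗮ, ψ (c • ν + y) := by
  rw [← map_hypParam hν, (measurableEmbedding_hypParam ν c).integral_map]
  rfl

theorem surf_lt_top_of_isBounded {d : ℕ} {ν : E d} (hν : ‖ν‖ = 1) (c : ℝ) {S : Set (E d)}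
    (hS : Bornology.IsBounded S) : surf d (S ∩ hyp ν c) < ⊤ := by
  rw [← Measure.restrict_apply' (isClosed_hyp ν c).measurableSet, ← map_hypParam hν,
    (measurableEmbedding_hypParam ν c).map_apply]
  refine Bornology.IsBounded.measure_lt_top ?_
  exact (isometry_hypParam ν c).antilipschitz.isBounded_preimage hS

/-- Seen inside the first hyperplane, the intersection is an affine subspace, hence null unless it
is everything. In that case `μ` is orthogonal to all of `νᗮ`, so it is parallel to `ν` and the
hyperplanes coincide. -/
theorem surf_hyp_inter_eq_zero {d : ℕ} {ν μ : E d} (hν : ‖ν‖ = 1) (c c' : ℝ)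
    (h : hyp ν c ≠ hyp μ c') (hμ : ‖μ‖ = 1) : surf d (hyp ν c ∩ hyp μ c') = 0 := by
  rw [Set.inter_comm, ← Measure.restrict_apply' (isClosed_hyp ν c).measurableSet,
    ← map_hypParam hν, (measurableEmbedding_hypParam ν c).map_apply]
  let L : (ℝ ∙ ν)ᗮ →ₗ[ℝ] ℝ := (innerₛₗ ℝ μ).comp (ℝ ∙ ν)ᗮ.subtype
  let A : AffineSubspace ℝ (ℝ ∙ ν)ᗮ := (AffineSubspace.mk' (c' - c * inner ℝ μ ν) ⊥).comap
    L.toAffineMap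
  have hA : (hypParam ν c) ⁻¹' (hyp μ c') = A := by
    ext y
    simp [A, L, hyp, hypParam, inner_add_right, inner_smul_right, AffineSubspace.mem_mk',
      sub_eq_zero, eq_sub_iff_add_eq, add_comm]
  rw [hA]
  refine Measure.addHaar_affineSubspace _ _ fun htop => h ?_
  have hall : ∀ y : (ℝ ∙ ν)ᗮ, hypParam ν c y ∈ hyp μ c' := fun y => by
    have : y ∈ (A : Set _) := by rw [htop]; trivial
    rwa [← hA] at this
  -- the direction `μ` is parallel to `ν`
  have h0 : inner ℝ μ (c • ν) = c' := by simpa [hypParam, hyp] using hall 0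
  have hperp : ∀ y ∈ (ℝ ∙ ν)ᗮ, inner ℝ μ y = 0 := fun y hy => by
    have := hall ⟨y, hy⟩
    simp only [hypParam, hyp, Set.mem_ofPred_eq, inner_add_right, h0] at this
    linarith
  have hmem : μ ∈ (ℝ ∙ ν) := by
    rw [← Submodule.orthogonal_orthogonal (ℝ ∙ ν)]
    exact (Submodule.mem_orthogonal' _ _).2 hperp
  obtain ⟨s, rfl⟩ := Submodule.mem_span_singleton.1 hmem
  have hs : s ≠ 0 := by rintro rfl; simp at hμ
  ext x
  simp only [hyp, Set.mem_ofPred_eq, inner_smul_left, inner_smul_right,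
    real_inner_self_eq_norm_sq, hν] at h0 ⊢
  simp at h0 ⊢
  rw [← h0]
  constructor
  · rintro rfl; ring
  · intro h; rw [mul_comm c] at h; exact mul_left_cancel₀ hs h

theorem volume_hyp {d : ℕ} {ν : E d} (hν : ‖ν‖ = 1) (c : ℝ) : volume (hyp ν c) = 0 := by
  let A : AffineSubspace ℝ (E d) := (AffineSubspace.mk' c ⊥).comap
    (innerₛₗ ℝ ν).toAffineMap
  have hA : hyp ν c = A := by
    ext y; simp [A, hyp, AffineSubspace.mem_mk', sub_eq_zero]
  rw [hA]
  refine Measure.addHaar_affineSubspace _ _ fun htop => ?_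
  have : (c + 1) • ν ∈ hyp ν c := by rw [hA, htop]; trivial
  simp [hyp, inner_smul_right, hν] at this

/-! ### The divergence theorem in a half-space -/

/-- The indicator of the half-space is constant along `η`, so its line derivative in this direction
is zero and integration by parts leaves nothing. -/
theorem integral_halfspace_fderiv_tangential {d : ℕ} {ν η : E d} (h : inner ℝ ν η = 0) (c : ℝ)
    {ψ : E d → ℝ} (hψ : ContDiff ℝ 1 ψ) (hc : HasCompactSupport ψ) :
    ∫ x in {x | inner ℝ ν x < c}, fderiv ℝ ψ x η = 0 := by
  have hS : MeasurableSet {x : E d | inner ℝ ν x < c} :=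
    (isOpen_lt (by fun_prop) continuous_const).measurableSet
  have h_int : Integrable ψ := hψ.continuous.integrable_of_hasCompactSupport hc
  have h_int' : Integrable (fun x => fderiv ℝ ψ x η) :=
    ((hψ.continuous_fderiv (by norm_num)).clm_apply continuous_const).integrable_of_hasCompactSupport
      (hc.fderiv_apply ℝ η)
  have key := integral_bilinear_hasLineDerivAt_right_eq_neg_left_of_integrable
    (μ := (volume : Measure (E d))) (f := Set.indicator {x : E d | inner ℝ ν x < c} 1)
    (f' := 0) (g := ψ) (g' := fun x => fderiv ℝ ψ x η) (v := η)
    (B := ContinuousLinearMap.mul ℝ ℝ) (by simp) ?_ ?_ ?_ ?_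
  · simp only [ContinuousLinearMap.mul_apply', Pi.zero_apply, zero_mul, integral_zero,
      neg_zero] at key
    rw [← key, ← integral_indicator hS]
    congr 1; ext x
    by_cases hx : inner ℝ ν x < c <;> simp [Set.indicator, hx]
  · refine (h_int'.indicator hS).congr (Eventually.of_forall fun x => ?_)
    by_cases hx : inner ℝ ν x < c <;> simp [Set.indicator, hx]
  · refine (h_int.indicator hS).congr (Eventually.of_forall fun x => ?_)
    by_cases hx : inner ℝ ν x < c <;> simp [Set.indicator, hx]
  · intro x _
    have : (fun t : ℝ => Set.indicator {x : E d | inner ℝ ν x < c} (1 : E d → ℝ) (x + t • η))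
        = fun _ => Set.indicator {x : E d | inner ℝ ν x < c} (1 : E d → ℝ) x := by
      funext t
      simp [Set.indicator, inner_add_right, inner_smul_right, h]
    unfold HasLineDerivAt
    rw [this]
    exact hasDerivAt_const _ _
  · intro x _
    exact (hψ.differentiable (by norm_num) x).hasFDerivAt.hasLineDerivAt η

/-- Fubini for the splitting into the line of `ν` and its orthogonal complement, with the
fundamental theorem of calculus on each line. -/
theorem integral_halfspace_fderiv_normal {d : ℕ} {ν : E d} (hν : ‖ν‖ = 1) (c : ℝ)
    {ψ : E d → ℝ} (hψ : ContDiff ℝ 1 ψ) (hc : HasCompactSupport ψ) :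
    ∫ x in {x | inner ℝ ν x < c}, fderiv ℝ ψ x ν = ∫ x in hyp ν c, ψ x ∂(surf d) := by
  have hS : MeasurableSet {x : E d | inner ℝ ν x < c} :=
    (isOpen_lt (by fun_prop) continuous_const).measurableSet
  have h_int' : Integrable (fun x => fderiv ℝ ψ x ν) :=
    ((hψ.continuous_fderiv (by norm_num)).clm_apply continuous_const).integrable_of_hasCompactSupport
      (hc.fderiv_apply ℝ ν)
  let g : E d → ℝ := Set.indicator {x | inner ℝ ν x < c} (fun x => fderiv ℝ ψ x ν)
  have hg : Integrable g := h_int'.indicator hS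
  have hmp := (ℝ ∙ ν).measurePreserving_measurableEquivProd (0 : E d)
  rw [InnerProductSpace.euclideanHausdorffMeasure_eq_volume] at hmp
  have hmp' := hmp.symm
  have h1 : ∫ x, g x = ∫ q : (ℝ ∙ ν) × (ℝ ∙ ν)ᗮ, g (q.1 + q.2) := by
    rw [← hmp'.integral_comp ((ℝ ∙ ν).measurableEquivProd (0 : E d)).symm.measurableEmbedding]
    simp
  have hgi : Integrable (fun q : (ℝ ∙ ν) × (ℝ ∙ ν)ᗮ => g (q.1 + q.2)) := by
    have := (hmp'.integrable_comp_emb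
      ((ℝ ∙ ν).measurableEquivProd (0 : E d)).symm.measurableEmbedding (g := g)).2 hg
    simpa [Function.comp_def] using this
  rw [← integral_indicator hS, integral_hyp hν]
  change ∫ x, g x = _
  rw [h1, Measure.volume_eq_prod, integral_prod_symm _ hgi]
  refine integral_congr_ae (Eventually.of_forall fun y => ?_)
  have hy := Submodule.mem_orthogonal_singleton_iff_inner_right.1 y.2
  let e := LinearIsometryEquiv.toSpanUnitSingleton (𝕜 := ℝ) ν hν
  simp only
  rw [← e.measurePreserving.integral_comp e.toHomeomorph.measurableEmbedding]
  have hline : ContDiff ℝ 1 (fun t : ℝ => t • ν + (y : E d)) := by fun_prop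
  have hsupp : HasCompactSupport (fun t : ℝ => ψ (t • ν + (y : E d))) := by
    have hiso : Isometry (fun t : ℝ => t • ν + (y : E d)) := Isometry.of_dist_eq fun s t => by
      simp [dist_eq_norm, ← sub_smul, norm_smul, hν]
    exact hc.comp_isClosedEmbedding hiso.isClosedEmbedding
  have hψl : ContDiff ℝ 1 (fun t : ℝ => ψ (t • ν + (y : E d))) := hψ.comp hline
  rw [← HasCompactSupport.integral_Iic_deriv_eq hψl hsupp c,
    ← integral_indicator measurableSet_Iic]
  -- The half-space is open and the half-line `Iic c` is closed; on each line they differ in one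
  -- point.
  have hne : ∀ᵐ t : ℝ, t ≠ c := by
    simp [ae_iff]
  refine integral_congr_ae (hne.mono fun t ht => ?_)
  have hcoe : ((e t : (ℝ ∙ ν)) : E d) = t • ν := rfl
  have hin : inner ℝ ν (t • ν + (y : E d)) = t := by
    simp [inner_add_right, inner_smul_right, hy, hν]
  simp only [g, hcoe, Set.indicator, Set.mem_ofPred_eq, hin, Set.mem_Iic]
  have hd : deriv (fun t : ℝ => ψ (t • ν + (y : E d))) t = fderiv ℝ ψ (t • ν + y) ν := by
    have h2 : HasDerivAt (fun t : ℝ => t • ν + (y : E d)) ν t := by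
      simpa using ((hasDerivAt_id t).smul_const ν).add_const (y : E d)
    exact ((hψ.differentiable (by norm_num) _).hasFDerivAt.comp_hasDerivAt t h2).deriv
  by_cases h : t < c
  · simp [h, h.le, hd]
  · have : ¬ t ≤ c := fun h' => h (lt_of_le_of_ne h' ht)
    simp [h, this]

/-- The divergence theorem in a half-space. -/
theorem integral_halfspace_fderiv {d : ℕ} {ν : E d} (hν : ‖ν‖ = 1) (η : E d) (c : ℝ)
    {ψ : E d → ℝ} (hψ : ContDiff ℝ 1 ψ) (hc : HasCompactSupport ψ) :
    ∫ x in {x | inner ℝ ν x < c}, fderiv ℝ ψ x η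
      = inner ℝ ν η * ∫ x in hyp ν c, ψ x ∂(surf d) := by
  have hη : η = inner ℝ ν η • ν + (η - inner ℝ ν η • ν) := by abel
  have hperp : inner ℝ ν (η - inner ℝ ν η • ν) = 0 := by
    simp [inner_sub_right, inner_smul_right, hν]
  have h_int : ∀ w : E d, Integrable (fun x => fderiv ℝ ψ x w) := fun w =>
    ((hψ.continuous_fderiv (by norm_num)).clm_apply continuous_const).integrable_of_hasCompactSupport
      (hc.fderiv_apply ℝ w)
  calc _ = ∫ x in {x | inner ℝ ν x < c}, (inner ℝ ν η * fderiv ℝ ψ x ν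
        + fderiv ℝ ψ x (η - inner ℝ ν η • ν)) := by
        congr 1; ext x
        conv_lhs => rw [hη, map_add, map_smul, smul_eq_mul]
    _ = _ := by
      rw [integral_add ((h_int _).const_mul _).integrableOn (h_int _).integrableOn,
        integral_halfspace_fderiv_tangential hperp c hψ hc, add_zero, integral_const_mul,
        integral_halfspace_fderiv_normal hν c hψ hc]

/-! ### First order functionals and removal of sets of codimension two -/

theorem isTestFunction_univ {d : ℕ} {φ : E d → ℝ} :
    IsTestFunction Set.univ φ ↔ ContDiff ℝ ∞ φ ∧ HasCompactSupport φ := by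
  simp [IsTestFunction]

theorem IsTestFunction.mono {d : ℕ} {U V : Set (E d)} {φ : E d → ℝ} (h : IsTestFunction U φ)
    (hUV : U ⊆ V) : IsTestFunction V φ :=
  ⟨h.1, h.2.1, h.2.2.trans hUV⟩

theorem IsTestFunction.mul_contDiff {d : ℕ} {U : Set (E d)} {φ χ : E d → ℝ}
    (h : IsTestFunction U φ) (hχ : ContDiff ℝ ∞ χ) : IsTestFunction U (fun x => χ x * φ x) :=
  ⟨hχ.mul h.1, h.2.1.mul_left, (tsupport_mul_subset_right).trans h.2.2⟩

/-- The functional `φ ↦ ∫ F · ∇φ + ∫ g φ dμ`. -/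
def firstOrder {d : ℕ} (F : E d → E d) (g : E d → ℝ) (μ : Measure (E d)) (φ : E d → ℝ) : ℝ :=
  (∫ x, fderiv ℝ φ x (F x)) + ∫ x, φ x * g x ∂μ

section

variable {d : ℕ} {F : E d → E d} {g : E d → ℝ} {μ : Measure (E d)}

theorem IsTestFunction.exists_bound {U : Set (E d)} {φ : E d → ℝ} (h : IsTestFunction U φ) :
    ∃ C : ℝ, 0 ≤ C ∧ ∀ x, |φ x| ≤ C ∧ ‖fderiv ℝ φ x‖ ≤ C := by
  obtain ⟨C, hC⟩ := h.1.continuous.bounded_above_of_compact_support h.2.1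
  obtain ⟨C', hC'⟩ := (h.1.continuous_fderiv (by norm_num)).bounded_above_of_compact_support
    (h.2.1.fderiv ℝ)
  refine ⟨max C C', (norm_nonneg _).trans ((hC 0).trans (le_max_left _ _)), fun x =>
    ⟨(hC x).trans (le_max_left _ _), (hC' x).trans (le_max_right _ _)⟩⟩

theorem integrable_fderiv_apply {B : ℝ} (hF : AEStronglyMeasurable F) (hB : ∀ x, ‖F x‖ ≤ B)
    {U : Set (E d)} {φ : E d → ℝ} (h : IsTestFunction U φ) :
    Integrable (fun x => fderiv ℝ φ x (F x)) := by
  have hc : Continuous (fderiv ℝ φ) := h.1.continuous_fderiv (by norm_num)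
  have h1 : Integrable (fun x => ‖fderiv ℝ φ x‖ * B) :=
    ((hc.integrable_of_hasCompactSupport (h.2.1.fderiv ℝ)).norm).mul_const B
  refine h1.mono' (isBoundedBilinearMap_apply.continuous.comp_aestronglyMeasurable
    (hc.aestronglyMeasurable.prodMk hF)) (Eventually.of_forall fun x => ?_)
  exact (ContinuousLinearMap.le_opNorm _ _).trans
    (mul_le_mul_of_nonneg_left (hB x) (norm_nonneg _))

theorem integrable_test_mul (hg : Integrable g μ) {U : Set (E d)} {φ : E d → ℝ}
    (h : IsTestFunction U φ) : Integrable (fun x => φ x * g x) μ := by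
  obtain ⟨C, -, hC⟩ := h.exists_bound
  exact hg.bdd_mul (c := C) h.1.continuous.aestronglyMeasurable
    (Eventually.of_forall fun x => (hC x).1)

theorem firstOrder_add {B : ℝ} (hF : AEStronglyMeasurable F) (hB : ∀ x, ‖F x‖ ≤ B)
    (hg : Integrable g μ) {U V : Set (E d)} {φ ψ : E d → ℝ} (hφ : IsTestFunction U φ)
    (hψ : IsTestFunction V ψ) :
    firstOrder F g μ (fun x => φ x + ψ x) = firstOrder F g μ φ + firstOrder F g μ ψ := by
  have h1 : ∀ x, fderiv ℝ (fun x => φ x + ψ x) x (F x)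
      = fderiv ℝ φ x (F x) + fderiv ℝ ψ x (F x) := fun x => by
    rw [fderiv_fun_add (hφ.1.differentiable (by norm_num) x) (hψ.1.differentiable (by norm_num) x)]
    rfl
  simp only [firstOrder, h1, add_mul]
  rw [integral_add (integrable_fderiv_apply hF hB hφ) (integrable_fderiv_apply hF hB hψ),
    integral_add (integrable_test_mul hg hφ) (integrable_test_mul hg hψ)]
  ring

theorem IsTestFunction.sum {ι : Type*} (s : Finset ι) {φ : ι → E d → ℝ}
    (hφ : ∀ i ∈ s, IsTestFunction Set.univ (φ i)) :
    IsTestFunction Set.univ (fun x => ∑ i ∈ s, φ i x) := by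
  classical
  refine isTestFunction_univ.2 ⟨ContDiff.sum fun j hj => (hφ j hj).1, ?_⟩
  induction s using Finset.induction_on with
  | empty =>
    simp only [Finset.sum_empty]
    exact HasCompactSupport.zero
  | insert j s hj ih =>
    simp only [Finset.sum_insert hj]
    exact (hφ j (Finset.mem_insert_self _ _)).2.1.add
      (ih fun k hk => hφ k (Finset.mem_insert_of_mem hk))

theorem firstOrder_zero : firstOrder F g μ (fun _ => 0) = 0 := by
  simp [firstOrder]

theorem firstOrder_sum {B : ℝ} (hF : AEStronglyMeasurable F) (hB : ∀ x, ‖F x‖ ≤ B)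
    (hg : Integrable g μ) {ι : Type*} (s : Finset ι) {φ : ι → E d → ℝ}
    (hφ : ∀ i ∈ s, IsTestFunction Set.univ (φ i)) :
    firstOrder F g μ (fun x => ∑ i ∈ s, φ i x) = ∑ i ∈ s, firstOrder F g μ (φ i) := by
  classical
  induction s using Finset.induction_on with
  | empty => simp [firstOrder_zero]
  | insert i s hi ih =>
    simp only [Finset.sum_insert hi]
    have hsum := IsTestFunction.sum s fun j hj => hφ j (Finset.mem_insert_of_mem hj)
    rw [firstOrder_add hF hB hg (hφ i (Finset.mem_insert_self _ _)) hsum,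
      ih fun j hj => hφ j (Finset.mem_insert_of_mem hj)]

/-- A first order functional that vanishes locally vanishes. -/
theorem firstOrder_eq_zero_of_locally {B : ℝ} (hF : AEStronglyMeasurable F)
    (hB : ∀ x, ‖F x‖ ≤ B) (hg : Integrable g μ) {φ : E d → ℝ}
    (hφ : IsTestFunction Set.univ φ)
    (hloc : ∀ x ∈ tsupport φ, ∃ U, IsOpen U ∧ x ∈ U ∧
      ∀ ψ, IsTestFunction U ψ → firstOrder F g μ ψ = 0) :
    firstOrder F g μ φ = 0 := by
  classical
  choose! U hUo hxU hU using hloc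
  obtain ⟨t, htU⟩ := IsCompact.elim_nhds_subcover' hφ.2.1 (fun x _ => U x)
    (fun x hx => (hUo x hx).mem_nhds (hxU x hx))
  obtain ⟨f, hf⟩ := SmoothPartitionOfUnity.exists_isSubordinate
    (modelWithCornersSelf ℝ (E d)) (isClosed_tsupport φ)
    (fun x : t => U (x : tsupport φ)) (fun x => hUo _ (x : tsupport φ).2) (by
      intro x hx
      obtain ⟨y, hy, hxy⟩ := Set.mem_iUnion₂.1 (htU hx)
      exact Set.mem_iUnion.2 ⟨⟨y, hy⟩, hxy⟩)
  have hfs : ∀ i, ContDiff ℝ ∞ (f i) := fun i => (f i).contMDiff.contDiff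
  have hsum : φ = fun x => ∑ i, f i x * φ x := by
    funext x
    by_cases hx : x ∈ tsupport φ
    · have := f.sum_eq_one hx
      rw [finsum_eq_sum_of_fintype] at this
      rw [← Finset.sum_mul, this, one_mul]
    · simp [image_eq_zero_of_notMem_tsupport hx]
  rw [hsum, firstOrder_sum hF hB hg Finset.univ fun i _ => hφ.mul_contDiff (hfs i)]
  refine Finset.sum_eq_zero fun i _ => hU _ (i : tsupport φ).2 _ ⟨(hfs i).mul hφ.1,
    hφ.2.1.mul_left, (tsupport_mul_subset_left).trans (hf i)⟩

end

/-! #### Tubes around intersections of two hyperplanes -/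

/-- Distinct hyperplanes that meet are not parallel, so their normals are independent. The vector is
the component of `ν` orthogonal to `μ`, rescaled; its squared length is `1 - ⟪ν, μ⟫²`. -/
theorem exists_dual_vector {d : ℕ} {ν μ : E d} (hν : ‖ν‖ = 1) (hμ : ‖μ‖ = 1) {c c' : ℝ}
    (hne : hyp ν c ≠ hyp μ c') (h_int : (hyp ν c ∩ hyp μ c').Nonempty) :
    ∃ v : E d, inner ℝ ν v = 1 ∧ inner ℝ μ v = 0 := by
  have hs : inner ℝ ν μ ^ 2 ≠ (1 : ℝ) := by
    intro h1
    apply hne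
    have h2 : ‖ν - inner ℝ ν μ • μ‖ ^ 2 = 0 := by
      rw [norm_sub_sq_real, inner_smul_right, norm_smul, hν, hμ, mul_one, Real.norm_eq_abs,
        sq_abs]
      linarith [h1]
    have h3 : ν = inner ℝ ν μ • μ := sub_eq_zero.1 (norm_eq_zero.1 (pow_eq_zero_iff two_ne_zero |>.1 h2))
    set s := inner ℝ ν μ with hs
    have hs0 : s ≠ 0 := by rintro h; rw [h] at h1; norm_num at h1
    obtain ⟨z, hz1, hz2⟩ := h_int
    simp only [hyp, Set.mem_ofPred_eq] at hz1 hz2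
    have hval : ∀ x, inner ℝ ν x = s * inner ℝ μ x := fun x => by
      conv_lhs => rw [h3]
      rw [inner_smul_left]; rfl
    ext x
    simp only [hyp, Set.mem_ofPred_eq]
    rw [← hz1, ← hz2, hval x, hval z]
    exact mul_right_inj' hs0
  have hs' : (1 : ℝ) - inner ℝ ν μ ^ 2 ≠ 0 := sub_ne_zero.2 hs.symm
  refine ⟨(1 - inner ℝ ν μ ^ 2)⁻¹ • (ν - inner ℝ ν μ • μ), ?_, ?_⟩
  · rw [inner_smul_right, inner_sub_right, inner_smul_right, real_inner_self_eq_norm_sq, hν]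
    field_simp
  · rw [inner_smul_right, inner_sub_right, inner_smul_right, real_inner_self_eq_norm_sq, hμ,
      real_inner_comm]
    ring

/-- The part of a ball within distance `ε` of two hyperplanes. -/
def tube {d : ℕ} (ν μ : E d) (c c' R ε : ℝ) : Set (E d) :=
  {x | ‖x‖ ≤ R ∧ |inner ℝ ν x - c| ≤ ε ∧ |inner ℝ μ x - c'| ≤ ε}

theorem isClosed_tube {d : ℕ} (ν μ : E d) (c c' R ε : ℝ) : IsClosed (tube ν μ c c' R ε) := by
  have h1 : IsClosed {x : E d | ‖x‖ ≤ R} := isClosed_le (by fun_prop) (by fun_prop)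
  have h2 : ∀ (η : E d) (b : ℝ), IsClosed {x : E d | |inner ℝ η x - b| ≤ ε} := fun η b =>
    isClosed_le (by fun_prop) (by fun_prop)
  exact h1.inter ((h2 ν c).inter (h2 μ c'))

/-- A packing argument: with `ε = 1 / (n + 1)`, the translates of the tube by multiples of `3ε`
along the two dual vectors are `(n + 1)²` disjoint sets of equal volume, all in one ball whose
radius does not depend on `n`. -/
theorem exists_volume_tube_le {d : ℕ} {ν μ : E d} (hν : ‖ν‖ = 1) (hμ : ‖μ‖ = 1) {c c' : ℝ}
    (hne : hyp ν c ≠ hyp μ c') (h_int : (hyp ν c ∩ hyp μ c').Nonempty) (R : ℝ) :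
    ∃ C : ℝ, ∀ n : ℕ, volume.real (tube ν μ c c' R (1 / (n + 1))) ≤ C / (n + 1) ^ 2 := by
  obtain ⟨v, hv1, hv2⟩ := exists_dual_vector hν hμ hne h_int
  obtain ⟨w, hw2, hw1⟩ := exists_dual_vector hμ hν hne.symm (by rwa [Set.inter_comm])
  let K := R + 3 * ‖v‖ + 3 * ‖w‖
  refine ⟨volume.real (Metric.closedBall (0 : E d) K), fun n => ?_⟩
  set ε : ℝ := 1 / (n + 1) with hε
  have hn : (0 : ℝ) < n + 1 := by positivity
  have hεpos : 0 < ε := by positivity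
  let S := tube ν μ c c' R ε
  let sh : Fin (n + 1) × Fin (n + 1) → E d := fun q =>
    (3 * ε * (q.1 : ℕ)) • v + (3 * ε * (q.2 : ℕ)) • w
  let Sq : Fin (n + 1) × Fin (n + 1) → Set (E d) := fun q => (fun x => x + -sh q) ⁻¹' S
  have hmS : MeasurableSet S := (isClosed_tube ν μ c c' R ε).measurableSet
  have hmeas : ∀ q, MeasurableSet (Sq q) := fun q =>
    hmS.preimage (by fun_prop)
  have hvol : ∀ q, volume.real (Sq q) = volume.real S := fun q => by
    simp only [Sq, measureReal_def, measure_preimage_add_right]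
  have hνsh : ∀ q, inner ℝ ν (sh q) = 3 * ε * (q.1 : ℕ) := fun q => by
    simp [sh, inner_add_right, inner_smul_right, hv1, hw1]
  have hμsh : ∀ q, inner ℝ μ (sh q) = 3 * ε * (q.2 : ℕ) := fun q => by
    simp [sh, inner_add_right, inner_smul_right, hv2, hw2]
  have haux : ∀ (a b : ℕ) (s : ℝ), |s - 3 * ε * a| ≤ ε → |s - 3 * ε * b| ≤ ε → a = b := by
    intro a b s h1 h2
    have h3 : |3 * ε * (a - b : ℝ)| ≤ 2 * ε := by
      rw [abs_le] at h1 h2 ⊢; constructor <;> linarith [h1.1, h1.2, h2.1, h2.2]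
    rw [abs_mul, abs_of_pos (by positivity : 0 < 3 * ε)] at h3
    have h4 : |(a - b : ℝ)| < 1 := by nlinarith
    have h5 : |((a : ℤ) - (b : ℤ))| < 1 := by exact_mod_cast h4
    rw [Int.abs_lt_one_iff] at h5; omega
  have hdisj : Pairwise (Function.onFun Disjoint Sq) := by
    intro p q hpq
    rw [Function.onFun, Set.disjoint_left]
    rintro x ⟨-, h1, h2⟩ ⟨-, h3, h4⟩
    apply hpq
    rw [inner_add_right, inner_neg_right, hνsh] at h1 h3
    rw [inner_add_right, inner_neg_right, hμsh] at h2 h4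
    refine Prod.ext (Fin.ext ?_) (Fin.ext ?_)
    · refine haux _ _ (inner ℝ ν x - c) ?_ ?_
      · convert h1 using 2; ring
      · convert h3 using 2; ring
    · refine haux _ _ (inner ℝ μ x - c') ?_ ?_
      · convert h2 using 2; ring
      · convert h4 using 2; ring
  have hsub : (⋃ q, Sq q) ⊆ Metric.closedBall (0 : E d) K := by
    refine Set.iUnion_subset fun q x hx => ?_
    have h1 : ‖x + -sh q‖ ≤ R := hx.1
    have hb : ∀ a : Fin (n + 1), 3 * ε * (a : ℕ) ≤ 3 := fun a => by
      have : ((a : ℕ) : ℝ) ≤ n + 1 := by exact_mod_cast a.2.le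
      calc 3 * ε * (a : ℕ) ≤ 3 * ε * (n + 1) := by gcongr
        _ = 3 := by rw [hε]; field_simp
    have h2 : ‖sh q‖ ≤ 3 * ‖v‖ + 3 * ‖w‖ := by
      refine (norm_add_le _ _).trans (add_le_add ?_ ?_)
      · rw [norm_smul, Real.norm_of_nonneg (by positivity)]
        exact mul_le_mul_of_nonneg_right (hb _) (norm_nonneg _)
      · rw [norm_smul, Real.norm_of_nonneg (by positivity)]
        exact mul_le_mul_of_nonneg_right (hb _) (norm_nonneg _)
    rw [mem_closedBall_zero_iff]
    calc ‖x‖ = ‖(x + -sh q) + sh q‖ := by simp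
      _ ≤ R + (3 * ‖v‖ + 3 * ‖w‖) := (norm_add_le _ _).trans (add_le_add h1 h2)
      _ = K := by ring
  have hball : volume (Metric.closedBall (0 : E d) K) ≠ ⊤ := measure_closedBall_lt_top.ne
  have h1 : ∑ q, volume.real (Sq q) ≤ volume.real (Metric.closedBall (0 : E d) K) := by
    have hfin : ∀ q, volume (Sq q) ≠ ⊤ := fun q =>
      ((measure_mono ((Set.subset_iUnion Sq q).trans hsub)).trans_lt hball.lt_top).ne
    have h2 := measureReal_biUnion_finset (μ := (volume : Measure (E d))) (s := Finset.univ)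
      (f := Sq) (fun p _ q _ h => hdisj h) (fun q _ => hmeas q) (fun q _ => hfin q)
    rw [← h2]
    exact measureReal_mono (by simpa using hsub) hball
  simp only [hvol, Finset.sum_const, Finset.card_univ, Fintype.card_prod, Fintype.card_fin,
    nsmul_eq_mul] at h1
  rw [le_div_iff₀ (by positivity)]
  push_cast at h1
  calc volume.real S * (n + 1 : ℝ) ^ 2 = ((n + 1 : ℝ) * (n + 1)) * volume.real S := by ring
    _ ≤ _ := h1

/-- A smooth function on the line, equal to `1` near `0` and supported in `[-1, 1]`. -/
def bump₁ : ContDiffBump (0 : ℝ) := ⟨1 / 2, 1, by norm_num, by norm_num⟩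

/-- A smooth function equal to `1` near the intersection of two hyperplanes and supported in a
thin tube around it. -/
def tubeCutoff {d : ℕ} (ν μ : E d) (c c' : ℝ) (n : ℕ) (x : E d) : ℝ :=
  bump₁ ((n + 1) * (inner ℝ ν x - c)) * bump₁ ((n + 1) * (inner ℝ μ x - c'))

section

variable {d : ℕ} {ν μ : E d} {c c' : ℝ}

theorem bump₁_eq_zero {s : ℝ} (hs : 1 ≤ |s|) : bump₁ s = 0 :=
  bump₁.zero_of_le_dist (by simpa [bump₁] using hs)

theorem contDiff_tubeCutoff (n : ℕ) : ContDiff ℝ ∞ (tubeCutoff ν μ c c' n) := by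
  have h : ∀ (η : E d) (b : ℝ), ContDiff ℝ ∞ (fun x => bump₁ ((n + 1 : ℝ) * (inner ℝ η x - b))) :=
    fun η b => bump₁.contDiff.comp
      (contDiff_const.mul ((contDiff_const.inner ℝ contDiff_id).sub contDiff_const))
  exact (h ν c).mul (h μ c')

theorem abs_tubeCutoff_le (n : ℕ) (x : E d) : |tubeCutoff ν μ c c' n x| ≤ 1 := by
  rw [tubeCutoff, abs_mul, abs_of_nonneg bump₁.nonneg, abs_of_nonneg bump₁.nonneg]
  exact mul_le_one₀ bump₁.le_one bump₁.nonneg bump₁.le_one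

theorem tubeCutoff_eventually_eq_one (n : ℕ) {x : E d} (hx : x ∈ hyp ν c ∩ hyp μ c') :
    ∀ᶠ y in 𝓝 x, tubeCutoff ν μ c c' n y = 1 := by
  have h1 : ∀ᶠ s in 𝓝 (0 : ℝ), bump₁ s = 1 := bump₁.eventuallyEq_one
  have h2 : ∀ (η : E d) (b : ℝ), inner ℝ η x = b →
      Tendsto (fun y : E d => (n + 1 : ℝ) * (inner ℝ η y - b)) (𝓝 x) (𝓝 0) := fun η b hb => by
    have : Continuous (fun y : E d => (n + 1 : ℝ) * (inner ℝ η y - b)) := by fun_prop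
    simpa [hb] using this.tendsto x
  filter_upwards [(h2 ν c hx.1).eventually h1, (h2 μ c' hx.2).eventually h1] with y hy1 hy2
  rw [tubeCutoff, hy1, hy2, one_mul]

theorem tendsto_tubeCutoff {x : E d} (hx : x ∉ hyp ν c ∩ hyp μ c') :
    Tendsto (fun n => tubeCutoff ν μ c c' n x) atTop (𝓝 0) := by
  have haux : ∀ s : ℝ, s ≠ 0 → ∀ᶠ n : ℕ in atTop, bump₁ ((n + 1) * s) = 0 := fun s hs => by
    have h1 : Tendsto (fun n : ℕ => ((n : ℝ) + 1) * |s|) atTop atTop :=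
      (tendsto_atTop_add_const_right _ _ tendsto_natCast_atTop_atTop).atTop_mul_const
        (abs_pos.2 hs)
    filter_upwards [h1.eventually_ge_atTop 1] with n hn
    refine bump₁_eq_zero ?_
    rwa [abs_mul, abs_of_pos (by positivity : (0 : ℝ) < n + 1)]
  refine tendsto_const_nhds.congr' ?_
  by_cases h : inner ℝ ν x = c
  · have h' : inner ℝ μ x ≠ c' := fun h' => hx ⟨h, h'⟩
    filter_upwards [haux _ (sub_ne_zero.2 h')] with n hn
    simp [tubeCutoff, hn]
  · filter_upwards [haux _ (sub_ne_zero.2 h)] with n hn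
    simp [tubeCutoff, hn]

theorem exists_fderiv_tubeCutoff_le (hν : ‖ν‖ = 1) (hμ : ‖μ‖ = 1) :
    ∃ K : ℝ, 0 ≤ K ∧ ∀ (n : ℕ) (x : E d),
      ‖fderiv ℝ (tubeCutoff ν μ c c' n) x‖ ≤ K * (n + 1) := by
  have hsm : ContDiff ℝ 1 bump₁ := bump₁.contDiff
  obtain ⟨C, hC⟩ := (hsm.continuous_fderiv
    (by norm_num)).bounded_above_of_compact_support (bump₁.hasCompactSupport.fderiv ℝ)
  have hC0 : 0 ≤ C := (norm_nonneg _).trans (hC 0)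
  refine ⟨2 * C, by positivity, fun n x => ?_⟩
  have hn : (0 : ℝ) < n + 1 := by positivity
  have h1 : ∀ (η : E d) (b : ℝ), HasFDerivAt (fun y : E d => bump₁ ((n + 1 : ℝ) * (inner ℝ η y - b)))
      ((fderiv ℝ bump₁ ((n + 1 : ℝ) * (inner ℝ η x - b))).comp ((n + 1 : ℝ) • innerSL ℝ η)) x := by
    intro η b
    have h : HasFDerivAt (fun y : E d => inner ℝ η y - b) (innerSL ℝ η) x :=
      (innerSL ℝ η).hasFDerivAt.sub_const b
    exact HasFDerivAt.comp (g := bump₁) x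
      (hsm.differentiable (by norm_num) _).hasFDerivAt (h.const_mul (n + 1 : ℝ))
  have h2 : ∀ (η : E d) (b : ℝ), ‖η‖ = 1 →
      ‖(fderiv ℝ bump₁ ((n + 1 : ℝ) * (inner ℝ η x - b))).comp ((n + 1 : ℝ) • innerSL ℝ η)‖
        ≤ C * (n + 1) := by
    intro η b hη
    refine (ContinuousLinearMap.opNorm_comp_le _ _).trans ?_
    refine mul_le_mul (hC _) ?_ (norm_nonneg _) hC0
    rw [norm_smul, innerSL_apply_norm, hη, Real.norm_of_nonneg hn.le, mul_one]
  have h3 := (h1 ν c).mul (h1 μ c')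
  have h4 : fderiv ℝ (tubeCutoff ν μ c c' n) x = _ := h3.fderiv
  rw [h4]
  have hb : ∀ s, ‖bump₁ s‖ ≤ 1 := fun s => by
    rw [Real.norm_of_nonneg bump₁.nonneg]; exact bump₁.le_one
  refine (norm_add_le _ _).trans ?_
  rw [norm_smul, norm_smul]
  calc _ ≤ 1 * (C * (n + 1)) + 1 * (C * (n + 1)) := by
        gcongr
        · exact hb _
        · exact h2 _ _ hμ
        · exact hb _
        · exact h2 _ _ hν
    _ = _ := by ring

/-- The gradient of the cutoff is `O(n)` on a tube of volume `O(n⁻²)`, so for bounded `F` the first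
integral is `O(1/n)`. The second one tends to zero by dominated convergence, as the cutoffs tend to
zero off a null set. -/
theorem tendsto_firstOrder_tubeCutoff {F : E d → E d} {g : E d → ℝ} {m : Measure (E d)} {B : ℝ}
    (hB : ∀ x, ‖F x‖ ≤ B) (hg : Integrable g m)
    (hν : ‖ν‖ = 1) (hμ : ‖μ‖ = 1) (hne : hyp ν c ≠ hyp μ c')
    (h_int : (hyp ν c ∩ hyp μ c').Nonempty) (hm : m (hyp ν c ∩ hyp μ c') = 0)
    {φ : E d → ℝ} (hφ : IsTestFunction Set.univ φ) :
    Tendsto (fun n => firstOrder F g m (fun x => tubeCutoff ν μ c c' n x * φ x)) atTop (𝓝 0) := by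
  have hB0 : 0 ≤ B := (norm_nonneg _).trans (hB 0)
  obtain ⟨C, hC0, hC⟩ := hφ.exists_bound
  obtain ⟨K, hK0, hK⟩ := exists_fderiv_tubeCutoff_le (c := c) (c' := c') hν hμ
  obtain ⟨R, hR⟩ := hφ.2.1.isBounded.subset_closedBall (0 : E d)
  obtain ⟨A, hA⟩ := exists_volume_tube_le hν hμ hne h_int R
  have hA0 : 0 ≤ A := by
    have := (measureReal_nonneg).trans (hA 0); simpa using this
  have htest : ∀ n, IsTestFunction Set.univ (fun x => tubeCutoff ν μ c c' n x * φ x) := fun n =>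
    hφ.mul_contDiff (contDiff_tubeCutoff n)
  have hsupp : ∀ n, tsupport (fun x => tubeCutoff ν μ c c' n x * φ x)
      ⊆ tube ν μ c c' R (1 / (n + 1)) := fun n => by
    refine closure_minimal (fun x hx => ?_) (isClosed_tube _ _ _ _ _ _)
    have hn : (0 : ℝ) < n + 1 := by positivity
    have hx1 : tubeCutoff ν μ c c' n x ≠ 0 := left_ne_zero_of_mul hx
    have hx2 : φ x ≠ 0 := right_ne_zero_of_mul hx
    have haux : ∀ s : ℝ, bump₁ ((n + 1) * s) ≠ 0 → |s| ≤ 1 / (n + 1) := fun s hs => by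
      by_contra! h
      refine hs (bump₁_eq_zero ?_)
      rw [abs_mul, abs_of_pos hn]
      rw [div_lt_iff₀ hn] at h
      linarith
    refine ⟨?_, haux _ (left_ne_zero_of_mul hx1), haux _ (right_ne_zero_of_mul hx1)⟩
    simpa using hR (subset_tsupport _ hx2)
  have hfd : ∀ n x, ‖fderiv ℝ (fun x => tubeCutoff ν μ c c' n x * φ x) x‖
      ≤ (C + K * C) * (n + 1) := fun n x => by
    rw [fderiv_fun_mul ((contDiff_tubeCutoff n).differentiable (by norm_num) x)
      (hφ.1.differentiable (by norm_num) x)]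
    refine (norm_add_le _ _).trans ?_
    rw [norm_smul, norm_smul, Real.norm_eq_abs, Real.norm_eq_abs]
    calc _ ≤ 1 * C + C * (K * (n + 1)) := by
          gcongr
          · exact abs_tubeCutoff_le n x
          · exact (hC x).2
          · exact (hC x).1
          · exact hK n x
      _ ≤ _ := by
        have : (0 : ℝ) ≤ n := by positivity
        nlinarith [mul_nonneg hC0 this]
  have h1 : Tendsto (fun n => ∫ x, fderiv ℝ (fun x => tubeCutoff ν μ c c' n x * φ x) x (F x))
      atTop (𝓝 0) := by
    have hlim : Tendsto (fun n : ℕ => (C + K * C) * B * A * (1 / ((n : ℝ) + 1))) atTop (𝓝 0) := by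
      simpa using tendsto_one_div_add_atTop_nhds_zero_nat.const_mul ((C + K * C) * B * A)
    refine squeeze_zero_norm (fun n => ?_) hlim
    have hn : (0 : ℝ) < n + 1 := by positivity
    rw [← setIntegral_eq_integral_of_forall_compl_eq_zero
      (s := tube ν μ c c' R (1 / (n + 1))) (fun x hx => by
        have : fderiv ℝ (fun x => tubeCutoff ν μ c c' n x * φ x) x = 0 :=
          image_eq_zero_of_notMem_tsupport fun h => hx (hsupp n (tsupport_fderiv_subset ℝ h))
        rw [this]; rfl)]
    have hfin : volume (tube ν μ c c' R (1 / (n + 1))) < ⊤ :=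
      (Metric.isBounded_closedBall (x := (0 : E d)) (r := R)).subset
        (fun x hx => by simpa using hx.1) |>.measure_lt_top
    refine (norm_setIntegral_le_of_norm_le_const (C := (C + K * C) * (n + 1) * B) hfin
      fun x _ => ?_).trans ?_
    · exact (ContinuousLinearMap.le_opNorm _ _).trans
        (mul_le_mul (hfd n x) (hB x) (norm_nonneg _) (by positivity))
    · calc _ ≤ (C + K * C) * (n + 1) * B * (A / (n + 1) ^ 2) := by
            gcongr; exact hA n
        _ = _ := by field_simp
  have h2 : Tendsto (fun n => ∫ x, tubeCutoff ν μ c c' n x * φ x * g x ∂m) atTop (𝓝 0) := by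
    have h0 : (0 : ℝ) = ∫ x, (0 : ℝ) ∂m := by simp
    rw [h0]
    refine tendsto_integral_of_dominated_convergence (fun x => ‖φ x * g x‖)
      (fun n => (integrable_test_mul hg (htest n)).aestronglyMeasurable)
      (integrable_test_mul hg hφ).norm (fun n => Eventually.of_forall fun x => ?_) ?_
    · rw [mul_assoc, norm_mul]
      exact mul_le_of_le_one_left (norm_nonneg _) (abs_tubeCutoff_le n x)
    · have : ∀ᵐ x ∂m, x ∉ hyp ν c ∩ hyp μ c' := by
        exact measure_eq_zero_iff_ae_notMem.1 hm
      filter_upwards [this] with x hx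
      simpa [mul_assoc] using (tendsto_tubeCutoff hx).mul_const (φ x * g x)
  simpa [firstOrder] using h1.add h2

end

/-- The points lying on two different hyperplanes of a family. -/
def hypSing {d : ℕ} {ι : Type*} (ν : ι → E d) (c : ι → ℝ) : Set (E d) :=
  {x | ∃ i j, hyp (ν i) (c i) ≠ hyp (ν j) (c j) ∧ x ∈ hyp (ν i) (c i) ∩ hyp (ν j) (c j)}

/-- A first order functional with bounded principal part that vanishes locally outside the set of
points lying on two different hyperplanes of a finite family vanishes everywhere. -/
theorem firstOrder_eq_zero_of_locally_off_hypSing {d : ℕ} {ι : Type*} [Finite ι] {ν : ι → E d}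
    {c : ι → ℝ} (hν : ∀ i, ‖ν i‖ = 1) {F : E d → E d} {g : E d → ℝ} {m : Measure (E d)} {B : ℝ}
    (hF : AEStronglyMeasurable F) (hB : ∀ x, ‖F x‖ ≤ B) (hg : Integrable g m)
    (hm : ∀ i j, hyp (ν i) (c i) ≠ hyp (ν j) (c j) → m (hyp (ν i) (c i) ∩ hyp (ν j) (c j)) = 0)
    (hloc : ∀ x ∉ hypSing ν c, ∃ U, IsOpen U ∧ x ∈ U ∧
      ∀ ψ, IsTestFunction U ψ → firstOrder F g m ψ = 0)
    {φ : E d → ℝ} (hφ : IsTestFunction Set.univ φ) : firstOrder F g m φ = 0 := by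
  classical
  have := Fintype.ofFinite ι
  let Zp : ι × ι → Set (E d) := fun q => {x | hyp (ν q.1) (c q.1) ≠ hyp (ν q.2) (c q.2) ∧
    x ∈ hyp (ν q.1) (c q.1) ∩ hyp (ν q.2) (c q.2)}
  -- Induction on the set of pairs of hyperplanes whose intersection the support of the test
  -- function may still meet.
  suffices h : ∀ (s : Finset (ι × ι)) (φ : E d → ℝ), IsTestFunction Set.univ φ →
      (∀ q ∉ s, ∀ x ∈ tsupport φ, x ∉ Zp q) → firstOrder F g m φ = 0 from
    h Finset.univ φ hφ (fun q hq => absurd (Finset.mem_univ q) hq)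
  intro s
  induction s using Finset.induction_on with
  | empty =>
    intro φ hφ h
    refine firstOrder_eq_zero_of_locally hF hB hg hφ fun x hx => hloc x ?_
    rintro ⟨i, j, hij⟩
    exact h (i, j) (Finset.notMem_empty _) x hx hij
  | insert q s hq ih =>
    intro φ hφ h
    by_cases hemp : Zp q = ∅
    · refine ih φ hφ fun p hp x hx => ?_
      by_cases hpq : p = q
      · simp [hpq, hemp]
      · exact h p (by simp [hpq, hp]) x hx
    obtain ⟨z, hne, hz⟩ := Set.nonempty_iff_ne_empty.2 hemp
    -- Split `φ = κφ + (1 - κ)φ`. The second part stays away from the intersection of the pair `q`,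
    -- so the induction hypothesis applies to it; the first part then has a value independent of
    -- `n`, which tends to zero.
    let κ : ℕ → E d → ℝ := tubeCutoff (ν q.1) (ν q.2) (c q.1) (c q.2)
    have hκ : ∀ n, ContDiff ℝ ∞ (fun x => 1 - κ n x) := fun n =>
      contDiff_const.sub (contDiff_tubeCutoff n)
    have h1 : ∀ n, firstOrder F g m (fun x => (1 - κ n x) * φ x) = 0 := fun n => by
      refine ih _ (hφ.mul_contDiff (hκ n)) fun p hp x hx => ?_
      by_cases hpq : p = q
      · subst hpq
        rintro ⟨-, hxZ⟩
        have hev := tubeCutoff_eventually_eq_one n hxZ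
        refine notMem_tsupport_iff_eventuallyEq.2 ?_ hx
        filter_upwards [hev] with y hy
        simp [κ, hy]
      · exact h p (by simp [hpq, hp]) x (tsupport_mul_subset_right hx)
    have h2 : ∀ n, firstOrder F g m (fun x => κ n x * φ x) = firstOrder F g m φ := fun n => by
      have := firstOrder_add hF hB hg
        (hφ.mul_contDiff (contDiff_tubeCutoff n : ContDiff ℝ ∞ (κ n)))
        (hφ.mul_contDiff (hκ n))
      rw [h1 n, add_zero] at this
      rw [← this]
      congr 1; funext x; simp only [κ]; ring
    have h3 := tendsto_firstOrder_tubeCutoff hB hg (hν q.1) (hν q.2) hne ⟨z, hz⟩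
      (hm _ _ hne) hφ
    simp only [κ] at h2
    simp only [h2] at h3
    exact tendsto_nhds_unique tendsto_const_nhds h3

/-! ### Polytopes -/

section

variable {d m : ℕ} {S : Set (E d)}

theorem IsPolytope.isCompact (hS : IsPolytope m S) : IsCompact S := by
  obtain ⟨A, -, F, -, -, rfl⟩ := hS
  exact F.isCompact_biUnion fun V _ => V.finite_toSet.isCompact_convexHull ℝ

/-- The points of a polytope are approximated by points of the relative interior. -/
theorem IsPolytope.measure_inter_pos (hS : IsPolytope m S) {U : Set (E d)}
    (hU : IsOpen U) (h : (U ∩ S).Nonempty) :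
    0 < (Measure.euclideanHausdorffMeasure m : Measure (E d)) (U ∩ S) := by
  obtain ⟨A, hA, F, -, hF, rfl⟩ := hS
  obtain ⟨x, hxU, hxS⟩ := h
  obtain ⟨V, hV, hxV⟩ := Set.mem_iUnion₂.1 hxS
  have hVA : (V : Set (E d)) ⊆ A := by rw [← hF V hV]; exact subset_affineSpan ℝ _
  have hVne : (V : Set (E d)).Nonempty := convexHull_nonempty_iff.1 ⟨x, hxV⟩
  obtain ⟨p, hp⟩ := hVne
  have hpA : p ∈ A := hVA hp
  -- In these coordinates of the affine hull the convex piece has interior points and lies in the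
  -- closure of its interior. An open set that meets the piece therefore meets it in positive
  -- Lebesgue measure, which `ι` turns into Hausdorff measure.
  let ι : A.direction →ᵃ[ℝ] E d := A.direction.subtype.toAffineMap +ᵥ AffineMap.const ℝ _ p
  have hι : ∀ y, ι y = (y : E d) + p := fun y => by simp [ι]
  have hiso : Isometry ι := Isometry.of_dist_eq fun y z => by
    rw [hι, hι, dist_add_right]; rfl
  have hrange : ∀ y, ι y ∈ A := fun y => by
    rw [hι]; exact AffineSubspace.vadd_mem_of_mem_direction y.2 hpA
  have hsurj : ∀ z ∈ A, ∃ y, ι y = z := fun z hz =>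
    ⟨⟨z - p, AffineSubspace.vsub_mem_direction hz hpA⟩, by rw [hι]; simp⟩
  let W : Set A.direction := ι ⁻¹' V
  have hW : ι '' W = V := Set.image_preimage_eq_of_subset fun z hz => hsurj z (hVA hz)
  have hspan : affineSpan ℝ W = ⊤ := by
    have h1 : (affineSpan ℝ W).map ι = A := by
      rw [AffineSubspace.map_span, hW, hF V hV]
    rw [eq_top_iff]
    intro y _
    have hy : ι y ∈ (affineSpan ℝ W).map ι := by rw [h1]; exact hrange y
    obtain ⟨y', hy', h2⟩ := (AffineSubspace.mem_map).1 hy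
    rwa [hiso.injective h2] at hy'
  have h_int : (interior (convexHull ℝ W)).Nonempty :=
    interior_convexHull_nonempty_iff_affineSpan_eq_top.2 hspan
  have hcl := (convex_convexHull ℝ W).closure_interior_eq_closure_of_nonempty_interior h_int
  have himg : ι '' convexHull ℝ W = convexHull ℝ V := by
    rw [AffineMap.image_convexHull, hW]
  obtain ⟨x', hx', rfl⟩ : x ∈ ι '' convexHull ℝ W := by rw [himg]; exact hxV
  have hx'' : x' ∈ closure (interior (convexHull ℝ W)) := by rw [hcl]; exact subset_closure hx'
  have hne : (ι ⁻¹' U ∩ interior (convexHull ℝ W)).Nonempty :=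
    mem_closure_iff.1 hx'' _ (hU.preimage hiso.continuous) hxU
  have hpos : 0 < (volume : Measure A.direction) (ι ⁻¹' U ∩ interior (convexHull ℝ W)) :=
    ((hU.preimage hiso.continuous).inter isOpen_interior).measure_pos _ hne
  rw [← InnerProductSpace.euclideanHausdorffMeasure_eq_volume, hA,
    ← hiso.euclideanHausdorffMeasure_image] at hpos
  refine hpos.trans_le (measure_mono ?_)
  rintro _ ⟨y, ⟨hy1, hy2⟩, rfl⟩
  refine ⟨hy1, Set.mem_iUnion₂.2 ⟨V, hV, ?_⟩⟩
  rw [← himg]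
  exact Set.mem_image_of_mem _ (interior_subset hy2)

/-- Each convex piece spans the whole space, so it has interior points and lies in the closure of
its own interior. -/
theorem IsPolytope.closure_interior (hS : IsPolytope d S) :
    closure (interior S) = S := by
  refine subset_antisymm (closure_minimal interior_subset hS.isCompact.isClosed) ?_
  obtain ⟨A, hA, F, -, hF, rfl⟩ := hS
  refine Set.iUnion₂_subset fun V hV x hx => ?_
  have hAne : (A : Set (E d)).Nonempty := by
    obtain ⟨y, hy⟩ : (V : Set (E d)).Nonempty := convexHull_nonempty_iff.1 ⟨x, hx⟩
    exact ⟨y, by rw [← hF V hV]; exact subset_affineSpan ℝ _ hy⟩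
  have htop : A = ⊤ := by
    rw [← AffineSubspace.direction_eq_top_iff_of_nonempty hAne]
    exact Submodule.eq_top_of_finrank_eq (by rw [hA, finrank_euclideanSpace_fin])
  have h_int : (interior (convexHull ℝ (V : Set (E d)))).Nonempty :=
    interior_convexHull_nonempty_iff_affineSpan_eq_top.2 (by rw [hF V hV, htop])
  have hcl := (convex_convexHull ℝ (V : Set (E d))).closure_interior_eq_closure_of_nonempty_interior
    h_int
  have hx' := subset_closure hx
  rw [← hcl] at hx'
  exact closure_mono (interior_mono (Set.subset_biUnion_of_mem (u := fun V : Finset (E d) =>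
    convexHull ℝ (V : Set (E d))) hV)) hx'

end

section

variable {d : ℕ} {Ω : Set (E d)}

theorem IsPolytopalDomain.isOpen (hΩ : IsPolytopalDomain Ω) : IsOpen Ω := by
  obtain ⟨-, P, -, rfl⟩ := hΩ
  exact isOpen_interior

theorem IsPolytopalDomain.isBounded (hΩ : IsPolytopalDomain Ω) : Bornology.IsBounded Ω := by
  obtain ⟨-, P, hP, rfl⟩ := hΩ
  exact hP.isCompact.isBounded.subset interior_subset

/-- The domain has no slits or punctures. This regularity replaces a Lipschitz condition: it
excludes boundary points with the domain on both sides, and makes the complement of the domain the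
closure of its exterior. -/
theorem IsPolytopalDomain.interior_closure (hΩ : IsPolytopalDomain Ω) :
    interior (closure Ω) = Ω := by
  obtain ⟨-, P, hP, rfl⟩ := hΩ
  rw [hP.closure_interior]

theorem IsPolytopalDomain.volume_lt_top (hΩ : IsPolytopalDomain Ω) : volume Ω < ⊤ :=
  hΩ.isBounded.measure_lt_top

end

/-! ### Geometry of meshes -/

theorem hyp_eq_hyp_iff {d : ℕ} {ν μ : E d} (hν : ‖ν‖ = 1) (hμ : ‖μ‖ = 1) {c c' : ℝ}
    (h : hyp ν c = hyp μ c') : (μ = ν ∧ c' = c) ∨ (μ = -ν ∧ c' = -c) := by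
  have hc : inner ℝ μ (c • ν) = c' := by
    have : c • ν ∈ hyp ν c := by simp [hyp, inner_smul_right, hν]
    rw [h] at this; exact this
  have hperp : ∀ y ∈ (ℝ ∙ ν)ᗮ, inner ℝ μ y = 0 := fun y hy => by
    have hy' := Submodule.mem_orthogonal_singleton_iff_inner_right.1 hy
    have : c • ν + y ∈ hyp ν c := by simp [hyp, inner_add_right, inner_smul_right, hν, hy']
    rw [h] at this
    simp only [hyp, Set.mem_ofPred_eq, inner_add_right, hc] at this
    linarith
  have hmem : μ ∈ (ℝ ∙ ν) := by
    rw [← Submodule.orthogonal_orthogonal (ℝ ∙ ν)]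
    exact (Submodule.mem_orthogonal' _ _).2 hperp
  obtain ⟨s, rfl⟩ := Submodule.mem_span_singleton.1 hmem
  rw [norm_smul, hν, mul_one, Real.norm_eq_abs] at hμ
  rw [inner_smul_right, inner_smul_left, real_inner_self_eq_norm_sq, hν] at hc
  rcases (abs_eq zero_le_one).1 hμ with rfl | rfl
  · left; simp at hc; simp [hc]
  · right; simp at hc; simp [← hc]

namespace Mesh

variable {d : ℕ} {Ω : Set (E d)} (M : Mesh Ω)

theorem mem_facesOf {t : Fin M.numElems} {e : Fin M.numFaces} :
    e ∈ M.facesOf t ↔ M.face e ⊆ frontier (M.elem t) := by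
  simp [facesOf]

theorem isClosed_elem (t : Fin M.numElems) : IsClosed (M.elem t) :=
  (M.isPolytope_elem t).isCompact.isClosed

theorem isCompact_face (e : Fin M.numFaces) : IsCompact (M.face e) :=
  (M.isPolytope_face e).isCompact

/-- An element adjacent to a face. -/
def adj (e : Fin M.numFaces) : Fin M.numElems := (M.exists_elem e).choose

theorem mem_facesOf_adj (e : Fin M.numFaces) : e ∈ M.facesOf (M.adj e) :=
  M.mem_facesOf.2 (M.exists_elem e).choose_spec

/-- A unit normal to a face. -/
def faceNormal (e : Fin M.numFaces) : E d := M.normal (M.adj e) e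

/-- The value of the normal coordinate on a face. -/
def faceOffset (e : Fin M.numFaces) : ℝ :=
  inner ℝ (M.faceNormal e) (M.isConnected_face e).nonempty.some

/-- The hyperplane containing a face. -/
def faceHyp (e : Fin M.numFaces) : Set (E d) := hyp (M.faceNormal e) (M.faceOffset e)

theorem norm_normal {t : Fin M.numElems} {e : Fin M.numFaces} (h : e ∈ M.facesOf t) :
    ‖M.normal t e‖ = 1 := (M.normal_spec t e (M.mem_facesOf.1 h)).1

theorem norm_faceNormal (e : Fin M.numFaces) : ‖M.faceNormal e‖ = 1 :=
  M.norm_normal (M.mem_facesOf_adj e)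

theorem face_subset_hyp {t : Fin M.numElems} {e : Fin M.numFaces} (h : e ∈ M.facesOf t)
    {y : E d} (hy : y ∈ M.face e) :
    M.face e ⊆ hyp (M.normal t e) (inner ℝ (M.normal t e) y) := fun x hx => by
  have := (M.normal_spec t e (M.mem_facesOf.1 h)).2.1 x hx y hy
  rw [inner_sub_right] at this
  exact sub_eq_zero.1 this

theorem face_subset_faceHyp (e : Fin M.numFaces) : M.face e ⊆ M.faceHyp e :=
  M.face_subset_hyp (M.mem_facesOf_adj e) (M.isConnected_face e).nonempty.some_mem

theorem surf_face_inter_pos (e : Fin M.numFaces) {U : Set (E d)} (hU : IsOpen U)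
    (h : (U ∩ M.face e).Nonempty) : 0 < surf d (U ∩ M.face e) :=
  (M.isPolytope_face e).measure_inter_pos hU h

theorem surf_face_lt_top (e : Fin M.numFaces) : surf d (M.face e) < ⊤ := by
  have := surf_lt_top_of_isBounded (M.norm_faceNormal e) (M.faceOffset e)
    (M.isCompact_face e).isBounded
  rwa [Set.inter_eq_left.2 (show M.face e ⊆ hyp _ _ from M.face_subset_faceHyp e)] at this

theorem volume_face (e : Fin M.numFaces) : volume (M.face e) = 0 :=
  measure_mono_null (M.face_subset_faceHyp e) (volume_hyp (M.norm_faceNormal e) _)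

/-- The hyperplane of a face does not depend on the adjacent element. -/
theorem hyp_normal_eq {t : Fin M.numElems} {e : Fin M.numFaces}
    (h : e ∈ M.facesOf t) {y : E d} (hy : y ∈ M.face e) :
    hyp (M.normal t e) (inner ℝ (M.normal t e) y) = M.faceHyp e := by
  by_contra hne
  have h0 := surf_hyp_inter_eq_zero (M.norm_normal h) _ _ hne (M.norm_faceNormal e)
  have h1 := M.surf_face_inter_pos e isOpen_univ ⟨y, trivial, hy⟩
  rw [Set.univ_inter] at h1
  exact h1.ne' (measure_mono_null
    (Set.subset_inter (M.face_subset_hyp h hy) (M.face_subset_faceHyp e)) h0)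

theorem frontier_elem_subset (t : Fin M.numElems) {x : E d} (hx : x ∈ frontier (M.elem t)) :
    ∃ e ∈ M.facesOf t, x ∈ M.face e := by
  rw [M.frontier_elem t] at hx
  obtain ⟨e, he, hx⟩ := Set.mem_iUnion₂.1 hx
  exact ⟨e, M.mem_facesOf.2 he, hx⟩

theorem volume_frontier_elem (t : Fin M.numElems) : volume (frontier (M.elem t)) = 0 := by
  refine measure_mono_null (t := ⋃ e, M.face e) (fun x hx => ?_)
    (measure_iUnion_null fun e => M.volume_face e)
  obtain ⟨e, -, hx⟩ := M.frontier_elem_subset t hx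
  exact Set.mem_iUnion.2 ⟨e, hx⟩

theorem elem_ae_eq_interior (t : Fin M.numElems) :
    (M.elem t : Set (E d)) =ᵐ[volume] interior (M.elem t) :=
  (interior_ae_eq_of_null_frontier (M.volume_frontier_elem t)).symm

theorem frontier_subset_iUnion_face (hΩ : IsPolytopalDomain Ω) :
    frontier Ω ⊆ ⋃ e, M.face e := by
  intro x hx
  rw [hΩ.isOpen.frontier_eq] at hx
  have hx1 := hx.1
  rw [← M.iUnion_elem] at hx1
  obtain ⟨t, ht⟩ := Set.mem_iUnion.1 hx1
  have hx2 : x ∉ interior (M.elem t) := fun h => hx.2 <| by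
    rw [← hΩ.interior_closure, ← M.iUnion_elem]
    exact interior_mono (Set.subset_iUnion _ t) h
  obtain ⟨e, -, hx⟩ := M.frontier_elem_subset t
    (by rw [(M.isClosed_elem t).frontier_eq]; exact ⟨ht, hx2⟩)
  exact Set.mem_iUnion.2 ⟨e, hx⟩

theorem volume_frontier (M : Mesh Ω) (hΩ : IsPolytopalDomain Ω) : volume (frontier Ω) = 0 :=
  measure_mono_null (M.frontier_subset_iUnion_face hΩ)
    (measure_iUnion_null fun e => M.volume_face e)

theorem interior_elem_subset (hΩ : IsPolytopalDomain Ω) (t : Fin M.numElems) :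
    interior (M.elem t) ⊆ Ω := by
  have h : M.elem t ⊆ closure Ω := by rw [← M.iUnion_elem]; exact Set.subset_iUnion _ t
  exact (interior_mono h).trans hΩ.interior_closure.subset

theorem nonempty_interior_elem (t : Fin M.numElems) : (interior (M.elem t)).Nonempty :=
  (M.isConnected_elem t).nonempty

/-- Points on two different face hyperplanes. -/
def sing : Set (E d) := hypSing M.faceNormal M.faceOffset

/-- Only the face hyperplanes through a point are met near it. -/
theorem exists_ball_faceHyp (x : E d) :
    ∃ δ > 0, ∀ e, (Metric.ball x δ ∩ M.faceHyp e).Nonempty → x ∈ M.faceHyp e := by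
  have h : ∀ e, ∃ δ > 0, (Metric.ball x δ ∩ M.faceHyp e).Nonempty → x ∈ M.faceHyp e := by
    intro e
    by_cases he : x ∈ M.faceHyp e
    · exact ⟨1, one_pos, fun _ => he⟩
    · obtain ⟨δ, hδ, h⟩ := Metric.isOpen_iff.1 (isClosed_hyp _ _).isOpen_compl x he
      exact ⟨δ, hδ, fun ⟨y, hy1, hy2⟩ => absurd hy2 (h hy1)⟩
  choose δ hδ h using h
  by_cases hne : Nonempty (Fin M.numFaces)
  · refine ⟨Finset.univ.inf' Finset.univ_nonempty δ, (Finset.lt_inf'_iff _).2 fun e _ => hδ e,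
      fun e ⟨y, hy, hy'⟩ => h e ⟨y, Metric.ball_subset_ball (Finset.inf'_le _ (Finset.mem_univ e)) hy, hy'⟩⟩
  · exact ⟨1, one_pos, fun e => absurd ⟨e⟩ hne⟩

theorem faceHyp_eq_of_notMem_sing {x : E d} (hx : x ∉ M.sing) {e e' : Fin M.numFaces}
    (h : x ∈ M.faceHyp e) (h' : x ∈ M.faceHyp e') : M.faceHyp e = M.faceHyp e' := by
  by_contra hne
  exact hx ⟨e, e', hne, h, h'⟩

end Mesh

/-- A connected set not meeting the frontier of `S` is inside or outside of `S`. -/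
theorem subset_interior_or_subset_compl_closure {X : Type*} [TopologicalSpace X] {S B : Set X}
    (hB : IsPreconnected B) (h : ∀ x ∈ B, x ∉ frontier S) :
    B ⊆ interior S ∨ B ⊆ (closure S)ᶜ := by
  refine hB.subset_or_subset isOpen_interior isClosed_closure.isOpen_compl ?_ ?_
  · exact Set.disjoint_left.2 fun x hx hx' => hx' (interior_subset_closure hx)
  · intro x hx
    by_cases hxc : x ∈ closure S
    · exact Or.inl (by by_contra h'; exact h x hx ⟨hxc, h'⟩)
    · exact Or.inr hxc

/-! ### The divergence theorem on an element -/

theorem interior_hyp {d : ℕ} {ν : E d} (hν : ‖ν‖ = 1) (c : ℝ) : interior (hyp ν c) = ∅ := by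
  by_contra h
  have := isOpen_interior.measure_pos (volume : Measure (E d)) (Set.nonempty_iff_ne_empty.2 h)
  exact this.ne' (measure_mono_null interior_subset (volume_hyp hν c))

theorem integral_fderiv_eq_zero {d : ℕ} {ψ : E d → ℝ} (hψ : IsTestFunction Set.univ ψ) (η : E d) :
    ∫ x, fderiv ℝ ψ x η = 0 := by
  have h := integral_mul_fderiv_eq_neg_fderiv_mul_of_integrable
    (μ := (volume : Measure (E d))) (f := fun _ => (1 : ℝ)) (g := ψ) (v := η)
    (by simp) (by
      simpa using integrable_fderiv_apply (F := fun _ => η) (B := ‖η‖) (by fun_prop)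
        (fun _ => le_rfl) hψ)
    (by simpa using hψ.1.continuous.integrable_of_hasCompactSupport hψ.2.1)
    (by simp) (fun x _ => hψ.1.differentiable (by norm_num) x)
  simpa using h

namespace Mesh

variable {d : ℕ} {Ω : Set (E d)} (M : Mesh Ω)

theorem integrableOn_face {ψ : E d → ℝ} (hψ : Continuous ψ) (e : Fin M.numFaces) :
    IntegrableOn ψ (M.face e) (surf d) :=
  hψ.continuousOn.integrableOn_of_subset_isCompact (M.isCompact_face e)
    (M.isCompact_face e).measurableSet subset_rfl (M.surf_face_lt_top e).ne

theorem sum_integral_face (t : Fin M.numElems) {ψ : E d → ℝ} (hψ : Continuous ψ) :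
    ∑ e ∈ M.facesOf t, ∫ x in M.face e, ψ x ∂(surf d)
      = ∫ x in frontier (M.elem t), ψ x ∂(surf d) := by
  have h1 : frontier (M.elem t) = ⋃ e : M.facesOf t, M.face e := by
    rw [M.frontier_elem t]
    ext x
    simp [M.mem_facesOf]
  have hd : Pairwise (Function.onFun (AEDisjoint (surf d)) fun e : M.facesOf t => M.face e) :=
    fun e e' hne => M.overlap_face (Subtype.coe_injective.ne hne)
  rw [h1, integral_iUnion_ae (fun e => (M.isCompact_face _).nullMeasurableSet) hd
    ((integrableOn_finite_iUnion).2 fun e => M.integrableOn_face hψ e), tsum_fintype,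
    Finset.sum_coe_sort (M.facesOf t) fun e => ∫ x in M.face e, ψ x ∂(surf d)]

/-- The case of a neighbourhood in which the element is exactly a half-space: the volume and surface
integrals are those of the half-space, and the half-space theorem applies once every relevant normal
is known to be `ν` and not `-ν`. -/
theorem integral_elem_fderiv_of_half (t : Fin M.numElems) {ν : E d} (hν : ‖ν‖ = 1) {c : ℝ}
    {B : Set (E d)} (hB : IsOpen B) (hin : B ∩ {x | inner ℝ ν x < c} ⊆ interior (M.elem t))
    (hout : B ∩ {x | c < inner ℝ ν x} ⊆ (M.elem t)ᶜ)
    (hfaces : ∀ e, (B ∩ M.faceHyp e).Nonempty → M.faceHyp e = hyp ν c) (η : E d)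
    {ψ : E d → ℝ} (hψ : IsTestFunction B ψ) :
    ∫ x in M.elem t, fderiv ℝ ψ x η
      = ∑ e ∈ M.facesOf t, inner ℝ (M.normal t e) η * ∫ x in M.face e, ψ x ∂(surf d) := by
  have hzero : ∀ x ∉ B, ψ x = 0 := fun x hx =>
    image_eq_zero_of_notMem_tsupport fun h => hx (hψ.2.2 h)
  have hfzero : ∀ x ∉ B, fderiv ℝ ψ x = 0 := fun x hx =>
    image_eq_zero_of_notMem_tsupport fun h => hx (hψ.2.2 (tsupport_fderiv_subset ℝ h))
  -- the volume integral
  have hvol : ∫ x in M.elem t, fderiv ℝ ψ x η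
      = ∫ x in {x | inner ℝ ν x < c}, fderiv ℝ ψ x η := by
    rw [← integral_indicator (M.isClosed_elem t).measurableSet,
      ← integral_indicator (isOpen_lt (by fun_prop) continuous_const).measurableSet]
    refine integral_congr_ae ?_
    filter_upwards [measure_eq_zero_iff_ae_notMem.1 (volume_hyp hν c)] with x hx
    by_cases hxB : x ∈ B
    · rcases lt_trichotomy (inner ℝ ν x) c with h | h | h
      · have h' : x ∈ {x | inner ℝ ν x < c} := h
        rw [Set.indicator_of_mem (interior_subset (hin ⟨hxB, h⟩)), Set.indicator_of_mem h']
      · exact absurd h hx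
      · rw [Set.indicator_of_notMem (hout ⟨hxB, h⟩), Set.indicator_of_notMem]
        exact h.not_gt
    · simp [Set.indicator, hfzero x hxB]
  -- the frontier is the hyperplane
  have hfr : frontier (M.elem t) ∩ B = hyp ν c ∩ B := by
    ext x
    refine ⟨fun ⟨hx, hxB⟩ => ⟨?_, hxB⟩, fun ⟨hx, hxB⟩ => ⟨?_, hxB⟩⟩
    · obtain ⟨e, -, he⟩ := M.frontier_elem_subset t hx
      have he' := M.face_subset_faceHyp e he
      rwa [hfaces e ⟨x, hxB, he'⟩] at he'
    · have hline : Tendsto (fun s : ℝ => x + s • ν) (𝓝 0) (𝓝 x) := by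
        have : Continuous (fun s : ℝ => x + s • ν) := by fun_prop
        simpa using this.tendsto 0
      have hev : ∀ᶠ s in 𝓝 (0 : ℝ), x + s • ν ∈ B := hline.eventually (hB.mem_nhds hxB)
      have hin' : ∀ s : ℝ, inner ℝ ν (x + s • ν) = c + s := fun s => by
        rw [inner_add_right, inner_smul_right, real_inner_self_eq_norm_sq, hν, hx]; simp
      rw [frontier_eq_closure_inter_closure]
      constructor
      · refine mem_closure_of_tendsto (hline.mono_left (nhdsWithin_le_nhds (s := Set.Iio 0))) ?_
        filter_upwards [hev.filter_mono nhdsWithin_le_nhds, self_mem_nhdsWithin] with s hs hs'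
        refine interior_subset (hin ⟨hs, ?_⟩)
        simp only [Set.mem_ofPred_eq, hin']
        have : s < 0 := hs'
        linarith
      · refine mem_closure_of_tendsto (hline.mono_left (nhdsWithin_le_nhds (s := Set.Ioi 0))) ?_
        filter_upwards [hev.filter_mono nhdsWithin_le_nhds, self_mem_nhdsWithin] with s hs hs'
        refine hout ⟨hs, ?_⟩
        simp only [Set.mem_ofPred_eq, hin']
        have : 0 < s := hs'
        linarith
  have hbdry : ∫ x in frontier (M.elem t), ψ x ∂(surf d) = ∫ x in hyp ν c, ψ x ∂(surf d) := by
    rw [← integral_indicator isClosed_frontier.measurableSet,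
      ← integral_indicator (isClosed_hyp ν c).measurableSet]
    congr 1
    funext x
    by_cases hxB : x ∈ B
    · have : x ∈ frontier (M.elem t) ↔ x ∈ hyp ν c := by
        have := Set.ext_iff.1 hfr x
        simpa [hxB] using this
      by_cases hx : x ∈ hyp ν c
      · rw [Set.indicator_of_mem hx, Set.indicator_of_mem (this.2 hx)]
      · rw [Set.indicator_of_notMem hx, Set.indicator_of_notMem (fun h => hx (this.1 h))]
    · simp [Set.indicator, hzero x hxB]
  -- the outward normals
  have hnormal : ∀ e ∈ M.facesOf t, inner ℝ (M.normal t e) η * ∫ x in M.face e, ψ x ∂(surf d)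
      = inner ℝ ν η * ∫ x in M.face e, ψ x ∂(surf d) := by
    intro e he
    -- The outward property of a normal is only known at almost every point of the face. A face that
    -- meets `B` in a null set contributes nothing; otherwise some point in `B` has the property,
    -- and there `-ν` would point into the element.
    by_cases hpos : surf d (B ∩ M.face e) = 0
    · have : ∫ x in M.face e, ψ x ∂(surf d) = 0 := by
        refine integral_eq_zero_of_ae ?_
        have h1 : ∀ᵐ x ∂(surf d), x ∉ B ∩ M.face e := measure_eq_zero_iff_ae_notMem.1 hpos
        filter_upwards [ae_restrict_of_ae h1, ae_restrict_mem (M.isCompact_face e).measurableSet]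
          with x hx hxe
        exact hzero x fun hxB => hx ⟨hxB, hxe⟩
      simp [this]
    · have hae := (M.normal_spec t e (M.mem_facesOf.1 he)).2.2
      have hae' := ae_restrict_of_ae_restrict_of_subset (Set.inter_subset_right (s := B)) hae
      have hne : (surf d).restrict (B ∩ M.face e) ≠ 0 := by
        rwa [Ne, Measure.restrict_eq_zero]
      have := ae_neBot.2 hne
      obtain ⟨y, ⟨hy, hyB, hye⟩⟩ := (hae'.and (ae_restrict_mem
        (hB.measurableSet.inter (M.isCompact_face e).measurableSet))).exists
      have h1 := hfaces e ⟨y, hyB, M.face_subset_faceHyp e hye⟩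
      rw [← M.hyp_normal_eq he hye] at h1
      rcases hyp_eq_hyp_iff (M.norm_normal he) hν h1 with ⟨h2, h3⟩ | ⟨h2, h3⟩
      · rw [h2]
      · exfalso
        have hline : Tendsto (fun s : ℝ => y + s • M.normal t e) (𝓝[>] 0) (𝓝 y) := by
          have : Continuous (fun s : ℝ => y + s • M.normal t e) := by fun_prop
          simpa using (this.tendsto 0).mono_left nhdsWithin_le_nhds
        obtain ⟨s, ⟨hs, -⟩, hsB, hs0⟩ :=
          (hy.and ((hline.eventually (hB.mem_nhds hyB)).and self_mem_nhdsWithin)).exists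
        refine hs (interior_subset (hin ⟨hsB, ?_⟩))
        have hs0 : 0 < s := hs0
        simp only [Set.mem_ofPred_eq, inner_add_right, inner_smul_right, h2, h3, inner_neg_left,
          real_inner_self_eq_norm_sq, M.norm_normal he]
        linarith
  rw [Finset.sum_congr rfl hnormal, ← Finset.mul_sum, M.sum_integral_face t hψ.1.continuous, hbdry,
    hvol, integral_halfspace_fderiv hν η c (hψ.1.of_le (by norm_num)) hψ.2.1]

/-- The case of a neighbourhood that avoids the boundary of the element: both sides vanish. -/
theorem integral_elem_fderiv_of_notMem_frontier (t : Fin M.numElems) {B : Set (E d)}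
    (h : B ⊆ interior (M.elem t) ∨ B ⊆ (M.elem t)ᶜ) (η : E d)
    {ψ : E d → ℝ} (hψ : IsTestFunction B ψ) :
    ∫ x in M.elem t, fderiv ℝ ψ x η
      = ∑ e ∈ M.facesOf t, inner ℝ (M.normal t e) η * ∫ x in M.face e, ψ x ∂(surf d) := by
  have hzero : ∀ x ∉ B, ψ x = 0 := fun x hx =>
    image_eq_zero_of_notMem_tsupport fun h => hx (hψ.2.2 h)
  have hfzero : ∀ x ∉ B, fderiv ℝ ψ x = 0 := fun x hx =>
    image_eq_zero_of_notMem_tsupport fun h => hx (hψ.2.2 (tsupport_fderiv_subset ℝ h))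
  have hfr : ∀ x ∈ frontier (M.elem t), x ∉ B := fun x hx hxB => by
    rw [(M.isClosed_elem t).frontier_eq] at hx
    rcases h with h | h
    · exact hx.2 (h hxB)
    · exact h hxB hx.1
  have hr : ∑ e ∈ M.facesOf t, inner ℝ (M.normal t e) η * ∫ x in M.face e, ψ x ∂(surf d) = 0 := by
    refine Finset.sum_eq_zero fun e he => ?_
    rw [setIntegral_eq_zero_of_forall_eq_zero fun x hx =>
      hzero x (hfr x (M.mem_facesOf.1 he hx)), mul_zero]
  rw [hr]
  rcases h with h | h
  · rw [setIntegral_eq_integral_of_forall_compl_eq_zero fun x hx => by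
      rw [hfzero x fun hxB => hx (interior_subset (h hxB))]; rfl]
    exact integral_fderiv_eq_zero (hψ.mono (Set.subset_univ _)) η
  · exact setIntegral_eq_zero_of_forall_eq_zero fun x hx => by
      rw [hfzero x fun hxB => h hxB hx]; rfl

/-- Off the singular set, a small ball meets at most one face hyperplane. Each open half of the ball
is connected and misses the boundary of the element, so it lies inside or outside; the four
combinations reduce to the two preceding lemmas. -/
theorem exists_local_integral_elem_fderiv (t : Fin M.numElems) (η : E d) {x : E d}
    (hx : x ∉ M.sing) : ∃ U, IsOpen U ∧ x ∈ U ∧ ∀ ψ, IsTestFunction U ψ →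
      ∫ x in M.elem t, fderiv ℝ ψ x η
        = ∑ e ∈ M.facesOf t, inner ℝ (M.normal t e) η * ∫ x in M.face e, ψ x ∂(surf d) := by
  obtain ⟨δ, hδ, hball⟩ := M.exists_ball_faceHyp x
  refine ⟨Metric.ball x δ, Metric.isOpen_ball, Metric.mem_ball_self hδ, fun ψ hψ => ?_⟩
  have hcl := M.isClosed_elem t
  have hreg : closure (interior (M.elem t)) = M.elem t := (M.isPolytope_elem t).closure_interior
  by_cases hno : ∃ e, x ∈ M.faceHyp e
  · obtain ⟨e₀, he₀⟩ := hno
    have hfaces : ∀ e, (Metric.ball x δ ∩ M.faceHyp e).Nonempty → M.faceHyp e = M.faceHyp e₀ :=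
      fun e he => M.faceHyp_eq_of_notMem_sing hx (hball e he) he₀
    set ν := M.faceNormal e₀ with hνdef
    set c := M.faceOffset e₀ with hcdef
    have hν : ‖ν‖ = 1 := M.norm_faceNormal e₀
    have hfr : ∀ y ∈ Metric.ball x δ, y ∈ frontier (M.elem t) → inner ℝ ν y = c := by
      intro y hy hyf
      obtain ⟨e, -, he⟩ := M.frontier_elem_subset t hyf
      have he' := M.face_subset_faceHyp e he
      rw [hfaces e ⟨y, hy, he'⟩] at he'
      exact he'
    have hlin : IsLinearMap ℝ (fun y : E d => inner ℝ ν y) :=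
      ⟨fun _ _ => inner_add_right _ _ _, fun _ _ => inner_smul_right _ _ _⟩
    have h1 := subset_interior_or_subset_compl_closure (S := M.elem t)
      (B := Metric.ball x δ ∩ {y | inner ℝ ν y < c})
      ((convex_ball x δ).inter (convex_halfSpace_lt hlin c)).isPreconnected
      (fun y hy hyf => (hfr y hy.1 hyf ▸ hy.2 : c < c).false)
    have h2 := subset_interior_or_subset_compl_closure (S := M.elem t)
      (B := Metric.ball x δ ∩ {y | c < inner ℝ ν y})
      ((convex_ball x δ).inter (convex_halfSpace_gt hlin c)).isPreconnected
      (fun y hy hyf => (hfr y hy.1 hyf ▸ hy.2 : c < c).false)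
    rw [hcl.closure_eq] at h1 h2
    have hsplit : ∀ y ∈ Metric.ball x δ, y ∉ hyp ν c →
        y ∈ Metric.ball x δ ∩ {y | inner ℝ ν y < c} ∨
        y ∈ Metric.ball x δ ∩ {y | c < inner ℝ ν y} := fun y hy hyh =>
      (lt_or_gt_of_ne hyh).imp (fun h => ⟨hy, h⟩) (fun h => ⟨hy, h⟩)
    rcases h1 with h1 | h1 <;> rcases h2 with h2 | h2
    · refine M.integral_elem_fderiv_of_notMem_frontier t (Or.inl ?_) η hψ
      refine interior_maximal (fun y hy => ?_) Metric.isOpen_ball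
      by_contra hyT
      -- Both halves lie inside: what the ball contains of the complement is an open subset of a
      -- hyperplane, hence empty.
      have hsub : Metric.ball x δ ∩ (M.elem t)ᶜ ⊆ interior (hyp ν c) := by
        refine interior_maximal (fun z hz => ?_) (Metric.isOpen_ball.inter hcl.isOpen_compl)
        by_contra hzh
        rcases hsplit z hz.1 hzh with h | h
        · exact hz.2 (interior_subset (h1 h))
        · exact hz.2 (interior_subset (h2 h))
      rw [interior_hyp hν] at hsub
      exact hsub ⟨hy, hyT⟩
    · exact M.integral_elem_fderiv_of_half t hν Metric.isOpen_ball h1 h2 hfaces η hψ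
    · refine M.integral_elem_fderiv_of_half t (ν := -ν) (c := -c) (by rwa [norm_neg])
        Metric.isOpen_ball ?_ ?_ (fun e he => ?_) η hψ
      · simpa [inner_neg_left] using h2
      · simpa [inner_neg_left] using h1
      · rw [hfaces e he]
        ext y; simp [faceHyp, hyp, inner_neg_left, ← hνdef, ← hcdef]
    · refine M.integral_elem_fderiv_of_notMem_frontier t (Or.inr fun y hy hyT => ?_) η hψ
      rw [← hreg] at hyT
      -- Both halves lie outside: the element could only meet the ball in the hyperplane, which is
      -- impossible for the closure of an open set.
      have hsub : Metric.ball x δ ∩ interior (M.elem t) ⊆ interior (hyp ν c) := by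
        refine interior_maximal (fun z hz => ?_) (Metric.isOpen_ball.inter isOpen_interior)
        by_contra hzh
        rcases hsplit z hz.1 hzh with h | h
        · exact h1 h (interior_subset hz.2)
        · exact h2 h (interior_subset hz.2)
      rw [interior_hyp hν] at hsub
      obtain ⟨z, hz⟩ := mem_closure_iff.1 hyT _ Metric.isOpen_ball hy
      exact hsub hz
  · refine M.integral_elem_fderiv_of_notMem_frontier t ?_ η hψ
    have := subset_interior_or_subset_compl_closure (S := M.elem t) (B := Metric.ball x δ)
      (convex_ball x δ).isPreconnected (fun y hy hyf => by
        obtain ⟨e, -, he⟩ := M.frontier_elem_subset t hyf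
        exact hno ⟨e, hball e ⟨y, hy, M.face_subset_faceHyp e he⟩⟩)
    rwa [hcl.closure_eq] at this

/-- The divergence theorem on an element. -/
theorem integral_elem_fderiv (t : Fin M.numElems) (η : E d) {ψ : E d → ℝ}
    (hψ : IsTestFunction Set.univ ψ) :
    ∫ x in M.elem t, fderiv ℝ ψ x η
      = ∑ e ∈ M.facesOf t, inner ℝ (M.normal t e) η * ∫ x in M.face e, ψ x ∂(surf d) := by
  have hT := (M.isClosed_elem t).measurableSet
  -- The difference of the two sides is a first order functional with bounded principal part `F`. It
  -- vanishes locally off the singular set, so it vanishes.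
  let F : E d → E d := (M.elem t).indicator fun _ => η
  let g : E d → ℝ := fun x =>
    -∑ e ∈ M.facesOf t, (M.face e).indicator (fun _ => inner ℝ (M.normal t e) η) x
  let m : Measure (E d) := (surf d).restrict (⋃ e, M.face e)
  have hF : AEStronglyMeasurable F := (aestronglyMeasurable_const).indicator hT
  have hFB : ∀ x, ‖F x‖ ≤ ‖η‖ := fun x => norm_indicator_le_norm_self _ _
  have hface : ∀ e (φ : E d → ℝ), Continuous φ → Integrable ((M.face e).indicator φ) m :=
    fun e φ hφ => by
      rw [integrable_indicator_iff (M.isCompact_face e).measurableSet]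
      exact (M.integrableOn_face hφ e).mono_measure Measure.restrict_le_self
  have hg : Integrable g m := (integrable_finsetSum _ fun e _ => hface e _ continuous_const).neg
  have hfo : ∀ φ, IsTestFunction Set.univ φ → firstOrder F g m φ
      = (∫ x in M.elem t, fderiv ℝ φ x η)
        - ∑ e ∈ M.facesOf t, inner ℝ (M.normal t e) η * ∫ x in M.face e, φ x ∂(surf d) := by
    intro φ hφ
    rw [firstOrder, sub_eq_add_neg]
    congr 1
    · rw [← integral_indicator hT]
      congr 1; funext x
      by_cases hx : x ∈ M.elem t <;> simp [F, hx]
    · have h1 : ∀ x, φ x * g x = -∑ e ∈ M.facesOf t,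
          inner ℝ (M.normal t e) η * (M.face e).indicator φ x := fun x => by
        simp only [g, mul_neg, Finset.mul_sum]
        congr 1
        refine Finset.sum_congr rfl fun e _ => ?_
        by_cases hx : x ∈ M.face e <;> simp [hx, mul_comm]
      simp only [h1]
      rw [integral_neg, integral_finsetSum _ fun e _ =>
        (hface e φ hφ.1.continuous).const_mul _]
      congr 1
      refine Finset.sum_congr rfl fun e _ => ?_
      rw [integral_const_mul, integral_indicator (M.isCompact_face e).measurableSet,
        Measure.restrict_restrict_of_subset (Set.subset_iUnion _ e)]
  have h := firstOrder_eq_zero_of_locally_off_hypSing (ν := M.faceNormal) (c := M.faceOffset)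
    M.norm_faceNormal hF hFB hg (fun i j hij => ?_) (fun x hx => ?_) hψ
  · rw [hfo ψ hψ] at h
    exact sub_eq_zero.1 h
  · exact le_antisymm ((Measure.restrict_le_self _).trans
      (surf_hyp_inter_eq_zero (M.norm_faceNormal i) _ _ hij (M.norm_faceNormal j)).le) bot_le
  · obtain ⟨U, hU, hxU, h⟩ := M.exists_local_integral_elem_fderiv t η hx
    refine ⟨U, hU, hxU, fun φ hφ => ?_⟩
    rw [hfo φ (hφ.mono (Set.subset_univ _)), h φ hφ, sub_self]

end Mesh

/-! ### Polynomial functions -/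

section

variable {d : ℕ}

@[simp] theorem ev_add (P Q : MvPolynomial (Fin d) ℝ) (x : E d) :
    ev (P + Q) x = ev P x + ev Q x := by simp [ev]

@[simp] theorem ev_sub (P Q : MvPolynomial (Fin d) ℝ) (x : E d) :
    ev (P - Q) x = ev P x - ev Q x := by simp [ev]

@[simp] theorem ev_neg (P : MvPolynomial (Fin d) ℝ) (x : E d) : ev (-P) x = -ev P x := by
  simp [ev]

@[simp] theorem ev_mul (P Q : MvPolynomial (Fin d) ℝ) (x : E d) :
    ev (P * Q) x = ev P x * ev Q x := by simp [ev]

@[simp] theorem ev_smul (c : ℝ) (P : MvPolynomial (Fin d) ℝ) (x : E d) :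
    ev (c • P) x = c * ev P x := by simp [ev, MvPolynomial.smul_eval]

@[simp] theorem ev_zero (x : E d) : ev (0 : MvPolynomial (Fin d) ℝ) x = 0 := by simp [ev]

@[simp] theorem ev_one (x : E d) : ev (1 : MvPolynomial (Fin d) ℝ) x = 1 := by simp [ev]

@[simp] theorem ev_sum {ι : Type*} (s : Finset ι) (P : ι → MvPolynomial (Fin d) ℝ) (x : E d) :
    ev (∑ i ∈ s, P i) x = ∑ i ∈ s, ev (P i) x := by simp [ev]

theorem hasFDerivAt_ev (P : MvPolynomial (Fin d) ℝ) (x : E d) :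
    HasFDerivAt (ev P)
      (∑ i, ev (MvPolynomial.pderiv i P) x • (EuclideanSpace.proj i : E d →L[ℝ] ℝ)) x := by
  classical
  induction P using MvPolynomial.induction_on with
  | C a =>
    have h : (ev (MvPolynomial.C a) : E d → ℝ) = fun _ => a := by funext y; simp [ev]
    rw [h]
    refine (hasFDerivAt_const a x).congr_fderiv ?_
    simp
  | add P Q hP hQ =>
    have h : (ev (P + Q) : E d → ℝ) = fun y => ev P y + ev Q y := by funext y; simp
    rw [h]
    refine (hP.fun_add hQ).congr_fderiv ?_
    simp [add_smul, Finset.sum_add_distrib]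
  | mul_X P j hP =>
    have h : (ev (P * MvPolynomial.X j) : E d → ℝ) = fun y => ev P y * y j := by
      funext y; simp [ev]
    rw [h]
    have hX : HasFDerivAt (fun y : E d => y j) (EuclideanSpace.proj j : E d →L[ℝ] ℝ) x :=
      (EuclideanSpace.proj j : E d →L[ℝ] ℝ).hasFDerivAt
    refine (hP.fun_mul hX).congr_fderiv ?_
    have hXj : ev (MvPolynomial.X j) x = x j := by simp [ev]
    ext v
    simp only [MvPolynomial.pderiv_mul, MvPolynomial.pderiv_X, ev_add, ev_mul, hXj,
      add_apply, smul_apply, smul_eq_mul,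
      sum_apply, add_mul, Finset.sum_add_distrib, Finset.mul_sum]
    rw [add_comm]
    congr 1
    · exact Finset.sum_congr rfl fun i _ => by ring
    · rw [Finset.sum_eq_single j]
      · simp
      · intro i _ hij; simp [hij.symm]
      · simp

theorem contDiff_ev (P : MvPolynomial (Fin d) ℝ) {n : WithTop ℕ∞} : ContDiff ℝ n (ev P) := by
  induction P using MvPolynomial.induction_on with
  | C a =>
    have h : (ev (MvPolynomial.C a) : E d → ℝ) = fun _ => a := by funext y; simp [ev]
    rw [h]; exact contDiff_const
  | add P Q hP hQ =>
    have h : (ev (P + Q) : E d → ℝ) = fun y => ev P y + ev Q y := by funext y; simp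
    rw [h]; exact hP.add hQ
  | mul_X P j hP =>
    have h : (ev (P * MvPolynomial.X j) : E d → ℝ) = fun y => ev P y * y j := by
      funext y; simp [ev]
    rw [h]
    exact hP.mul (EuclideanSpace.proj j : E d →L[ℝ] ℝ).contDiff

@[fun_prop]
theorem continuous_ev (P : MvPolynomial (Fin d) ℝ) : Continuous (ev P) :=
  (contDiff_ev P (n := 0)).continuous

theorem partialD_ev (i : Fin d) (P : MvPolynomial (Fin d) ℝ) (x : E d) :
    partialD i (ev P) x = ev (MvPolynomial.pderiv i P) x := by
  classical
  rw [partialD, (hasFDerivAt_ev P x).fderiv]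
  simp only [sum_apply, smul_apply, smul_eq_mul]
  rw [Finset.sum_eq_single i]
  · simp
  · intro j _ hij; simp [hij]
  · simp

theorem partialD_mul (i : Fin d) {φ ψ : E d → ℝ} {x : E d} (hφ : DifferentiableAt ℝ φ x)
    (hψ : DifferentiableAt ℝ ψ x) :
    partialD i (fun y => φ y * ψ y) x = φ x * partialD i ψ x + partialD i φ x * ψ x := by
  simp only [partialD]
  rw [fderiv_fun_mul hφ hψ]
  simp [mul_comm]

theorem eq_zero_of_ev_eq_zero {P : MvPolynomial (Fin d) ℝ} {U : Set (E d)} (hU : IsOpen U)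
    (hne : U.Nonempty) (h : ∀ x ∈ U, ev P x = 0) : P = 0 := by
  obtain ⟨x₀, hx₀⟩ := hne
  have han : AnalyticOnNhd ℝ (ev P) Set.univ :=
    AnalyticOnNhd.eval_continuousLinearMap'
      (fun i => (EuclideanSpace.proj i : E d →L[ℝ] ℝ)) P
  have hz : Set.EqOn (ev P) 0 Set.univ :=
    han.eqOn_zero_of_preconnected_of_eventuallyEq_zero isPreconnected_univ (Set.mem_univ x₀)
      (by filter_upwards [hU.mem_nhds hx₀] with x hx using h x hx)
  refine MvPolynomial.funext fun y => ?_
  have := hz (Set.mem_univ (WithLp.toLp 2 y))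
  simpa [ev] using this

theorem pderiv_mem_poly {m : ℕ} {P : MvPolynomial (Fin d) ℝ} (hP : P ∈ Poly d m) (i : Fin d) :
    MvPolynomial.pderiv i P ∈ Poly d (m - 1) := by
  classical
  rw [MvPolynomial.mem_restrictTotalDegree] at hP
  rw [MvPolynomial.as_sum P, map_sum]
  refine Submodule.sum_mem _ fun s hs => ?_
  rw [MvPolynomial.pderiv_monomial, MvPolynomial.mem_restrictTotalDegree]
  -- If the variable does not occur, the monomial is killed; otherwise its degree is at least one
  -- and drops by one. So the truncated subtraction in `m - 1` is harmless at `m = 0`.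
  by_cases h0 : s i = 0
  · simp [h0]
  refine (MvPolynomial.totalDegree_monomial_le _ _).trans ?_
  have h1 : s.degree ≤ m := (MvPolynomial.le_totalDegree hs).trans hP
  have h2 : s - Finsupp.single i 1 + Finsupp.single i 1 = s := by
    ext j
    by_cases hij : i = j
    · subst hij; simp; omega
    · simp [hij]
  have h3 : (s - Finsupp.single i 1).degree + 1 = s.degree := by
    conv_rhs => rw [← h2]
    simp
  have h4 : (s - Finsupp.single i 1).degree ≤ m - 1 := by omega
  exact h4

theorem poly_mono {m n : ℕ} (h : m ≤ n) : Poly d m ≤ Poly d n := fun P hP => by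
  rw [MvPolynomial.mem_restrictTotalDegree] at hP ⊢
  exact hP.trans h

theorem pderiv_comm (i j : Fin d) (P : MvPolynomial (Fin d) ℝ) :
    MvPolynomial.pderiv i (MvPolynomial.pderiv j P)
      = MvPolynomial.pderiv j (MvPolynomial.pderiv i P) := by
  classical
  induction P using MvPolynomial.induction_on with
  | C a => simp
  | add P Q hP hQ => simp [hP, hQ]
  | mul_X P k hP =>
    simp only [MvPolynomial.pderiv_mul, map_add, hP, MvPolynomial.pderiv_X]
    have : ∀ a b : Fin d, MvPolynomial.pderiv a (Pi.single (M := fun _ => MvPolynomial (Fin d) ℝ) b 1 k) = 0 := by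
      intro a b
      by_cases h : k = b
      · subst h; simp
      · simp [h]
    simp only [this]
    ring

end

/-- A test function equal to `1` near a bounded set. -/
theorem exists_test_eq_one {d : ℕ} {S : Set (E d)} (hS : Bornology.IsBounded S) :
    ∃ χ : E d → ℝ, IsTestFunction Set.univ χ ∧ ∀ x ∈ S, ∀ᶠ y in 𝓝 x, χ y = 1 := by
  obtain ⟨R, hR⟩ := hS.subset_closedBall (0 : E d)
  let f : ContDiffBump (0 : E d) := ⟨max R 0 + 1, max R 0 + 2, by positivity, by linarith⟩
  refine ⟨f, isTestFunction_univ.2 ⟨f.contDiff, f.hasCompactSupport⟩, fun x hx => ?_⟩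
  refine f.eventuallyEq_one_of_mem_ball ?_
  have : ‖x‖ ≤ R := by simpa using hR hx
  simp only [Metric.mem_ball, dist_zero_right, f]
  linarith [le_max_left R 0]

/-! ### Integration by parts for piecewise polynomials -/

namespace Mesh

variable {d : ℕ} {Ω : Set (E d)} (M : Mesh Ω)

theorem integrableOn_elem {ψ : E d → ℝ} (hψ : Continuous ψ) (t : Fin M.numElems) :
    IntegrableOn ψ (M.elem t) :=
  hψ.continuousOn.integrableOn_compact (M.isPolytope_elem t).isCompact

theorem inner_normal_single (t : Fin M.numElems) (e : Fin M.numFaces) (i : Fin d) :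
    inner ℝ (M.normal t e) (EuclideanSpace.single i 1) = M.normal t e i := by
  simp [EuclideanSpace.inner_single_right]

theorem integral_elem_partialD_mul (t : Fin M.numElems) (i : Fin d)
    (P : MvPolynomial (Fin d) ℝ) {φ : E d → ℝ} (hφ : IsTestFunction Set.univ φ) :
    ∫ x in M.elem t, ev P x * partialD i φ x
      = -(∫ x in M.elem t, ev (MvPolynomial.pderiv i P) x * φ x)
        + ∑ e ∈ M.facesOf t, M.normal t e i * ∫ x in M.face e, ev P x * φ x ∂(surf d) := by
  have hψ := hφ.mul_contDiff (contDiff_ev P)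
  have h := M.integral_elem_fderiv t (EuclideanSpace.single i 1) hψ
  have h1 : ∀ x, fderiv ℝ (fun x => ev P x * φ x) x (EuclideanSpace.single i 1)
      = ev P x * partialD i φ x + ev (MvPolynomial.pderiv i P) x * φ x := fun x => by
    rw [← partialD_ev]
    exact partialD_mul i ((contDiff_ev P (n := 1)).differentiable (by norm_num) x)
      (hφ.1.differentiable (by norm_num) x)
  have hc : Continuous (partialD i φ) :=
    (hφ.1.continuous_fderiv (by norm_num)).clm_apply continuous_const
  simp only [h1, M.inner_normal_single] at h
  have hφc := hφ.1.continuous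
  rw [integral_add (M.integrableOn_elem (by fun_prop) t)
    (M.integrableOn_elem (by fun_prop) t)] at h
  linarith

/-- A polynomial has no compact support; it is multiplied by a cutoff equal to one near the element,
which changes nothing there. -/
theorem integral_elem_pderiv (t : Fin M.numElems) (i : Fin d) (P : MvPolynomial (Fin d) ℝ) :
    ∫ x in M.elem t, ev (MvPolynomial.pderiv i P) x
      = ∑ e ∈ M.facesOf t, M.normal t e i * ∫ x in M.face e, ev P x ∂(surf d) := by
  obtain ⟨χ, hχ, h1⟩ := exists_test_eq_one (M.isPolytope_elem t).isCompact.isBounded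
  have h := M.integral_elem_partialD_mul t i P hχ
  have hone : ∀ x ∈ M.elem t, χ x = 1 := fun x hx => (h1 x hx).self_of_nhds
  have hzero : ∀ x ∈ M.elem t, partialD i χ x = 0 := fun x hx => by
    have : χ =ᶠ[𝓝 x] fun _ => 1 := h1 x hx
    rw [partialD, this.fderiv_eq]; simp
  rw [setIntegral_eq_zero_of_forall_eq_zero fun x hx => by rw [hzero x hx, mul_zero],
    setIntegral_congr_fun (g := fun x => ev (MvPolynomial.pderiv i P) x)
      (M.isClosed_elem t).measurableSet (fun x hx => by simp [hone x hx])] at h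
  have h2 : ∀ e ∈ M.facesOf t, M.normal t e i * ∫ x in M.face e, ev P x * χ x ∂(surf d)
      = M.normal t e i * ∫ x in M.face e, ev P x ∂(surf d) := fun e he => by
    rw [setIntegral_congr_fun (g := fun x => ev P x) (M.isCompact_face e).measurableSet
      (fun x hx => by
        have : x ∈ M.elem t := (M.isClosed_elem t).frontier_subset (M.mem_facesOf.1 he hx)
        simp [hone x this])]
  rw [Finset.sum_congr rfl h2] at h
  linarith

/-- The piecewise polynomial function given by a polynomial on each element. -/
def pw (P : Fin M.numElems → MvPolynomial (Fin d) ℝ) (x : E d) : ℝ :=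
  ∑ t, (interior (M.elem t)).indicator (ev (P t)) x

theorem pw_apply (P : Fin M.numElems → MvPolynomial (Fin d) ℝ) {t : Fin M.numElems} {x : E d}
    (hx : x ∈ interior (M.elem t)) : M.pw P x = ev (P t) x := by
  rw [pw, Finset.sum_eq_single t, Set.indicator_of_mem hx]
  · intro s _ hst
    exact Set.indicator_of_notMem (fun h => Set.disjoint_left.1 (M.disjoint_elem hst) h hx) _
  · simp

theorem pw_apply_of_notMem (P : Fin M.numElems → MvPolynomial (Fin d) ℝ) {x : E d}
    (hx : ∀ t, x ∉ interior (M.elem t)) : M.pw P x = 0 :=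
  Finset.sum_eq_zero fun t _ => Set.indicator_of_notMem (hx t) _

theorem pw_eq_zero_of_notMem (hΩ : IsPolytopalDomain Ω)
    (P : Fin M.numElems → MvPolynomial (Fin d) ℝ) {x : E d} (hx : x ∉ Ω) : M.pw P x = 0 :=
  M.pw_apply_of_notMem P fun t h => hx (M.interior_elem_subset hΩ t h)

theorem measurable_pw (P : Fin M.numElems → MvPolynomial (Fin d) ℝ) : Measurable (M.pw P) :=
  Finset.measurable_fun_sum _ fun _ _ =>
    (continuous_ev _).measurable.indicator isOpen_interior.measurableSet

theorem exists_pw_bound (P : Fin M.numElems → MvPolynomial (Fin d) ℝ) :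
    ∃ C : ℝ, 0 ≤ C ∧ ∀ x, |M.pw P x| ≤ C := by
  have h : ∀ t, ∃ C : ℝ, ∀ x ∈ M.elem t, ‖ev (P t) x‖ ≤ C := fun t =>
    (M.isPolytope_elem t).isCompact.exists_bound_of_continuousOn (continuous_ev _).continuousOn
  choose C hC using h
  refine ⟨∑ t, |C t|, Finset.sum_nonneg fun t _ => abs_nonneg _, fun x => ?_⟩
  refine (Finset.abs_sum_le_sum_abs _ _).trans (Finset.sum_le_sum fun t _ => ?_)
  by_cases hx : x ∈ interior (M.elem t)
  · rw [Set.indicator_of_mem hx]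
    exact (hC t x (interior_subset hx)).trans (le_abs_self _)
  · rw [Set.indicator_of_notMem hx]; simp

theorem ae_mem_interior :
    ∀ᵐ x : E d, x ∈ Ω → ∃ t, x ∈ interior (M.elem t) := by
  have h : ∀ᵐ x : E d, ∀ t, x ∉ frontier (M.elem t) :=
    ae_all_iff.2 fun t => measure_eq_zero_iff_ae_notMem.1 (M.volume_frontier_elem t)
  filter_upwards [h] with x hx hxΩ
  have : x ∈ ⋃ t, M.elem t := by rw [M.iUnion_elem]; exact subset_closure hxΩ
  obtain ⟨t, ht⟩ := Set.mem_iUnion.1 this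
  refine ⟨t, ?_⟩
  by_contra hn
  exact hx t (by rw [(M.isClosed_elem t).frontier_eq]; exact ⟨ht, hn⟩)

theorem ae_eq_iUnion_interior (hΩ : IsPolytopalDomain Ω) :
    (Ω : Set (E d)) =ᵐ[volume] ⋃ t, interior (M.elem t) := by
  filter_upwards [M.ae_mem_interior] with x hx
  refine propext ⟨fun h => Set.mem_iUnion.2 (hx h), fun h => ?_⟩
  obtain ⟨t, ht⟩ := Set.mem_iUnion.1 h
  exact M.interior_elem_subset hΩ t ht

theorem integral_eq_sum_elem (hΩ : IsPolytopalDomain Ω) {g : E d → ℝ} (hg : IntegrableOn g Ω) :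
    ∫ x in Ω, g x = ∑ t, ∫ x in M.elem t, g x := by
  rw [setIntegral_congr_set (M.ae_eq_iUnion_interior hΩ),
    integral_iUnion_fintype (fun t => isOpen_interior.measurableSet) M.disjoint_elem
      (fun t => hg.mono_set (M.interior_elem_subset hΩ t))]
  exact Finset.sum_congr rfl fun t _ => (setIntegral_congr_set (M.elem_ae_eq_interior t)).symm

theorem setIntegral_elem_congr (t : Fin M.numElems) {f g : E d → ℝ}
    (h : ∀ x ∈ interior (M.elem t), f x = g x) : ∫ x in M.elem t, f x = ∫ x in M.elem t, g x := by
  rw [setIntegral_congr_set (M.elem_ae_eq_interior t),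
    setIntegral_congr_set (M.elem_ae_eq_interior t)]
  exact setIntegral_congr_fun isOpen_interior.measurableSet h

theorem integrableOn_pw_mul {Ω' : Set (E d)} (P : Fin M.numElems → MvPolynomial (Fin d) ℝ)
    {g : E d → ℝ} (hg : IntegrableOn g Ω') : IntegrableOn (fun x => M.pw P x * g x) Ω' := by
  obtain ⟨C, -, hC⟩ := M.exists_pw_bound P
  exact hg.bdd_mul (c := C) (M.measurable_pw P).aestronglyMeasurable
    (Eventually.of_forall fun x => hC x)

theorem integral_pw_mul (hΩ : IsPolytopalDomain Ω) (P : Fin M.numElems → MvPolynomial (Fin d) ℝ)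
    {g : E d → ℝ} (hg : IntegrableOn g Ω) :
    ∫ x in Ω, M.pw P x * g x = ∑ t, ∫ x in M.elem t, ev (P t) x * g x := by
  rw [M.integral_eq_sum_elem hΩ (M.integrableOn_pw_mul P hg)]
  exact Finset.sum_congr rfl fun t _ => M.setIntegral_elem_congr t fun x hx => by
    rw [M.pw_apply P hx]

/-- The elements adjacent to a face. -/
def elemsOf (e : Fin M.numFaces) : Finset (Fin M.numElems) :=
  Finset.univ.filter fun t => e ∈ M.facesOf t

/-- The sum of the normal components, over the two sides of a face. -/
def jump (P : Fin M.numElems → MvPolynomial (Fin d) ℝ) (i : Fin d) (e : Fin M.numFaces) :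
    MvPolynomial (Fin d) ℝ := ∑ t ∈ M.elemsOf e, M.normal t e i • P t

theorem sum_facesOf_comm (f : Fin M.numElems → Fin M.numFaces → ℝ) :
    ∑ t, ∑ e ∈ M.facesOf t, f t e = ∑ e, ∑ t ∈ M.elemsOf e, f t e := by
  refine Finset.sum_comm' fun t e => ?_
  simp [elemsOf]

theorem integrableOn_test {Ω' : Set (E d)} {φ : E d → ℝ} (hφ : IsTestFunction Set.univ φ) :
    IntegrableOn φ Ω' := (hφ.1.continuous.integrable_of_hasCompactSupport hφ.2.1).integrableOn

theorem integrableOn_partialD {Ω' : Set (E d)} {φ : E d → ℝ} (hφ : IsTestFunction Set.univ φ)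
    (i : Fin d) : IntegrableOn (partialD i φ) Ω' :=
  (integrable_fderiv_apply (F := fun _ => EuclideanSpace.single i 1) (B := 1) (by fun_prop)
    (fun _ => by simp) hφ).integrableOn

theorem integral_pw_partialD (hΩ : IsPolytopalDomain Ω)
    (P : Fin M.numElems → MvPolynomial (Fin d) ℝ) (i : Fin d) {φ : E d → ℝ}
    (hφ : IsTestFunction Set.univ φ) :
    ∫ x in Ω, M.pw P x * partialD i φ x
      = -(∫ x in Ω, M.pw (fun t => MvPolynomial.pderiv i (P t)) x * φ x)
        + ∑ e, ∫ x in M.face e, ev (M.jump P i e) x * φ x ∂(surf d) := by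
  rw [M.integral_pw_mul hΩ P (integrableOn_partialD hφ i),
    M.integral_pw_mul hΩ _ (integrableOn_test hφ)]
  simp only [M.integral_elem_partialD_mul _ i _ hφ, Finset.sum_add_distrib,
    Finset.sum_neg_distrib]
  congr 1
  rw [M.sum_facesOf_comm]
  refine Finset.sum_congr rfl fun e _ => ?_
  simp only [jump, ev_sum, ev_smul, Finset.sum_mul]
  have hφc := hφ.1.continuous
  rw [integral_finsetSum _ fun t _ => M.integrableOn_face (by fun_prop) e]
  refine Finset.sum_congr rfl fun t _ => ?_
  rw [← integral_const_mul]
  simp only [mul_assoc]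

/-- Across a face that is not on the boundary, the normals of the two sides cancel. -/
theorem sum_normal_eq_zero (hΩ : IsPolytopalDomain Ω) {e : Fin M.numFaces}
    (he : ¬ M.face e ⊆ frontier Ω) (i : Fin d) : ∑ t ∈ M.elemsOf e, M.normal t e i = 0 := by
  classical
  let c : Fin M.numFaces → ℝ := fun e => ∑ t ∈ M.elemsOf e, M.normal t e i
  let m : Measure (E d) := (surf d).restrict (⋃ e, M.face e)
  let g : E d → ℝ := fun x => ∑ e, (M.face e).indicator (fun _ => c e) x
  have hface : ∀ e (φ : E d → ℝ), Continuous φ → Integrable ((M.face e).indicator φ) m :=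
    fun e φ hφ => by
      rw [integrable_indicator_iff (M.isCompact_face e).measurableSet]
      exact (M.integrableOn_face hφ e).mono_measure Measure.restrict_le_self
  have hg : Integrable g m := integrable_finsetSum _ fun e _ => hface e _ continuous_const
  -- Piecewise integration by parts is applied to the constant function one, which has no jumps. The
  -- face terms then sum to zero for every test function in `Ω`, so the function with value `c e` on
  -- each face vanishes almost everywhere in `Ω`. No description of the two sides of a face is
  -- needed.
  have hzero : ∀ᵐ x ∂m, x ∈ Ω → g x = 0 := by
    refine hΩ.isOpen.ae_eq_zero_of_integral_contDiff_smul_eq_zero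
      (hg.locallyIntegrable.locallyIntegrableOn Ω) fun φ h1 h2 h3 => ?_
    have hφ : IsTestFunction Set.univ φ := isTestFunction_univ.2 ⟨h1, h2⟩
    have h := M.integral_pw_partialD hΩ (fun _ => 1) i hφ
    have h4 : ∫ x in Ω, M.pw (fun _ => 1) x * partialD i φ x = 0 := by
      have h5 : ∫ x in Ω, M.pw (fun _ => 1) x * partialD i φ x = ∫ x in Ω, partialD i φ x := by
        refine setIntegral_congr_ae hΩ.isOpen.measurableSet ?_
        filter_upwards [M.ae_mem_interior] with x hx hxΩ
        obtain ⟨t, ht⟩ := hx hxΩ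
        rw [M.pw_apply _ ht]; simp
      rw [h5, setIntegral_eq_integral_of_forall_compl_eq_zero fun x hx => by
        rw [partialD, image_eq_zero_of_notMem_tsupport
          fun h => hx (h3 (tsupport_fderiv_subset ℝ h))]; rfl]
      exact integral_fderiv_eq_zero hφ _
    have h6 : ∀ x, M.pw (fun _ => MvPolynomial.pderiv i (1 : MvPolynomial (Fin d) ℝ)) x = 0 :=
      fun x => by simp [pw, Set.indicator]
    rw [h4] at h
    simp only [h6, zero_mul, integral_zero, neg_zero, zero_add] at h
    have h7 : ∀ x, φ x • g x = ∑ e, (M.face e).indicator (fun x => c e * φ x) x := fun x => by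
      simp only [g, smul_eq_mul, Finset.mul_sum]
      refine Finset.sum_congr rfl fun e _ => ?_
      by_cases hx : x ∈ M.face e <;> simp [hx, mul_comm]
    simp only [h7]
    have hφc := hφ.1.continuous
    rw [integral_finsetSum _ fun e _ => hface e _ (by fun_prop), h]
    refine Finset.sum_congr rfl fun e _ => ?_
    rw [integral_indicator (M.isCompact_face e).measurableSet,
      Measure.restrict_restrict_of_subset (Set.subset_iUnion _ e)]
    simp [jump, c]
  -- pick a generic point of `e` in `Ω`
  have hsub : M.face e ⊆ closure Ω := fun x hx => by
    rw [← M.iUnion_elem]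
    obtain ⟨t, ht⟩ := M.exists_elem e
    exact Set.mem_iUnion.2 ⟨t, (M.isClosed_elem t).frontier_subset (ht hx)⟩
  have hne : (Ω ∩ M.face e).Nonempty := by
    by_contra hemp
    refine he fun x hx => ?_
    rw [hΩ.isOpen.frontier_eq]
    exact ⟨hsub hx, fun hxΩ => hemp ⟨x, hxΩ, hx⟩⟩
  have hpos := M.surf_face_inter_pos e hΩ.isOpen hne
  have hres : m.restrict (Ω ∩ M.face e) = (surf d).restrict (Ω ∩ M.face e) :=
    Measure.restrict_restrict_of_subset
      (Set.inter_subset_right.trans (Set.subset_iUnion _ e))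
  -- Faces overlap in null sets, so at a generic point of `e` only the term `c e` is present in `g`.
  have hover : ∀ᵐ x ∂(surf d), ∀ e', e' ≠ e → x ∉ M.face e' ∩ M.face e :=
    ae_all_iff.2 fun e' => by
      by_cases h : e' = e
      · simp [h]
      · filter_upwards [measure_eq_zero_iff_ae_notMem.1 (M.overlap_face h)] with x hx _ using hx
  have hne' : (surf d).restrict (Ω ∩ M.face e) ≠ 0 := by
    rw [Ne, Measure.restrict_eq_zero]; exact hpos.ne'
  have := ae_neBot.2 hne'
  have h1 : ∀ᵐ x ∂((surf d).restrict (Ω ∩ M.face e)), x ∈ Ω → g x = 0 := by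
    rw [← hres]; exact ae_restrict_of_ae hzero
  obtain ⟨x, hx1, hx2, hxΩ, hxe⟩ := (h1.and ((ae_restrict_of_ae hover).and (ae_restrict_mem
    (hΩ.isOpen.measurableSet.inter (M.isCompact_face e).measurableSet)))).exists
  have hgx := hx1 hxΩ
  simp only [g] at hgx
  rw [Finset.sum_eq_single e, Set.indicator_of_mem hxe] at hgx
  · exact hgx
  · intro e' _ hne
    exact Set.indicator_of_notMem (fun h => hx2 e' hne ⟨h, hxe⟩) _
  · simp

end Mesh

/-! ### Mollification -/

/-- The convolution of `f` with the kernel `κ`. -/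
def moll {d : ℕ} (κ f : E d → ℝ) (x : E d) : ℝ := ∫ y, f y * κ (x - y)

section

variable {d : ℕ} {κ f : E d → ℝ}

theorem moll_eq_convolution (κ f : E d → ℝ) :
    moll κ f = convolution f κ (ContinuousLinearMap.mul ℝ ℝ) volume := rfl

theorem contDiff_moll (hκ : IsTestFunction Set.univ κ) (hf : LocallyIntegrable f) :
    ContDiff ℝ ∞ (moll κ f) := by
  rw [moll_eq_convolution]
  exact hκ.2.1.contDiff_convolution_right _ hf hκ.1

theorem partialD_moll (hκ : IsTestFunction Set.univ κ) (hf : LocallyIntegrable f) (i : Fin d)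
    (x : E d) : partialD i (moll κ f) x = ∫ y, f y * partialD i κ (x - y) := by
  have h := hκ.2.1.hasFDerivAt_convolution_right (ContinuousLinearMap.mul ℝ ℝ) hf
    (hκ.1.of_le (by norm_num)) x
  rw [partialD, moll_eq_convolution, h.fderiv]
  exact convolution_precompR_apply (ContinuousLinearMap.mul ℝ ℝ) hf (hκ.2.1.fderiv ℝ)
    (hκ.1.continuous_fderiv (by norm_num)) x _

theorem isTestFunction_reflect {U : Set (E d)} (hκ : IsTestFunction Set.univ κ) (x : E d)
    (hU : ∀ y, x - y ∈ tsupport κ → y ∈ U) : IsTestFunction U (fun y => κ (x - y)) := by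
  refine ⟨hκ.1.comp (contDiff_const.sub contDiff_id), ?_, ?_⟩
  · exact hκ.2.1.comp_homeomorph (Homeomorph.subLeft x)
  · intro y hy
    refine hU y ?_
    have := tsupport_comp_subset_preimage κ (f := fun y => x - y) (by fun_prop) hy
    exact this

theorem partialD_reflect (hκ : IsTestFunction Set.univ κ) (i : Fin d) (x y : E d) :
    partialD i (fun y => κ (x - y)) y = -partialD i κ (x - y) := by
  have h : HasFDerivAt (fun y : E d => x - y) (-ContinuousLinearMap.id ℝ (E d)) y := by
    exact (hasFDerivAt_id y).const_sub x
  have h2 := (hκ.1.differentiable (by norm_num) (x - y)).hasFDerivAt.comp y h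
  simp only [partialD]
  have h3 : fderiv ℝ (fun y => κ (x - y)) y = _ := h2.fderiv
  rw [h3]
  simp

end

/-- A nonnegative smooth kernel of integral `1`, supported in the ball of radius
`1 / (2 (n + 1))` about `s / (n + 1)`. -/
def kern {d : ℕ} (s : E d) (n : ℕ) (z : E d) : ℝ :=
  (⟨1 / (4 * (n + 1)), 1 / (2 * (n + 1)), by positivity, by
    have : (0 : ℝ) < n + 1 := by positivity
    exact one_div_lt_one_div_of_lt (by positivity) (by linarith)⟩ :
      ContDiffBump (0 : E d)).normed volume (z - (1 / ((n : ℝ) + 1)) • s)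

section

variable {d : ℕ} (s : E d) (n : ℕ)

theorem kern_nonneg (z : E d) : 0 ≤ kern s n z := ContDiffBump.nonneg_normed _ _

theorem contDiff_kern : ContDiff ℝ ∞ (kern s n) :=
  (ContDiffBump.contDiff_normed _).comp (contDiff_id.sub contDiff_const)

theorem integral_kern : ∫ z, kern s n z = 1 := by
  unfold kern
  rw [integral_sub_right_eq_self (fun z => (ContDiffBump.normed _ volume z))]
  exact ContDiffBump.integral_normed _

theorem tsupport_kern : tsupport (kern s n) ⊆
    Metric.closedBall ((1 / ((n : ℝ) + 1)) • s) (1 / (2 * (n + 1))) := by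
  refine closure_minimal (fun z hz => ?_) Metric.isClosed_closedBall
  have h : z - (1 / ((n : ℝ) + 1)) • s ∈ Function.support (ContDiffBump.normed _ volume) := hz
  rw [ContDiffBump.support_normed_eq] at h
  rw [mem_ball_zero_iff] at h
  rw [mem_closedBall_iff_norm]
  exact h.le

theorem isTestFunction_kern : IsTestFunction Set.univ (kern s n) :=
  isTestFunction_univ.2 ⟨contDiff_kern s n,
    (isCompact_closedBall _ _).of_isClosed_subset (isClosed_tsupport _) (tsupport_kern s n)⟩

theorem integrable_kern_reflect (x : E d) : Integrable (fun y => kern s n (x - y)) :=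
  have h := isTestFunction_reflect (U := Set.univ) (isTestFunction_kern s n) x (by simp)
  h.1.continuous.integrable_of_hasCompactSupport h.2.1

theorem integral_kern_reflect (x : E d) : ∫ y, kern s n (x - y) = 1 := by
  rw [integral_sub_left_eq_self (kern s n), integral_kern]

theorem norm_le_of_kern_ne_zero {z : E d} (h : kern s n z ≠ 0) :
    ‖z‖ ≤ (‖s‖ + 1) / (n + 1) := by
  have h1 := tsupport_kern s n (subset_tsupport _ h)
  rw [mem_closedBall_iff_norm] at h1
  have hn : (0 : ℝ) < n + 1 := by positivity
  calc ‖z‖ = ‖(z - (1 / ((n : ℝ) + 1)) • s) + (1 / ((n : ℝ) + 1)) • s‖ := by simp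
    _ ≤ 1 / (2 * (n + 1)) + 1 / (n + 1) * ‖s‖ := by
      refine (norm_add_le _ _).trans (add_le_add h1 ?_)
      rw [norm_smul, Real.norm_of_nonneg (by positivity)]
    _ ≤ (‖s‖ + 1) / (n + 1) := by
      have : (1 : ℝ) / (2 * (n + 1)) ≤ 1 / (n + 1) :=
        one_div_le_one_div_of_le hn (by linarith)
      calc _ ≤ 1 / ((n : ℝ) + 1) + 1 / (n + 1) * ‖s‖ := by linarith
        _ = _ := by field_simp; ring

variable {f : E d → ℝ}

theorem locallyIntegrable_of_bounded (hf : AEStronglyMeasurable f) {C : ℝ} (hC : ∀ x, |f x| ≤ C) :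
    LocallyIntegrable f := by
  have h : LocallyIntegrable (fun _ : E d => C) := locallyIntegrable_const C
  exact h.mono hf (Eventually.of_forall fun x => (hC x).trans (le_abs_self _))

theorem abs_moll_le {C : ℝ} (hC : ∀ x, |f x| ≤ C) (x : E d) : |moll (kern s n) f x| ≤ C := by
  have h1 : ∀ y, ‖f y * kern s n (x - y)‖ ≤ C * kern s n (x - y) := fun y => by
    rw [norm_mul, Real.norm_of_nonneg (kern_nonneg s n _)]
    exact mul_le_mul_of_nonneg_right (hC y) (kern_nonneg s n _)
  calc |moll (kern s n) f x| ≤ ∫ y, C * kern s n (x - y) :=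
        norm_integral_le_of_norm_le ((integrable_kern_reflect s n x).const_mul C)
          (Eventually.of_forall h1)
    _ = C := by rw [integral_const_mul, integral_kern_reflect, mul_one]

theorem integrable_mul_kern {C : ℝ} (hf : AEStronglyMeasurable f) (hC : ∀ x, |f x| ≤ C)
    (x : E d) : Integrable (fun y => f y * kern s n (x - y)) :=
  (integrable_kern_reflect s n x).bdd_mul (c := C) hf (Eventually.of_forall hC)

theorem tendsto_moll {C : ℝ} (hf : AEStronglyMeasurable f) (hC : ∀ x, |f x| ≤ C) {x : E d}
    (hx : ContinuousAt f x) : Tendsto (fun n => moll (kern s n) f x) atTop (𝓝 (f x)) := by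
  rw [Metric.tendsto_atTop]
  intro ε hε
  obtain ⟨δ, hδ, h⟩ := Metric.continuousAt_iff.1 hx (ε / 2) (by positivity)
  have hlim : Tendsto (fun n : ℕ => (‖s‖ + 1) / ((n : ℝ) + 1)) atTop (𝓝 0) := by
    simpa [div_eq_mul_inv] using tendsto_one_div_add_atTop_nhds_zero_nat.const_mul (‖s‖ + 1)
  obtain ⟨N, hN⟩ := (hlim.eventually_lt_const hδ).exists_forall_of_atTop
  refine ⟨N, fun n hn => ?_⟩
  have h1 : moll (kern s n) f x - f x = ∫ y, (f y - f x) * kern s n (x - y) := by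
    simp only [sub_mul]
    rw [integral_sub (integrable_mul_kern s n hf hC x)
      ((integrable_kern_reflect s n x).const_mul _), integral_const_mul, integral_kern_reflect,
      mul_one]
    rfl
  rw [Real.dist_eq, h1]
  have h2 : ∀ y, ‖(f y - f x) * kern s n (x - y)‖ ≤ ε / 2 * kern s n (x - y) := fun y => by
    rw [norm_mul, Real.norm_of_nonneg (kern_nonneg s n _)]
    by_cases h0 : kern s n (x - y) = 0
    · simp [h0]
    · refine mul_le_mul_of_nonneg_right ?_ (kern_nonneg s n _)
      have h3 := (norm_le_of_kern_ne_zero s n h0).trans_lt (hN n hn)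
      have := h (x := y) (by rwa [dist_comm, dist_eq_norm])
      rw [Real.dist_eq] at this
      exact this.le
  calc _ ≤ ∫ y, ε / 2 * kern s n (x - y) :=
        norm_integral_le_of_norm_le ((integrable_kern_reflect s n x).const_mul _)
          (Eventually.of_forall h2)
    _ = ε / 2 := by rw [integral_const_mul, integral_kern_reflect, mul_one]
    _ < ε := by linarith

theorem tsupport_moll_subset {S K : Set (E d)} (hS : ∀ y ∉ S, f y = 0) (hK : IsClosed K)
    (h : ∀ y ∈ S, ∀ z, ‖z - (1 / ((n : ℝ) + 1)) • s‖ ≤ 1 / (2 * (n + 1)) → y + z ∈ K) :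
    tsupport (moll (kern s n) f) ⊆ K := by
  refine closure_minimal (fun x hx => ?_) hK
  by_contra hxK
  refine hx (integral_eq_zero_of_ae (Eventually.of_forall fun y => ?_))
  by_cases hy : y ∈ S
  · have : kern s n (x - y) = 0 := by
      by_contra h0
      have h1 := tsupport_kern s n (subset_tsupport _ h0)
      rw [mem_closedBall_iff_norm] at h1
      exact hxK (by simpa using h y hy (x - y) h1)
    simp [this]
  · simp [hS y hy]

end

/-- Integration by parts of a Sobolev function against a bounded vector field that has a bounded
distributional divergence and whose mollifications are supported in the domain. -/
theorem integral_mul_div_add_eq_zero {d : ℕ} {Ω : Set (E d)}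
    {G : E d → ℝ} {g : Fin d → E d → ℝ} (hG : IntegrableOn G Ω) (hg : ∀ j, IntegrableOn (g j) Ω)
    (hw : ∀ j, HasWeakPartial Ω j G (g j)) {X : Fin d → E d → ℝ} {h : E d → ℝ} {C : ℝ}
    (hXm : ∀ j, AEStronglyMeasurable (X j)) (hhm : AEStronglyMeasurable h)
    (hXC : ∀ j x, |X j x| ≤ C) (hhC : ∀ x, |h x| ≤ C)
    (hXc : ∀ j, ∀ᵐ x, ContinuousAt (X j) x) (hhc : ∀ᵐ x, ContinuousAt h x)
    (hdiv : ∀ φ, IsTestFunction Set.univ φ →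
      ∫ x, ∑ j, X j x * partialD j φ x = -∫ x, h x * φ x)
    {S : Set (E d)} (hS : ∀ j, ∀ y ∉ S, X j y = 0) (s : E d)
    (hsupp : ∀ᶠ n : ℕ in atTop, ∃ K, IsCompact K ∧ K ⊆ Ω ∧ ∀ y ∈ S, ∀ z,
      ‖z - (1 / ((n : ℝ) + 1)) • s‖ ≤ 1 / (2 * (n + 1)) → y + z ∈ K) :
    (∫ x in Ω, G x * h x) + ∑ j, ∫ x in Ω, g j x * X j x = 0 := by
  let Xn : ℕ → Fin d → E d → ℝ := fun n j => moll (kern s n) (X j)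
  have hXl : ∀ j, LocallyIntegrable (X j) := fun j => locallyIntegrable_of_bounded (hXm j) (hXC j)
  have hhl : LocallyIntegrable h := locallyIntegrable_of_bounded hhm hhC
  -- Testing the divergence identity with the reflected kernel shows that the divergence of the
  -- mollified field is the mollification of `h`.
  have hdivn : ∀ n x, ∑ j, partialD j (Xn n j) x = moll (kern s n) h x := fun n x => by
    have hr := isTestFunction_reflect (U := Set.univ) (isTestFunction_kern s n) x (by simp)
    have h1 := hdiv _ hr
    simp only [partialD_reflect (isTestFunction_kern s n), mul_neg, Finset.sum_neg_distrib] at h1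
    rw [integral_neg, neg_inj] at h1
    rw [integral_finsetSum] at h1
    · simp only [Xn, partialD_moll (isTestFunction_kern s n) (hXl _)]
      exact h1
    · intro j _
      have h2 := integrable_fderiv_apply (F := fun _ => EuclideanSpace.single j 1) (B := 1)
        (by fun_prop) (fun _ => by simp) hr
      have h3 : Integrable (fun y => X j y * partialD j (fun y => kern s n (x - y)) y) :=
        Integrable.bdd_mul (c := C) h2 (hXm j) (Eventually.of_forall (hXC j))
      simpa [partialD_reflect (isTestFunction_kern s n)] using h3.neg
  have heq : ∀ᶠ n in atTop, (∫ x in Ω, G x * moll (kern s n) h x)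
      + ∑ j, ∫ x in Ω, g j x * Xn n j x = 0 := by
    filter_upwards [hsupp] with n ⟨K, hK, hKΩ, hn⟩
    -- The support hypothesis makes the mollified components admissible in the definition of the
    -- weak derivatives of `G`, although `X` itself need not vanish near the boundary.
    have htest : ∀ j, IsTestFunction Ω (Xn n j) := fun j => by
      have ht := tsupport_moll_subset s n (hS j) hK.isClosed hn
      exact ⟨contDiff_moll (isTestFunction_kern s n) (hXl j),
        hK.of_isClosed_subset (isClosed_tsupport _) ht, ht.trans hKΩ⟩
    have h1 : ∀ j, ∫ x in Ω, G x * partialD j (Xn n j) x = -∫ x in Ω, g j x * Xn n j x :=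
      fun j => hw j _ (htest j)
    have h2 : ∀ j, IntegrableOn (fun x => G x * partialD j (Xn n j) x) Ω := fun j => by
      obtain ⟨B, -, hB⟩ := (htest j).exists_bound
      refine hG.mul_bdd (c := B * ‖(EuclideanSpace.single j 1 : E d)‖) ?_
        (Eventually.of_forall fun x => ?_)
      · exact (((htest j).1.continuous_fderiv (by norm_num)).clm_apply
          continuous_const).aestronglyMeasurable
      · exact (ContinuousLinearMap.le_opNorm _ _).trans
          (mul_le_mul_of_nonneg_right (hB x).2 (norm_nonneg _))
    simp only [← hdivn, Finset.mul_sum]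
    rw [integral_finsetSum _ fun j _ => h2 j, ← Finset.sum_add_distrib]
    exact Finset.sum_eq_zero fun j _ => by rw [h1 j]; ring
  have hmm : ∀ n (f : E d → ℝ), LocallyIntegrable f →
      AEStronglyMeasurable (moll (kern s n) f) (volume.restrict Ω) := fun n f hf =>
    (contDiff_moll (isTestFunction_kern s n) hf).continuous.aestronglyMeasurable
  -- The kernel may be shifted off the origin. Boundedness together with continuity almost
  -- everywhere gives the pointwise limits regardless of the shift, and dominated convergence does
  -- the rest.
  have hlim : ∀ (G' f : E d → ℝ), IntegrableOn G' Ω → AEStronglyMeasurable f →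
      (∀ x, |f x| ≤ C) → (∀ᵐ x, ContinuousAt f x) →
      Tendsto (fun n => ∫ x in Ω, G' x * moll (kern s n) f x) atTop
        (𝓝 (∫ x in Ω, G' x * f x)) := by
    intro G' f hG' hfm hfC hfc
    refine tendsto_integral_of_dominated_convergence (fun x => ‖G' x‖ * C)
      (fun n => hG'.aestronglyMeasurable.mul (hmm n f (locallyIntegrable_of_bounded hfm hfC)))
      (hG'.norm.mul_const C) (fun n => Eventually.of_forall fun x => ?_) ?_
    · rw [norm_mul]
      exact mul_le_mul_of_nonneg_left (abs_moll_le s n hfC x) (norm_nonneg _)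
    · filter_upwards [ae_restrict_of_ae hfc] with x hx
      exact (tendsto_moll s hfm hfC hx).const_mul _
  have h1 := (hlim G h hG hhm hhC hhc).add
    (tendsto_finsetSum Finset.univ fun j _ => hlim (g j) (X j) (hg j) (hXm j) (hXC j) (hXc j))
  exact tendsto_nhds_unique h1 (tendsto_const_nhds.congr' (heq.mono fun n hn => hn.symm))

/-! ### Approximation of integrable functions and the chain rule -/

section

variable {d : ℕ}

theorem integrable_kern (s : E d) (n : ℕ) : Integrable (kern s n) :=
  (contDiff_kern s n).continuous.integrable_of_hasCompactSupport (isTestFunction_kern s n).2.1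

theorem integrable_moll (s : E d) (n : ℕ) {f : E d → ℝ} (hf : Integrable f) :
    Integrable (moll (kern s n) f) := by
  rw [moll_eq_convolution]
  exact hf.integrable_convolution _ (integrable_kern s n)

theorem integral_abs_moll_le (s : E d) (n : ℕ) {f : E d → ℝ} (hf : Integrable f) :
    ∫ x, |moll (kern s n) f x| ≤ ∫ x, |f x| := by
  have h1 : ∀ x, |moll (kern s n) f x| ≤ moll (kern s n) (fun y => |f y|) x := fun x => by
    calc |moll (kern s n) f x| ≤ ∫ y, ‖f y * kern s n (x - y)‖ :=
          norm_integral_le_integral_norm (fun y => f y * kern s n (x - y))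
      _ = _ := integral_congr_ae (Eventually.of_forall fun y => by
          simp [abs_of_nonneg (kern_nonneg s n _)])
  have h2 : ∫ x, moll (kern s n) (fun y => |f y|) x = ∫ x, |f x| := by
    rw [moll_eq_convolution, integral_convolution _ hf.abs (integrable_kern s n), integral_kern]
    simp
  rw [← h2]
  exact integral_mono (integrable_moll s n hf).abs (integrable_moll s n hf.abs) h1

theorem moll_sub (s : E d) (n : ℕ) {f g : E d → ℝ} (hf : LocallyIntegrable f)
    (hg : LocallyIntegrable g) (x : E d) :
    moll (kern s n) (fun y => f y - g y) x = moll (kern s n) f x - moll (kern s n) g x := by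
  have hi : ∀ f : E d → ℝ, LocallyIntegrable f → Integrable (fun y => f y * kern s n (x - y)) :=
    fun f hf => (isTestFunction_kern s n).2.1.convolutionExists_right
      (ContinuousLinearMap.mul ℝ ℝ) hf (contDiff_kern s n).continuous x
  simp only [moll, sub_mul]
  exact integral_sub (hi f hf) (hi g hg)

theorem tendsto_integral_abs_moll_sub_of_continuous {h : E d → ℝ} (hc : Continuous h)
    (hs : HasCompactSupport h) :
    Tendsto (fun n => ∫ x, |moll (kern 0 n) h x - h x|) atTop (𝓝 0) := by
  obtain ⟨C, hC⟩ := hc.bounded_above_of_compact_support hs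
  obtain ⟨R, hR⟩ := hs.isBounded.subset_closedBall (0 : E d)
  have h0 : (0 : ℝ) = ∫ x : E d, (0 : ℝ) := by simp
  rw [h0]
  have hC0 : 0 ≤ C := (norm_nonneg _).trans (hC 0)
  have hz : ∀ x ∉ Metric.closedBall (0 : E d) R, h x = 0 := fun x hx =>
    image_eq_zero_of_notMem_tsupport fun hx' => hx (hR hx')
  refine tendsto_integral_of_dominated_convergence
    ((Metric.closedBall (0 : E d) (R + 1)).indicator fun _ => C + C) (fun n => ?_) ?_
    (fun n => Eventually.of_forall fun x => ?_) (Eventually.of_forall fun x => ?_)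
  · exact (((contDiff_moll (isTestFunction_kern 0 n) hc.locallyIntegrable).continuous.sub
      hc).abs).aestronglyMeasurable
  · rw [integrable_indicator_iff measurableSet_closedBall]
    exact integrableOn_const measure_closedBall_lt_top.ne
  · rw [Real.norm_eq_abs, abs_abs]
    by_cases hx : x ∈ Metric.closedBall (0 : E d) (R + 1)
    · rw [Set.indicator_of_mem hx]
      exact (abs_sub _ _).trans (add_le_add (abs_moll_le 0 n hC x) (hC x))
    · rw [Set.indicator_of_notMem hx]
      have h1 : h x = 0 := hz x fun h' => hx (Metric.closedBall_subset_closedBall (by linarith) h')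
      have h2 : moll (kern 0 n) h x = 0 := by
        refine integral_eq_zero_of_ae (Eventually.of_forall fun y => ?_)
        by_cases hy : y ∈ Metric.closedBall (0 : E d) R
        · have : kern 0 n (x - y) = 0 := by
            by_contra hk
            have h3 := norm_le_of_kern_ne_zero 0 n hk
            have h4 : (‖(0 : E d)‖ + 1) / ((n : ℝ) + 1) ≤ 1 := by
              rw [norm_zero, zero_add]
              exact (div_le_one (by positivity)).2 (by linarith [(Nat.cast_nonneg n : (0 : ℝ) ≤ n)])
            apply hx
            rw [mem_closedBall_zero_iff] at hy ⊢
            calc ‖x‖ = ‖y + (x - y)‖ := by simp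
              _ ≤ R + 1 := (norm_add_le _ _).trans (add_le_add hy (h3.trans h4))
          simp [this]
        · simp [hz y hy]
      simp [h1, h2]
  · have := (tendsto_moll 0 hc.aestronglyMeasurable hC hc.continuousAt (x := x)).sub_const (h x)
    simpa using this.abs

/-- Mollifications converge in `L¹`. -/
theorem tendsto_integral_abs_moll_sub {f : E d → ℝ} (hf : Integrable f) :
    Tendsto (fun n => ∫ x, |moll (kern 0 n) f x - f x|) atTop (𝓝 0) := by
  rw [Metric.tendsto_atTop]
  intro ε hε
  obtain ⟨h, hs, hfh, hc, hi⟩ := hf.exists_hasCompactSupport_integral_sub_le (ε := ε / 4)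
    (by positivity)
  obtain ⟨N, hN⟩ := Metric.tendsto_atTop.1 (tendsto_integral_abs_moll_sub_of_continuous hc hs)
    (ε / 4) (by positivity)
  refine ⟨N, fun n hn => ?_⟩
  have h1 := hN n hn
  rw [Real.dist_eq, sub_zero, abs_of_nonneg (integral_nonneg fun _ => abs_nonneg _)] at h1 ⊢
  have hd : Integrable (fun x => f x - h x) := hf.sub hi
  have h2 := integral_abs_moll_le 0 n hd
  have h3 : ∀ x, |moll (kern 0 n) f x - f x| ≤ |moll (kern 0 n) (fun y => f y - h y) x|
      + |moll (kern 0 n) h x - h x| + |f x - h x| := fun x => by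
    rw [moll_sub 0 n hf.locallyIntegrable hi.locallyIntegrable]
    have : moll (kern 0 n) f x - f x = (moll (kern 0 n) f x - moll (kern 0 n) h x)
      + (moll (kern 0 n) h x - h x) - (f x - h x) := by ring
    rw [this]
    exact (abs_sub _ _).trans (add_le_add (abs_add_le _ _) le_rfl)
  have hi1 : Integrable (fun x => |moll (kern 0 n) (fun y => f y - h y) x|) :=
    (integrable_moll 0 n hd).abs
  have hi2 : Integrable (fun x => |moll (kern 0 n) h x - h x|) :=
    ((integrable_moll 0 n hi).sub hi).abs
  have hi12 : Integrable (fun x => |moll (kern 0 n) (fun y => f y - h y) x|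
      + |moll (kern 0 n) h x - h x|) := hi1.add hi2
  calc _ ≤ ∫ x, (|moll (kern 0 n) (fun y => f y - h y) x|
      + |moll (kern 0 n) h x - h x| + |f x - h x|) :=
        integral_mono ((integrable_moll 0 n hf).sub hf).abs (hi12.add hd.abs) h3
    _ = (∫ x, |moll (kern 0 n) (fun y => f y - h y) x|)
      + (∫ x, |moll (kern 0 n) h x - h x|) + ∫ x, |f x - h x| := by
        rw [integral_add hi12 hd.abs, integral_add hi1 hi2]
    _ ≤ (∫ x, |f x - h x|) + (∫ x, |moll (kern 0 n) h x - h x|) + ∫ x, |f x - h x| := by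
        gcongr
    _ < ε := by
        have : ∫ x, |f x - h x| ≤ ε / 4 := hfh
        linarith

/-- Mollifications converge almost everywhere. -/
theorem ae_tendsto_moll {f : E d → ℝ} (hf : LocallyIntegrable f) :
    ∀ᵐ x, Tendsto (fun n => moll (kern 0 n) f x) atTop (𝓝 (f x)) := by
  let φ : ℕ → ContDiffBump (0 : E d) := fun n => ⟨1 / (4 * (n + 1)), 1 / (2 * (n + 1)),
    by positivity, by
    have : (0 : ℝ) < n + 1 := by positivity
    exact one_div_lt_one_div_of_lt (by positivity) (by linarith)⟩
  have hφ : Tendsto (fun n => (φ n).rOut) atTop (𝓝 0) := by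
    have : Tendsto (fun n : ℕ => (1 / 2 : ℝ) * (1 / ((n : ℝ) + 1))) atTop (𝓝 0) := by
      simpa using tendsto_one_div_add_atTop_nhds_zero_nat.const_mul (1 / 2 : ℝ)
    refine this.congr fun n => ?_
    simp only [φ]
    field_simp
  have h := ContDiffBump.ae_convolution_tendsto_right_of_locallyIntegrable (μ := volume)
    (K := 2) hφ (Eventually.of_forall fun n => by
      simp only [φ]
      rw [le_iff_eq_or_lt]; left; field_simp; norm_num) hf
  filter_upwards [h] with x hx
  refine hx.congr fun n => ?_
  rw [convolution_lsmul_swap]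
  refine integral_congr_ae (Eventually.of_forall fun y => ?_)
  simp [kern, φ, mul_comm]

/-- The chain rule for weak derivatives. -/
theorem HasWeakPartial.comp {Ω : Set (E d)} (hΩ : IsOpen Ω) {j : Fin d} {G g : E d → ℝ}
    (hG : IntegrableOn G Ω) (hg : IntegrableOn g Ω) (hw : HasWeakPartial Ω j G g)
    {F F' : ℝ → ℝ} (hF : ∀ s, HasDerivAt F (F' s) s) (hF' : Continuous F') {B : ℝ}
    (hFB : ∀ s, |F s| ≤ B) (hFB' : ∀ s, |F' s| ≤ B) :
    HasWeakPartial Ω j (fun x => F (G x)) (fun x => F' (G x) * g x) := by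
  intro φ hφ
  have hφu := hφ.mono (Set.subset_univ _)
  have hFc : Continuous F := continuous_iff_continuousAt.2 fun s => (hF s).continuousAt
  have hF1 : ContDiff ℝ 1 F := by
    refine contDiff_one_iff_deriv.2 ⟨fun s => (hF s).differentiableAt, ?_⟩
    have : deriv F = F' := funext fun s => (hF s).deriv
    rwa [this]
  have hB0 : 0 ≤ B := (abs_nonneg _).trans (hFB 0)
  obtain ⟨C, hC0, hC⟩ := hφ.exists_bound
  let Ge : E d → ℝ := Ω.indicator G
  let ge : E d → ℝ := Ω.indicator g
  have hGe : Integrable Ge := hG.integrable_indicator hΩ.measurableSet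
  have hge : Integrable ge := hg.integrable_indicator hΩ.measurableSet
  let Gn : ℕ → E d → ℝ := fun n => moll (kern 0 n) Ge
  let gn : ℕ → E d → ℝ := fun n => moll (kern 0 n) ge
  have hGn : ∀ n, ContDiff ℝ ∞ (Gn n) := fun n =>
    contDiff_moll (isTestFunction_kern 0 n) hGe.locallyIntegrable
  have hgn : ∀ n, ContDiff ℝ ∞ (gn n) := fun n =>
    contDiff_moll (isTestFunction_kern 0 n) hge.locallyIntegrable
  have hpc : Continuous (partialD j φ) :=
    (hφ.1.continuous_fderiv (by norm_num)).clm_apply continuous_const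
  have hpi : Integrable (partialD j φ) := by
    have := Mesh.integrableOn_partialD (Ω' := Set.univ) hφu j
    rwa [integrableOn_univ] at this
  have hφi : Integrable φ := hφ.1.continuous.integrable_of_hasCompactSupport hφ.2.1
  obtain ⟨δ, hδ, hδΩ⟩ := hφ.2.1.exists_cthickening_subset_open hΩ hφ.2.2
  have hlim0 : Tendsto (fun n : ℕ => 1 / ((n : ℝ) + 1)) atTop (𝓝 0) :=
    tendsto_one_div_add_atTop_nhds_zero_nat
  -- integration by parts for the mollified function
  have hibp : ∀ᶠ n in atTop, ∫ x, F (Gn n x) * partialD j φ x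
      = -∫ x, F' (Gn n x) * gn n x * φ x := by
    filter_upwards [hlim0.eventually_lt_const hδ] with n hn
    -- Extension by zero may destroy weak differentiability across the boundary of `Ω`. The identity
    -- is therefore claimed on the support of `φ` only, from which the kernel does not leave `Ω`
    -- when `n` is large.
    have hder : ∀ x ∈ tsupport φ, partialD j (Gn n) x = gn n x := fun x hx => by
      have ht : IsTestFunction Ω (fun y => kern 0 n (x - y)) := by
        refine isTestFunction_reflect (isTestFunction_kern 0 n) x fun y hy => hδΩ ?_
        have h1 := tsupport_kern 0 n hy
        rw [smul_zero, mem_closedBall_zero_iff] at h1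
        refine Metric.mem_cthickening_of_dist_le y x δ _ hx ?_
        rw [dist_comm, dist_eq_norm]
        refine h1.trans (le_trans ?_ hn.le)
        exact one_div_le_one_div_of_le (by positivity)
          (by linarith [(Nat.cast_nonneg n : (0 : ℝ) ≤ n)])
      have h2 := hw _ ht
      simp only [partialD_reflect (isTestFunction_kern 0 n), mul_neg] at h2
      rw [integral_neg, neg_inj] at h2
      rw [partialD_moll (isTestFunction_kern 0 n) hGe.locallyIntegrable]
      simp only [gn, moll]
      rw [← integral_indicator hΩ.measurableSet, ← integral_indicator hΩ.measurableSet] at h2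
      refine Eq.trans (integral_congr_ae (Eventually.of_forall fun y => ?_))
        (h2.trans (integral_congr_ae (Eventually.of_forall fun y => ?_)))
      · by_cases hy : y ∈ Ω <;> simp [Ge, hy]
      · by_cases hy : y ∈ Ω <;> simp [ge, hy]
    have hcomp : ∀ x, partialD j (fun y => F (Gn n y)) x = F' (Gn n x) * partialD j (Gn n) x :=
      fun x => by
        have h1 := (hF (Gn n x)).comp_hasFDerivAt x
          ((hGn n).differentiable (by norm_num) x).hasFDerivAt
        have h2 : fderiv ℝ (fun y => F (Gn n y)) x = _ := h1.fderiv
        simp [partialD, h2]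
    have hFG : ContDiff ℝ 1 (fun x => F (Gn n x)) := hF1.comp ((hGn n).of_le (by norm_num))
    have hFGp : Continuous (partialD j (fun x => F (Gn n x))) :=
      (hFG.continuous_fderiv (by norm_num)).clm_apply continuous_const
    have hFGc := hFG.continuous
    have hφc := hφ.1.continuous
    have h3 := integral_mul_fderiv_eq_neg_fderiv_mul_of_integrable
      (μ := (volume : Measure (E d))) (f := fun x => F (Gn n x)) (g := φ)
      (v := EuclideanSpace.single j 1)
      ((hFGp.mul hφc).integrable_of_hasCompactSupport hφ.2.1.mul_left)
      ((hFGc.mul hpc).integrable_of_hasCompactSupport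
        ((hφ.2.1.fderiv_apply ℝ _).mul_left))
      ((hFGc.mul hφc).integrable_of_hasCompactSupport hφ.2.1.mul_left)
      (fun x _ => hFG.differentiable (by norm_num) x)
      (fun x _ => hφ.1.differentiable (by norm_num) x)
    rw [show (∫ x, F (Gn n x) * partialD j φ x)
      = ∫ x, F (Gn n x) * fderiv ℝ φ x (EuclideanSpace.single j 1) from rfl, h3]
    congr 1
    refine integral_congr_ae (Eventually.of_forall fun x => ?_)
    by_cases hx : x ∈ tsupport φ
    · have h4 := hcomp x
      rw [hder x hx] at h4
      simp only [partialD] at h4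
      simp only [h4]
    · simp [image_eq_zero_of_notMem_tsupport hx]
  have hae := ae_tendsto_moll hGe.locallyIntegrable
  have hL : Tendsto (fun n => ∫ x, F (Gn n x) * partialD j φ x) atTop
      (𝓝 (∫ x, F (Ge x) * partialD j φ x)) := by
    refine tendsto_integral_of_dominated_convergence (fun x => B * ‖partialD j φ x‖)
      (fun n => ((hFc.comp (hGn n).continuous).mul hpc).aestronglyMeasurable)
      (hpi.norm.const_mul B) (fun n => Eventually.of_forall fun x => ?_) ?_
    · rw [norm_mul]
      exact mul_le_mul_of_nonneg_right (hFB _) (norm_nonneg _)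
    · filter_upwards [hae] with x hx
      exact ((hFc.tendsto _).comp hx).mul_const _
  -- The products `F' (Gn n) * gn n` are split: with `ge` in place of `gn n` dominated convergence
  -- applies, and the remainder is controlled by the `L¹` convergence of `gn n` and the bound on
  -- `F'`.
  have hR1 : Tendsto (fun n => ∫ x, F' (Gn n x) * ge x * φ x) atTop
      (𝓝 (∫ x, F' (Ge x) * ge x * φ x)) := by
    refine tendsto_integral_of_dominated_convergence (fun x => B * ‖ge x‖ * C)
      (fun n => (((hF'.comp (hGn n).continuous).aestronglyMeasurable.mul
        hge.aestronglyMeasurable)).mul hφ.1.continuous.aestronglyMeasurable)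
      ((hge.norm.const_mul B).mul_const C) (fun n => Eventually.of_forall fun x => ?_) ?_
    · rw [norm_mul, norm_mul]
      exact mul_le_mul (mul_le_mul_of_nonneg_right (hFB' _) (norm_nonneg _)) (hC x).1
        (norm_nonneg _) (by positivity)
    · filter_upwards [hae] with x hx
      exact (((hF'.tendsto _).comp hx).mul_const _).mul_const _
  have hR2 : Tendsto (fun n => ∫ x, F' (Gn n x) * (gn n x - ge x) * φ x) atTop (𝓝 0) := by
    have h1 : Tendsto (fun n => B * C * ∫ x, |gn n x - ge x|) atTop (𝓝 0) := by
      simpa using (tendsto_integral_abs_moll_sub hge).const_mul (B * C)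
    refine squeeze_zero_norm (fun n => ?_) h1
    rw [← integral_const_mul]
    refine norm_integral_le_of_norm_le (((integrable_moll 0 n hge).sub hge).abs.const_mul _)
      (Eventually.of_forall fun x => ?_)
    rw [norm_mul, norm_mul]
    calc _ ≤ B * |gn n x - ge x| * C :=
          mul_le_mul (mul_le_mul_of_nonneg_right (hFB' _) (abs_nonneg _)) (hC x).1
            (abs_nonneg _) (by positivity)
      _ = _ := by ring
  have h_int : ∀ n (q : E d → ℝ), Integrable q → Integrable (fun x => F' (Gn n x) * q x * φ x) :=
    fun n q hq => by
      refine Integrable.mul_bdd (c := C) (Integrable.bdd_mul (c := B) hq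
        (hF'.comp (hGn n).continuous).aestronglyMeasurable (Eventually.of_forall fun x => hFB' _))
        hφ.1.continuous.aestronglyMeasurable (Eventually.of_forall fun x => (hC x).1)
  have hR : Tendsto (fun n => -∫ x, F' (Gn n x) * gn n x * φ x) atTop
      (𝓝 (-∫ x, F' (Ge x) * ge x * φ x)) := by
    have h1 := (hR1.add hR2).neg
    rw [add_zero] at h1
    refine h1.congr fun n => ?_
    have hd : Integrable (fun x => gn n x - ge x) := (integrable_moll 0 n hge).sub hge
    rw [← integral_add (h_int n _ hge) (h_int n _ hd)]
    refine congrArg Neg.neg (integral_congr_ae (Eventually.of_forall fun x => ?_))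
    ring
  have hfinal := tendsto_nhds_unique (hL.congr' hibp) hR
  have hz : ∀ x ∉ Ω, φ x = 0 := fun x hx =>
    image_eq_zero_of_notMem_tsupport fun h => hx (hφ.2.2 h)
  have hz' : ∀ x ∉ Ω, partialD j φ x = 0 := fun x hx => by
    rw [partialD, image_eq_zero_of_notMem_tsupport
      fun h => hx (hφ.2.2 (tsupport_fderiv_subset ℝ h))]
    rfl
  rw [← integral_indicator hΩ.measurableSet, ← integral_indicator hΩ.measurableSet]
  refine Eq.trans (integral_congr_ae (Eventually.of_forall fun x => ?_))
    (hfinal.trans (congrArg Neg.neg (integral_congr_ae (Eventually.of_forall fun x => ?_))))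
  · by_cases hx : x ∈ Ω <;> simp [Ge, hx, hz']
  · by_cases hx : x ∈ Ω <;> simp [Ge, ge, hx, hz]

end

/-! ### Integration by parts against piecewise polynomial fields -/

namespace Mesh

section

variable {d : ℕ} {Ω : Set (E d)} (M : Mesh Ω)

theorem ae_continuousAt_pw (hΩ : IsPolytopalDomain Ω)
    (P : Fin M.numElems → MvPolynomial (Fin d) ℝ) : ∀ᵐ x : E d, ContinuousAt (M.pw P) x := by
  have h1 : ∀ᵐ x : E d, x ∉ frontier Ω := by
    rw [ae_iff]; simpa using M.volume_frontier hΩ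
  filter_upwards [M.ae_mem_interior, h1] with x hx hx1
  by_cases hxΩ : x ∈ Ω
  · obtain ⟨t, ht⟩ := hx hxΩ
    refine (continuous_ev (P t)).continuousAt.congr ?_
    filter_upwards [isOpen_interior.mem_nhds ht] with y hy using (M.pw_apply P hy).symm
  · have hxc : x ∈ (closure Ω)ᶜ := fun h => hx1 ⟨h, by rwa [hΩ.isOpen.interior_eq]⟩
    refine (continuous_const (y := (0 : ℝ))).continuousAt.congr ?_
    filter_upwards [isClosed_closure.isOpen_compl.mem_nhds hxc] with y hy
    exact (M.pw_eq_zero_of_notMem hΩ P fun h => hy (subset_closure h)).symm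

/-- The piecewise divergence of a piecewise polynomial field. -/
def pwDiv (τ : Fin d → Fin M.numElems → MvPolynomial (Fin d) ℝ) (t : Fin M.numElems) :
    MvPolynomial (Fin d) ℝ := ∑ j, MvPolynomial.pderiv j (τ j t)

theorem setIntegral_pw_mul (hΩ : IsPolytopalDomain Ω)
    (P : Fin M.numElems → MvPolynomial (Fin d) ℝ) (g : E d → ℝ) :
    ∫ x in Ω, M.pw P x * g x = ∫ x, M.pw P x * g x :=
  setIntegral_eq_integral_of_forall_compl_eq_zero fun x hx => by
    rw [M.pw_eq_zero_of_notMem hΩ P hx, zero_mul]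

theorem pw_sum {ι : Type*} (s : Finset ι) (P : ι → Fin M.numElems → MvPolynomial (Fin d) ℝ)
    (x : E d) : M.pw (fun t => ∑ i ∈ s, P i t) x = ∑ i ∈ s, M.pw (P i) x := by
  by_cases h : ∃ t, x ∈ interior (M.elem t)
  · obtain ⟨t, ht⟩ := h
    simp [M.pw_apply _ ht]
  · push Not at h
    simp [M.pw_apply_of_notMem _ h]

/-- A piecewise polynomial field without normal jumps has a weak divergence. -/
theorem integral_pw_div (hΩ : IsPolytopalDomain Ω)
    (τ : Fin d → Fin M.numElems → MvPolynomial (Fin d) ℝ)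
    (hτ : ∀ e, ∀ x ∈ M.face e, ∑ j, ev (M.jump (τ j) j e) x = 0) {φ : E d → ℝ}
    (hφ : IsTestFunction Set.univ φ) :
    ∫ x, ∑ j, M.pw (τ j) x * partialD j φ x = -∫ x, M.pw (M.pwDiv τ) x * φ x := by
  have hi1 : ∀ j, Integrable (fun x => M.pw (τ j) x * partialD j φ x) := fun j => by
    have h := M.integrableOn_pw_mul (Ω' := Set.univ) (τ j) (integrableOn_partialD hφ j)
    rwa [integrableOn_univ] at h
  have hi2 : ∀ P, Integrable (fun x => M.pw P x * φ x) := fun P => by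
    have h := M.integrableOn_pw_mul (Ω' := Set.univ) P (integrableOn_test hφ)
    rwa [integrableOn_univ] at h
  rw [integral_finsetSum _ fun j _ => hi1 j]
  have h1 : ∀ j, ∫ x, M.pw (τ j) x * partialD j φ x
      = -(∫ x, M.pw (fun t => MvPolynomial.pderiv j (τ j t)) x * φ x)
        + ∑ e, ∫ x in M.face e, ev (M.jump (τ j) j e) x * φ x ∂(surf d) := fun j => by
    rw [← M.setIntegral_pw_mul hΩ, ← M.setIntegral_pw_mul hΩ, M.integral_pw_partialD hΩ _ j hφ]
  have h2 : ∑ j, ∑ e, ∫ x in M.face e, ev (M.jump (τ j) j e) x * φ x ∂(surf d) = 0 := by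
    rw [Finset.sum_comm]
    refine Finset.sum_eq_zero fun e _ => ?_
    have hc := hφ.1.continuous
    rw [← integral_finsetSum _ fun j _ => M.integrableOn_face (by fun_prop) e]
    refine setIntegral_eq_zero_of_forall_eq_zero fun x hx => ?_
    rw [← Finset.sum_mul, hτ e x hx, zero_mul]
  simp only [h1]
  rw [Finset.sum_add_distrib, h2, add_zero, Finset.sum_neg_distrib,
    ← integral_finsetSum _ fun j _ => hi2 _]
  refine congrArg Neg.neg (integral_congr_ae (Eventually.of_forall fun x => ?_))
  have h3 : M.pw (M.pwDiv τ) x = ∑ j, M.pw (fun t => MvPolynomial.pderiv j (τ j t)) x :=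
    M.pw_sum _ _ x
  simp only [h3, Finset.sum_mul]

/-- At a regular boundary point the domain is locally a half space. -/
theorem exists_half_ball (hΩ : IsPolytopalDomain Ω) {x : E d} (hx : x ∈ frontier Ω)
    (hxs : x ∉ M.sing) : ∃ δ > 0, ∃ ν : E d, ∃ c : ℝ, ‖ν‖ = 1 ∧
      Metric.ball x δ ∩ {y | inner ℝ ν y < c} ⊆ Ω ∧
      Metric.ball x δ ∩ {y | c < inner ℝ ν y} ⊆ (closure Ω)ᶜ := by
  obtain ⟨e, he⟩ := Set.mem_iUnion.1 (M.frontier_subset_iUnion_face hΩ hx)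
  have hxe := M.face_subset_faceHyp e he
  obtain ⟨δ, hδ, hball⟩ := M.exists_ball_faceHyp x
  set B := Metric.ball x δ with hB
  set ν := M.faceNormal e with hνdef
  set c := M.faceOffset e with hcdef
  have hν : ‖ν‖ = 1 := M.norm_faceNormal e
  have hfr : ∀ y ∈ B, y ∈ frontier Ω → inner ℝ ν y = c := fun y hy hyf => by
    obtain ⟨e', he'⟩ := Set.mem_iUnion.1 (M.frontier_subset_iUnion_face hΩ hyf)
    have hy' := M.face_subset_faceHyp e' he'
    have : M.faceHyp e' = M.faceHyp e :=
      M.faceHyp_eq_of_notMem_sing hxs (hball e' ⟨y, hy, hy'⟩) hxe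
    rw [this] at hy'
    exact hy'
  have h_int : ∀ U : Set (E d), IsOpen U → U ⊆ hyp ν c → U = ∅ := fun U hU h => by
    have := interior_maximal h hU
    rwa [interior_hyp hν, Set.subset_empty_iff] at this
  have hd1 := subset_interior_or_subset_compl_closure (S := Ω) (B := B ∩ {y | inner ℝ ν y < c})
    ((convex_ball x δ).inter (convex_halfSpace_lt
      (innerₛₗ ℝ ν).isLinear c)).isPreconnected
    fun y hy hyf => (ne_of_lt hy.2) (hfr y hy.1 hyf)
  have hd2 := subset_interior_or_subset_compl_closure (S := Ω) (B := B ∩ {y | c < inner ℝ ν y})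
    ((convex_ball x δ).inter (convex_halfSpace_gt
      (innerₛₗ ℝ ν).isLinear c)).isPreconnected
    fun y hy hyf => (ne_of_gt hy.2) (hfr y hy.1 hyf)
  rw [hΩ.isOpen.interior_eq] at hd1 hd2
  have hxΩ : x ∉ Ω := by
    have := hx.2; rwa [hΩ.isOpen.interior_eq] at this
  rcases hd1 with h1 | h1 <;> rcases hd2 with h2 | h2
  · exfalso
    -- If both halves lie in `Ω`, the exterior meets the ball in an open subset of a hyperplane,
    -- that is nowhere. Then `x` is interior to `closure Ω`, hence in `Ω`, contrary to its choice.
    have hU : B ∩ (closure Ω)ᶜ = ∅ := h_int _ (Metric.isOpen_ball.inter isClosed_closure.isOpen_compl)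
      fun y hy => by
        rcases lt_trichotomy (inner ℝ ν y) c with h | h | h
        · exact absurd (subset_closure (h1 ⟨hy.1, h⟩)) hy.2
        · exact h
        · exact absurd (subset_closure (h2 ⟨hy.1, h⟩)) hy.2
    have hBc : B ⊆ closure Ω := fun y hy => by
      by_contra hyc
      have : y ∈ B ∩ (closure Ω)ᶜ := ⟨hy, hyc⟩
      rw [hU] at this
      exact this
    have := interior_maximal hBc Metric.isOpen_ball (Metric.mem_ball_self hδ)
    rw [hΩ.interior_closure] at this
    exact hxΩ this
  · exact ⟨δ, hδ, ν, c, hν, h1, h2⟩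
  · refine ⟨δ, hδ, -ν, -c, by rwa [norm_neg], fun y hy => h2 ⟨hy.1, ?_⟩, fun y hy => h1 ⟨hy.1, ?_⟩⟩
    · simpa [inner_neg_left] using hy.2
    · simpa [inner_neg_left] using hy.2
  · exfalso
    have hU : B ∩ Ω = ∅ := h_int _ (Metric.isOpen_ball.inter hΩ.isOpen)
      fun y hy => by
        rcases lt_trichotomy (inner ℝ ν y) c with h | h | h
        · exact absurd (subset_closure hy.2) (h1 ⟨hy.1, h⟩)
        · exact h
        · exact absurd (subset_closure hy.2) (h2 ⟨hy.1, h⟩)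
    obtain ⟨y, hy1, hy2⟩ := mem_closure_iff.1 hx.1 B Metric.isOpen_ball (Metric.mem_ball_self hδ)
    have : y ∈ B ∩ Ω := ⟨hy1, hy2⟩
    rw [hU] at this
    exact this

/-- Integration by parts for a Sobolev function and a localised piecewise polynomial field. -/
theorem integral_mul_pw_add_of_shift (hΩ : IsPolytopalDomain Ω)
    (τ : Fin d → Fin M.numElems → MvPolynomial (Fin d) ℝ)
    (hτ : ∀ e, ∀ x ∈ M.face e, ∑ j, ev (M.jump (τ j) j e) x = 0)
    {G : E d → ℝ} {g : Fin d → E d → ℝ} (hG : IntegrableOn G Ω) (hg : ∀ j, IntegrableOn (g j) Ω)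
    (hw : ∀ j, HasWeakPartial Ω j G (g j)) {ψ : E d → ℝ} (hψ : IsTestFunction Set.univ ψ)
    {S : Set (E d)} (hS : ∀ j, ∀ y ∉ S, ψ y * M.pw (τ j) y = 0) (s : E d)
    (hsupp : ∀ᶠ n : ℕ in atTop, ∃ K, IsCompact K ∧ K ⊆ Ω ∧ ∀ y ∈ S, ∀ z,
      ‖z - (1 / ((n : ℝ) + 1)) • s‖ ≤ 1 / (2 * (n + 1)) → y + z ∈ K) :
    (∫ x in Ω, G x * (∑ j, M.pw (τ j) x * partialD j ψ x + ψ x * M.pw (M.pwDiv τ) x))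
      + ∑ j, ∫ x in Ω, g j x * (ψ x * M.pw (τ j) x) = 0 := by
  obtain ⟨C₁, hC₁, hψC⟩ := hψ.exists_bound
  choose C₂ hC₂ hτC using fun j => M.exists_pw_bound (τ j)
  obtain ⟨C₃, hC₃, hηC⟩ := M.exists_pw_bound (M.pwDiv τ)
  have hψc := hψ.1.continuous
  have hpc : ∀ j, Continuous (partialD j ψ) := fun j =>
    (hψ.1.continuous_fderiv (by norm_num)).clm_apply continuous_const
  have hpb : ∀ j x, |partialD j ψ x| ≤ C₁ := fun j x => by
    refine ((fderiv ℝ ψ x).le_opNorm _).trans ?_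
    simpa using (hψC x).2
  have hpwc := M.ae_continuousAt_pw hΩ
  have hsum : 0 ≤ ∑ j, C₂ j := Finset.sum_nonneg fun j _ => hC₂ j
  refine integral_mul_div_add_eq_zero (C := (∑ j, C₂ j) * C₁ + C₁ * C₃) hG hg hw
    (X := fun j x => ψ x * M.pw (τ j) x)
    (h := fun x => ∑ j, M.pw (τ j) x * partialD j ψ x + ψ x * M.pw (M.pwDiv τ) x)
    (fun j => (hψc.measurable.mul (M.measurable_pw _)).aestronglyMeasurable) ?_ ?_ ?_ ?_ ?_ ?_
    hS s hsupp
  · exact ((Finset.measurable_fun_sum _ fun j _ => (M.measurable_pw _).mul (hpc j).measurable).add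
      (hψc.measurable.mul (M.measurable_pw _))).aestronglyMeasurable
  · intro j x
    rw [abs_mul]
    calc |ψ x| * |M.pw (τ j) x| ≤ C₁ * C₂ j :=
          mul_le_mul (hψC x).1 (hτC j x) (abs_nonneg _) hC₁
      _ ≤ C₁ * ∑ j, C₂ j := mul_le_mul_of_nonneg_left
          (Finset.single_le_sum (fun j _ => hC₂ j) (Finset.mem_univ j)) hC₁
      _ ≤ _ := by nlinarith [mul_nonneg hC₁ hC₃]
  · intro x
    refine (abs_add_le _ _).trans (add_le_add ?_ ?_)
    · refine (Finset.abs_sum_le_sum_abs _ _).trans ?_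
      rw [Finset.sum_mul]
      refine Finset.sum_le_sum fun j _ => ?_
      rw [abs_mul]
      exact mul_le_mul (hτC j x) (hpb j x) (abs_nonneg _) (hC₂ j)
    · rw [abs_mul]
      exact mul_le_mul (hψC x).1 (hηC x) (abs_nonneg _) hC₁
  · intro j
    filter_upwards [hpwc (τ j)] with x hx
    exact hψc.continuousAt.mul hx
  · filter_upwards [ae_all_iff.2 fun j => hpwc (τ j), hpwc (M.pwDiv τ)] with x hx hx'
    exact (tendsto_finsetSum _ fun j _ => (hx j).mul (hpc j).continuousAt).add
      (hψc.continuousAt.mul hx')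
  · intro φ hφ
    have h1 := M.integral_pw_div hΩ τ hτ (hφ.mul_contDiff hψ.1)
    have hd : ∀ j x, partialD j (fun y => ψ y * φ y) x = ψ x * partialD j φ x + partialD j ψ x * φ x :=
      fun j x => partialD_mul j (hψ.1.differentiable (by norm_num) x)
        (hφ.1.differentiable (by norm_num) x)
    simp only [hd] at h1
    have hi1 : Integrable (fun x => ∑ j, ψ x * M.pw (τ j) x * partialD j φ x) := by
      refine integrable_finsetSum _ fun j _ => ?_
      have h := M.integrableOn_pw_mul (Ω' := Set.univ) (τ j)
        (integrableOn_partialD hφ j)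
      rw [integrableOn_univ] at h
      have h' := Integrable.bdd_mul (c := C₁) h hψc.aestronglyMeasurable
        (Eventually.of_forall fun x => (hψC x).1)
      exact h'.congr (Eventually.of_forall fun x => by simp only; ring)
    have hi2 : Integrable (fun x => ∑ j, M.pw (τ j) x * partialD j ψ x * φ x) := by
      refine integrable_finsetSum _ fun j _ => ?_
      have h := M.integrableOn_pw_mul (Ω' := Set.univ) (τ j)
        (integrableOn_partialD hψ j)
      rw [integrableOn_univ] at h
      obtain ⟨C, hC, hφC⟩ := hφ.exists_bound
      exact Integrable.mul_bdd (c := C) h hφ.1.continuous.aestronglyMeasurable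
        (Eventually.of_forall fun x => (hφC x).1)
    have hi3 : Integrable (fun x => M.pw (M.pwDiv τ) x * (ψ x * φ x)) := by
      have h := M.integrableOn_pw_mul (Ω' := Set.univ) (M.pwDiv τ)
        (integrableOn_test (hφ.mul_contDiff hψ.1))
      rwa [integrableOn_univ] at h
    have e1 : ∫ x, ∑ j, M.pw (τ j) x * (ψ x * partialD j φ x + partialD j ψ x * φ x)
        = (∫ x, ∑ j, ψ x * M.pw (τ j) x * partialD j φ x)
          + ∫ x, ∑ j, M.pw (τ j) x * partialD j ψ x * φ x := by
      rw [← integral_add hi1 hi2]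
      refine integral_congr_ae (Eventually.of_forall fun x => ?_)
      simp only [← Finset.sum_add_distrib]
      exact Finset.sum_congr rfl fun j _ => by ring
    have e2 : ∫ x, (∑ j, M.pw (τ j) x * partialD j ψ x + ψ x * M.pw (M.pwDiv τ) x) * φ x
        = (∫ x, ∑ j, M.pw (τ j) x * partialD j ψ x * φ x)
          + ∫ x, M.pw (M.pwDiv τ) x * (ψ x * φ x) := by
      rw [← integral_add hi2 hi3]
      refine integral_congr_ae (Eventually.of_forall fun x => ?_)
      simp only [add_mul, Finset.sum_mul]
      ring
    rw [e2]
    linarith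

end

end Mesh

namespace Mesh

section

variable {d : ℕ} {Ω : Set (E d)} (M : Mesh Ω)

/-- At interior points the centred kernel will do, so the shift is `0`. -/
theorem exists_shift_of_subset {ψ : E d → ℝ} (hΩ : IsOpen Ω) (hψ : IsTestFunction Ω ψ) :
    ∀ᶠ n : ℕ in atTop, ∃ K, IsCompact K ∧ K ⊆ Ω ∧ ∀ y ∈ tsupport ψ, ∀ z,
      ‖z - (1 / ((n : ℝ) + 1)) • (0 : E d)‖ ≤ 1 / (2 * (n + 1)) → y + z ∈ K := by
  obtain ⟨δ, hδ, hδΩ⟩ := hψ.2.1.exists_cthickening_subset_open hΩ hψ.2.2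
  have hlim0 : Tendsto (fun n : ℕ => 1 / ((n : ℝ) + 1)) atTop (𝓝 0) :=
    tendsto_one_div_add_atTop_nhds_zero_nat
  filter_upwards [hlim0.eventually_lt_const hδ] with n hn
  refine ⟨Metric.cthickening δ (tsupport ψ), hψ.2.1.isCompact.cthickening, hδΩ,
    fun y hy z hz => Metric.mem_cthickening_of_dist_le _ y δ _ hy ?_⟩
  rw [smul_zero, sub_zero] at hz
  rw [dist_eq_norm, add_sub_cancel_left]
  refine hz.trans (le_trans ?_ hn.le)
  exact one_div_le_one_div_of_le (by positivity) (by linarith [(Nat.cast_nonneg n : (0 : ℝ) ≤ n)])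

/-- At a regular boundary point the field may be nonzero up to the boundary. The kernel is shifted
by `1 / (n + 1)` into the half-space and spreads by half as much, so the mollified support keeps the
distance `q / 2` from the hyperplane. -/
theorem exists_shift_of_half_ball {ψ : E d → ℝ} {B : Set (E d)} (hB : IsOpen B)
    (hψ : IsTestFunction B ψ) {ν : E d} {c : ℝ} (hν : ‖ν‖ = 1)
    (hin : B ∩ {y | inner ℝ ν y < c} ⊆ Ω) :
    ∀ᶠ n : ℕ in atTop, ∃ K, IsCompact K ∧ K ⊆ Ω ∧
      ∀ y ∈ tsupport ψ ∩ {y | inner ℝ ν y ≤ c}, ∀ z,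
      ‖z - (1 / ((n : ℝ) + 1)) • (-ν)‖ ≤ 1 / (2 * (n + 1)) → y + z ∈ K := by
  obtain ⟨δ, hδ, hδB⟩ := hψ.2.1.exists_cthickening_subset_open hB hψ.2.2
  have hlim0 : Tendsto (fun n : ℕ => 1 / ((n : ℝ) + 1)) atTop (𝓝 0) :=
    tendsto_one_div_add_atTop_nhds_zero_nat
  filter_upwards [hlim0.eventually_lt_const (half_pos hδ)] with n hn
  have hpos : (0 : ℝ) < 1 / ((n : ℝ) + 1) := by positivity
  have hhalf : (1 : ℝ) / (2 * (n + 1)) = (1 / ((n : ℝ) + 1)) / 2 := by field_simp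
  rw [hhalf]
  set q : ℝ := 1 / ((n : ℝ) + 1) with hq
  refine ⟨Metric.cthickening δ (tsupport ψ) ∩ {y | inner ℝ ν y ≤ c - q / 2},
    hψ.2.1.isCompact.cthickening.inter_right (isClosed_le (by fun_prop) continuous_const),
    fun y hy => hin ⟨hδB hy.1, ?_⟩, fun y hy z hz => ⟨?_, ?_⟩⟩
  · have := hy.2
    simp only [Set.mem_ofPred_eq] at this ⊢
    linarith
  · refine Metric.mem_cthickening_of_dist_le _ y δ _ hy.1 ?_
    rw [dist_eq_norm, add_sub_cancel_left]
    calc ‖z‖ = ‖(z - q • (-ν)) + q • (-ν)‖ := by simp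
      _ ≤ q / 2 + q := by
        refine (norm_add_le _ _).trans (add_le_add hz ?_)
        rw [norm_smul, norm_neg, hν, mul_one, Real.norm_of_nonneg hpos.le]
      _ ≤ δ := by linarith
  · have h1 : inner ℝ ν (z - q • (-ν)) ≤ q / 2 :=
      (real_inner_le_norm _ _).trans (by rw [hν, one_mul]; exact hz)
    rw [smul_neg, sub_neg_eq_add, inner_add_right, inner_smul_right, real_inner_self_eq_norm_sq,
      hν] at h1
    have h2 := hy.2
    simp only [Set.mem_ofPred_eq] at h2 ⊢
    rw [inner_add_right]
    linarith

/-- Integration by parts for a bounded Sobolev function and a piecewise polynomial field without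
normal jumps. -/
theorem integral_mul_pwDiv_add_of_bounded (hΩ : IsPolytopalDomain Ω)
    (τ : Fin d → Fin M.numElems → MvPolynomial (Fin d) ℝ)
    (hτ : ∀ e, ∀ x ∈ M.face e, ∑ j, ev (M.jump (τ j) j e) x = 0)
    {G : E d → ℝ} {g : Fin d → E d → ℝ} (hG : IntegrableOn G Ω) (hg : ∀ j, IntegrableOn (g j) Ω)
    (hw : ∀ j, HasWeakPartial Ω j G (g j)) {B : ℝ} (hGB : ∀ x, |G x| ≤ B) :
    ∫ x in Ω, (G x * M.pw (M.pwDiv τ) x + ∑ j, g j x * M.pw (τ j) x) = 0 := by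
  have hB0 : 0 ≤ B := (abs_nonneg _).trans (hGB 0)
  choose C hC hτC using fun j => M.exists_pw_bound (τ j)
  let Ge : E d → ℝ := Ω.indicator G
  have hGe : AEStronglyMeasurable Ge :=
    (aestronglyMeasurable_indicator_iff hΩ.isOpen.measurableSet).2 hG.aestronglyMeasurable
  -- The functional says that `Gτ`, extended by zero, has the weak divergence `G div τ + ∇G · τ` on
  -- the whole space. It is checked locally at interior, regular boundary and exterior points. The
  -- bound on `G` makes the principal part bounded, as the removal of the singular set requires.
  let F : E d → E d := fun x => ∑ j, (Ge x * M.pw (τ j) x) • EuclideanSpace.single j (1 : ℝ)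
  let gg : E d → ℝ := fun x => G x * M.pw (M.pwDiv τ) x + ∑ j, g j x * M.pw (τ j) x
  have hGi : ∀ P, IntegrableOn (fun x => G x * M.pw P x) Ω := fun P => by
    simpa only [mul_comm] using M.integrableOn_pw_mul P hG
  have hgi : ∀ j P, IntegrableOn (fun x => g j x * M.pw P x) Ω := fun j P => by
    simpa only [mul_comm] using M.integrableOn_pw_mul P (hg j)
  have hgg : Integrable gg (vol Ω) := (hGi _).add (integrable_finsetSum _ fun j _ => hgi j _)
  have hF : AEStronglyMeasurable F := Finset.aestronglyMeasurable_fun_sum _ fun j _ =>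
    (hGe.mul (M.measurable_pw _).aestronglyMeasurable).smul_const _
  have hFB : ∀ x, ‖F x‖ ≤ ∑ j, B * C j := fun x => by
    refine (norm_sum_le _ _).trans (Finset.sum_le_sum fun j _ => ?_)
    rw [norm_smul, norm_mul, PiLp.norm_single, norm_one, mul_one]
    refine mul_le_mul ?_ (hτC j x) (norm_nonneg _) hB0
    by_cases hx : x ∈ Ω
    · simpa [Ge, hx] using hGB x
    · simpa [Ge, hx] using hB0
  have hFapp : ∀ ψ : E d → ℝ, ∀ x, fderiv ℝ ψ x (F x)
      = Ω.indicator (fun x => G x * ∑ j, M.pw (τ j) x * partialD j ψ x) x := fun ψ x => by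
    by_cases hx : x ∈ Ω
    · simp only [F, Ge, Set.indicator_of_mem hx, map_sum, map_smul, smul_eq_mul, Finset.mul_sum,
        partialD, mul_assoc]
    · simp [F, Ge, hx]
  have hfo : ∀ ψ, IsTestFunction Set.univ ψ → firstOrder F gg (vol Ω) ψ
      = (∫ x in Ω, G x * (∑ j, M.pw (τ j) x * partialD j ψ x + ψ x * M.pw (M.pwDiv τ) x))
      + ∑ j, ∫ x in Ω, g j x * (ψ x * M.pw (τ j) x) := fun ψ hψ => by
    have hψi := integrable_fderiv_apply hF hFB hψ
    obtain ⟨C₁, hC₁, hψC⟩ := hψ.exists_bound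
    have hψm : AEStronglyMeasurable ψ (vol Ω) := hψ.1.continuous.aestronglyMeasurable
    have hbd : ∀ q : E d → ℝ, IntegrableOn q Ω → IntegrableOn (fun x => ψ x * q x) Ω :=
      fun q hq => Integrable.bdd_mul (c := C₁) hq hψm (Eventually.of_forall fun x => (hψC x).1)
    simp only [hFapp] at hψi
    rw [integrable_indicator_iff hΩ.isOpen.measurableSet] at hψi
    have hi2 : IntegrableOn (fun x => ψ x * (G x * M.pw (M.pwDiv τ) x)) Ω := hbd _ (hGi _)
    have hi3 : IntegrableOn (fun x => ψ x * ∑ j, g j x * M.pw (τ j) x) Ω :=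
      hbd _ (integrable_finsetSum _ fun j _ => hgi j _)
    have hi3' : ∀ j, IntegrableOn (fun x => g j x * (ψ x * M.pw (τ j) x)) Ω := fun j =>
      (hbd _ (hgi j (τ j))).congr (Eventually.of_forall fun x => by simp only; ring)
    rw [firstOrder]
    simp only [hFapp]
    rw [integral_indicator hΩ.isOpen.measurableSet, ← integral_finsetSum _ fun j _ => hi3' j]
    have e1 : ∫ x in Ω, ψ x * gg x = (∫ x in Ω, ψ x * (G x * M.pw (M.pwDiv τ) x))
        + ∫ x in Ω, ψ x * ∑ j, g j x * M.pw (τ j) x := by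
      rw [← integral_add hi2 hi3]
      exact integral_congr_ae (Eventually.of_forall fun x => by simp only [gg]; ring)
    have e2 : ∫ x in Ω, G x * (∑ j, M.pw (τ j) x * partialD j ψ x + ψ x * M.pw (M.pwDiv τ) x)
        = (∫ x in Ω, G x * ∑ j, M.pw (τ j) x * partialD j ψ x)
        + ∫ x in Ω, ψ x * (G x * M.pw (M.pwDiv τ) x) := by
      rw [← integral_add hψi hi2]
      exact integral_congr_ae (Eventually.of_forall fun x => by simp only; ring)
    rw [e1, e2, add_assoc]
    congr 2
    refine integral_congr_ae (Eventually.of_forall fun x => ?_)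
    simp only [Finset.mul_sum]
    exact Finset.sum_congr rfl fun j _ => by ring
  have hall : ∀ φ, IsTestFunction Set.univ φ → firstOrder F gg (vol Ω) φ = 0 := fun φ hφ => by
    refine firstOrder_eq_zero_of_locally_off_hypSing (ν := M.faceNormal) (c := M.faceOffset)
      M.norm_faceNormal hF hFB hgg (fun i j _ => ?_) (fun x hx => ?_) hφ
    · refine measure_mono_null Set.inter_subset_left ?_
      exact Measure.restrict_le_self.absolutelyContinuous (volume_hyp (M.norm_faceNormal i) _)
    by_cases hxΩ : x ∈ Ω
    · refine ⟨Ω, hΩ.isOpen, hxΩ, fun ψ hψ => ?_⟩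
      have hψu := hψ.mono (Set.subset_univ _)
      rw [hfo ψ hψu]
      refine M.integral_mul_pw_add_of_shift hΩ τ hτ hG hg hw hψu (S := tsupport ψ)
        (fun j y hy => ?_) 0 (exists_shift_of_subset hΩ.isOpen hψ)
      rw [image_eq_zero_of_notMem_tsupport hy, zero_mul]
    by_cases hxc : x ∈ closure Ω
    · have hxf : x ∈ frontier Ω := ⟨hxc, by rwa [hΩ.isOpen.interior_eq]⟩
      obtain ⟨δ, hδ, ν, c, hν, hin, hout⟩ := M.exists_half_ball hΩ hxf hx
      refine ⟨Metric.ball x δ, Metric.isOpen_ball, Metric.mem_ball_self hδ, fun ψ hψ => ?_⟩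
      have hψu := hψ.mono (Set.subset_univ _)
      rw [hfo ψ hψu]
      refine M.integral_mul_pw_add_of_shift hΩ τ hτ hG hg hw hψu
        (S := tsupport ψ ∩ {y | inner ℝ ν y ≤ c})
        (fun j y hy => ?_) (-ν) (exists_shift_of_half_ball Metric.isOpen_ball hψ hν hin)
      by_cases hy1 : y ∈ tsupport ψ
      · have hy2 : c < inner ℝ ν y := not_le.1 fun h => hy ⟨hy1, h⟩
        rw [M.pw_eq_zero_of_notMem hΩ _ fun h => hout ⟨hψ.2.2 hy1, hy2⟩ (subset_closure h),
          mul_zero]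
      · rw [image_eq_zero_of_notMem_tsupport hy1, zero_mul]
    · refine ⟨(closure Ω)ᶜ, isClosed_closure.isOpen_compl, hxc, fun ψ hψ => ?_⟩
      have h1 : ∀ y, fderiv ℝ ψ y (F y) = 0 := fun y => by
        rw [hFapp]
        by_cases hy : y ∈ Ω
        · have : fderiv ℝ ψ y = 0 := image_eq_zero_of_notMem_tsupport fun h =>
            hψ.2.2 (tsupport_fderiv_subset ℝ h) (subset_closure hy)
          simp [hy, partialD, this]
        · simp [hy]
      have h2 : ∫ y in Ω, ψ y * gg y = 0 := setIntegral_eq_zero_of_forall_eq_zero fun y hy => by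
        rw [image_eq_zero_of_notMem_tsupport fun h => hψ.2.2 h (subset_closure hy), zero_mul]
      rw [firstOrder, h2]
      simp [h1]
  -- Testing with a function equal to one near `Ω` turns the weak divergence identity into the
  -- assertion.
  obtain ⟨χ, hχ, hχ1⟩ := exists_test_eq_one hΩ.isBounded
  have h := hall χ hχ
  have h1 : ∀ y, fderiv ℝ χ y (F y) = 0 := fun y => by
    rw [hFapp]
    by_cases hy : y ∈ Ω
    · have : fderiv ℝ χ y = 0 := by
        have h2 : χ =ᶠ[𝓝 y] fun _ => 1 := hχ1 y hy
        rw [h2.fderiv_eq]; simp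
      simp [hy, partialD, this]
    · simp [hy]
  rw [firstOrder] at h
  simp only [h1, integral_zero, zero_add] at h
  rw [← h]
  refine setIntegral_congr_fun hΩ.isOpen.measurableSet fun y hy => ?_
  simp only [(hχ1 y hy).self_of_nhds, one_mul, gg]

end

end Mesh

theorem abs_arctan_le (x : ℝ) : |Real.arctan x| ≤ |x| := by
  have h := Convex.norm_image_sub_le_of_norm_hasDerivWithin_le (f := Real.arctan)
    (f' := fun x => 1 / (1 + x ^ 2)) (C := 1) (s := Set.univ) (x := 0) (y := x)
    (fun x _ => (Real.hasDerivAt_arctan x).hasDerivWithinAt)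
    (fun x _ => by
      rw [Real.norm_of_nonneg (by positivity)]
      exact (div_le_one (by positivity)).2 (by nlinarith)) convex_univ trivial trivial
  simpa using h

namespace Mesh

section

variable {d : ℕ} {Ω : Set (E d)} (M : Mesh Ω)

/-- Integration by parts for a Sobolev function and a piecewise polynomial field without normal
jumps. -/
theorem integral_mul_pwDiv_add (hΩ : IsPolytopalDomain Ω)
    (τ : Fin d → Fin M.numElems → MvPolynomial (Fin d) ℝ)
    (hτ : ∀ e, ∀ x ∈ M.face e, ∑ j, ev (M.jump (τ j) j e) x = 0)
    {G : E d → ℝ} {g : Fin d → E d → ℝ} (hG : IntegrableOn G Ω) (hg : ∀ j, IntegrableOn (g j) Ω)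
    (hw : ∀ j, HasWeakPartial Ω j G (g j)) :
    ∫ x in Ω, (G x * M.pw (M.pwDiv τ) x + ∑ j, g j x * M.pw (τ j) x) = 0 := by
  let ε : ℕ → ℝ := fun n => 1 / ((n : ℝ) + 1)
  have hε : ∀ n, 0 < ε n := fun n => by positivity
  have hlim0 : Tendsto ε atTop (𝓝 0) := tendsto_one_div_add_atTop_nhds_zero_nat
  -- Smooth truncation: each `F n` is bounded, while `|F n s| ≤ |s|` and `|F' n s| ≤ 1` allow
  -- dominated convergence to the untruncated function.
  let F : ℕ → ℝ → ℝ := fun n s => (ε n)⁻¹ * Real.arctan (ε n * s)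
  let F' : ℕ → ℝ → ℝ := fun n s => 1 / (1 + (ε n * s) ^ 2)
  have hF : ∀ n s, HasDerivAt (F n) (F' n s) s := fun n s => by
    have h1 : HasDerivAt (fun s => ε n * s) (ε n) s := by
      simpa using (hasDerivAt_id s).const_mul (ε n)
    have h2 := ((Real.hasDerivAt_arctan (ε n * s)).comp s h1).const_mul (ε n)⁻¹
    refine h2.congr_deriv ?_
    have := (hε n).ne'
    simp only [F']
    field_simp
  have hF'c : ∀ n, Continuous (F' n) := fun n =>
    continuous_const.div (by fun_prop) fun s => by positivity
  have hF'1 : ∀ n s, |F' n s| ≤ 1 := fun n s => by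
    rw [abs_of_nonneg (by positivity)]
    exact (div_le_one (by positivity)).2 (by nlinarith [sq_nonneg (ε n * s)])
  have hFs : ∀ n s, |F n s| ≤ |s| := fun n s => by
    have := hε n
    simp only [F]
    rw [abs_mul, abs_of_pos (inv_pos.2 this)]
    calc (ε n)⁻¹ * |Real.arctan (ε n * s)| ≤ (ε n)⁻¹ * |ε n * s| := by
          exact mul_le_mul_of_nonneg_left (abs_arctan_le _) (inv_pos.2 this).le
      _ = |s| := by rw [abs_mul, abs_of_pos this]; field_simp
  have hFb : ∀ n s, |F n s| ≤ (ε n)⁻¹ * 2 := fun n s => by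
    have := hε n
    simp only [F]
    rw [abs_mul, abs_of_pos (inv_pos.2 this)]
    gcongr
    rw [abs_le]
    constructor <;> linarith [Real.arctan_lt_pi_div_two (ε n * s),
      Real.neg_pi_div_two_lt_arctan (ε n * s), Real.pi_lt_four]
  have hFlim : ∀ s, Tendsto (fun n => F n s) atTop (𝓝 s) := fun s => by
    have h1 : HasDerivAt (fun e => e * s) s (0 : ℝ) := by
      simpa using (hasDerivAt_id (0 : ℝ)).mul_const s
    have h2 : HasDerivAt (fun e => Real.arctan (e * s)) s (0 : ℝ) := by
      have h := (Real.hasDerivAt_arctan (0 * s)).comp 0 h1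
      exact h.congr_deriv (by simp)
    have h3 := (hasDerivAt_iff_tendsto_slope_zero.1 h2).comp
      (tendsto_nhdsWithin_iff.2 ⟨hlim0, Eventually.of_forall fun n => (hε n).ne'⟩)
    refine h3.congr fun n => ?_
    simp [F]
  have hF'lim : ∀ s, Tendsto (fun n => F' n s) atTop (𝓝 1) := fun s => by
    have h1 : Tendsto (fun n => 1 / (1 + (ε n * s) ^ 2)) atTop (𝓝 (1 / (1 + (0 * s) ^ 2))) :=
      tendsto_const_nhds.div (((hlim0.mul_const s).pow 2).const_add 1) (by positivity)
    rwa [zero_mul, zero_pow two_ne_zero, add_zero, div_one] at h1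
  have hFc : ∀ n, Continuous (F n) := fun n =>
    continuous_iff_continuousAt.2 fun s => (hF n s).continuousAt
  have hFi : ∀ n, IntegrableOn (fun x => F n (G x)) Ω := fun n =>
    Integrable.mono hG ((hFc n).comp_aestronglyMeasurable hG.aestronglyMeasurable)
      (Eventually.of_forall fun x => hFs n _)
  have hgi : ∀ n j, IntegrableOn (fun x => F' n (G x) * g j x) Ω := fun n j =>
    Integrable.bdd_mul (c := 1) (hg j)
      ((hF'c n).comp_aestronglyMeasurable hG.aestronglyMeasurable)
      (Eventually.of_forall fun x => hF'1 n _)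
  have hz : ∀ n, ∫ x in Ω, (F n (G x) * M.pw (M.pwDiv τ) x
      + ∑ j, (F' n (G x) * g j x) * M.pw (τ j) x) = 0 := fun n => by
    refine M.integral_mul_pwDiv_add_of_bounded hΩ τ hτ (hFi n) (hgi n) (fun j =>
      (hw j).comp hΩ.isOpen hG (hg j) (hF n) (hF'c n) (B := max ((ε n)⁻¹ * 2) 1)
        (fun s => (hFb n s).trans (le_max_left _ _))
        fun s => (hF'1 n s).trans (le_max_right _ _)) (fun x => hFb n _)
  have hGi : ∀ (q : E d → ℝ) P, IntegrableOn q Ω → IntegrableOn (fun x => q x * M.pw P x) Ω :=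
    fun q P hq => by simpa only [mul_comm] using M.integrableOn_pw_mul P hq
  refine tendsto_nhds_unique (f := fun n => ∫ x in Ω, (F n (G x) * M.pw (M.pwDiv τ) x
      + ∑ j, (F' n (G x) * g j x) * M.pw (τ j) x)) (l := atTop) ?_ ?_
  · refine tendsto_integral_of_dominated_convergence
      (fun x => |G x * M.pw (M.pwDiv τ) x| + ∑ j, |g j x * M.pw (τ j) x|) (fun n => ?_) ?_
      (fun n => Eventually.of_forall fun x => ?_) (Eventually.of_forall fun x => ?_)
    · exact ((hGi _ _ (hFi n)).add
        (integrable_finsetSum _ fun j _ => hGi _ _ (hgi n j))).aestronglyMeasurable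
    · exact (hGi _ _ hG).abs.add (integrable_finsetSum _ fun j _ => (hGi _ _ (hg j)).abs)
    · refine (norm_add_le _ _).trans (add_le_add ?_ ((norm_sum_le _ _).trans
        (Finset.sum_le_sum fun j _ => ?_)))
      · rw [norm_mul, abs_mul]
        exact mul_le_mul_of_nonneg_right (hFs n _) (abs_nonneg _)
      · rw [norm_mul, norm_mul, abs_mul]
        refine mul_le_mul_of_nonneg_right ?_ (abs_nonneg _)
        exact mul_le_of_le_one_left (abs_nonneg _) (hF'1 n _)
    · refine ((hFlim _).mul_const _).add (tendsto_finsetSum _ fun j _ => ?_)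
      have := ((hF'lim (G x)).mul_const (g j x)).mul_const (M.pw (τ j) x)
      rwa [one_mul] at this
  · simp only [hz]
    exact tendsto_const_nhds

end

end Mesh

/-! ### Functions vanishing outside the domain -/

section

variable {d : ℕ}

/-- The weak gradient vanishes almost everywhere on the zero set. -/
theorem HasWeakPartial.ae_eq_zero {i : Fin d} {u g : E d → ℝ} (hu : Integrable u)
    (hg : Integrable g) (hw : HasWeakPartial Set.univ i u g) : ∀ᵐ x, u x = 0 → g x = 0 := by
  -- Here `F n` tends to `0` uniformly, but `F' n` tends to the indicator of `{0}`. By the chain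
  -- rule, the restriction of `g` to the zero set of `u` is the weak derivative of the zero
  -- function.
  let F : ℕ → ℝ → ℝ := fun n s => ((n : ℝ) + 1)⁻¹ * Real.arctan ((n + 1) * s)
  let F' : ℕ → ℝ → ℝ := fun n s => 1 / (1 + ((n + 1) * s) ^ 2)
  have hpos : ∀ n : ℕ, (0 : ℝ) < n + 1 := fun n => by positivity
  have hF : ∀ n s, HasDerivAt (F n) (F' n s) s := fun n s => by
    have h1 : HasDerivAt (fun s => ((n : ℝ) + 1) * s) (n + 1) s := by
      simpa using (hasDerivAt_id s).const_mul ((n : ℝ) + 1)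
    have h2 := ((Real.hasDerivAt_arctan ((n + 1) * s)).comp s h1).const_mul ((n : ℝ) + 1)⁻¹
    refine h2.congr_deriv ?_
    have := (hpos n).ne'
    simp only [F']
    field_simp
  have hF'c : ∀ n, Continuous (F' n) := fun n =>
    continuous_const.div (by fun_prop) fun s => by positivity
  have hFc : ∀ n, Continuous (F n) := fun n =>
    continuous_iff_continuousAt.2 fun s => (hF n s).continuousAt
  have hF'1 : ∀ n s, |F' n s| ≤ 1 := fun n s => by
    rw [abs_of_nonneg (by positivity)]
    exact (div_le_one (by positivity)).2 (by nlinarith [sq_nonneg (((n : ℝ) + 1) * s)])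
  have hFb : ∀ n s, |F n s| ≤ 2 / ((n : ℝ) + 1) := fun n s => by
    simp only [F]
    rw [abs_mul, abs_of_pos (inv_pos.2 (hpos n)), div_eq_inv_mul]
    refine mul_le_mul_of_nonneg_left ?_ (inv_pos.2 (hpos n)).le
    rw [abs_le]
    constructor <;> linarith [Real.arctan_lt_pi_div_two ((n + 1) * s),
      Real.neg_pi_div_two_lt_arctan ((n + 1) * s), Real.pi_lt_four]
  have hF2 : ∀ n s, |F n s| ≤ 2 := fun n s => (hFb n s).trans
    (div_le_self (by norm_num) (by linarith [(Nat.cast_nonneg n : (0 : ℝ) ≤ n)]))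
  let q : E d → ℝ := {x | u x = 0}.indicator g
  have hF'lim : ∀ x, Tendsto (fun n => F' n (u x) * g x) atTop (𝓝 (q x)) := fun x => by
    by_cases hx : u x = 0
    · have : q x = g x := Set.indicator_of_mem (s := {x | u x = 0}) hx g
      rw [this]
      simp [F', hx]
    · have : q x = 0 := Set.indicator_of_notMem (s := {x | u x = 0}) hx g
      rw [this]
      have h1 : Tendsto (fun n : ℕ => ((n : ℝ) + 1)) atTop atTop :=
        tendsto_natCast_atTop_atTop.atTop_add tendsto_const_nhds
      have h2 : Tendsto (fun n : ℕ => 1 + (((n : ℝ) + 1) * u x) ^ 2) atTop atTop := by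
        refine tendsto_atTop_add_const_left _ _ ?_
        simp only [mul_pow]
        exact ((tendsto_pow_atTop two_ne_zero).comp h1).atTop_mul_const (by positivity)
      have h3 : Tendsto (fun n => F' n (u x)) atTop (𝓝 0) := by
        exact (h2.inv_tendsto_atTop).congr fun n => (one_div _).symm
      simpa using h3.mul_const (g x)
  have hFm : ∀ n, AEStronglyMeasurable (fun x => F' n (u x) * g x) := fun n =>
    ((hF'c n).comp_aestronglyMeasurable hu.aestronglyMeasurable).mul hg.aestronglyMeasurable
  have hqm : AEStronglyMeasurable q :=
    aestronglyMeasurable_of_tendsto_ae atTop hFm (Eventually.of_forall hF'lim)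
  have hqi : Integrable q := hg.mono hqm (Eventually.of_forall fun x => by
    by_cases hx : u x = 0
    · rw [show q x = g x from Set.indicator_of_mem (s := {x | u x = 0}) hx g]
    · rw [show q x = 0 from Set.indicator_of_notMem (s := {x | u x = 0}) hx g, norm_zero]
      exact norm_nonneg _)
  have key : ∀ᵐ x, q x = 0 := by
    refine ae_eq_zero_of_integral_contDiff_smul_eq_zero hqi.locallyIntegrable fun φ h1 h2 => ?_
    have hφ : IsTestFunction Set.univ φ := isTestFunction_univ.2 ⟨h1, h2⟩
    obtain ⟨C, hC0, hC⟩ := hφ.exists_bound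
    have hpi : Integrable (partialD i φ) := by
      have := Mesh.integrableOn_partialD (Ω' := Set.univ) hφ i
      rwa [integrableOn_univ] at this
    have hn : ∀ n, ∫ x, F n (u x) * partialD i φ x = -∫ x, F' n (u x) * g x * φ x := fun n => by
      have := HasWeakPartial.comp isOpen_univ (by rwa [integrableOn_univ])
        (by rwa [integrableOn_univ]) hw (hF n) (hF'c n) (B := 2) (hF2 n)
        (fun s => (hF'1 n s).trans (by norm_num)) φ hφ
      simpa only [Measure.restrict_univ] using this
    have hL : Tendsto (fun n => ∫ x, F n (u x) * partialD i φ x) atTop (𝓝 0) := by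
      have h3 : Tendsto (fun n : ℕ => 2 * (∫ x, ‖partialD i φ x‖) * (1 / ((n : ℝ) + 1))) atTop
          (𝓝 0) := by
        simpa using tendsto_one_div_add_atTop_nhds_zero_nat.const_mul (2 * ∫ x, ‖partialD i φ x‖)
      refine squeeze_zero_norm (fun n => ?_) h3
      calc _ ≤ ∫ x, 2 / ((n : ℝ) + 1) * ‖partialD i φ x‖ :=
            norm_integral_le_of_norm_le (hpi.norm.const_mul _) (Eventually.of_forall fun x => by
              rw [norm_mul]
              exact mul_le_mul_of_nonneg_right (hFb n _) (norm_nonneg _))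
        _ = _ := by rw [integral_const_mul]; ring
    have hR : Tendsto (fun n => -∫ x, F' n (u x) * g x * φ x) atTop (𝓝 (-∫ x, q x * φ x)) := by
      refine (tendsto_integral_of_dominated_convergence (fun x => ‖g x‖ * C)
        (fun n => (hFm n).mul h1.continuous.aestronglyMeasurable) (hg.norm.mul_const C)
        (fun n => Eventually.of_forall fun x => ?_)
        (Eventually.of_forall fun x => (hF'lim x).mul_const _)).neg
      rw [Pi.mul_apply, norm_mul, norm_mul]
      refine mul_le_mul ?_ (hC x).1 (norm_nonneg _) (norm_nonneg _)
      exact mul_le_of_le_one_left (norm_nonneg _) (hF'1 n _)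
    have h4 := tendsto_nhds_unique (hL.congr hn) hR
    rw [eq_comm, neg_eq_zero] at h4
    rw [← h4]
    exact integral_congr_ae (Eventually.of_forall fun x => by simp [mul_comm])
  filter_upwards [key] with x hx h0
  rwa [show q x = g x from Set.indicator_of_mem (s := {x | u x = 0}) h0 g] at hx

theorem tendsto_eLpNorm_of_bounded {μ : Measure (E d)} [IsFiniteMeasure μ] {f : ℕ → E d → ℝ}
    {C p : ℝ} (hp : 0 < p) (hm : ∀ n, AEStronglyMeasurable (f n) μ) (hC : ∀ n x, |f n x| ≤ C)
    (hlim : ∀ᵐ x ∂μ, Tendsto (fun n => f n x) atTop (𝓝 0)) :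
    Tendsto (fun n => eLpNorm (f n) (ENNReal.ofReal p) μ) atTop (𝓝 0) := by
  have hp0 : ENNReal.ofReal p ≠ 0 := by simpa using hp
  simp only [eLpNorm_eq_lintegral_rpow_enorm_toReal hp0 ENNReal.ofReal_ne_top, ENNReal.toReal_ofReal hp.le]
  have h1 : Tendsto (fun n => ∫⁻ x, ‖f n x‖ₑ ^ p ∂μ) atTop (𝓝 (∫⁻ _, 0 ∂μ)) := by
    refine tendsto_lintegral_of_dominated_convergence' (fun _ => ENNReal.ofReal C ^ p)
      (fun n => (hm n).enorm.pow_const p) (fun n => Eventually.of_forall fun x => ?_) ?_ ?_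
    · refine ENNReal.rpow_le_rpow ?_ hp.le
      rw [← ofReal_norm]
      exact ENNReal.ofReal_le_ofReal (hC n x)
    · rw [lintegral_const]
      exact ENNReal.mul_ne_top (ENNReal.rpow_ne_top_of_nonneg hp.le ENNReal.ofReal_ne_top)
        (measure_ne_top _ _)
    · filter_upwards [hlim] with x hx
      have h2 : Tendsto (fun n => ‖f n x‖ₑ) atTop (𝓝 0) := by
        simpa using hx.enorm
      have h3 := (ENNReal.continuous_rpow_const (y := p)).tendsto 0 |>.comp h2
      rwa [ENNReal.zero_rpow_of_pos hp] at h3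
  rw [lintegral_zero] at h1
  have h3 := (ENNReal.continuous_rpow_const (y := 1 / p)).tendsto 0 |>.comp h1
  rwa [ENNReal.zero_rpow_of_pos (by positivity)] at h3

theorem norm_fderiv_le_sum (f : E d → ℝ) (x : E d) :
    ‖fderiv ℝ f x‖ ≤ ∑ i, |partialD i f x| := by
  refine ContinuousLinearMap.opNorm_le_bound _ (Finset.sum_nonneg fun _ _ => abs_nonneg _)
    fun v => ?_
  have hv : v = ∑ i, v i • EuclideanSpace.single i (1 : ℝ) := by
    simpa using ((EuclideanSpace.basisFun (Fin d) ℝ).sum_repr v).symm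
  conv_lhs => rw [hv]
  rw [map_sum, Finset.sum_mul]
  refine (norm_sum_le _ _).trans (Finset.sum_le_sum fun i _ => ?_)
  rw [map_smul, norm_smul, mul_comm]
  exact mul_le_mul_of_nonneg_left (PiLp.norm_apply_le v i) (abs_nonneg _)

/-- A smooth function vanishing near `0` and equal to the identity far away. -/
def deadZone (s : ℝ) : ℝ := s * (1 - (⟨1, 2, by norm_num, by norm_num⟩ : ContDiffBump (0 : ℝ)) s)

theorem contDiff_deadZone : ContDiff ℝ ∞ deadZone :=
  contDiff_id.mul (contDiff_const.sub (ContDiffBump.contDiff _))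

theorem deadZone_of_le {s : ℝ} (h : |s| ≤ 1) : deadZone s = 0 := by
  rw [deadZone, ContDiffBump.one_of_mem_closedBall _ (by simpa using h), sub_self, mul_zero]

theorem deadZone_of_ge {s : ℝ} (h : 2 ≤ |s|) : deadZone s = s := by
  rw [deadZone, ContDiffBump.zero_of_le_dist _ (by simpa using h), sub_zero, mul_one]

theorem abs_deadZone_le (s : ℝ) : |deadZone s| ≤ |s| := by
  rw [deadZone, abs_mul]
  refine mul_le_of_le_one_right (abs_nonneg _) ?_
  set b : ContDiffBump (0 : ℝ) := ⟨1, 2, by norm_num, by norm_num⟩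
  rw [abs_le]
  constructor <;> linarith [b.nonneg (x := s), b.le_one (x := s)]

theorem abs_deadZone_sub_le (s : ℝ) : |deadZone s - s| ≤ 2 := by
  rcases le_total 2 |s| with h | h
  · simp [deadZone_of_ge h]
  · set b : ContDiffBump (0 : ℝ) := ⟨1, 2, by norm_num, by norm_num⟩ with hb
    have : deadZone s - s = -(s * b s) := by rw [deadZone, hb]; ring
    rw [this, abs_neg, abs_mul, abs_of_nonneg b.nonneg]
    exact (mul_le_of_le_one_right (abs_nonneg _) b.le_one).trans h

theorem deriv_deadZone_of_gt {s : ℝ} (h : 2 < |s|) : deriv deadZone s = 1 := by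
  have : deadZone =ᶠ[𝓝 s] id := by
    filter_upwards [(continuous_abs.isOpen_preimage _ isOpen_Ioi).mem_nhds
      (show s ∈ abs ⁻¹' Set.Ioi 2 from h)] with t ht using deadZone_of_ge (le_of_lt ht)
  rw [this.deriv_eq, deriv_id]

theorem exists_deriv_deadZone_bound : ∃ K : ℝ, 0 ≤ K ∧ ∀ s, |deriv deadZone s| ≤ K := by
  obtain ⟨K, hK⟩ := (isCompact_closedBall (0 : ℝ) 2).exists_bound_of_continuousOn
    (f := deriv deadZone) (contDiff_deadZone.continuous_deriv (by norm_num)).continuousOn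
  refine ⟨max K 1, by positivity, fun s => ?_⟩
  rcases le_or_gt |s| 2 with h | h
  · exact (hK s (by simpa using h)).trans (le_max_left _ _)
  · simp [deriv_deadZone_of_gt h]

/-- A bounded function with bounded weak gradient on the whole space that vanishes outside a
polytopal domain belongs to `W_0^{1,p}` of this domain. -/
theorem isW01p_of_vanishing {Ω : Set (E d)} (hΩ : IsPolytopalDomain Ω) {p : ℝ} (hp : 0 < p)
    {u : E d → ℝ} {G : Fin d → E d → ℝ} (hum : Measurable u) (hGm : ∀ i, Measurable (G i))
    {C : ℝ} (huC : ∀ x, |u x| ≤ C) (hGC : ∀ i x, |G i x| ≤ C) (hu0 : ∀ x ∉ Ω, u x = 0)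
    (hG0 : ∀ i, ∀ x ∉ Ω, G i x = 0) (hw : ∀ i, HasWeakPartial Set.univ i u (G i)) :
    IsW01p Ω p u G := by
  have hC0 : 0 ≤ C := (abs_nonneg _).trans (huC 0)
  have hfin : IsFiniteMeasure (vol Ω) := ⟨by
    rw [Measure.restrict_apply_univ]; exact hΩ.volume_lt_top⟩
  have h_int : ∀ q : E d → ℝ, Measurable q → (∀ x, |q x| ≤ C) → (∀ x ∉ Ω, q x = 0) →
      Integrable q := fun q hq hqC hq0 => by
    have h1 : IntegrableOn q Ω := Measure.integrableOn_of_bounded (M := C) hΩ.volume_lt_top.ne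
      hq.aestronglyMeasurable (Eventually.of_forall hqC)
    refine h1.integrable_of_forall_notMem_eq_zero hq0
  have hui := h_int u hum huC hu0
  have hGi := fun i => h_int (G i) (hGm i) (hGC i) (hG0 i)
  let un : ℕ → E d → ℝ := fun n => moll (kern 0 n) u
  have hun : ∀ n, ContDiff ℝ ∞ (un n) := fun n =>
    contDiff_moll (isTestFunction_kern 0 n) hui.locallyIntegrable
  have hgrad : ∀ n i x, partialD i (un n) x = moll (kern 0 n) (G i) x := fun n i x => by
    have ht : IsTestFunction Set.univ (fun y => kern 0 n (x - y)) :=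
      isTestFunction_reflect (isTestFunction_kern 0 n) x fun _ _ => trivial
    have h2 := hw i _ ht
    simp only [partialD_reflect (isTestFunction_kern 0 n), mul_neg] at h2
    rw [integral_neg, neg_inj] at h2
    simp only [Measure.restrict_univ] at h2
    rw [partialD_moll (isTestFunction_kern 0 n) hui.locallyIntegrable, h2]
    rfl
  set L : ℝ := ∑ _i : Fin d, C with hL
  have hL0 : 0 ≤ L := Finset.sum_nonneg fun _ _ => hC0
  have hlip : ∀ n x y, |un n x - un n y| ≤ L * ‖x - y‖ := fun n x y => by
    refine Convex.norm_image_sub_le_of_norm_fderiv_le (𝕜 := ℝ) (s := Set.univ) (f := un n)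
      (fun z _ => (hun n).differentiable (by norm_num) z) (fun z _ => ?_) convex_univ trivial trivial
    refine (norm_fderiv_le_sum _ _).trans (Finset.sum_le_sum fun i _ => ?_)
    rw [hgrad]
    exact abs_moll_le 0 n (hGC i) z
  have hae := ae_tendsto_moll hui.locallyIntegrable
  -- The uniform Lipschitz bound passes to the limit between almost every `y` and every exterior
  -- point, where `u` is zero. It extends to all points outside `Ω`, because these are limits of
  -- exterior points.
  have hdist : ∀ᵐ y, ∀ x ∉ Ω, |u y| ≤ L * ‖y - x‖ := by
    filter_upwards [hae] with y hy x hx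
    have hcl : IsClosed {z | |u y| ≤ L * ‖y - z‖} :=
      isClosed_le continuous_const (by fun_prop)
    have hsub : (closure Ω)ᶜ ⊆ {z | |u y| ≤ L * ‖y - z‖} := fun z hz => by
      have hev : u =ᶠ[𝓝 z] fun _ => 0 := by
        filter_upwards [isClosed_closure.isOpen_compl.mem_nhds hz] with w hw'
        exact hu0 w fun h => hw' (subset_closure h)
      have hcz : ContinuousAt u z := continuousAt_const.congr hev.symm
      have h1 := tendsto_moll 0 hum.aestronglyMeasurable huC hcz
      rw [hev.self_of_nhds] at h1
      have h2 : Tendsto (fun n => |un n y - un n z|) atTop (𝓝 |u y - 0|) := (hy.sub h1).abs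
      rw [sub_zero] at h2
      exact le_of_tendsto h2 (Eventually.of_forall fun n => hlip n y z)
    refine hcl.closure_subset_iff.2 hsub ?_
    rw [closure_compl, hΩ.interior_closure]
    exact hx
  have hbd : ∀ n, ∀ x ∉ Ω, |un n x| ≤ L / ((n : ℝ) + 1) := fun n x hx => by
    have h1 : ∀ᵐ y, ‖u y * kern 0 n (x - y)‖ ≤ L / ((n : ℝ) + 1) * kern 0 n (x - y) := by
      filter_upwards [hdist] with y hy
      rw [norm_mul, Real.norm_of_nonneg (kern_nonneg 0 n _)]
      by_cases hk : kern 0 n (x - y) = 0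
      · rw [hk, mul_zero, mul_zero]
      · refine mul_le_mul_of_nonneg_right ?_ (kern_nonneg 0 n _)
        have h2 := norm_le_of_kern_ne_zero 0 n hk
        rw [norm_zero, zero_add, norm_sub_rev] at h2
        refine (hy x hx).trans ?_
        rw [div_eq_mul_one_div]
        exact mul_le_mul_of_nonneg_left h2 hL0
    calc |un n x| ≤ ∫ y, L / ((n : ℝ) + 1) * kern 0 n (x - y) :=
          norm_integral_le_of_norm_le ((integrable_kern_reflect 0 n x).const_mul _) h1
      _ = _ := by rw [integral_const_mul, integral_kern_reflect, mul_one]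
  -- Outside `Ω` the mollified function is at most `L / (n + 1)`, strictly less than `ε n`. So `{ε n
  -- ≤ |un n|}` is a compact subset of `Ω`, and composition with the rescaled `deadZone` produces a
  -- test function in `Ω`.
  let ε : ℕ → ℝ := fun n => (L + 1) / ((n : ℝ) + 1)
  have hε : ∀ n, 0 < ε n := fun n => by positivity
  have hε0 : Tendsto ε atTop (𝓝 0) := by
    have := tendsto_one_div_add_atTop_nhds_zero_nat.const_mul (L + 1)
    simpa [ε, div_eq_mul_inv] using this
  let φ : ℕ → E d → ℝ := fun n x => ε n * deadZone (un n x / ε n)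
  have hφs : ∀ n, ContDiff ℝ ∞ (φ n) := fun n =>
    contDiff_const.mul (contDiff_deadZone.comp ((hun n).div_const _))
  have hsupp : ∀ n, {x | ε n ≤ |un n x|} ⊆ Ω := fun n x hx => by
    by_contra hxΩ
    have h1 := hbd n x hxΩ
    have h2 : ε n ≤ |un n x| := hx
    have h3 : L / ((n : ℝ) + 1) < ε n := by
      simp only [ε]; gcongr; linarith
    linarith
  have hsuppφ : ∀ n, Function.support (φ n) ⊆ {x | ε n ≤ |un n x|} := fun n x hx => by
    by_contra hlt
    apply hx
    have hlt' : |un n x| < ε n := not_le.1 hlt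
    have : deadZone (un n x / ε n) = 0 := deadZone_of_le (by
      rw [abs_div, abs_of_pos (hε n)]
      exact (div_le_one (hε n)).2 hlt'.le)
    simp [φ, this]
  have hclosed : ∀ n, IsClosed {x | ε n ≤ |un n x|} := fun n =>
    isClosed_le continuous_const (hun n).continuous.abs
  have hcomp : ∀ n, IsCompact {x | ε n ≤ |un n x|} := fun n =>
    Metric.isCompact_of_isClosed_isBounded (hclosed n) (hΩ.isBounded.subset (hsupp n))
  have htest : ∀ n, IsTestFunction Ω (φ n) := fun n =>
    ⟨hφs n, HasCompactSupport.of_support_subset_isCompact (hcomp n) (hsuppφ n),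
      (closure_minimal (hsuppφ n) (hclosed n)).trans (hsupp n)⟩
  have hφgrad : ∀ n i x, partialD i (φ n) x
      = deriv deadZone (un n x / ε n) * moll (kern 0 n) (G i) x := fun n i x => by
    have h1 : HasDerivAt (fun s => ε n * deadZone (s / ε n)) (deriv deadZone (un n x / ε n))
        (un n x) := by
      have h2 : HasDerivAt (fun s => s / ε n) (1 / ε n) (un n x) :=
        (hasDerivAt_id _).div_const _
      have h3 := ((contDiff_deadZone.differentiable (by norm_num) (un n x / ε n)).hasDerivAt.comp
        (un n x) h2).const_mul (ε n)
      refine h3.congr_deriv ?_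
      have := (hε n).ne'
      field_simp
    have h4 := h1.comp_hasFDerivAt x ((hun n).differentiable (by norm_num) x).hasFDerivAt
    have h5 : fderiv ℝ (φ n) x = _ := h4.fderiv
    rw [← hgrad]
    simp [partialD, h5]
  obtain ⟨K, hK0, hK⟩ := exists_deriv_deadZone_bound
  have hunC : ∀ n x, |un n x| ≤ C := fun n x => abs_moll_le 0 n huC x
  have hvol : ∀ {q : E d → Prop}, (∀ᵐ x, q x) → ∀ᵐ x ∂(vol Ω), q x := fun h =>
    ae_restrict_of_ae h
  refine ⟨φ, htest, ?_, fun i => ?_⟩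
  · refine tendsto_eLpNorm_of_bounded (C := C + C) hp
      (fun n => (hum.sub (hφs n).continuous.measurable).aestronglyMeasurable) (fun n x => ?_) ?_
    · refine (abs_sub _ _).trans (add_le_add (huC x) ?_)
      simp only [φ]
      rw [abs_mul, abs_of_pos (hε n)]
      calc ε n * |deadZone (un n x / ε n)| ≤ ε n * |un n x / ε n| :=
            mul_le_mul_of_nonneg_left (abs_deadZone_le _) (hε n).le
        _ = |un n x| := by
            rw [abs_div, abs_of_pos (hε n)]; have := (hε n).ne'; field_simp
        _ ≤ C := hunC n x
    · filter_upwards [hvol hae] with x hx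
      have h1 : Tendsto (fun n => φ n x - un n x) atTop (𝓝 0) := by
        have h2 : Tendsto (fun n => ε n * 2) atTop (𝓝 0) := by simpa using hε0.mul_const 2
        refine squeeze_zero_norm (fun n => ?_) h2
        have h3 : φ n x - un n x = ε n * (deadZone (un n x / ε n) - un n x / ε n) := by
          have := (hε n).ne'
          simp only [φ]; field_simp
        rw [h3, norm_mul, Real.norm_of_nonneg (hε n).le]
        exact mul_le_mul_of_nonneg_left (abs_deadZone_sub_le _) (hε n).le
      have h4 : Tendsto (fun n => u x - un n x) atTop (𝓝 0) := by
        simpa using (tendsto_const_nhds (x := u x)).sub hx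
      have h5 := h4.sub h1
      rw [sub_zero] at h5
      exact h5.congr fun n => by ring
  · have hpc : ∀ n, Continuous (partialD i (φ n)) := fun n =>
      ((hφs n).continuous_fderiv (by norm_num)).clm_apply continuous_const
    refine tendsto_eLpNorm_of_bounded (C := C + K * C) hp
      (fun n => ((hGm i).sub (hpc n).measurable).aestronglyMeasurable) (fun n x => ?_) ?_
    · refine (abs_sub _ _).trans (add_le_add (hGC i x) ?_)
      rw [hφgrad, abs_mul]
      exact mul_le_mul (hK _) (abs_moll_le 0 n (hGC i) x) (abs_nonneg _) hK0
    · filter_upwards [hvol hae, hvol (ae_tendsto_moll (hGi i).locallyIntegrable),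
        hvol ((hw i).ae_eq_zero hui (hGi i))] with x hx hGx hx0
      suffices h : Tendsto (fun n => partialD i (φ n) x) atTop (𝓝 (G i x)) by
        simpa using (tendsto_const_nhds (x := G i x)).sub h
      -- Where `u ≠ 0` the factor `deriv deadZone` is eventually one. Where `u = 0` it is merely
      -- bounded, but there the gradient vanishes almost everywhere.
      by_cases hux : u x = 0
      · rw [hx0 hux] at hGx ⊢
        have h1 : Tendsto (fun n => K * |moll (kern 0 n) (G i) x|) atTop (𝓝 0) := by
          simpa using hGx.abs.const_mul K
        refine squeeze_zero_norm (fun n => ?_) h1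
        rw [hφgrad, norm_mul]
        exact mul_le_mul_of_nonneg_right (hK _) (abs_nonneg _)
      · refine hGx.congr' ?_
        have h1 : Tendsto (fun n => |un n x| - 2 * ε n) atTop (𝓝 (|u x| - 2 * 0)) :=
          hx.abs.sub (hε0.const_mul 2)
        rw [mul_zero, sub_zero] at h1
        filter_upwards [h1.eventually_const_lt (abs_pos.2 hux)] with n hn
        rw [hφgrad, deriv_deadZone_of_gt, one_mul]
        rw [abs_div, abs_of_pos (hε n), lt_div_iff₀ (hε n)]
        linarith

end

/-! ### Weak functions with vanishing stabilizer -/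

theorem exists_ev_eq_of_mem_polyOn {d m : ℕ} {S : Set (E d)} {g : E d → ℝ} (h : g ∈ PolyOn m S) :
    ∃ P ∈ Poly d m, g = S.indicator (ev P) := by
  obtain ⟨P, hP, rfl⟩ := h
  exact ⟨P, hP, rfl⟩

theorem indicator_ev_mem_polyOn {d m : ℕ} (S : Set (E d)) {P : MvPolynomial (Fin d) ℝ}
    (h : P ∈ Poly d m) : S.indicator (ev P) ∈ PolyOn m S := ⟨P, h, rfl⟩

namespace Mesh

section

variable {d : ℕ} {Ω : Set (E d)} (M : Mesh Ω)

/-- Relatively open nonempty subsets of a face have positive surface measure, so vanishing almost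
everywhere is vanishing for a continuous function. This holds since faces have pure dimension. -/
theorem eqOn_zero_of_integral_face_eq_zero (e : Fin M.numFaces) {D : E d → ℝ} (hD : Continuous D)
    (h0 : ∀ x ∈ M.face e, 0 ≤ D x) (h : ∫ x in M.face e, D x ∂(surf d) = 0) :
    ∀ x ∈ M.face e, D x = 0 := by
  have h1 := (setIntegral_eq_zero_iff_of_nonneg_ae
    ((ae_restrict_iff' (M.isCompact_face e).measurableSet).2 (Eventually.of_forall h0))
    (M.integrableOn_face hD e)).1 h
  intro x hx
  by_contra hne
  have hU : IsOpen {y | D y ≠ 0} := isOpen_ne_fun hD continuous_const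
  have hpos := M.surf_face_inter_pos e hU ⟨x, hne, hx⟩
  have h2 : (surf d).restrict (M.face e) {y | D y ≠ 0} = 0 := h1
  rw [Measure.restrict_apply hU.measurableSet] at h2
  exact hpos.ne' h2

theorem diam_pos (hd : 0 < d) (t : Fin M.numElems) : 0 < M.diam t := by
  obtain ⟨x, hx⟩ := M.nonempty_interior_elem t
  have hb : Bornology.IsBounded (M.elem t) := (M.isPolytope_elem t).isCompact.isBounded
  have : Nontrivial (E d) := by
    have : Nonempty (Fin d) := ⟨⟨0, hd⟩⟩
    infer_instance
  have hxn : M.elem t ∈ 𝓝 x := mem_interior_iff_mem_nhds.1 hx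
  have := Module.punctured_nhds_neBot ℝ (E d) x
  exact Metric.diam_pos (infinite_of_mem_nhds x hxn).nontrivial hb

/-- The traces of `v_0` and `∇ v_0` are `v_b` and `v_g`. -/
def Compatible (v : WeakFun M) : Prop :=
  ∀ t, ∀ e ∈ M.facesOf t, ∀ x ∈ M.face e, ev (v.1 t) x = v.2.1 e x ∧
    ∀ i, ev (MvPolynomial.pderiv i (v.1 t)) x = v.2.2 e i x

/-- The integrand of the stabilizer. -/
def stabDensity (p r : ℝ) (v : WeakFun M) (t : Fin M.numElems) (e : Fin M.numFaces) (x : E d) : ℝ :=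
  M.diam t ^ (1 - 2 * p) * |ev (v.1 t) x - v.2.1 e x| ^ p
    + M.diam t ^ (1 - p) *
      (∑ i, |ev (MvPolynomial.pderiv i (v.1 t)) x - v.2.2 e i x| ^ r) ^ (p / r)

theorem stabilizer_eq (p r : ℝ) (v : WeakFun M) : M.stabilizer p r v
    = (1 / p) * ∑ t, ∑ e ∈ M.facesOf t, ∫ x in M.face e, M.stabDensity p r v t e x ∂(surf d) :=
  rfl

theorem exists_continuous_eq_of_mem_Vh {k : ℕ} {v : WeakFun M} (hv : v ∈ M.Vh k)
    (e : Fin M.numFaces) : ∃ (b : E d → ℝ) (g : Fin d → E d → ℝ), Continuous b ∧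
      (∀ i, Continuous (g i)) ∧ (∀ x ∈ M.face e, v.2.1 e x = b x) ∧
      ∀ x ∈ M.face e, ∀ i, v.2.2 e i x = g i x := by
  obtain ⟨B, -, hB⟩ := exists_ev_eq_of_mem_polyOn (hv.2.1 e)
  choose g hg hg' using fun i => exists_ev_eq_of_mem_polyOn (hv.2.2 e i)
  refine ⟨ev B, fun i => ev (g i), continuous_ev _, fun i => continuous_ev _, fun x hx => ?_,
    fun x hx i => ?_⟩
  · rw [hB, Set.indicator_of_mem hx]
  · rw [hg', Set.indicator_of_mem hx]

theorem exists_continuous_stabDensity {k : ℕ} {v : WeakFun M} (hv : v ∈ M.Vh k) {p r : ℝ}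
    (hp : 0 < p) (hr : 0 < r) (t : Fin M.numElems) (e : Fin M.numFaces) :
    ∃ D : E d → ℝ, Continuous D ∧ ∀ x ∈ M.face e, M.stabDensity p r v t e x = D x := by
  obtain ⟨b, g, hb, hg, hb', hg'⟩ := M.exists_continuous_eq_of_mem_Vh hv e
  refine ⟨fun x => M.diam t ^ (1 - 2 * p) * |ev (v.1 t) x - b x| ^ p + M.diam t ^ (1 - p) *
      (∑ i, |ev (MvPolynomial.pderiv i (v.1 t)) x - g i x| ^ r) ^ (p / r), ?_, fun x hx => ?_⟩
  · have h1 : Continuous fun x => |ev (v.1 t) x - b x| ^ p :=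
      (((continuous_ev _).sub hb).abs).rpow_const fun _ => Or.inr hp.le
    have h2 : Continuous fun x =>
        (∑ i, |ev (MvPolynomial.pderiv i (v.1 t)) x - g i x| ^ r) ^ (p / r) :=
      (continuous_finsetSum _ fun i _ =>
        (((continuous_ev _).sub (hg i)).abs).rpow_const fun _ => Or.inr hr.le).rpow_const
        fun _ => Or.inr (div_pos hp hr).le
    exact (h1.const_mul _).add (h2.const_mul _)
  · simp only [stabDensity, hb' x hx, hg' x hx]

theorem integrableOn_stabDensity {k : ℕ} {v : WeakFun M} (hv : v ∈ M.Vh k) {p r : ℝ}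
    (hp : 0 < p) (hr : 0 < r) (t : Fin M.numElems) (e : Fin M.numFaces) :
    IntegrableOn (M.stabDensity p r v t e) (M.face e) (surf d) := by
  obtain ⟨D, hD, h⟩ := M.exists_continuous_stabDensity hv hp hr t e
  exact (M.integrableOn_face hD e).congr_fun (fun x hx => (h x hx).symm)
    (M.isCompact_face e).measurableSet

theorem eq_zero_of_integral_elem_sq {t : Fin M.numElems} {P : MvPolynomial (Fin d) ℝ}
    (h : ∫ x in M.elem t, ev P x * ev P x = 0) : P = 0 := by
  have hc : Continuous fun x => ev P x * ev P x := by fun_prop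
  have h1 := (setIntegral_eq_zero_iff_of_nonneg_ae
    (Eventually.of_forall fun x => mul_self_nonneg (ev P x)) (M.integrableOn_elem hc t)).1 h
  refine eq_zero_of_ev_eq_zero isOpen_interior (M.nonempty_interior_elem t) fun x hx => ?_
  by_contra hne
  have hU : IsOpen ({y | ev P y * ev P y ≠ 0} ∩ interior (M.elem t)) :=
    (isOpen_ne_fun hc continuous_const).inter isOpen_interior
  have hpos := hU.measure_pos volume ⟨x, mul_self_ne_zero.2 hne, hx⟩
  have h2 : volume.restrict (M.elem t) {y | ev P y * ev P y ≠ 0} = 0 := h1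
  rw [Measure.restrict_apply (isOpen_ne_fun hc continuous_const).measurableSet] at h2
  exact hpos.ne' (measure_mono_null (Set.inter_subset_inter_right _ interior_subset) h2)

/-- The weak Hessian is unique. -/
theorem IsWeakHessian.unique {l : ℕ} {v : WeakFun M}
    {H H' : Fin M.numElems → Fin d → Fin d → MvPolynomial (Fin d) ℝ}
    (h : M.IsWeakHessian l v H) (h' : M.IsWeakHessian l v H') : H = H' := by
  funext t i j
  have hmem : H t i j - H' t i j ∈ Poly d l := Submodule.sub_mem _ (h t i j).1 (h' t i j).1
  have h1 := (h t i j).2 _ hmem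
  rw [← (h' t i j).2 _ hmem] at h1
  refine sub_eq_zero.1 (M.eq_zero_of_integral_elem_sq (t := t) ?_)
  rw [← sub_eq_zero, ← integral_sub (M.integrableOn_elem (by fun_prop) t)
    (M.integrableOn_elem (by fun_prop) t)] at h1
  rw [← h1]
  refine integral_congr_ae (Eventually.of_forall fun x => ?_)
  simp only [ev_sub]
  ring

/-- For compatible functions the weak Hessian is the classical one. -/
theorem Compatible.isWeakHessian {k l : ℕ} (hkl : k ≤ l + 2) {v : WeakFun M} (hv : v ∈ M.Vh k)
    (hc : M.Compatible v) : M.IsWeakHessian l v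
      fun t i j => MvPolynomial.pderiv j (MvPolynomial.pderiv i (v.1 t)) := by
  intro t i j
  -- This is where `k ≤ l + 2` is used: the classical second derivatives belong to the space of weak
  -- ones. Two integrations by parts then match the two boundary terms.
  refine ⟨poly_mono (by omega) (pderiv_mem_poly (pderiv_mem_poly (hv.1 t) i) j), fun ψ _ => ?_⟩
  have h1 := M.integral_elem_pderiv t i (v.1 t * MvPolynomial.pderiv j ψ)
  have h2 := M.integral_elem_pderiv t j (MvPolynomial.pderiv i (v.1 t) * ψ)
  have e1 : ∑ e ∈ M.facesOf t, ∫ x in M.face e,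
      v.2.1 e x * M.normal t e i * ev (MvPolynomial.pderiv j ψ) x ∂(surf d)
      = ∑ e ∈ M.facesOf t, M.normal t e i * ∫ x in M.face e,
        ev (v.1 t * MvPolynomial.pderiv j ψ) x ∂(surf d) := by
    refine Finset.sum_congr rfl fun e he => ?_
    rw [← integral_const_mul]
    refine setIntegral_congr_fun (M.isCompact_face e).measurableSet fun x hx => ?_
    simp only [← (hc t e he x hx).1, ev_mul]
    ring
  have e2 : ∑ e ∈ M.facesOf t, ∫ x in M.face e,
      v.2.2 e i x * (ev ψ x * M.normal t e j) ∂(surf d)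
      = ∑ e ∈ M.facesOf t, M.normal t e j * ∫ x in M.face e,
        ev (MvPolynomial.pderiv i (v.1 t) * ψ) x ∂(surf d) := by
    refine Finset.sum_congr rfl fun e he => ?_
    rw [← integral_const_mul]
    refine setIntegral_congr_fun (M.isCompact_face e).measurableSet fun x hx => ?_
    simp only [← (hc t e he x hx).2 i, ev_mul]
    ring
  rw [e1, e2, ← h1, ← h2]
  simp only [Derivation.leibniz, smul_eq_mul, ev_add, ev_mul]
  rw [integral_add (M.integrableOn_elem (by fun_prop) t) (M.integrableOn_elem (by fun_prop) t),
    integral_add (M.integrableOn_elem (by fun_prop) t) (M.integrableOn_elem (by fun_prop) t),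
    pderiv_comm j i ψ]
  simp only [mul_comm (ev (MvPolynomial.pderiv j ψ) _) (ev (MvPolynomial.pderiv i (v.1 t)) _),
    mul_comm (ev ψ _) (ev (MvPolynomial.pderiv j (MvPolynomial.pderiv i (v.1 t))) _)]
  ring

theorem ev_jump (P : Fin M.numElems → MvPolynomial (Fin d) ℝ) (i : Fin d) (e : Fin M.numFaces)
    (x : E d) : ev (M.jump P i e) x = ∑ t ∈ M.elemsOf e, M.normal t e i * ev (P t) x := by
  simp [jump]

theorem mem_elemsOf {t : Fin M.numElems} {e : Fin M.numFaces} :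
    t ∈ M.elemsOf e ↔ e ∈ M.facesOf t := by
  simp [elemsOf]

/-- A piecewise polynomial function that is single valued on a face which is not on the boundary
has no jump there. -/
theorem ev_jump_eq_zero (hΩ : IsPolytopalDomain Ω) {P : Fin M.numElems → MvPolynomial (Fin d) ℝ}
    {e : Fin M.numFaces} {x : E d} {b : ℝ} (h : ∀ t, e ∈ M.facesOf t → ev (P t) x = b)
    (hb : M.face e ⊆ frontier Ω → b = 0) (i : Fin d) : ev (M.jump P i e) x = 0 := by
  rw [ev_jump, Finset.sum_congr rfl fun t ht => by rw [h t (M.mem_elemsOf.1 ht)],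
    ← Finset.sum_mul]
  by_cases he : M.face e ⊆ frontier Ω
  · rw [hb he, mul_zero]
  · rw [M.sum_normal_eq_zero hΩ he, zero_mul]

/-- Faces on the boundary may be ignored, because test functions in `Ω` vanish there. -/
theorem hasWeakPartial_pw_of_jump (hΩ : IsPolytopalDomain Ω)
    {P : Fin M.numElems → MvPolynomial (Fin d) ℝ} {i : Fin d}
    (h : ∀ e, ¬ M.face e ⊆ frontier Ω → ∀ x ∈ M.face e, ev (M.jump P i e) x = 0) :
    HasWeakPartial Ω i (M.pw P) (M.pw fun t => MvPolynomial.pderiv i (P t)) := fun φ hφ => by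
  rw [M.integral_pw_partialD hΩ P i (hφ.mono (Set.subset_univ _)), add_eq_left]
  refine Finset.sum_eq_zero fun e _ => setIntegral_eq_zero_of_forall_eq_zero fun x hx => ?_
  by_cases he : M.face e ⊆ frontier Ω
  · rw [image_eq_zero_of_notMem_tsupport (f := φ) fun h' => ?_, mul_zero]
    have := (he hx).2
    rw [hΩ.isOpen.interior_eq] at this
    exact this (hφ.2.2 h')
  · rw [h e he x hx, zero_mul]

theorem memLp_pw (hΩ : IsPolytopalDomain Ω) (P : Fin M.numElems → MvPolynomial (Fin d) ℝ)
    (q : ℝ≥0∞) : MemLp (M.pw P) q (vol Ω) := by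
  obtain ⟨C, -, hC⟩ := M.exists_pw_bound P
  have hfin : IsFiniteMeasure (vol Ω) := ⟨by
    rw [Measure.restrict_apply_univ]; exact hΩ.volume_lt_top⟩
  exact MemLp.of_bound (M.measurable_pw P).aestronglyMeasurable C (Eventually.of_forall hC)

/-- The piecewise polynomial of a compatible weak function is in `W^{2,p} ∩ W_0^{1,p}`. -/
theorem Compatible.isW2p (hΩ : IsPolytopalDomain Ω) {k : ℕ} {v : WeakFun M} (hv : v ∈ M.Vh0 k)
    (hc : M.Compatible v) {p : ℝ} (hp : 0 < p) :
    IsW2p Ω p (M.pw v.1) (fun i => M.pw fun t => MvPolynomial.pderiv i (v.1 t))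
      (fun i j => M.pw fun t => MvPolynomial.pderiv j (MvPolynomial.pderiv i (v.1 t))) ∧
    IsW01p Ω p (M.pw v.1) (fun i => M.pw fun t => MvPolynomial.pderiv i (v.1 t)) := by
  -- The trace `v_b` is single-valued and zero on the boundary, so the function has no jumps on any
  -- face. The gradient traces are only known to agree across interior faces, which is enough for
  -- the Hessian.
  have hj : ∀ i e, ∀ x ∈ M.face e, ev (M.jump v.1 i e) x = 0 := fun i e x hx =>
    M.ev_jump_eq_zero hΩ (b := v.2.1 e x) (fun t ht => (hc t e ht x hx).1)
      (fun he => by rw [hv.2 e he]; rfl) i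
  refine ⟨⟨M.memLp_pw hΩ _ _, fun i => M.memLp_pw hΩ _ _, fun i j => M.memLp_pw hΩ _ _,
    fun i => M.hasWeakPartial_pw_of_jump hΩ fun e _ => hj i e, fun i j =>
      M.hasWeakPartial_pw_of_jump hΩ fun e he x hx =>
        M.ev_jump_eq_zero hΩ (b := v.2.2 e i x) (fun t ht => (hc t e ht x hx).2 i)
        (fun he' => absurd he' he) j⟩, ?_⟩
  obtain ⟨C₀, hC₀, hC₀'⟩ := M.exists_pw_bound v.1
  choose C₁ hC₁ hC₁' using fun i : Fin d =>
    M.exists_pw_bound fun t => MvPolynomial.pderiv i (v.1 t)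
  refine isW01p_of_vanishing hΩ hp (C := C₀ + ∑ i, C₁ i) (M.measurable_pw _)
    (fun i => M.measurable_pw _) (fun x => ?_) (fun i x => ?_)
    (fun x hx => M.pw_eq_zero_of_notMem hΩ _ hx) (fun i x hx => M.pw_eq_zero_of_notMem hΩ _ hx)
    (fun i φ hφ => ?_)
  · exact (hC₀' x).trans (le_add_of_nonneg_right (Finset.sum_nonneg fun i _ => hC₁ i))
  · exact (hC₁' i x).trans ((Finset.single_le_sum (fun i _ => hC₁ i) (Finset.mem_univ i)).trans
      (le_add_of_nonneg_left hC₀))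
  -- As the jumps also vanish on the boundary faces, the extension by zero has a weak gradient on
  -- the whole space, which is what `isW01p_of_vanishing` asks for.
  · have h := M.integral_pw_partialD hΩ v.1 i hφ
    rw [Finset.sum_eq_zero fun e _ => setIntegral_eq_zero_of_forall_eq_zero fun x hx => by
      rw [hj i e x hx, zero_mul], add_zero] at h
    rw [Measure.restrict_univ, ← M.setIntegral_pw_mul hΩ, ← M.setIntegral_pw_mul hΩ]
    exact h

/-- A compatible weak function is determined by its element part. -/
theorem Compatible.eq_zero {k : ℕ} {v : WeakFun M} (hv : v ∈ M.Vh k) (hc : M.Compatible v)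
    (h : v.1 = 0) : v = 0 := by
  refine Prod.ext h (Prod.ext ?_ ?_)
  · funext e x
    obtain ⟨B, -, hB⟩ := exists_ev_eq_of_mem_polyOn (hv.2.1 e)
    by_cases hx : x ∈ M.face e
    · rw [← (hc (M.adj e) e (M.mem_facesOf_adj e) x hx).1, h]; simp
    · rw [hB, Set.indicator_of_notMem hx]; rfl
  · funext e i x
    obtain ⟨B, -, hB⟩ := exists_ev_eq_of_mem_polyOn (hv.2.2 e i)
    by_cases hx : x ∈ M.face e
    · rw [← (hc (M.adj e) e (M.mem_facesOf_adj e) x hx).2 i, h]; simp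
    · rw [hB, Set.indicator_of_notMem hx]; rfl

end

end Mesh

/-! ### Inverse estimates and the `L²` projection -/

section

variable {d : ℕ}

/-- The affine polynomials that are the components of an affine map. -/
def affPoly (A : E d →ᵃ[ℝ] E d) (i : Fin d) : MvPolynomial (Fin d) ℝ :=
  MvPolynomial.C (A 0 i)
    + ∑ j, MvPolynomial.C (A.linear (EuclideanSpace.single j 1) i) * MvPolynomial.X j

theorem ev_affPoly (A : E d →ᵃ[ℝ] E d) (i : Fin d) (x : E d) : ev (affPoly A i) x = A x i := by
  have hx : x = ∑ j, x j • EuclideanSpace.single j (1 : ℝ) := by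
    simpa using ((EuclideanSpace.basisFun (Fin d) ℝ).sum_repr x).symm
  have h1 : A x = A.linear x + A 0 := by
    have := A.map_vadd 0 x
    simpa using this
  rw [h1]
  conv_rhs => rw [hx]
  simp [affPoly, ev, map_sum, mul_comm, add_comm]

theorem totalDegree_affPoly_le (A : E d →ᵃ[ℝ] E d) (i : Fin d) :
    (affPoly A i).totalDegree ≤ 1 := by
  refine (MvPolynomial.totalDegree_add _ _).trans (max_le (by simp) ?_)
  refine MvPolynomial.totalDegree_finsetSum_le fun j _ => ?_
  refine (MvPolynomial.totalDegree_mul _ _).trans ?_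
  simp [MvPolynomial.totalDegree_X]

/-- Composition of a polynomial with an affine map. -/
theorem exists_ev_comp_affine {m : ℕ} (A : E d →ᵃ[ℝ] E d) {P : MvPolynomial (Fin d) ℝ}
    (hP : P ∈ Poly d m) : ∃ Q ∈ Poly d m, ∀ x, ev Q x = ev P (A x) := by
  refine ⟨MvPolynomial.aeval (affPoly A) P, ?_, fun x => ?_⟩
  · rw [MvPolynomial.mem_restrictTotalDegree] at hP ⊢
    rw [MvPolynomial.aeval_def, MvPolynomial.eval₂_eq']
    refine MvPolynomial.totalDegree_finsetSum_le fun n hn => ?_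
    refine (MvPolynomial.totalDegree_mul _ _).trans ?_
    rw [MvPolynomial.algebraMap_eq, MvPolynomial.totalDegree_C, zero_add]
    refine (MvPolynomial.totalDegree_finsetProd _ _).trans ?_
    calc ∑ i, (affPoly A i ^ n i).totalDegree ≤ ∑ i, n i := Finset.sum_le_sum fun i _ => by
          refine (MvPolynomial.totalDegree_pow _ _).trans ?_
          exact (Nat.mul_le_mul_left _ (totalDegree_affPoly_le A i)).trans (by simp)
      _ ≤ m := by
          refine le_trans (le_of_eq ?_) ((MvPolynomial.le_totalDegree hn).trans hP)
          rw [Finsupp.sum_fintype _ _ fun _ => rfl]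
  · have h1 : ev (MvPolynomial.aeval (affPoly A) P) x
        = MvPolynomial.eval (fun i => ev (affPoly A i) x) P := by
      simp only [ev]
      rw [MvPolynomial.map_aeval]
      have : (MvPolynomial.eval fun i => x i).comp (algebraMap ℝ (MvPolynomial (Fin d) ℝ))
          = RingHom.id ℝ := by
        ext c; simp [MvPolynomial.algebraMap_eq]
      rw [this]
      rfl
    rw [h1]
    simp only [ev_affPoly]
    rfl

/-- Compactness in finite dimension: the integral is continuous and positive on the unit sphere of
coefficient vectors, and both sides are homogeneous of degree `s`. No norm property is needed, so
any `s > 0` is allowed. -/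
theorem exists_ball_inverse_estimate (d m : ℕ) {ρ s : ℝ} (hρ : 0 < ρ) (hs : 0 < s) :
    ∃ c > 0, ∀ P ∈ Poly d m, ∀ z ∈ Metric.closedBall (0 : E d) 1,
      c * |ev P z| ^ s ≤ ∫ x in Metric.closedBall (0 : E d) ρ, |ev P x| ^ s := by
  let b := Module.finBasis ℝ (Poly d m)
  let n := Module.finrank ℝ (Poly d m)
  let Φ : (Fin n → ℝ) → ℝ := fun x =>
    ∫ y in Metric.closedBall (0 : E d) ρ, |∑ i, x i * ev (b i : MvPolynomial (Fin d) ℝ) y| ^ s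
  have hcont : Continuous (Function.uncurry fun (x : Fin n → ℝ) (y : E d) =>
      |∑ i, x i * ev (b i : MvPolynomial (Fin d) ℝ) y| ^ s) := by
    refine Continuous.rpow_const (Continuous.abs ?_) fun _ => Or.inr hs.le
    refine continuous_finsetSum _ fun i _ => ?_
    exact ((continuous_apply i).comp continuous_fst).mul ((continuous_ev _).comp continuous_snd)
  have hΦ : Continuous Φ :=
    continuous_parametric_integral_of_continuous hcont (isCompact_closedBall _ _)
  have hpos : ∀ x ∈ Metric.sphere (0 : Fin n → ℝ) 1, 0 < Φ x := fun x hx => by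
    refine lt_of_le_of_ne (integral_nonneg fun y => by positivity) fun h0 => ?_
    have hc : Continuous fun y : E d => |∑ i, x i * ev (b i : MvPolynomial (Fin d) ℝ) y| ^ s :=
      hcont.comp (Continuous.prodMk_right x)
    have h1 := (setIntegral_eq_zero_iff_of_nonneg_ae
      (Eventually.of_forall fun y => by positivity)
      (hc.continuousOn.integrableOn_compact (isCompact_closedBall _ _))).1 h0.symm
    have h2 : ∑ i, x i • (b i : MvPolynomial (Fin d) ℝ) = 0 := by
      refine eq_zero_of_ev_eq_zero (U := Metric.ball (0 : E d) ρ) Metric.isOpen_ball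
        ⟨0, Metric.mem_ball_self hρ⟩ fun z hz => ?_
      by_contra hne
      have hU : IsOpen ({y : E d | |∑ i, x i * ev (b i : MvPolynomial (Fin d) ℝ) y| ^ s ≠ 0}) :=
        isOpen_ne_fun hc continuous_const
      have hz' : |∑ i, x i * ev (b i : MvPolynomial (Fin d) ℝ) z| ^ s ≠ 0 := by
        rw [ev_sum] at hne
        simp only [ev_smul] at hne
        exact (Real.rpow_pos_of_pos (abs_pos.2 hne) s).ne'
      have hp := (hU.inter Metric.isOpen_ball).measure_pos volume ⟨z, hz', hz⟩
      have h3 : volume.restrict (Metric.closedBall (0 : E d) ρ)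
        {y : E d | |∑ i, x i * ev (b i : MvPolynomial (Fin d) ℝ) y| ^ s ≠ 0} = 0 := h1
      rw [Measure.restrict_apply hU.measurableSet] at h3
      exact hp.ne' (measure_mono_null
        (Set.inter_subset_inter_right _ Metric.ball_subset_closedBall) h3)
    have h4 : ∑ i, x i • b i = 0 := by
      apply Subtype.ext
      simpa using h2
    have h5 : x = 0 := funext fun i =>
      Fintype.linearIndependent_iff.1 b.linearIndependent x h4 i
    rw [h5, mem_sphere_zero_iff_norm, norm_zero] at hx
    exact zero_ne_one hx
  obtain ⟨δ, hδ, hδΦ⟩ := (isCompact_sphere (0 : Fin n → ℝ) 1).exists_forall_le'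
    hΦ.continuousOn hpos
  choose B hB using fun i : Fin n => (isCompact_closedBall (0 : E d) 1).exists_bound_of_continuousOn
    (continuous_ev (b i : MvPolynomial (Fin d) ℝ)).continuousOn
  have hB0 : ∀ i, 0 ≤ B i := fun i => (norm_nonneg _).trans (hB i 0 (by simp))
  set K : ℝ := ∑ i, B i + 1 with hK
  have hKpos : 0 < K := by
    have := Finset.sum_nonneg fun i (_ : i ∈ Finset.univ) => hB0 i
    linarith
  refine ⟨δ / K ^ s, by positivity, fun P hP z hz => ?_⟩
  set x : Fin n → ℝ := ⇑(b.repr ⟨P, hP⟩) with hx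
  have hPx : ∀ y, ev P y = ∑ i, x i * ev (b i : MvPolynomial (Fin d) ℝ) y := fun y => by
    have h1 : P = ∑ i, x i • (b i : MvPolynomial (Fin d) ℝ) := by
      have := congrArg (Poly d m).subtype (b.sum_repr ⟨P, hP⟩)
      rw [map_sum] at this
      exact this.symm
    conv_lhs => rw [h1]
    simp
  have hsup : |ev P z| ≤ K * ‖x‖ := by
    rw [hPx]
    calc |∑ i, x i * ev (b i : MvPolynomial (Fin d) ℝ) z| ≤ ∑ i, ‖x‖ * B i := by
          refine (Finset.abs_sum_le_sum_abs _ _).trans (Finset.sum_le_sum fun i _ => ?_)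
          rw [abs_mul]
          exact mul_le_mul (norm_le_pi_norm x i) (hB i z hz) (abs_nonneg _) (norm_nonneg _)
      _ = (∑ i, B i) * ‖x‖ := by rw [← Finset.mul_sum, mul_comm]
      _ ≤ K * ‖x‖ := mul_le_mul_of_nonneg_right (by linarith) (norm_nonneg _)
  have hlow : δ * ‖x‖ ^ s ≤ ∫ y in Metric.closedBall (0 : E d) ρ, |ev P y| ^ s := by
    by_cases hx0 : x = 0
    · rw [hx0, norm_zero, Real.zero_rpow hs.ne', mul_zero]
      exact integral_nonneg fun y => by positivity
    · have hn : 0 < ‖x‖ := norm_pos_iff.2 hx0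
      have h1 := hδΦ (‖x‖⁻¹ • x) (by
        rw [mem_sphere_zero_iff_norm, norm_smul, norm_inv, norm_norm, inv_mul_cancel₀ hn.ne'])
      have h2 : Φ (‖x‖⁻¹ • x) = (‖x‖ ^ s)⁻¹
          * ∫ y in Metric.closedBall (0 : E d) ρ, |ev P y| ^ s := by
        rw [← integral_const_mul]
        refine integral_congr_ae (Eventually.of_forall fun y => ?_)
        simp only [Pi.smul_apply, smul_eq_mul, mul_assoc]
        rw [← Finset.mul_sum, ← hPx, abs_mul, abs_of_pos (inv_pos.2 hn),
          Real.mul_rpow (by positivity) (abs_nonneg _), Real.inv_rpow hn.le]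
      rw [h2, inv_mul_eq_div, le_div_iff₀ (by positivity)] at h1
      exact h1
  calc δ / K ^ s * |ev P z| ^ s ≤ δ / K ^ s * (K * ‖x‖) ^ s := by gcongr
    _ = δ * ‖x‖ ^ s := by
        rw [Real.mul_rpow hKpos.le (norm_nonneg _)]
        have : K ^ s ≠ 0 := by positivity
        field_simp
    _ ≤ _ := hlow

/-- The change of variables formula for an affine map. -/
theorem exists_integral_image_affine (A : E d ≃ᵃ[ℝ] E d) : ∃ D : ℝ, 0 ≤ D ∧
    ∀ (T : Set (E d)), MeasurableSet T → ∀ g : E d → ℝ,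
      ∫ x in T, g x = D * ∫ y in A '' T, g (A.symm y) := by
  let L : E d →L[ℝ] E d := LinearMap.toContinuousLinearMap (A.symm : E d →ᵃ[ℝ] E d).linear
  have hL : ∀ y, A.symm y = L y + A.symm 0 := fun y => by
    have := (A.symm : E d →ᵃ[ℝ] E d).map_vadd 0 y
    simpa [L] using this
  have hder : ∀ y, HasFDerivAt (fun y => A.symm y) L y := fun y => by
    exact (L.hasFDerivAt.add_const (A.symm 0)).congr_of_eventuallyEq (Eventually.of_forall hL)
  have hAcont : Continuous A.symm := continuous_iff_continuousAt.2 fun y => (hder y).continuousAt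
  refine ⟨|L.det|, abs_nonneg _, fun T hT g => ?_⟩
  have hT' : MeasurableSet (A '' T) := by
    have : A '' T = A.symm ⁻¹' T := A.toEquiv.image_eq_preimage_symm T
    rw [this]
    exact hAcont.measurable hT
  have h := integral_image_eq_integral_abs_det_fderiv_smul volume hT'
    (fun y _ => (hder y).hasFDerivWithinAt) A.symm.injective.injOn g
  have h2 : (fun y => A.symm y) '' (A '' T) = T := by
    rw [← Set.image_comp]; simp
  rw [h2] at h
  rw [h, ← integral_const_mul]
  rfl

end

namespace Mesh

/-- The inverse estimate on shape regular elements. -/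
theorem exists_inverse_estimate (d m : ℕ) {ρ s : ℝ} (hρ : 0 < ρ) (hs : 0 < s) :
    ∃ C : ℝ, 0 < C ∧ ∀ {Ω : Set (E d)} (M : Mesh Ω), M.ShapeRegular ρ → ∀ t, ∀ P ∈ Poly d m,
      ∀ x ∈ M.elem t, volume.real (M.elem t) * |ev P x| ^ s
        ≤ C * ∫ y in M.elem t, |ev P y| ^ s := by
  -- The closed ball of half the radius lies in the open ball contained in the image of the element.
  -- The Jacobian of the affine map appears on both sides, so the constant depends only on `d`, `m`,
  -- `ρ` and `s`; this permits arbitrarily flat elements.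
  obtain ⟨c, hc, h⟩ := exists_ball_inverse_estimate d m (half_pos hρ) hs
  set V : ℝ := volume.real (Metric.closedBall (0 : E d) 1) with hV
  refine ⟨(V + 1) / c, by positivity, fun {Ω} M hM t P hP x hx => ?_⟩
  obtain ⟨A, hin, hout⟩ := hM t
  obtain ⟨D, hD, hcv⟩ := exists_integral_image_affine A
  have hTm := (M.isClosed_elem t).measurableSet
  obtain ⟨Q, hQ, hQP⟩ := exists_ev_comp_affine (A.symm : E d →ᵃ[ℝ] E d) hP
  have hQP' : ∀ y, ev Q y = ev P (A.symm y) := hQP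
  have hQc : Continuous fun y => |ev Q y| ^ s :=
    (continuous_ev Q).abs.rpow_const fun _ => Or.inr hs.le
  have hvol : volume.real (M.elem t) ≤ D * V := by
    have h1 := hcv (M.elem t) hTm fun _ => 1
    simp only [integral_const, smul_eq_mul, mul_one, measureReal_restrict_apply_univ] at h1
    rw [h1]
    exact mul_le_mul_of_nonneg_left (measureReal_mono hout measure_closedBall_lt_top.ne) hD
  have h_int : D * (c * |ev P x| ^ s) ≤ ∫ y in M.elem t, |ev P y| ^ s := by
    rw [hcv (M.elem t) hTm]
    refine mul_le_mul_of_nonneg_left ?_ hD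
    have h1 := h Q hQ (A x) (hout ⟨x, hx, rfl⟩)
    rw [hQP', A.symm_apply_apply] at h1
    refine h1.trans ?_
    simp only [← hQP']
    refine setIntegral_mono_set (hQc.continuousOn.integrableOn_compact
      (isCompact_closedBall (0 : E d) 1) |>.mono_set hout)
      (Eventually.of_forall fun y => by positivity) (LE.le.eventuallyLE ?_)
    exact (Metric.closedBall_subset_ball (by linarith)).trans hin
  have hDc : 0 ≤ D * (c * |ev P x| ^ s) := by positivity
  calc volume.real (M.elem t) * |ev P x| ^ s ≤ D * V * |ev P x| ^ s := by gcongr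
    _ ≤ D * (V + 1) * |ev P x| ^ s := by gcongr; linarith
    _ = (V + 1) / c * (D * (c * |ev P x| ^ s)) := by field_simp
    _ ≤ _ := mul_le_mul_of_nonneg_left h_int (by positivity)

section

variable {d : ℕ} {Ω : Set (E d)} (M : Mesh Ω)

theorem volume_elem_pos (t : Fin M.numElems) : 0 < volume.real (M.elem t) := by
  refine ENNReal.toReal_pos (ne_of_gt ?_) (M.isPolytope_elem t).isCompact.measure_lt_top.ne
  exact (isOpen_interior.measure_pos volume (M.nonempty_interior_elem t)).trans_le
    (measure_mono interior_subset)

theorem integrableOn_mul_ev {t : Fin M.numElems} {g : E d → ℝ} (hg : IntegrableOn g (M.elem t))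
    (Q : MvPolynomial (Fin d) ℝ) : IntegrableOn (fun x => g x * ev Q x) (M.elem t) := by
  obtain ⟨C, hC⟩ := (M.isPolytope_elem t).isCompact.exists_bound_of_continuousOn
    (continuous_ev Q).continuousOn
  refine Integrable.mul_bdd (c := C) hg (continuous_ev Q).aestronglyMeasurable ?_
  exact (ae_restrict_iff' (M.isClosed_elem t).measurableSet).2 (Eventually.of_forall hC)

/-- Linear functionals on polynomials are represented by the `L²` inner product. -/
theorem exists_riesz {l : ℕ} (t : Fin M.numElems) (Λ : Poly d l →ₗ[ℝ] ℝ) :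
    ∃ P ∈ Poly d l, ∀ ψ : Poly d l, ∫ x in M.elem t, ev P x * ev (ψ : MvPolynomial (Fin d) ℝ) x
      = Λ ψ := by
  have hi : ∀ P Q : MvPolynomial (Fin d) ℝ, IntegrableOn (fun x => ev P x * ev Q x) (M.elem t) :=
    fun P Q => M.integrableOn_elem (by fun_prop) t
  let B : Poly d l →ₗ[ℝ] Module.Dual ℝ (Poly d l) := LinearMap.mk₂ ℝ
    (fun P Q => ∫ x in M.elem t, ev (P : MvPolynomial (Fin d) ℝ) x * ev (Q : MvPolynomial (Fin d) ℝ) x)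
    (fun P P' Q => by
      simp only [Submodule.coe_add, ev_add, add_mul]; exact integral_add (hi _ _) (hi _ _))
    (fun c P Q => by
      simp only [Submodule.coe_smul, ev_smul, mul_assoc]; exact integral_const_mul _ _)
    (fun P Q Q' => by
      simp only [Submodule.coe_add, ev_add, mul_add]; exact integral_add (hi _ _) (hi _ _))
    (fun c P Q => by
      simp only [Submodule.coe_smul, ev_smul, mul_left_comm _ c]; exact integral_const_mul _ _)
  have hinj : Function.Injective B := by
    rw [injective_iff_map_eq_zero]
    intro P hP
    apply Subtype.ext
    exact M.eq_zero_of_integral_elem_sq (t := t) (LinearMap.congr_fun hP P)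
  obtain ⟨P, hP⟩ := (LinearMap.injective_iff_surjective_of_finrank_eq_finrank
    (Subspace.dual_finrank_eq).symm).1 hinj Λ
  exact ⟨P, P.2, fun ψ => LinearMap.congr_fun hP ψ⟩

/-- Existence of the `L²` projection onto polynomials. -/
theorem exists_projection (l : ℕ) (t : Fin M.numElems) {g : E d → ℝ}
    (hg : IntegrableOn g (M.elem t)) : ∃ P ∈ Poly d l, ∀ ψ ∈ Poly d l,
      ∫ x in M.elem t, ev P x * ev ψ x = ∫ x in M.elem t, g x * ev ψ x := by
  have hi := fun Q => M.integrableOn_mul_ev hg Q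
  let Λ : Poly d l →ₗ[ℝ] ℝ :=
    { toFun := fun ψ => ∫ x in M.elem t, g x * ev (ψ : MvPolynomial (Fin d) ℝ) x
      map_add' := fun ψ ψ' => by
        simp only [Submodule.coe_add, ev_add, mul_add]; exact integral_add (hi _) (hi _)
      map_smul' := fun c ψ => by
        simp only [Submodule.coe_smul, ev_smul, mul_left_comm _ c]; exact integral_const_mul _ _ }
  obtain ⟨P, hP, h⟩ := M.exists_riesz t Λ
  exact ⟨P, hP, fun ψ hψ => h ⟨ψ, hψ⟩⟩

/-- The `L²` projection is bounded for the supremum norm. -/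
theorem abs_projection_le {C : ℝ} {l : ℕ} {t : Fin M.numElems}
    (hC : ∀ P ∈ Poly d l, ∀ x ∈ M.elem t, volume.real (M.elem t) * |ev P x| ^ (2 : ℝ)
        ≤ C * ∫ y in M.elem t, |ev P y| ^ (2 : ℝ))
    {g : E d → ℝ} {B : ℝ} (hB : ∀ x ∈ interior (M.elem t), |g x| ≤ B)
    {P : MvPolynomial (Fin d) ℝ} (hP : P ∈ Poly d l)
    (h : ∫ x in M.elem t, ev P x * ev P x = ∫ x in M.elem t, g x * ev P x) :
    ∀ x ∈ M.elem t, |ev P x| ≤ C * B := by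
  have hcomp := (M.isPolytope_elem t).isCompact
  have hVpos := M.volume_elem_pos t
  have hne : (M.elem t).Nonempty := (M.nonempty_interior_elem t).mono interior_subset
  obtain ⟨z, hz, hzmax⟩ := hcomp.exists_isMaxOn hne (continuous_ev P).abs.continuousOn
  have hzmax' : ∀ x ∈ M.elem t, |ev P x| ≤ |ev P z| := fun x hx => hzmax hx
  obtain ⟨y₀, hy₀⟩ := M.nonempty_interior_elem t
  have hB0 : 0 ≤ B := (abs_nonneg _).trans (hB y₀ hy₀)
  -- Testing with `P` itself bounds its squared `L²` norm by the volume times `B` times the maximum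
  -- of `|P|`. The inverse estimate bounds the squared maximum by the squared `L²` norm over the
  -- volume, and one factor cancels.
  have h1 : ∫ y in M.elem t, |ev P y| ^ (2 : ℝ) ≤ volume.real (M.elem t) * (B * |ev P z|) := by
    have e1 : ∫ y in M.elem t, |ev P y| ^ (2 : ℝ) = ∫ x in M.elem t, g x * ev P x := by
      rw [← h]
      refine integral_congr_ae (Eventually.of_forall fun y => ?_)
      simp only [Real.rpow_two, sq_abs]
      ring
    rw [e1]
    calc _ ≤ ‖∫ x in M.elem t, g x * ev P x‖ := Real.le_norm_self _
      _ ≤ (B * |ev P z|) * volume.real (M.elem t) := by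
          refine norm_setIntegral_le_of_norm_le_const_ae hcomp.measure_lt_top ?_
          rw [Measure.restrict_congr_set (M.elem_ae_eq_interior t)]
          refine (ae_restrict_iff' isOpen_interior.measurableSet).2 (Eventually.of_forall
            fun x hx => ?_)
          rw [norm_mul]
          exact mul_le_mul (hB x hx) (hzmax' x (interior_subset hx)) (abs_nonneg _) hB0
      _ = _ := mul_comm _ _
  have hC0 : 0 ≤ C := by
    have h2 := hC 1 (by simp [MvPolynomial.mem_restrictTotalDegree]) z hz
    simp only [ev_one, abs_one, Real.one_rpow, mul_one, integral_const, smul_eq_mul,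
      measureReal_restrict_apply_univ] at h2
    nlinarith
  have h2 := (hC P hP z hz).trans (mul_le_mul_of_nonneg_left h1 hC0)
  have h3 : |ev P z| * |ev P z| ≤ C * B * |ev P z| := by
    rw [Real.rpow_two, sq] at h2
    have : volume.real (M.elem t) * (|ev P z| * |ev P z|)
        ≤ volume.real (M.elem t) * (C * B * |ev P z|) := by linarith
    exact le_of_mul_le_mul_left this hVpos
  have h4 : |ev P z| ≤ C * B := by
    rcases (abs_nonneg (ev P z)).eq_or_lt with h0 | h0
    · rw [← h0]; positivity
    · exact le_of_mul_le_mul_right h3 h0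
  exact fun x hx => (hzmax' x hx).trans h4

end

end Mesh

/-! ### Oscillation of the coefficients -/

theorem volume_le_of_dist_le {S : Set ℝ} {ε : ℝ} (h : ∀ x ∈ S, ∀ y ∈ S, |x - y| ≤ ε) :
    volume (closure S) ≤ ENNReal.ofReal ε := by
  refine (Real.volume_le_diam _).trans ?_
  rw [Metric.ediam_closure]
  refine Metric.ediam_le fun x hx y hy => ?_
  rw [edist_dist]
  exact ENNReal.ofReal_le_ofReal (h x hx y hy)

namespace Mesh

variable {d : ℕ} {Ω : Set (E d)}

theorem diam_le_meshSize (M : Mesh Ω) (t : Fin M.numElems) : M.diam t ≤ M.meshSize :=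
  le_ciSup (Set.finite_range _).bddAbove t

/-- A function that is uniformly continuous on the elements of one partition has a small
oscillation on the elements of all fine partitions on whose elements it is continuous. -/
theorem oscillation_le (hΩ : IsPolytopalDomain Ω) (M₁ : Mesh Ω) {b : E d → ℝ} {ε δ : ℝ}
    (hε : 0 ≤ ε)
    (h₁ : ∀ t, ∀ x ∈ interior (M₁.elem t), ∀ y ∈ interior (M₁.elem t), dist x y < δ →
      |b x - b y| ≤ ε)
    (M : Mesh Ω) (hM : M.meshSize < δ) (t : Fin M.numElems)
    (hb : ContinuousOn b (interior (M.elem t))) {x y : E d} (hx : x ∈ interior (M.elem t))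
    (hy : y ∈ interior (M.elem t)) : |b x - b y| ≤ M₁.numElems * ε := by
  set T := interior (M.elem t) with hT
  have hbd : Bornology.IsBounded (M.elem t) := (M.isPolytope_elem t).isCompact.isBounded
  have hdist : ∀ z ∈ T, ∀ w ∈ T, dist z w < δ := fun z hz w hw =>
    ((Metric.dist_le_diam_of_mem hbd (interior_subset hz) (interior_subset hw)).trans
      (M.diam_le_meshSize t)).trans_lt hM
  -- The reference partition cuts `T` into pieces on which `b` varies by at most `ε`. The pieces
  -- exhaust `T` up to a null set, so by continuity on `T` the closures of their images cover `b ''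
  -- T`.
  let J : Fin M₁.numElems → Set ℝ := fun s => b '' (T ∩ interior (M₁.elem s))
  have hJ : ∀ s, volume (closure (J s)) ≤ ENNReal.ofReal ε := fun s => by
    refine volume_le_of_dist_le ?_
    rintro _ ⟨z, hz, rfl⟩ _ ⟨w, hw, rfl⟩
    exact h₁ s z hz.2 w hw.2 (hdist z hz.1 w hw.1)
  have hcov : b '' T ⊆ ⋃ s, closure (J s) := by
    rintro _ ⟨z, hz, rfl⟩
    have hzcl : z ∈ closure (T ∩ ⋃ s, interior (M₁.elem s)) := by
      rw [mem_closure_iff]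
      intro U hU hzU
      by_contra hemp
      have hpos := (hU.inter isOpen_interior).measure_pos volume ⟨z, hzU, hz⟩
      refine hpos.ne' (measure_mono_null (fun w hw => ?_) (ae_iff.1 M₁.ae_mem_interior))
      intro himp
      obtain ⟨s, hs⟩ := himp (M.interior_elem_subset hΩ t hw.2)
      exact hemp ⟨w, hw.1, hw.2, Set.mem_iUnion.2 ⟨s, hs⟩⟩
    have h1 : b z ∈ closure (b '' (T ∩ ⋃ s, interior (M₁.elem s))) := by
      have hcw : ContinuousWithinAt b (T ∩ ⋃ s, interior (M₁.elem s)) z :=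
        (hb z hz).mono Set.inter_subset_left
      exact hcw.mem_closure_image hzcl
    rw [Set.inter_iUnion, Set.image_iUnion, closure_iUnion_of_finite] at h1
    exact h1
  have hvol : volume (b '' T) ≤ ENNReal.ofReal (M₁.numElems * ε) := by
    calc volume (b '' T) ≤ ∑ s, volume (closure (J s)) :=
          (measure_mono hcov).trans (measure_iUnion_fintype_le _ _)
      _ ≤ ∑ _s : Fin M₁.numElems, ENNReal.ofReal ε := Finset.sum_le_sum fun s _ => hJ s
      _ = ENNReal.ofReal (M₁.numElems * ε) := by
          rw [Finset.sum_const, Finset.card_univ, Fintype.card_fin, nsmul_eq_mul,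
            ENNReal.ofReal_mul (by positivity), ENNReal.ofReal_natCast]
  -- Connectedness of the interior of the element makes `b '' T` an interval, so its length is at
  -- most the sum of the lengths of the pieces. How the pieces of `T` are arranged does not matter.
  have hconn : (b '' T).OrdConnected :=
    ((M.isConnected_elem t).isPreconnected.image b hb).ordConnected
  have hsub : Set.uIcc (b y) (b x) ⊆ b '' T := hconn.uIcc_subset ⟨y, hy, rfl⟩ ⟨x, hx, rfl⟩
  have h2 := (measure_mono hsub).trans hvol
  rw [Real.volume_interval, ENNReal.ofReal_le_ofReal_iff (by positivity)] at h2
  exact h2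

/-- Coefficients that are uniformly continuous on the elements have a small oscillation on the
elements of fine partitions. -/
theorem exists_meshSize_oscillation_le (hΩ : IsPolytopalDomain Ω)
    (a : E d → Matrix (Fin d) (Fin d) ℝ) {ε : ℝ} (hε : 0 < ε) :
    ∃ h₀ : ℝ, 0 < h₀ ∧ ∀ M : Mesh Ω, M.meshSize < h₀ →
      (∀ t i j, UniformContinuousOn (fun x => a x i j) (interior (M.elem t))) →
      ∀ t i j, ∀ x ∈ interior (M.elem t), ∀ y ∈ interior (M.elem t),
        |a x i j - a y i j| ≤ ε := by
  -- Any one partition with uniformly continuous coefficients serves as the reference, so `h₀`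
  -- depends on `Ω`, `a` and `ε` only. If there is none, the assertion is empty.
  by_cases hex : ∃ M₁ : Mesh Ω,
      ∀ t i j, UniformContinuousOn (fun x => a x i j) (interior (M₁.elem t))
  · obtain ⟨M₁, hM₁⟩ := hex
    set ε' : ℝ := ε / (M₁.numElems + 1) with hε'
    have hε'pos : 0 < ε' := by positivity
    choose δ hδ hδ' using fun t i j => Metric.uniformContinuousOn_iff.1 (hM₁ t i j) ε' hε'pos
    have hmin : ∃ h₀ : ℝ, 0 < h₀ ∧ ∀ t i j, h₀ ≤ δ t i j := by
      have : ∀ᶠ h in 𝓝[>] (0 : ℝ), ∀ t i j, h ≤ δ t i j := by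
        simp only [eventually_all]
        exact fun t i j => mem_nhdsWithin_of_mem_nhds (Iic_mem_nhds (hδ t i j))
      obtain ⟨h, h1, h2⟩ := (this.and self_mem_nhdsWithin).exists
      exact ⟨h, h2, h1⟩
    obtain ⟨h₀, hh₀, hle⟩ := hmin
    refine ⟨h₀, hh₀, fun M hM hcont t i j x hx y hy => ?_⟩
    refine (oscillation_le hΩ M₁ (b := fun x => a x i j) hε'pos.le (δ := h₀)
      (fun s z hz w hw hzw => ?_) M hM t (hcont t i j).continuousOn hx hy).trans ?_
    · exact (hδ' s i j z hz w hw (hzw.trans_le (hle s i j))).le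
    · rw [hε', mul_div_assoc', div_le_iff₀ (by positivity)]
      nlinarith
  · push Not at hex
    exact ⟨1, one_pos, fun M _ h => absurd h (by push Not; exact hex M)⟩

end Mesh

/-! ### The dual problem -/

namespace Mesh

section

variable {d : ℕ} {Ω : Set (E d)} (M : Mesh Ω)

theorem integrableOn_face_mul {k : ℕ} {e : Fin M.numFaces} {g : E d → ℝ}
    (hg : g ∈ PolyOn k (M.face e)) {ψ : E d → ℝ} (hψ : Continuous ψ) :
    IntegrableOn (fun x => g x * ψ x) (M.face e) (surf d) := by
  obtain ⟨P, -, rfl⟩ := exists_ev_eq_of_mem_polyOn hg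
  refine (M.integrableOn_face (ψ := fun x => ev P x * ψ x) (by fun_prop) e).congr_fun
    (fun x hx => ?_) (M.isCompact_face e).measurableSet
  simp only [Set.indicator_of_mem hx]

/-- The right-hand side in the definition of the weak Hessian. -/
def hessianFunctional (v : WeakFun M) (t : Fin M.numElems) (i j : Fin d)
    (ψ : MvPolynomial (Fin d) ℝ) : ℝ :=
  (∫ x in M.elem t, ev (v.1 t) x * ev (MvPolynomial.pderiv j (MvPolynomial.pderiv i ψ)) x)
      - (∑ e ∈ M.facesOf t, ∫ x in M.face e,
          v.2.1 e x * M.normal t e i * ev (MvPolynomial.pderiv j ψ) x ∂(surf d))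
      + ∑ e ∈ M.facesOf t, ∫ x in M.face e,
          v.2.2 e i x * (ev ψ x * M.normal t e j) ∂(surf d)

theorem hessianFunctional_eq (v : WeakFun M) (t : Fin M.numElems)
    (i j : Fin d) (ψ : MvPolynomial (Fin d) ℝ) : M.hessianFunctional v t i j ψ
      = (∫ x in M.elem t, ev (v.1 t) x * ev (MvPolynomial.pderiv j (MvPolynomial.pderiv i ψ)) x)
      - (∑ e ∈ M.facesOf t, M.normal t e i *
          ∫ x in M.face e, v.2.1 e x * ev (MvPolynomial.pderiv j ψ) x ∂(surf d))
      + ∑ e ∈ M.facesOf t, M.normal t e j *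
          ∫ x in M.face e, v.2.2 e i x * ev ψ x ∂(surf d) := by
  simp only [hessianFunctional, ← integral_const_mul]
  congr 2
  · refine Finset.sum_congr rfl fun e _ => integral_congr_ae (Eventually.of_forall fun x => ?_)
    simp only; ring
  · funext e
    refine integral_congr_ae (Eventually.of_forall fun x => ?_)
    simp only; ring

theorem hessianFunctional_add {k : ℕ} {v : WeakFun M} (hv : v ∈ M.Vh k) (t : Fin M.numElems)
    (i j : Fin d) (ψ ψ' : MvPolynomial (Fin d) ℝ) : M.hessianFunctional v t i j (ψ + ψ')
      = M.hessianFunctional v t i j ψ + M.hessianFunctional v t i j ψ' := by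
  simp only [M.hessianFunctional_eq, map_add, ev_add, mul_add]
  rw [integral_add (M.integrableOn_elem (by fun_prop) t) (M.integrableOn_elem (by fun_prop) t)]
  have h1 : ∀ e (P Q : MvPolynomial (Fin d) ℝ),
      ∫ x in M.face e, v.2.1 e x * ev P x + v.2.1 e x * ev Q x ∂(surf d)
      = (∫ x in M.face e, v.2.1 e x * ev P x ∂(surf d))
        + ∫ x in M.face e, v.2.1 e x * ev Q x ∂(surf d) := fun e P Q =>
    integral_add (M.integrableOn_face_mul (hv.2.1 e) (continuous_ev P))
      (M.integrableOn_face_mul (hv.2.1 e) (continuous_ev Q))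
  have h2 : ∀ e (P Q : MvPolynomial (Fin d) ℝ),
      ∫ x in M.face e, v.2.2 e i x * ev P x + v.2.2 e i x * ev Q x ∂(surf d)
      = (∫ x in M.face e, v.2.2 e i x * ev P x ∂(surf d))
        + ∫ x in M.face e, v.2.2 e i x * ev Q x ∂(surf d) := fun e P Q =>
    integral_add (M.integrableOn_face_mul (hv.2.2 e i) (continuous_ev P))
      (M.integrableOn_face_mul (hv.2.2 e i) (continuous_ev Q))
  simp only [h1, h2, mul_add, Finset.sum_add_distrib]
  ring

theorem hessianFunctional_smul (v : WeakFun M) (t : Fin M.numElems)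
    (i j : Fin d) (c : ℝ) (ψ : MvPolynomial (Fin d) ℝ) : M.hessianFunctional v t i j (c • ψ)
      = c * M.hessianFunctional v t i j ψ := by
  simp only [M.hessianFunctional_eq, Derivation.map_smul, ev_smul, mul_left_comm _ c,
    integral_const_mul, ← Finset.mul_sum]
  ring

/-- The weak Hessian exists. -/
theorem exists_isWeakHessian {k : ℕ} (l : ℕ) {v : WeakFun M} (hv : v ∈ M.Vh k) :
    ∃ H, M.IsWeakHessian l v H := by
  have h : ∀ t i j, ∃ P ∈ Poly d l, ∀ ψ : Poly d l,
      ∫ x in M.elem t, ev P x * ev (ψ : MvPolynomial (Fin d) ℝ) x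
        = M.hessianFunctional v t i j ψ := fun t i j =>
    M.exists_riesz t
      { toFun := fun ψ => M.hessianFunctional v t i j (ψ : MvPolynomial (Fin d) ℝ)
        map_add' := fun ψ ψ' => M.hessianFunctional_add hv t i j ψ ψ'
        map_smul' := fun c ψ => M.hessianFunctional_smul v t i j c ψ }
  choose H hH hH' using h
  exact ⟨H, fun t i j => ⟨hH t i j, fun ψ hψ => hH' t i j ⟨ψ, hψ⟩⟩⟩

/-- Integration of polynomials against a function on a face. -/
def facePairing {k : ℕ} {e : Fin M.numFaces} {g : E d → ℝ} (hg : g ∈ PolyOn k (M.face e)) :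
    MvPolynomial (Fin d) ℝ →ₗ[ℝ] ℝ where
  toFun P := ∫ x in M.face e, g x * ev P x ∂(surf d)
  map_add' P Q := by
    simp only [ev_add, mul_add]
    exact integral_add (M.integrableOn_face_mul hg (continuous_ev P))
      (M.integrableOn_face_mul hg (continuous_ev Q))
  map_smul' c P := by
    simp only [ev_smul, mul_left_comm _ c, integral_const_mul]; rfl

theorem facePairing_apply {k : ℕ} {e : Fin M.numFaces} {g : E d → ℝ}
    (hg : g ∈ PolyOn k (M.face e)) (P : MvPolynomial (Fin d) ℝ) :
    M.facePairing hg P = ∫ x in M.face e, g x * ev P x ∂(surf d) := rfl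

theorem sum_sum_facesOf_comm (F : Fin M.numElems → Fin d → Fin d → Fin M.numFaces → ℝ) :
    ∑ t, ∑ i, ∑ j, ∑ e ∈ M.facesOf t, F t i j e
      = ∑ e, ∑ i, ∑ j, ∑ t ∈ M.elemsOf e, F t i j e := by
  have h1 : ∀ t, ∑ i, ∑ j, ∑ e ∈ M.facesOf t, F t i j e
      = ∑ e ∈ M.facesOf t, ∑ i, ∑ j, F t i j e := fun t => by
    rw [Finset.sum_comm (s := M.facesOf t)]
    exact Finset.sum_congr rfl fun i _ => Finset.sum_comm
  have h2 : ∀ e, ∑ t ∈ M.elemsOf e, ∑ i, ∑ j, F t i j e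
      = ∑ i, ∑ j, ∑ t ∈ M.elemsOf e, F t i j e := fun e => by
    rw [Finset.sum_comm]
    exact Finset.sum_congr rfl fun i _ => Finset.sum_comm
  simp only [h1]
  rw [M.sum_facesOf_comm]
  simp only [h2]

/-- Summation of the weak Hessian against a piecewise polynomial tensor field. -/
theorem sum_hessianFunctional {k : ℕ} {v : WeakFun M} (hv : v ∈ M.Vh k)
    (τ : Fin d → Fin d → Fin M.numElems → MvPolynomial (Fin d) ℝ) :
    ∑ t, ∑ i, ∑ j, M.hessianFunctional v t i j (τ i j t)
      = (∑ t, ∫ x in M.elem t,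
          ev (v.1 t) x * ev (∑ i, MvPolynomial.pderiv i (M.pwDiv (τ i) t)) x)
      - (∑ e, ∫ x in M.face e, v.2.1 e x * ev (∑ i, M.jump (M.pwDiv (τ i)) i e) x ∂(surf d))
      + ∑ e, ∑ i, ∫ x in M.face e, v.2.2 e i x * ev (∑ j, M.jump (τ i j) j e) x ∂(surf d) := by
  simp only [M.hessianFunctional_eq, Finset.sum_add_distrib, Finset.sum_sub_distrib]
  congr 1
  · congr 1
    · refine Finset.sum_congr rfl fun t _ => ?_
      simp only [pwDiv, map_sum, ev_sum, Finset.mul_sum]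
      rw [integral_finsetSum _ fun i _ => integrable_finsetSum _ fun j _ =>
        M.integrableOn_elem (by fun_prop) t]
      refine Finset.sum_congr rfl fun i _ => ?_
      rw [integral_finsetSum _ fun j _ => M.integrableOn_elem (by fun_prop) t]
      refine Finset.sum_congr rfl fun j _ => ?_
      rw [pderiv_comm]
    · rw [M.sum_sum_facesOf_comm]
      refine Finset.sum_congr rfl fun e _ => ?_
      have h := M.facePairing_apply (hv.2.1 e)
      simp only [← h, jump, pwDiv, map_sum, map_smul, smul_eq_mul, Finset.mul_sum]
      exact Finset.sum_congr rfl fun i _ => Finset.sum_comm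
  · rw [M.sum_sum_facesOf_comm]
    refine Finset.sum_congr rfl fun e _ => Finset.sum_congr rfl fun i _ => ?_
    have h := M.facePairing_apply (hv.2.2 e i)
    simp only [← h, jump, map_sum, map_smul, smul_eq_mul]

/-- A discrete tensor field in the annihilator of the weak Hessians has no jumps, and its double
divergence vanishes. -/
theorem jump_eq_zero_of_orthogonal {k l : ℕ} (hlk : l + 1 ≤ k)
    {τ : Fin d → Fin d → Fin M.numElems → MvPolynomial (Fin d) ℝ}
    (hτ : ∀ i j t, τ i j t ∈ Poly d l)
    (h : ∀ v ∈ M.Vh0 k, ∑ t, ∑ i, ∑ j, M.hessianFunctional v t i j (τ i j t) = 0) :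
    (∀ t, ∑ i, MvPolynomial.pderiv i (M.pwDiv (τ i) t) = 0) ∧
    (∀ e, ¬ M.face e ⊆ frontier Ω → ∀ x ∈ M.face e,
      ev (∑ i, M.jump (M.pwDiv (τ i)) i e) x = 0) ∧
    ∀ e i, ∀ x ∈ M.face e, ev (∑ j, M.jump (τ i j) j e) x = 0 := by
  classical
  have hdiv : ∀ i t, M.pwDiv (τ i) t ∈ Poly d l := fun i t => Submodule.sum_mem _ fun j _ =>
    poly_mono (by omega) (pderiv_mem_poly (hτ i j t) j)
  have hjump : ∀ (P : Fin M.numElems → MvPolynomial (Fin d) ℝ), (∀ t, P t ∈ Poly d l) →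
      ∀ i e, M.jump P i e ∈ Poly d l := fun P hP i e =>
    Submodule.sum_mem _ fun t _ => Submodule.smul_mem _ _ (hP t)
  set D : Fin M.numElems → MvPolynomial (Fin d) ℝ :=
    fun t => ∑ i, MvPolynomial.pderiv i (M.pwDiv (τ i) t) with hD
  set J : Fin M.numFaces → MvPolynomial (Fin d) ℝ :=
    fun e => ∑ i, M.jump (M.pwDiv (τ i)) i e with hJ
  set R : Fin M.numFaces → Fin d → MvPolynomial (Fin d) ℝ :=
    fun e i => ∑ j, M.jump (τ i j) j e with hR
  have hDm : ∀ t, D t ∈ Poly d k := fun t => Submodule.sum_mem _ fun i _ =>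
    poly_mono (by omega) (pderiv_mem_poly (hdiv i t) i)
  have hJm : ∀ e, J e ∈ Poly d k := fun e => poly_mono (by omega : l ≤ k)
    (Submodule.sum_mem _ fun i _ => hjump _ (hdiv i) i e)
  have hRm : ∀ e i, R e i ∈ Poly d (k - 1) := fun e i => poly_mono (by omega : l ≤ k - 1)
    (Submodule.sum_mem _ fun j _ => hjump _ (hτ i j) j e)
  -- The choice that turns the three sums into sums of squares. The degree of `R` requires `l ≤ k -
  -- 1`. On boundary faces `v_b` must be zero, so nothing is learned about `J` there, whereas `v_g`
  -- is free and `R` vanishes on all faces.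
  let v : WeakFun M := (D,
    fun e => if M.face e ⊆ frontier Ω then 0 else (M.face e).indicator (ev (-J e)),
    fun e i => (M.face e).indicator (ev (R e i)))
  have hv : v ∈ M.Vh0 k := by
    refine ⟨⟨hDm, fun e => ?_, fun e i => indicator_ev_mem_polyOn _ (hRm e i)⟩, fun e he => ?_⟩
    · by_cases he : M.face e ⊆ frontier Ω
      · simp only [v, if_pos he]; exact Submodule.zero_mem _
      · simp only [v, if_neg he]
        exact indicator_ev_mem_polyOn _ (Submodule.neg_mem _ (hJm e))
    · simp only [v, if_pos he]
  have h0 := h v hv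
  rw [M.sum_hessianFunctional hv.1 τ, sub_eq_add_neg, ← Finset.sum_neg_distrib] at h0
  have hb : ∀ e, -∫ x in M.face e, v.2.1 e x * ev (J e) x ∂(surf d)
      = if M.face e ⊆ frontier Ω then 0 else ∫ x in M.face e, ev (J e) x * ev (J e) x ∂(surf d) :=
    fun e => by
      by_cases he : M.face e ⊆ frontier Ω
      · simp [v, he]
      · simp only [v, if_neg he]
        rw [← integral_neg]
        refine setIntegral_congr_fun (M.isCompact_face e).measurableSet fun x hx => ?_
        simp [Set.indicator_of_mem hx]
  have hg : ∀ e i, ∫ x in M.face e, v.2.2 e i x * ev (R e i) x ∂(surf d)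
      = ∫ x in M.face e, ev (R e i) x * ev (R e i) x ∂(surf d) := fun e i => by
    refine setIntegral_congr_fun (M.isCompact_face e).measurableSet fun x hx => ?_
    simp [v, Set.indicator_of_mem hx]
  replace h0 : (∑ t, ∫ x in M.elem t, ev (D t) x * ev (D t) x)
      + (∑ e, -∫ x in M.face e, v.2.1 e x * ev (J e) x ∂(surf d))
      + ∑ e, ∑ i, ∫ x in M.face e, v.2.2 e i x * ev (R e i) x ∂(surf d) = 0 := h0
  have n1 : ∀ t, 0 ≤ ∫ x in M.elem t, ev (D t) x * ev (D t) x := fun t =>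
    integral_nonneg fun x => mul_self_nonneg _
  have n2 : ∀ e, 0 ≤ -∫ x in M.face e, v.2.1 e x * ev (J e) x ∂(surf d) := fun e => by
    rw [hb]; split_ifs
    · exact le_rfl
    · exact integral_nonneg fun x => mul_self_nonneg _
  have n3 : ∀ e i, 0 ≤ ∫ x in M.face e, v.2.2 e i x * ev (R e i) x ∂(surf d) := fun e i => by
    rw [hg]; exact integral_nonneg fun x => mul_self_nonneg _
  have s1 := Finset.sum_nonneg fun t (_ : t ∈ Finset.univ) => n1 t
  have s2 := Finset.sum_nonneg fun e (_ : e ∈ Finset.univ) => n2 e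
  have s3 := Finset.sum_nonneg fun e (_ : e ∈ Finset.univ) =>
    Finset.sum_nonneg fun i (_ : i ∈ Finset.univ) => n3 e i
  have z1 : ∑ t, ∫ x in M.elem t, ev (D t) x * ev (D t) x = 0 := by linarith
  have z2 : ∑ e, -∫ x in M.face e, v.2.1 e x * ev (J e) x ∂(surf d) = 0 := by linarith
  have z3 : ∑ e, ∑ i, ∫ x in M.face e, v.2.2 e i x * ev (R e i) x ∂(surf d) = 0 := by linarith
  refine ⟨fun t => ?_, fun e he x hx => ?_, fun e i x hx => ?_⟩
  · exact M.eq_zero_of_integral_elem_sq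
      ((Finset.sum_eq_zero_iff_of_nonneg fun t _ => n1 t).1 z1 t (Finset.mem_univ t))
  · have h1 := (Finset.sum_eq_zero_iff_of_nonneg fun e _ => n2 e).1 z2 e (Finset.mem_univ e)
    rw [hb, if_neg he] at h1
    exact mul_self_eq_zero.1 (M.eqOn_zero_of_integral_face_eq_zero e
      (D := fun x => ev (J e) x * ev (J e) x) (by fun_prop) (fun x _ => mul_self_nonneg _) h1 x hx)
  · have h1 := (Finset.sum_eq_zero_iff_of_nonneg fun i _ => n3 e i).1
      ((Finset.sum_eq_zero_iff_of_nonneg fun e _ => Finset.sum_nonneg fun i _ => n3 e i).1 z3 e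
        (Finset.mem_univ e)) i (Finset.mem_univ i)
    rw [hg] at h1
    exact mul_self_eq_zero.1 (M.eqOn_zero_of_integral_face_eq_zero e
      (D := fun x => ev (R e i) x * ev (R e i) x) (by fun_prop) (fun x _ => mul_self_nonneg _)
      h1 x hx)

/-- A piecewise polynomial tensor field without normal jumps whose double divergence vanishes is
orthogonal to the Hessians of the functions in `W^{2,p} ∩ W_0^{1,p}`. -/
theorem integral_hessian_eq_zero (hΩ : IsPolytopalDomain Ω) {p : ℝ} (hp : 1 ≤ p)
    {τ : Fin d → Fin d → Fin M.numElems → MvPolynomial (Fin d) ℝ}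
    (hD : ∀ t, ∑ i, MvPolynomial.pderiv i (M.pwDiv (τ i) t) = 0)
    (hJ : ∀ e, ¬ M.face e ⊆ frontier Ω → ∀ x ∈ M.face e,
      ev (∑ i, M.jump (M.pwDiv (τ i)) i e) x = 0)
    (hR : ∀ e i, ∀ x ∈ M.face e, ev (∑ j, M.jump (τ i j) j e) x = 0)
    {u : E d → ℝ} {G : Fin d → E d → ℝ} {H : Fin d → Fin d → E d → ℝ}
    (hu : IsW2p Ω p u G H) (hu0 : IsW01p Ω p u G) :
    ∫ x in Ω, ∑ i, ∑ j, H i j x * M.pw (τ i j) x = 0 := by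
  have hfin : IsFiniteMeasure (vol Ω) := ⟨by
    rw [Measure.restrict_apply_univ]; exact hΩ.volume_lt_top⟩
  have hp1 : (1 : ℝ≥0∞) ≤ ENNReal.ofReal p := by simpa using hp
  have hGi : ∀ i, IntegrableOn (G i) Ω := fun i => (hu.memLp_grad i).integrable hp1
  have hHi : ∀ i j, IntegrableOn (H i j) Ω := fun i j => (hu.memLp_hess i j).integrable hp1
  have hmul : ∀ (q : E d → ℝ) P, IntegrableOn q Ω → IntegrableOn (fun x => q x * M.pw P x) Ω :=
    fun q P hq => by simpa only [mul_comm] using M.integrableOn_pw_mul P hq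
  -- The first integration by parts. The gradient `G` has no boundary condition, so it is essential
  -- that the normal components of `τ` vanish on boundary faces as well.
  have hstep : ∀ i, (∫ x in Ω, G i x * M.pw (M.pwDiv (τ i)) x)
      + ∫ x in Ω, ∑ j, H i j x * M.pw (τ i j) x = 0 := fun i => by
    rw [← integral_add (hmul _ _ (hGi i)) (integrable_finsetSum _ fun j _ => hmul _ _ (hHi i j))]
    refine M.integral_mul_pwDiv_add hΩ (τ i) (fun e x hx => ?_) (hGi i) (hHi i) (hu.weak_hess i)
    rw [← ev_sum]
    exact hR e i x hx
  -- The field `div τ` is weakly divergence free in `Ω`: its piecewise divergence is zero and its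
  -- normal jumps vanish on the interior faces.
  have htest : ∀ φ, IsTestFunction Ω φ →
      ∑ i, ∫ x in Ω, partialD i φ x * M.pw (M.pwDiv (τ i)) x = 0 := fun φ hφ => by
    have hφu := hφ.mono (Set.subset_univ _)
    have h1 : ∀ i, ∫ x in Ω, partialD i φ x * M.pw (M.pwDiv (τ i)) x
        = -(∫ x in Ω, M.pw (fun t => MvPolynomial.pderiv i (M.pwDiv (τ i) t)) x * φ x)
        + ∑ e, ∫ x in M.face e, ev (M.jump (M.pwDiv (τ i)) i e) x * φ x ∂(surf d) := fun i => by
      rw [← M.integral_pw_partialD hΩ _ i hφu]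
      exact integral_congr_ae (Eventually.of_forall fun x => mul_comm _ _)
    simp only [h1]
    rw [Finset.sum_add_distrib, Finset.sum_neg_distrib, ← integral_finsetSum _ fun i _ =>
      M.integrableOn_pw_mul _ (integrableOn_test hφu), Finset.sum_comm]
    have h2 : ∀ x, ∑ i, M.pw (fun t => MvPolynomial.pderiv i (M.pwDiv (τ i) t)) x * φ x = 0 :=
      fun x => by
        rw [← Finset.sum_mul, ← M.pw_sum]
        simp only [hD]
        rw [show M.pw (fun _ => 0) x = 0 by simp [pw, Set.indicator], zero_mul]
    simp only [h2, integral_zero, neg_zero, zero_add]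
    refine Finset.sum_eq_zero fun e _ => ?_
    have hφc := hφ.1.continuous
    rw [← integral_finsetSum _ fun i _ => M.integrableOn_face (by fun_prop) e]
    refine setIntegral_eq_zero_of_forall_eq_zero fun x hx => ?_
    by_cases he : M.face e ⊆ frontier Ω
    · have h3 : φ x = 0 := image_eq_zero_of_notMem_tsupport fun h' => by
        have := (he hx).2
        rw [hΩ.isOpen.interior_eq] at this
        exact this (hφ.2.2 h')
      simp [h3]
    · rw [← Finset.sum_mul, ← ev_sum, hJ e he x hx, zero_mul]
  obtain ⟨φ, hφ, -, hφG⟩ := hu0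
  -- The second integration by parts is inherited by `u` from its approximating test functions:
  -- convergence of gradients in `L^p` implies convergence in `L¹` on a set of finite measure, and
  -- `div τ` is bounded.
  have hlim : Tendsto (fun n => ∑ i, ∫ x in Ω, partialD i (φ n) x * M.pw (M.pwDiv (τ i)) x) atTop
      (𝓝 (∑ i, ∫ x in Ω, G i x * M.pw (M.pwDiv (τ i)) x)) := by
    refine tendsto_finsetSum _ fun i _ => ?_
    obtain ⟨C, hC, hCb⟩ := M.exists_pw_bound (M.pwDiv (τ i))
    have hφi : ∀ n, IntegrableOn (partialD i (φ n)) Ω := fun n =>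
      integrableOn_partialD ((hφ n).mono (Set.subset_univ _)) i
    refine tendsto_integral_of_L1' _ (hmul _ _ (hGi i)).aestronglyMeasurable
      (Eventually.of_forall fun n => hmul _ _ (hφi n)) ?_
    set m : ℝ≥0∞ := (vol Ω) Set.univ ^ (1 / (1 : ℝ≥0∞).toReal - 1 / (ENNReal.ofReal p).toReal)
      with hm
    have hmtop : m ≠ ⊤ := by
      refine ENNReal.rpow_ne_top_of_nonneg ?_ (measure_ne_top _ _)
      rw [ENNReal.toReal_one, ENNReal.toReal_ofReal (by linarith), sub_nonneg, div_one]
      exact (div_le_one (by linarith)).2 hp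
    have hlim0 : Tendsto (fun n => ENNReal.ofReal C *
        (eLpNorm (fun x => G i x - partialD i (φ n) x) (ENNReal.ofReal p) (vol Ω) * m)) atTop
        (𝓝 0) := by
      have h1 := ENNReal.Tendsto.mul_const (b := m) (hφG i) (Or.inr hmtop)
      have h2 := ENNReal.Tendsto.const_mul (a := ENNReal.ofReal C) h1
        (Or.inr ENNReal.ofReal_ne_top)
      simpa using h2
    refine tendsto_of_tendsto_of_tendsto_of_le_of_le tendsto_const_nhds hlim0
      (fun n => zero_le) fun n => ?_
    refine (eLpNorm_le_mul_eLpNorm_of_ae_le_mul (c := C)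
      (g := fun x => G i x - partialD i (φ n) x) (Eventually.of_forall fun x => ?_) 1).trans ?_
    · rw [Pi.sub_apply, ← sub_mul, norm_mul, norm_sub_rev, mul_comm]
      exact mul_le_mul_of_nonneg_right (hCb x) (norm_nonneg _)
    · gcongr
      exact eLpNorm_le_eLpNorm_mul_rpow_measure_univ hp1 ((hGi i).sub (hφi n)).aestronglyMeasurable
  have hz : ∑ i, ∫ x in Ω, G i x * M.pw (M.pwDiv (τ i)) x = 0 := by
    refine tendsto_nhds_unique hlim ?_
    simp only [fun n => htest (φ n) (hφ n)]
    exact tendsto_const_nhds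
  have hsum := Finset.sum_congr rfl fun i (_ : i ∈ Finset.univ) => hstep i
  rw [Finset.sum_add_distrib, hz, zero_add, Finset.sum_const_zero] at hsum
  rw [integral_finsetSum _ fun i _ => integrable_finsetSum _ fun j _ => hmul _ _ (hHi i j)]
  exact hsum

end

end Mesh

/-! ### Uniqueness and solvability on fine partitions -/

/-- Evaluating the form at unit vectors bounds the diagonal entries by `0` and `β`; at `e_i ± e_j`
the upper bound reads `a_ii + a_jj ± 2 a_ij ≤ 2β`. -/
theorem abs_coeff_le {d : ℕ} {A : Matrix (Fin d) (Fin d) ℝ} (hs : A.IsSymm) {α β : ℝ} (hα : 0 < α)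
    (h : ∀ ξ : Fin d → ℝ, α * (ξ ⬝ᵥ ξ) ≤ ξ ⬝ᵥ A.mulVec ξ ∧ ξ ⬝ᵥ A.mulVec ξ ≤ β * (ξ ⬝ᵥ ξ))
    (i j : Fin d) : |A i j| ≤ β := by
  have hdiag : ∀ i, 0 ≤ A i i ∧ A i i ≤ β := fun i => by
    have := h (Pi.single i 1)
    simp at this
    exact ⟨hα.le.trans this.1, this.2⟩
  by_cases hij : i = j
  · subst hij
    rw [abs_of_nonneg (hdiag i).1]
    exact (hdiag i).2
  · have hsym : A j i = A i j := hs.apply i j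
    have h1 := (h (Pi.single i 1 + Pi.single j 1)).2
    have h2 := (h (Pi.single i 1 - Pi.single j 1)).2
    simp [Matrix.mulVec_add, Matrix.mulVec_sub, dotProduct_add, add_dotProduct, dotProduct_sub,
      sub_dotProduct, hij, Ne.symm hij, hsym] at h1 h2
    rw [abs_le]
    constructor <;> nlinarith [hdiag i, hdiag j]

theorem integral_rpow_abs_eq {d : ℕ} {μ : Measure (E d)} {p : ℝ} (hp : 0 < p) {f : E d → ℝ}
    (hf : MemLp f (ENNReal.ofReal p) μ) :
    eLpNorm f (ENNReal.ofReal p) μ ^ p = ENNReal.ofReal (∫ x, |f x| ^ p ∂μ) := by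
  have hp0 : ENNReal.ofReal p ≠ 0 := by simpa using hp
  rw [hf.eLpNorm_eq_integral_rpow_norm hp0 ENNReal.ofReal_ne_top, ENNReal.toReal_ofReal hp.le,
    ENNReal.ofReal_rpow_of_nonneg (by positivity) hp.le, ← Real.rpow_mul (by positivity),
    inv_mul_cancel₀ hp.ne', Real.rpow_one]
  rfl

theorem integrable_rpow_abs {d : ℕ} {μ : Measure (E d)} {p : ℝ} (hp : 0 < p) {f : E d → ℝ}
    (hf : MemLp f (ENNReal.ofReal p) μ) : Integrable (fun x => |f x| ^ p) μ := by
  have hp0 : ENNReal.ofReal p ≠ 0 := by simpa using hp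
  have := hf.integrable_norm_rpow hp0 ENNReal.ofReal_ne_top
  rwa [ENNReal.toReal_ofReal hp.le] at this

/-- The regularity estimate for the second derivatives. -/
theorem sum_integral_hessian_le {d : ℕ} {Ω : Set (E d)} {p : ℝ} (hp : 0 < p) {u : E d → ℝ}
    {G : Fin d → E d → ℝ} {H : Fin d → Fin d → E d → ℝ} (hu : IsW2p Ω p u G H) {f : E d → ℝ}
    (hf : MemLp f (ENNReal.ofReal p) (vol Ω)) {C : ℝ≥0}
    (h : normW2p Ω p u G H ≤ C * eLpNorm f (ENNReal.ofReal p) (vol Ω)) :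
    ∑ i, ∑ j, ∫ x in Ω, |H i j x| ^ p ≤ (C : ℝ) ^ p * ∫ x in Ω, |f x| ^ p := by
  have h1 := ENNReal.rpow_le_rpow h hp.le
  rw [normW2p, ← ENNReal.rpow_mul, one_div, inv_mul_cancel₀ hp.ne', ENNReal.rpow_one,
    ENNReal.mul_rpow_of_nonneg _ _ hp.le, integral_rpow_abs_eq hp hf] at h1
  have h2 := le_add_self.trans h1
  simp only [fun i j => integral_rpow_abs_eq hp (hu.memLp_hess i j)] at h2
  have hnn : ∀ i j, 0 ≤ ∫ x in Ω, |H i j x| ^ p := fun i j =>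
    integral_nonneg fun x => by positivity
  have h3 : ∑ i, ∑ j, ENNReal.ofReal (∫ x in Ω, |H i j x| ^ p)
      = ENNReal.ofReal (∑ i, ∑ j, ∫ x in Ω, |H i j x| ^ p) := by
    rw [ENNReal.ofReal_sum_of_nonneg fun i _ => Finset.sum_nonneg fun j _ => hnn i j]
    refine Finset.sum_congr rfl fun i _ => ?_
    rw [ENNReal.ofReal_sum_of_nonneg fun j _ => hnn i j]
  have h4 : (C : ℝ≥0∞) ^ p = ENNReal.ofReal ((C : ℝ) ^ p) := by
    rw [← ENNReal.ofReal_coe_nnreal, ENNReal.ofReal_rpow_of_nonneg (NNReal.coe_nonneg C) hp.le]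
  rw [h3, h4, ← ENNReal.ofReal_mul (by positivity), ENNReal.ofReal_le_ofReal_iff
    (mul_nonneg (by positivity) (integral_nonneg fun x => by positivity))] at h2
  exact h2

/-! ### Elementwise perturbation estimates -/

namespace Mesh

section

variable {d : ℕ} {Ω : Set (E d)} (M : Mesh Ω)

theorem integrableOn_elem_of_integrableOn (hΩ : IsPolytopalDomain Ω) {f : E d → ℝ}
    (hf : IntegrableOn f Ω) (t : Fin M.numElems) : IntegrableOn f (M.elem t) := by
  rw [integrableOn_congr_set_ae (M.elem_ae_eq_interior t)]
  exact hf.mono_set (M.interior_elem_subset hΩ t)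

theorem integral_elem_rpow_le {t : Fin M.numElems} {g : E d → ℝ} {B s : ℝ} (hs : 0 < s)
    (hB : ∀ x ∈ interior (M.elem t), |g x| ≤ B) :
    ∫ x in M.elem t, |g x| ^ s ≤ volume.real (M.elem t) * B ^ s := by
  calc _ ≤ ‖∫ x in M.elem t, |g x| ^ s‖ := Real.le_norm_self _
    _ ≤ B ^ s * volume.real (M.elem t) := by
        refine norm_setIntegral_le_of_norm_le_const_ae
          (M.isPolytope_elem t).isCompact.measure_lt_top ?_
        rw [Measure.restrict_congr_set (M.elem_ae_eq_interior t)]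
        refine (ae_restrict_iff' isOpen_interior.measurableSet).2 (Eventually.of_forall
          fun x hx => ?_)
        rw [Real.norm_of_nonneg (by positivity)]
        exact Real.rpow_le_rpow (abs_nonneg _) (hB x hx) hs.le
    _ = _ := mul_comm _ _

/-- The inverse estimate with constant `C` and exponent `s` for polynomials of degree `l`. -/
def InverseEstimate (l : ℕ) (s C : ℝ) : Prop :=
  ∀ t, ∀ P ∈ Poly d l, ∀ x ∈ M.elem t,
    volume.real (M.elem t) * |ev P x| ^ s ≤ C * ∫ y in M.elem t, |ev P y| ^ s

variable {M}

theorem InverseEstimate.exists_sup {l : ℕ} {s C : ℝ} (h : M.InverseEstimate l s C)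
    (t : Fin M.numElems) {P : MvPolynomial (Fin d) ℝ} (hP : P ∈ Poly d l) :
    ∃ S : ℝ, 0 ≤ S ∧ (∀ x ∈ M.elem t, |ev P x| ≤ S) ∧
      volume.real (M.elem t) * S ^ s ≤ C * ∫ y in M.elem t, |ev P y| ^ s := by
  have hne : (M.elem t).Nonempty := (M.nonempty_interior_elem t).mono interior_subset
  obtain ⟨z, hz, hzmax⟩ := (M.isPolytope_elem t).isCompact.exists_isMaxOn hne
    (continuous_ev P).abs.continuousOn
  exact ⟨|ev P z|, abs_nonneg _, fun x hx => hzmax hx, h t P hP z hz⟩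

/-- A polynomial combination that is orthogonal to polynomials is small if the coefficients have
small oscillation. -/
theorem InverseEstimate.integral_orthogonal_le {l : ℕ} {p C₂ C ε : ℝ}
    (h₂ : M.InverseEstimate l 2 C₂) (h : M.InverseEstimate l p C) (hp : 1 ≤ p) (hC₂ : 0 ≤ C₂)
    {t : Fin M.numElems} {ι : Type*} [Fintype ι] {b : ι → E d → ℝ}
    (hb : ∀ i, IntegrableOn (b i) (M.elem t)) (hε : 0 ≤ ε)
    (hosc : ∀ i, ∀ x ∈ interior (M.elem t), ∀ y ∈ interior (M.elem t), |b i x - b i y| ≤ ε)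
    {P : ι → MvPolynomial (Fin d) ℝ} (hP : ∀ i, P i ∈ Poly d l)
    (horth : ∀ ψ ∈ Poly d l, ∫ x in M.elem t, (∑ i, b i x * ev (P i) x) * ev ψ x = 0) :
    ∫ x in M.elem t, |∑ i, b i x * ev (P i) x| ^ p
      ≤ ((1 + C₂) ^ p * ((Fintype.card ι : ℝ) ^ (p - 1) * C)) * ε ^ p
        * ∑ i, ∫ x in M.elem t, |ev (P i) x| ^ p := by
  choose S hS0 hS hSC using fun i => h.exists_sup t (hP i)
  obtain ⟨x₀, hx₀⟩ := M.nonempty_interior_elem t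
  -- The coefficients are frozen at one point. Since the combination is orthogonal to polynomials,
  -- `-Q` is the projection of its difference to `Q`; that difference is small, so `Q` is small, and
  -- hence so is the combination.
  set Q : MvPolynomial (Fin d) ℝ := ∑ i, b i x₀ • P i with hQ
  have hQm : Q ∈ Poly d l := Submodule.sum_mem _ fun i _ => Submodule.smul_mem _ _ (hP i)
  have hQev : ∀ x, ev Q x = ∑ i, b i x₀ * ev (P i) x := fun x => by simp [hQ]
  have hmulI : ∀ (q : E d → ℝ) (R : MvPolynomial (Fin d) ℝ), IntegrableOn q (M.elem t) →
      IntegrableOn (fun x => q x * ev R x) (M.elem t) := fun q R hq => by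
    obtain ⟨B, hB⟩ := (M.isPolytope_elem t).isCompact.exists_bound_of_continuousOn
      (continuous_ev R).continuousOn
    refine Integrable.mul_bdd (c := B) hq (continuous_ev R).aestronglyMeasurable ?_
    exact (ae_restrict_iff' (M.isClosed_elem t).measurableSet).2 (Eventually.of_forall hB)
  have hgi : IntegrableOn (fun x => ∑ i, b i x * ev (P i) x) (M.elem t) :=
    integrable_finsetSum _ fun i _ => hmulI _ _ (hb i)
  have hdiff : ∀ x ∈ interior (M.elem t), |(∑ i, b i x * ev (P i) x) - ev Q x| ≤ ε * ∑ i, S i :=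
    fun x hx => by
      rw [hQev, ← Finset.sum_sub_distrib, Finset.mul_sum]
      refine (Finset.abs_sum_le_sum_abs _ _).trans (Finset.sum_le_sum fun i _ => ?_)
      rw [← sub_mul, abs_mul]
      exact mul_le_mul (hosc i x hx x₀ hx₀) (hS i x (interior_subset hx)) (abs_nonneg _) hε
  have hproj := M.abs_projection_le (h₂ t) (g := fun x => (∑ i, b i x * ev (P i) x) - ev Q x)
    hdiff (P := -Q) (Submodule.neg_mem _ hQm) (by
      have h1 := horth (-Q) (Submodule.neg_mem _ hQm)
      have hi1 := hmulI _ (-Q) hgi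
      have hi2 : IntegrableOn (fun x => ev Q x * ev (-Q) x) (M.elem t) :=
        M.integrableOn_elem (by fun_prop) t
      simp only [sub_mul]
      rw [integral_sub hi1 hi2, h1, zero_sub, ← integral_neg]
      exact integral_congr_ae (Eventually.of_forall fun x => by simp))
  have hbound : ∀ x ∈ interior (M.elem t), |∑ i, b i x * ev (P i) x|
      ≤ (1 + C₂) * ε * ∑ i, S i := fun x hx => by
    have h1 := hdiff x hx
    have h2 := hproj x (interior_subset hx)
    rw [ev_neg, abs_neg] at h2
    calc |∑ i, b i x * ev (P i) x| = |((∑ i, b i x * ev (P i) x) - ev Q x) + ev Q x| := by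
          rw [sub_add_cancel]
      _ ≤ ε * ∑ i, S i + C₂ * (ε * ∑ i, S i) := (abs_add_le _ _).trans (add_le_add h1 h2)
      _ = _ := by ring
  have hSs : 0 ≤ ∑ i, S i := Finset.sum_nonneg fun i _ => hS0 i
  have hpow : (∑ i, S i) ^ p ≤ (Fintype.card ι : ℝ) ^ (p - 1) * ∑ i, S i ^ p := by
    have h1 := Real.rpow_sum_le_const_mul_sum_rpow Finset.univ S hp
    simpa [abs_of_nonneg (hS0 _), Finset.card_univ] using h1
  have hV := (M.volume_elem_pos t).le
  calc _ ≤ volume.real (M.elem t) * ((1 + C₂) * ε * ∑ i, S i) ^ p :=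
        M.integral_elem_rpow_le (by linarith) hbound
    _ = (1 + C₂) ^ p * ε ^ p * (volume.real (M.elem t) * (∑ i, S i) ^ p) := by
        rw [Real.mul_rpow (by positivity) hSs, Real.mul_rpow (by positivity) hε]; ring
    _ ≤ (1 + C₂) ^ p * ε ^ p * (volume.real (M.elem t)
          * ((Fintype.card ι : ℝ) ^ (p - 1) * ∑ i, S i ^ p)) := by gcongr
    _ = (1 + C₂) ^ p * ε ^ p * ((Fintype.card ι : ℝ) ^ (p - 1)
          * ∑ i, volume.real (M.elem t) * S i ^ p) := by rw [← Finset.mul_sum]; ring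
    _ ≤ (1 + C₂) ^ p * ε ^ p * ((Fintype.card ι : ℝ) ^ (p - 1)
          * ∑ i, C * ∫ y in M.elem t, |ev (P i) y| ^ p) := by
        refine mul_le_mul_of_nonneg_left (mul_le_mul_of_nonneg_left
          (Finset.sum_le_sum fun i _ => hSC i) (by positivity)) (by positivity)
    _ = _ := by rw [← Finset.mul_sum]; ring

/-- The projection of a product with a coefficient of small oscillation is close to this
product. -/
theorem InverseEstimate.integral_sub_projection_le {l : ℕ} {q C₂ C ε : ℝ}
    (h₂ : M.InverseEstimate l 2 C₂) (h : M.InverseEstimate l q C) (hq : 0 < q) (hC₂ : 0 ≤ C₂)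
    {t : Fin M.numElems} {b : E d → ℝ} (hb : IntegrableOn b (M.elem t)) (hε : 0 ≤ ε)
    (hosc : ∀ x ∈ interior (M.elem t), ∀ y ∈ interior (M.elem t), |b x - b y| ≤ ε)
    {σ τ : MvPolynomial (Fin d) ℝ} (hσ : σ ∈ Poly d l) (hτ : τ ∈ Poly d l)
    (hproj : ∀ ψ ∈ Poly d l, ∫ x in M.elem t, ev τ x * ev ψ x
      = ∫ x in M.elem t, (b x * ev σ x) * ev ψ x) :
    ∫ x in M.elem t, |b x * ev σ x - ev τ x| ^ q
      ≤ ((1 + C₂) ^ q * C) * ε ^ q * ∫ x in M.elem t, |ev σ x| ^ q := by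
  obtain ⟨S, hS0, hS, hSC⟩ := h.exists_sup t hσ
  obtain ⟨x₀, hx₀⟩ := M.nonempty_interior_elem t
  -- Projection leaves `b x₀ • σ` unchanged, so `Q` is the projection of `(b - b x₀) σ`. Hence `bσ -
  -- τ` is the difference of a small function and its projection.
  set Q : MvPolynomial (Fin d) ℝ := τ - b x₀ • σ with hQ
  have hQm : Q ∈ Poly d l := Submodule.sub_mem _ hτ (Submodule.smul_mem _ _ hσ)
  have hdiff : ∀ x ∈ interior (M.elem t), |(b x - b x₀) * ev σ x| ≤ ε * S := fun x hx => by
    rw [abs_mul]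
    exact mul_le_mul (hosc x hx x₀ hx₀) (hS x (interior_subset hx)) (abs_nonneg _) hε
  have hmulI : IntegrableOn (fun x => (b x * ev σ x) * ev Q x) (M.elem t) := by
    obtain ⟨B, hB⟩ := (M.isPolytope_elem t).isCompact.exists_bound_of_continuousOn
      (continuous_ev (σ * Q)).continuousOn
    have h1 : IntegrableOn (fun x => b x * ev (σ * Q) x) (M.elem t) :=
      Integrable.mul_bdd (c := B) hb (continuous_ev _).aestronglyMeasurable
        ((ae_restrict_iff' (M.isClosed_elem t).measurableSet).2 (Eventually.of_forall hB))
    exact h1.congr (Eventually.of_forall fun x => by simp [mul_assoc])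
  have hpr := M.abs_projection_le (h₂ t) (g := fun x => (b x - b x₀) * ev σ x)
    hdiff (P := Q) hQm (by
      have h1 := hproj Q hQm
      have hi2 : IntegrableOn (fun x => b x₀ * (ev σ x * ev Q x)) (M.elem t) :=
        M.integrableOn_elem (by fun_prop) t
      have hi3 : IntegrableOn (fun x => ev τ x * ev Q x) (M.elem t) :=
        M.integrableOn_elem (by fun_prop) t
      have e1 : ∫ x in M.elem t, ev Q x * ev Q x
          = (∫ x in M.elem t, ev τ x * ev Q x) - ∫ x in M.elem t, b x₀ * (ev σ x * ev Q x) := by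
        rw [← integral_sub hi3 hi2]
        refine integral_congr_ae (Eventually.of_forall fun x => ?_)
        have : ev Q x = ev τ x - b x₀ * ev σ x := by simp [hQ]
        simp only
        conv_lhs => rw [this]
        conv_rhs => rw [this]
        ring
      have e2 : ∫ x in M.elem t, (b x - b x₀) * ev σ x * ev Q x
          = (∫ x in M.elem t, (b x * ev σ x) * ev Q x)
            - ∫ x in M.elem t, b x₀ * (ev σ x * ev Q x) := by
        rw [← integral_sub hmulI hi2]
        exact integral_congr_ae (Eventually.of_forall fun x => by simp only; ring)
      rw [e1, e2, h1])
  have hbound : ∀ x ∈ interior (M.elem t), |b x * ev σ x - ev τ x| ≤ (1 + C₂) * ε * S :=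
    fun x hx => by
      have h1 := hdiff x hx
      have h2 := hpr x (interior_subset hx)
      have h3 : b x * ev σ x - ev τ x = (b x - b x₀) * ev σ x - ev Q x := by
        simp [hQ]; ring
      rw [h3]
      calc _ ≤ ε * S + C₂ * (ε * S) := (abs_sub _ _).trans (add_le_add h1 h2)
        _ = _ := by ring
  calc _ ≤ volume.real (M.elem t) * ((1 + C₂) * ε * S) ^ q :=
        M.integral_elem_rpow_le hq hbound
    _ = (1 + C₂) ^ q * ε ^ q * (volume.real (M.elem t) * S ^ q) := by
        rw [Real.mul_rpow (by positivity) hS0, Real.mul_rpow (by positivity) hε]; ring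
    _ ≤ (1 + C₂) ^ q * ε ^ q * (C * ∫ y in M.elem t, |ev σ y| ^ q) := by gcongr
    _ = _ := by ring

end

end Mesh

/-! ### Injectivity on compatible functions and surjectivity -/

namespace Mesh

section

variable {d : ℕ} {Ω : Set (E d)} {M : Mesh Ω} {a : E d → Matrix (Fin d) (Fin d) ℝ}

theorem integrableOn_coeff_mul (hΩ : IsPolytopalDomain Ω)
    (ha : ∀ i j, AEStronglyMeasurable (fun x => a x i j) (vol Ω)) {β : ℝ}
    (haβ : ∀ x ∈ Ω, ∀ i j, |a x i j| ≤ β) {g : E d → ℝ} (hg : IntegrableOn g Ω) (i j : Fin d) :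
    IntegrableOn (fun x => a x i j * g x) Ω :=
  Integrable.bdd_mul (c := β) hg (ha i j)
    ((ae_restrict_iff' hΩ.isOpen.measurableSet).2 (Eventually.of_forall fun x hx => haβ x hx i j))

theorem integrableOn_coeff (hΩ : IsPolytopalDomain Ω)
    (ha : ∀ i j, AEStronglyMeasurable (fun x => a x i j) (vol Ω)) {β : ℝ}
    (haβ : ∀ x ∈ Ω, ∀ i j, |a x i j| ≤ β) (i j : Fin d) :
    IntegrableOn (fun x => a x i j) Ω := by
  have := integrableOn_coeff_mul hΩ ha haβ (g := fun _ => 1)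
    (integrableOn_const hΩ.volume_lt_top.ne) i j
  simpa using this

theorem memLp_coeff_pw (hΩ : IsPolytopalDomain Ω)
    (ha : ∀ i j, AEStronglyMeasurable (fun x => a x i j) (vol Ω)) {β : ℝ}
    (haβ : ∀ x ∈ Ω, ∀ i j, |a x i j| ≤ β)
    (P : Fin d → Fin d → Fin M.numElems → MvPolynomial (Fin d) ℝ) (q : ℝ≥0∞) :
    MemLp (fun x => ∑ i, ∑ j, a x i j * M.pw (P i j) x) q (vol Ω) := by
  refine memLp_finsetSum _ fun i _ => memLp_finsetSum _ fun j _ => ?_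
  obtain ⟨C, hC0, hC⟩ := M.exists_pw_bound (P i j)
  have hfin : IsFiniteMeasure (vol Ω) := ⟨by
    rw [Measure.restrict_apply_univ]; exact hΩ.volume_lt_top⟩
  refine MemLp.of_bound ((ha i j).mul (M.measurable_pw _).aestronglyMeasurable) (β * C) ?_
  refine (ae_restrict_iff' hΩ.isOpen.measurableSet).2 (Eventually.of_forall fun x hx => ?_)
  rw [norm_mul]
  exact mul_le_mul (haβ x hx i j) (hC x) (abs_nonneg _) ((abs_nonneg _).trans (haβ x hx i j))

/-- On fine partitions, a weak function with vanishing stabilizer and vanishing discrete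
residual is zero. -/
theorem eq_zero_of_compatible (hΩ : IsPolytopalDomain Ω) {p : ℝ} (hp : 1 < p) {Creg : ℝ≥0}
    (hreg : ∀ f : E d → ℝ, MemLp f (ENNReal.ofReal p) (vol Ω) →
      ∀ u G H, IsW2p Ω p u G H → IsW01p Ω p u G →
      (∀ᵐ x ∂(vol Ω), ∑ i, ∑ j, a x i j * H i j x = f x) →
      normW2p Ω p u G H ≤ Creg * eLpNorm f (ENNReal.ofReal p) (vol Ω))
    (ha : ∀ i j, AEStronglyMeasurable (fun x => a x i j) (vol Ω)) {β : ℝ}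
    (haβ : ∀ x ∈ Ω, ∀ i j, |a x i j| ≤ β) {k l : ℕ} (hkl : k ≤ l + 2) {C₂ C ε : ℝ}
    (h₂ : M.InverseEstimate l 2 C₂) (h : M.InverseEstimate l p C) (hC₂ : 0 ≤ C₂) (hε : 0 ≤ ε)
    (hosc : ∀ t i j, ∀ x ∈ interior (M.elem t), ∀ y ∈ interior (M.elem t),
      |a x i j - a y i j| ≤ ε)
    (hsmall : ε ^ p * ((Creg : ℝ) ^ p
      * ((1 + C₂) ^ p * ((Fintype.card (Fin d × Fin d) : ℝ) ^ (p - 1) * C))) < 1)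
    {v : WeakFun M} (hv : v ∈ M.Vh0 k) (hc : M.Compatible v)
    (horth : ∀ w : Fin M.numElems → MvPolynomial (Fin d) ℝ, (∀ t, w t ∈ Poly d l) →
      ∑ t, ∫ x in M.elem t, (∑ i, ∑ j, a x i j
        * ev (MvPolynomial.pderiv j (MvPolynomial.pderiv i (v.1 t))) x) * ev (w t) x = 0) :
    v = 0 := by
  have hp0 : 0 < p := by linarith
  set K : ℝ := (1 + C₂) ^ p * ((Fintype.card (Fin d × Fin d) : ℝ) ^ (p - 1) * C) with hK
  let P : Fin d → Fin d → Fin M.numElems → MvPolynomial (Fin d) ℝ := fun i j t =>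
    MvPolynomial.pderiv j (MvPolynomial.pderiv i (v.1 t))
  have hPm : ∀ i j t, P i j t ∈ Poly d l := fun i j t =>
    poly_mono (by omega) (pderiv_mem_poly (pderiv_mem_poly (hv.1.1 t) i) j)
  let g : E d → ℝ := fun x => ∑ i, ∑ j, a x i j * M.pw (P i j) x
  have hgLp : MemLp g (ENNReal.ofReal p) (vol Ω) := memLp_coeff_pw hΩ ha haβ P _
  obtain ⟨hw2, hw0⟩ := hc.isW2p M hΩ hv hp0
  have hn := hreg g hgLp _ _ _ hw2 hw0 (Eventually.of_forall fun x => rfl)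
  have hX := sum_integral_hessian_le hp0 hw2 hgLp hn
  set X : ℝ := ∑ i, ∑ j, ∫ x in Ω, |M.pw (P i j) x| ^ p with hXdef
  have hpwLp : ∀ i j, IntegrableOn (fun x => |M.pw (P i j) x| ^ p) Ω := fun i j =>
    integrable_rpow_abs hp0 (M.memLp_pw hΩ _ _)
  have hai : ∀ t i j, IntegrableOn (fun x => a x i j) (M.elem t) := fun t i j =>
    M.integrableOn_elem_of_integrableOn hΩ (integrableOn_coeff hΩ ha haβ i j) t
  have hloc : ∀ t, ∀ ψ ∈ Poly d l,
      ∫ x in M.elem t, (∑ i, ∑ j, a x i j * ev (P i j t) x) * ev ψ x = 0 := fun t ψ hψ => by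
    classical
    have h1 := horth (Function.update 0 t ψ) fun s => by
      by_cases hst : s = t
      · subst hst; simpa using hψ
      · simp [Function.update_of_ne hst]
    rw [Finset.sum_eq_single t (fun s _ hst => by simp [Function.update_of_ne hst])
      (by simp)] at h1
    simpa using h1
  have hY : ∫ x in Ω, |g x| ^ p ≤ K * ε ^ p * X := by
    rw [M.integral_eq_sum_elem hΩ (integrable_rpow_abs hp0 hgLp)]
    have e1 : ∀ t, ∫ x in M.elem t, |g x| ^ p
        ≤ K * ε ^ p * ∑ i, ∑ j, ∫ x in M.elem t, |M.pw (P i j) x| ^ p := fun t => by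
      have h1 := h₂.integral_orthogonal_le h hp.le hC₂ (t := t) (ι := Fin d × Fin d)
        (b := fun q x => a x q.1 q.2) (fun q => hai t q.1 q.2) hε
        (fun q => hosc t q.1 q.2) (P := fun q => P q.1 q.2 t) (fun q => hPm q.1 q.2 t)
        (fun ψ hψ => by
          simp only [Fintype.sum_prod_type]
          exact hloc t ψ hψ)
      simp only [Fintype.sum_prod_type] at h1
      have e2 : ∫ x in M.elem t, |g x| ^ p
          = ∫ x in M.elem t, |∑ i, ∑ j, a x i j * ev (P i j t) x| ^ p :=
        M.setIntegral_elem_congr t fun x hx => by simp only [g, M.pw_apply _ hx]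
      have e3 : ∀ i j, ∫ x in M.elem t, |M.pw (P i j) x| ^ p
          = ∫ x in M.elem t, |ev (P i j t) x| ^ p := fun i j =>
        M.setIntegral_elem_congr t fun x hx => by simp only [M.pw_apply _ hx]
      simp only [e2, e3]
      exact h1
    refine (Finset.sum_le_sum fun t _ => e1 t).trans (le_of_eq ?_)
    rw [← Finset.mul_sum, hXdef, Finset.sum_comm]
    congr 1
    refine Finset.sum_congr rfl fun i _ => ?_
    rw [Finset.sum_comm]
    refine Finset.sum_congr rfl fun j _ => ?_
    rw [M.integral_eq_sum_elem hΩ (hpwLp i j)]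
  have hX0 : 0 ≤ X := Finset.sum_nonneg fun i _ => Finset.sum_nonneg fun j _ =>
    integral_nonneg fun x => by positivity
  -- The regularity estimate bounds `X` by a multiple of the integral of `|g| ^ p`, which
  -- orthogonality bounds by a multiple of `ε ^ p * X`. The product of the two constants is less
  -- than one by `hsmall`.
  have hXz : X = 0 := by
    have h1 : X ≤ (Creg : ℝ) ^ p * (K * ε ^ p * X) :=
      hX.trans (mul_le_mul_of_nonneg_left hY (by positivity))
    by_contra hne
    have hXpos := lt_of_le_of_ne hX0 (Ne.symm hne)
    have h2 : ε ^ p * ((Creg : ℝ) ^ p * K) * X < 1 * X := mul_lt_mul_of_pos_right hsmall hXpos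
    nlinarith
  have hgz : eLpNorm g (ENNReal.ofReal p) (vol Ω) = 0 := by
    have h1 : ∫ x in Ω, |g x| ^ p = 0 := le_antisymm (by rw [hXz, mul_zero] at hY; exact hY)
      (integral_nonneg fun x => by positivity)
    have h2 := integral_rpow_abs_eq hp0 hgLp
    rw [h1, ENNReal.ofReal_zero] at h2
    exact (ENNReal.rpow_eq_zero_iff_of_pos hp0).1 h2
  -- Now `𝓛 v_0 = 0`, and the regularity estimate, used once more in full, gives `v_0 = 0` rather
  -- than only a vanishing Hessian.
  rw [hgz, mul_zero, nonpos_iff_eq_zero, normW2p, ENNReal.rpow_eq_zero_iff_of_pos (by positivity),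
    add_eq_zero, add_eq_zero] at hn
  have hu : eLpNorm (M.pw v.1) (ENNReal.ofReal p) (vol Ω) = 0 :=
    (ENNReal.rpow_eq_zero_iff_of_pos hp0).1 hn.1.1
  rw [eLpNorm_eq_zero_iff (M.measurable_pw _).aestronglyMeasurable (by simpa using hp0)] at hu
  refine hc.eq_zero M hv.1 (funext fun t => ?_)
  refine M.eq_zero_of_integral_elem_sq (t := t) ?_
  have hu' : ∀ᵐ x ∂(volume.restrict (M.elem t)), M.pw v.1 x = 0 := by
    rw [Measure.restrict_congr_set (M.elem_ae_eq_interior t)]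
    exact ae_restrict_of_ae_restrict_of_subset (M.interior_elem_subset hΩ t) hu
  rw [← M.setIntegral_elem_congr t (f := fun x => M.pw v.1 x * M.pw v.1 x)
    (fun x hx => by simp only [M.pw_apply _ hx])]
  exact integral_eq_zero_of_ae (by filter_upwards [hu'] with x hx; simp [hx])

/-- The weight `lam` decides which factor is made small; it makes the Hessian term absorbable, at
the price of a large factor on the term that `ε` controls. The factors `1 / p` and `1 / q` are
dropped. -/
theorem abs_mul_le_young {p q lam : ℝ} (hpq : p.HolderConjugate q) (hl : 0 < lam) (x y : ℝ) :
    |x * y| ≤ lam ^ p * |x| ^ p + (lam⁻¹) ^ q * |y| ^ q := by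
  have h1 := Real.young_inequality_of_nonneg (a := lam * |x|) (b := lam⁻¹ * |y|) (by positivity)
    (by positivity) hpq
  have h2 : lam * |x| * (lam⁻¹ * |y|) = |x * y| := by rw [abs_mul]; field_simp
  rw [h2, Real.mul_rpow hl.le (abs_nonneg _), Real.mul_rpow (by positivity) (abs_nonneg _)] at h1
  refine h1.trans (add_le_add ?_ ?_)
  · exact div_le_self (by positivity) hpq.lt.le
  · exact div_le_self (by positivity) hpq.symm.lt.le

/-- On fine partitions the discrete operator is surjective: no piecewise polynomial is orthogonal
to its range. -/
theorem eq_zero_of_orthogonal (hΩ : IsPolytopalDomain Ω) {p q : ℝ} (hpq : p.HolderConjugate q)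
    {Creg : ℝ≥0}
    (hreg : ∀ f : E d → ℝ, MemLp f (ENNReal.ofReal p) (vol Ω) →
      (∃ u G H, IsW2p Ω p u G H ∧ IsW01p Ω p u G ∧
        ∀ᵐ x ∂(vol Ω), ∑ i, ∑ j, a x i j * H i j x = f x) ∧
      ∀ u G H, IsW2p Ω p u G H → IsW01p Ω p u G →
      (∀ᵐ x ∂(vol Ω), ∑ i, ∑ j, a x i j * H i j x = f x) →
      normW2p Ω p u G H ≤ Creg * eLpNorm f (ENNReal.ofReal p) (vol Ω))
    (ha : ∀ i j, AEStronglyMeasurable (fun x => a x i j) (vol Ω)) {β : ℝ}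
    (haβ : ∀ x ∈ Ω, ∀ i j, |a x i j| ≤ β) {k l : ℕ} (hlk : l + 1 ≤ k) {C₂ C ε lam : ℝ}
    (h₂ : M.InverseEstimate l 2 C₂) (h : M.InverseEstimate l q C) (hC₂ : 0 ≤ C₂) (hε : 0 ≤ ε)
    (hosc : ∀ t i j, ∀ x ∈ interior (M.elem t), ∀ y ∈ interior (M.elem t),
      |a x i j - a y i j| ≤ ε)
    (hlam : 0 < lam)
    (hsmall : lam ^ p * (Creg : ℝ) ^ p
      + ε ^ q * ((lam⁻¹) ^ q * ((d : ℝ) * (d * ((1 + C₂) ^ q * C)))) < 1)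
    {σ : Fin M.numElems → MvPolynomial (Fin d) ℝ} (hσ : ∀ t, σ t ∈ Poly d l)
    (horth : ∀ v ∈ M.Vh0 k, ∀ H, M.IsWeakHessian l v H →
      ∑ t, ∫ x in M.elem t, (∑ i, ∑ j, a x i j * ev (H t i j) x) * ev (σ t) x = 0) :
    σ = 0 := by
  have hp0 : 0 < p := hpq.pos
  have hq0 : 0 < q := hpq.symm.pos
  have hfin : IsFiniteMeasure (vol Ω) := ⟨by
    rw [Measure.restrict_apply_univ]; exact hΩ.volume_lt_top⟩
  have hai : ∀ t i j, IntegrableOn (fun x => a x i j) (M.elem t) := fun t i j =>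
    M.integrableOn_elem_of_integrableOn hΩ (integrableOn_coeff hΩ ha haβ i j) t
  have hmulI : ∀ t (b : E d → ℝ) (R : MvPolynomial (Fin d) ℝ), IntegrableOn b (M.elem t) →
      IntegrableOn (fun x => b x * ev R x) (M.elem t) := fun t b R hb =>
    M.integrableOn_mul_ev hb R
  -- The weak Hessian has degree at most `l`, so pairing it with `a_ij σ` is the same as pairing it
  -- with this projection. This turns orthogonality to the range into a statement about the
  -- polynomial tensor `τ`.
  choose τ hτm hτ using fun i j t => M.exists_projection l t (hmulI t _ (σ t) (hai t i j))
  have hzero : ∀ v ∈ M.Vh0 k, ∑ t, ∑ i, ∑ j, M.hessianFunctional v t i j (τ i j t) = 0 :=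
    fun v hv => by
      obtain ⟨H, hH⟩ := M.exists_isWeakHessian l hv.1
      rw [← horth v hv H hH]
      refine Finset.sum_congr rfl fun t _ => ?_
      have hi : ∀ i j, IntegrableOn (fun x => a x i j * ev (σ t) x * ev (H t i j) x) (M.elem t) :=
        fun i j => hmulI t _ _ (hmulI t _ _ (hai t i j))
      have e1 : ∫ x in M.elem t, (∑ i, ∑ j, a x i j * ev (H t i j) x) * ev (σ t) x
          = ∑ i, ∑ j, ∫ x in M.elem t, a x i j * ev (σ t) x * ev (H t i j) x := by
        rw [← Finset.sum_congr rfl fun i _ => integral_finsetSum _ fun j _ => hi i j,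
          ← integral_finsetSum _ fun i _ => integrable_finsetSum _ fun j _ => hi i j]
        refine integral_congr_ae (Eventually.of_forall fun x => ?_)
        simp only [Finset.sum_mul]
        exact Finset.sum_congr rfl fun i _ => Finset.sum_congr rfl fun j _ => by ring
      rw [e1]
      refine Finset.sum_congr rfl fun i _ => Finset.sum_congr rfl fun j _ => ?_
      rw [← hτ i j t _ (hH t i j).1, hessianFunctional, ← (hH t i j).2 _ (hτm i j t)]
      exact integral_congr_ae (Eventually.of_forall fun x => mul_comm _ _)
  obtain ⟨hD, hJ, hR⟩ := M.jump_eq_zero_of_orthogonal hlk hτm hzero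
  -- the dual solution
  let S : E d → ℝ := M.pw σ
  have hSm : Measurable S := M.measurable_pw σ
  -- The function dual to `S`: it satisfies `f * S = |S| ^ q` and `|f| ^ p = |S| ^ q`.
  let f : E d → ℝ := fun x => SignType.sign (S x) * |S x| ^ (q - 1)
  obtain ⟨B, hB0, hB⟩ := M.exists_pw_bound σ
  have hfabs : ∀ x, |f x| ^ p = |S x| ^ q := fun x => by
    by_cases hx : S x = 0
    · simp [f, hx, Real.zero_rpow hp0.ne', Real.zero_rpow hq0.ne']
    · have h1 : |f x| = |S x| ^ (q - 1) := by
        simp only [f]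
        rw [abs_mul, abs_of_nonneg (by positivity : 0 ≤ |S x| ^ (q - 1))]
        rcases lt_or_gt_of_ne hx with h' | h' <;> simp [h']
      rw [h1, ← Real.rpow_mul (abs_nonneg _), hpq.symm.sub_one_mul_conj]
  have hfS : ∀ x, f x * S x = |S x| ^ q := fun x => by
    by_cases hx : S x = 0
    · simp [f, hx, Real.zero_rpow hq0.ne']
    · have h1 : (SignType.sign (S x) : ℝ) * S x = |S x| := sign_mul_self _
      have h2 : |S x| ^ q = |S x| ^ (q - 1) * |S x| := by
        rw [← Real.rpow_add_one (abs_pos.2 hx).ne', sub_add_cancel]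
      simp only [f]
      rw [h2, ← h1]
      ring
  have hfm : Measurable f := by
    have h1 : f = fun x => (if 0 < S x then 1 else if S x < 0 then -1 else 0) * |S x| ^ (q - 1) := by
      funext x
      rcases lt_trichotomy (S x) 0 with h' | h' | h' <;> simp [f, h', not_lt.2 h'.le]
    rw [h1]
    exact (Measurable.ite (measurableSet_lt measurable_const hSm) measurable_const
      (Measurable.ite (measurableSet_lt hSm measurable_const) measurable_const
        measurable_const)).mul (hSm.abs.pow_const _)
  have hfLp : MemLp f (ENNReal.ofReal p) (vol Ω) := by
    refine MemLp.of_bound hfm.aestronglyMeasurable (B ^ (q - 1)) (Eventually.of_forall fun x => ?_)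
    have h1 : |(SignType.sign (S x) : ℝ)| ≤ 1 := by
      rcases lt_trichotomy (S x) 0 with h' | h' | h' <;> simp [h']
    rw [Real.norm_eq_abs, abs_mul, abs_of_nonneg (by positivity : 0 ≤ |S x| ^ (q - 1))]
    exact (mul_le_of_le_one_left (by positivity) h1).trans
      (Real.rpow_le_rpow (abs_nonneg _) (hB x) hpq.symm.sub_one_pos.le)
  obtain ⟨⟨u, G, H, hw2, hw0, hL⟩, hn⟩ := hreg f hfLp
  have hX := sum_integral_hessian_le hp0 hw2 hfLp (hn u G H hw2 hw0 hL)
  set Z : ℝ := ∫ x in Ω, |S x| ^ q with hZ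
  simp only [hfabs] at hX
  have hHi : ∀ i j, IntegrableOn (H i j) Ω := fun i j =>
    (hw2.memLp_hess i j).integrable (by simpa using hpq.lt.le)
  have hmul : ∀ (g : E d → ℝ) P, IntegrableOn g Ω → IntegrableOn (fun x => g x * M.pw P x) Ω :=
    fun g P hg => by simpa only [mul_comm] using M.integrableOn_pw_mul P hg
  have hHτ := M.integral_hessian_eq_zero hΩ hpq.lt.le hD hJ hR hw2 hw0
  -- As `τ` is orthogonal to the Hessian of the dual solution, it can be subtracted from `aσ` in the
  -- integral. What remains is the projection error, of order `ε`.
  let y : Fin d → Fin d → E d → ℝ := fun i j x => a x i j * S x - M.pw (τ i j) x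
  have hyi : ∀ i j, IntegrableOn (fun x => H i j x * y i j x) Ω := fun i j => by
    have h1 := (integrableOn_coeff_mul hΩ ha haβ (hmul _ σ (hHi i j)) i j).sub
      (hmul _ (τ i j) (hHi i j))
    exact h1.congr (Eventually.of_forall fun x => by simp only [y, S, Pi.sub_apply]; ring)
  have hZeq : Z = ∑ i, ∑ j, ∫ x in Ω, H i j x * y i j x := by
    rw [← Finset.sum_congr rfl fun i _ => integral_finsetSum _ fun j _ => hyi i j,
      ← integral_finsetSum _ fun i _ => integrable_finsetSum _ fun j _ => hyi i j]
    have hi1 : IntegrableOn (fun x => ∑ i, ∑ j, H i j x * M.pw (τ i j) x) Ω :=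
      integrable_finsetSum _ fun i _ => integrable_finsetSum _ fun j _ => hmul _ _ (hHi i j)
    have hi2 : IntegrableOn (fun x => ∑ i, ∑ j, H i j x * y i j x) Ω :=
      integrable_finsetSum _ fun i _ => integrable_finsetSum _ fun j _ => hyi i j
    rw [← add_zero (∫ x in Ω, ∑ i, ∑ j, H i j x * y i j x), ← hHτ, ← integral_add hi2 hi1]
    refine integral_congr_ae ?_
    filter_upwards [hL] with x hx
    rw [← hfS x, ← hx, Finset.sum_mul, ← Finset.sum_add_distrib]
    refine Finset.sum_congr rfl fun i _ => ?_
    rw [Finset.sum_mul, ← Finset.sum_add_distrib]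
    refine Finset.sum_congr rfl fun j _ => ?_
    simp only [y]
    ring
  have hSLp : IntegrableOn (fun x => |S x| ^ q) Ω :=
    integrable_rpow_abs hq0 (M.memLp_pw hΩ _ _)
  have hyLp : ∀ i j, MemLp (y i j) (ENNReal.ofReal q) (vol Ω) := fun i j => by
    refine MemLp.sub ?_ (M.memLp_pw hΩ _ _)
    refine MemLp.of_bound ((ha i j).mul hSm.aestronglyMeasurable) (β * B) ?_
    refine (ae_restrict_iff' hΩ.isOpen.measurableSet).2 (Eventually.of_forall fun x hx => ?_)
    rw [norm_mul]
    exact mul_le_mul (haβ x hx i j) (hB x) (abs_nonneg _) ((abs_nonneg _).trans (haβ x hx i j))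
  set K : ℝ := (1 + C₂) ^ q * C with hK
  have hy : ∀ i j, ∫ x in Ω, |y i j x| ^ q ≤ K * ε ^ q * Z := fun i j => by
    rw [M.integral_eq_sum_elem hΩ (integrable_rpow_abs hq0 (hyLp i j)), hZ,
      M.integral_eq_sum_elem hΩ hSLp, Finset.mul_sum]
    refine Finset.sum_le_sum fun t _ => ?_
    have e2 : ∫ x in M.elem t, |y i j x| ^ q
        = ∫ x in M.elem t, |a x i j * ev (σ t) x - ev (τ i j t) x| ^ q :=
      M.setIntegral_elem_congr t fun x hx => by simp only [y, S, M.pw_apply _ hx]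
    have e3 : ∫ x in M.elem t, |S x| ^ q = ∫ x in M.elem t, |ev (σ t) x| ^ q :=
      M.setIntegral_elem_congr t fun x hx => by simp only [S, M.pw_apply _ hx]
    rw [e2, e3]
    exact h₂.integral_sub_projection_le h hq0 hC₂ (hai t i j) hε (hosc t i j) (hσ t) (hτm i j t)
      (hτ i j t)
  have hest : ∀ i j, ∫ x in Ω, H i j x * y i j x
      ≤ lam ^ p * (∫ x in Ω, |H i j x| ^ p) + (lam⁻¹) ^ q * (K * ε ^ q * Z) := fun i j => by
    have hi1 : IntegrableOn (fun x => lam ^ p * |H i j x| ^ p) Ω :=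
      (integrable_rpow_abs hp0 (hw2.memLp_hess i j)).const_mul _
    have hi2 : IntegrableOn (fun x => (lam⁻¹) ^ q * |y i j x| ^ q) Ω :=
      (integrable_rpow_abs hq0 (hyLp i j)).const_mul _
    calc _ ≤ ∫ x in Ω, (lam ^ p * |H i j x| ^ p + (lam⁻¹) ^ q * |y i j x| ^ q) :=
          integral_mono (hyi i j) (hi1.add hi2) fun x =>
            (le_abs_self _).trans (abs_mul_le_young hpq hlam _ _)
      _ = lam ^ p * (∫ x in Ω, |H i j x| ^ p) + (lam⁻¹) ^ q * ∫ x in Ω, |y i j x| ^ q := by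
          rw [integral_add hi1 hi2, integral_const_mul, integral_const_mul]
      _ ≤ _ := by
          have := hy i j
          gcongr
  have hZ0 : 0 ≤ Z := integral_nonneg fun x => by positivity
  -- Both terms are multiples of `Z`: the Hessian is controlled through `f` and regularity, the
  -- projection error directly. By `hsmall` the total factor is less than one.
  have hZz : Z = 0 := by
    have h1 : Z ≤ lam ^ p * (∑ i, ∑ j, ∫ x in Ω, |H i j x| ^ p)
        + (d : ℝ) * (d * ((lam⁻¹) ^ q * (K * ε ^ q * Z))) := by
      calc Z = ∑ i, ∑ j, ∫ x in Ω, H i j x * y i j x := hZeq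
        _ ≤ ∑ i, ∑ j, (lam ^ p * (∫ x in Ω, |H i j x| ^ p) + (lam⁻¹) ^ q * (K * ε ^ q * Z)) :=
            Finset.sum_le_sum fun i _ => Finset.sum_le_sum fun j _ => hest i j
        _ = _ := by simp [Finset.sum_add_distrib, Finset.mul_sum]
    have h2 : lam ^ p * (∑ i, ∑ j, ∫ x in Ω, |H i j x| ^ p)
        ≤ lam ^ p * ((Creg : ℝ) ^ p * Z) := mul_le_mul_of_nonneg_left hX (by positivity)
    by_contra hne
    have hZpos := lt_of_le_of_ne hZ0 (Ne.symm hne)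
    have h3 := mul_lt_mul_of_pos_right hsmall hZpos
    nlinarith
  funext t
  refine M.eq_zero_of_integral_elem_sq (t := t) ?_
  rw [hZ, setIntegral_eq_zero_iff_of_nonneg_ae (Eventually.of_forall fun x => by positivity)
    hSLp] at hZz
  have hu' : ∀ᵐ x ∂(volume.restrict (M.elem t)), S x = 0 := by
    rw [Measure.restrict_congr_set (M.elem_ae_eq_interior t)]
    filter_upwards [ae_restrict_of_ae_restrict_of_subset (M.interior_elem_subset hΩ t) hZz]
      with x hx
    exact abs_eq_zero.1 ((Real.rpow_eq_zero (abs_nonneg _) hq0.ne').1 hx)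
  rw [← M.setIntegral_elem_congr t (f := fun x => S x * S x)
    (fun x hx => by simp only [S, M.pw_apply _ hx])]
  exact integral_eq_zero_of_ae (by filter_upwards [hu'] with x hx; simp [hx])

end

end Mesh

/-! ### Strict convexity and minimization of homogeneous functions -/

/-- For unequal norms the strictness comes from the power function on the half-line, for equal norms
from the strict convexity of balls. -/
theorem strictConvexOn_norm_rpow {V : Type*} [NormedAddCommGroup V] [NormedSpace ℝ V]
    [StrictConvexSpace ℝ V] {p : ℝ} (hp : 1 < p) :
    StrictConvexOn ℝ Set.univ fun x : V => ‖x‖ ^ p := by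
  refine ⟨convex_univ, fun x _ y _ hxy a b ha hb hab => ?_⟩
  have hp0 : 0 < p := by linarith
  have hle : ‖a • x + b • y‖ ≤ a * ‖x‖ + b * ‖y‖ := by
    refine (norm_add_le _ _).trans (le_of_eq ?_)
    rw [norm_smul, norm_smul, Real.norm_of_nonneg ha.le, Real.norm_of_nonneg hb.le]
  simp only [smul_eq_mul]
  by_cases h : ‖x‖ = ‖y‖
  · have h1 : ‖a • x + b • y‖ < ‖y‖ := norm_combo_lt_of_ne h.le le_rfl hxy ha hb hab
    have h2 := Real.rpow_lt_rpow (norm_nonneg _) h1 hp0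
    rwa [h, ← add_mul, hab, one_mul]
  · have h1 := (strictConvexOn_rpow hp).2 (norm_nonneg x) (norm_nonneg y) h ha hb hab
    exact (Real.rpow_le_rpow (norm_nonneg _) hle hp0.le).trans_lt h1

/-- The case `r = 2` is a power of the Euclidean norm. For `r = p` the outer exponent is one, and a
separate sum of strictly convex functions of the coordinates remains. -/
theorem strictConvexOn_sum_rpow {ι : Type*} [Fintype ι] {p r : ℝ} (hp : 1 < p)
    (hr : r = 2 ∨ r = p) :
    StrictConvexOn ℝ Set.univ fun B : ι → ℝ => (∑ i, |B i| ^ r) ^ (p / r) := by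
  rcases hr with rfl | rfl
  · have h : ∀ B : ι → ℝ, (∑ i, |B i| ^ (2 : ℝ)) ^ (p / 2) = ‖WithLp.toLp 2 B‖ ^ p := fun B => by
      rw [EuclideanSpace.norm_eq, Real.sqrt_eq_rpow, ← Real.rpow_mul (by positivity)]
      simp [div_eq_inv_mul]
    simp only [h]
    refine ⟨convex_univ, fun x _ y _ hxy a b ha hb hab => ?_⟩
    exact (strictConvexOn_norm_rpow hp).2 (x := WithLp.toLp 2 x) (y := WithLp.toLp 2 y) trivial
      trivial (fun h => hxy (WithLp.toLp_injective 2 h)) ha hb hab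
  · have hs := strictConvexOn_norm_rpow (V := ℝ) hp
    simp only [div_self (by linarith : r ≠ 0), Real.rpow_one]
    refine ⟨convex_univ, fun x _ y _ hxy a b ha hb hab => ?_⟩
    obtain ⟨i, hi⟩ := Function.ne_iff.1 hxy
    simp only [smul_eq_mul, Finset.mul_sum, ← Finset.sum_add_distrib]
    refine Finset.sum_lt_sum (fun j _ => ?_) ⟨i, Finset.mem_univ i, ?_⟩
    · exact hs.convexOn.2 (x := x j) (y := y j) trivial trivial ha.le hb.le hab
    · exact hs.2 (x := x i) (y := y i) trivial trivial hi ha hb hab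

/-- The integrand of the stabilizer as a function of the jumps. -/
def jumpEnergy {d : ℕ} (c₁ c₂ p r : ℝ) (z : ℝ × (Fin d → ℝ)) : ℝ :=
  c₁ * |z.1| ^ p + c₂ * (∑ i, |z.2 i| ^ r) ^ (p / r)

theorem strictConvexOn_jumpEnergy {d : ℕ} {c₁ c₂ p r : ℝ} (h₁ : 0 < c₁) (h₂ : 0 < c₂) (hp : 1 < p)
    (hr : r = 2 ∨ r = p) : StrictConvexOn ℝ Set.univ (jumpEnergy (d := d) c₁ c₂ p r) := by
  have hs := strictConvexOn_norm_rpow (V := ℝ) hp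
  have hs' := strictConvexOn_sum_rpow (ι := Fin d) hp hr
  refine ⟨convex_univ, fun x _ y _ hxy a b ha hb hab => ?_⟩
  have e1 := hs.convexOn.2 (x := x.1) (y := y.1) trivial trivial ha.le hb.le hab
  have e2 := hs'.convexOn.2 (x := x.2) (y := y.2) trivial trivial ha.le hb.le hab
  simp only [smul_eq_mul, Real.norm_eq_abs] at e1 e2
  simp only [jumpEnergy, smul_eq_mul, Prod.fst_add, Prod.smul_fst, Prod.snd_add, Prod.smul_snd]
  by_cases h : x.1 = y.1
  · have h' : x.2 ≠ y.2 := fun h' => hxy (Prod.ext h h')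
    have e3 := hs'.2 (x := x.2) (y := y.2) trivial trivial h' ha hb hab
    simp only [smul_eq_mul] at e3
    have := mul_le_mul_of_nonneg_left e1 h₁.le
    have := mul_lt_mul_of_pos_left e3 h₂
    linarith
  · have e3 := hs.2 (x := x.1) (y := y.1) trivial trivial h ha hb hab
    simp only [smul_eq_mul, Real.norm_eq_abs] at e3
    have := mul_lt_mul_of_pos_left e3 h₁
    have := mul_le_mul_of_nonneg_left e2 h₂.le
    linarith

theorem jumpEnergy_smul {d : ℕ} {c₁ c₂ p r : ℝ} (hr : 0 < r) (c : ℝ)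
    (z : ℝ × (Fin d → ℝ)) : jumpEnergy c₁ c₂ p r (c • z) = |c| ^ p * jumpEnergy c₁ c₂ p r z := by
  simp only [jumpEnergy, Prod.smul_fst, Prod.smul_snd, Pi.smul_apply, smul_eq_mul, abs_mul]
  rw [Real.mul_rpow (abs_nonneg _) (abs_nonneg _)]
  simp only [Real.mul_rpow (abs_nonneg _) (abs_nonneg _), ← Finset.mul_sum]
  rw [Real.mul_rpow (by positivity) (by positivity), ← Real.rpow_mul (abs_nonneg _),
    mul_div_cancel₀ _ hr.ne']
  ring

/-- A convex, homogeneous function attains its minimum on an affine subspace exactly once if it is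
strictly convex there. -/
theorem existsUnique_forall_le {F D : Type*} [AddCommGroup F] [Module ℝ F] [FiniteDimensional ℝ F]
    [AddCommGroup D] [Module ℝ D] (L : F →ₗ[ℝ] D) {b : D} (hb : b ∈ LinearMap.range L) {s : F → ℝ}
    {p : ℝ} (hp : 0 < p) (hconv : ConvexOn ℝ Set.univ s)
    (hhom : ∀ (c : ℝ) v, s (c • v) = |c| ^ p * s v)
    (hstrict : ∀ u v, L u = L v → u ≠ v →
      s ((1 / 2 : ℝ) • u + (1 / 2 : ℝ) • v) < 1 / 2 * s u + 1 / 2 * s v) :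
    ∃! u, L u = b ∧ ∀ v, L v = b → s u ≤ s v := by
  obtain ⟨u₀, hu₀⟩ := hb
  -- The solution set is `u₀` plus the kernel, described by coordinates of the kernel. As `F`
  -- carries no topology, continuity and compactness are stated in these coordinates, where
  -- convexity implies continuity.
  let K := LinearMap.ker L
  let B : K ≃ₗ[ℝ] (Fin (Module.finrank ℝ K) → ℝ) := (Module.finBasis ℝ K).equivFun
  let g : (Fin (Module.finrank ℝ K) → ℝ) →ₗ[ℝ] F := K.subtype ∘ₗ B.symm.toLinearMap
  have hgL : ∀ x, L (g x) = 0 := fun x => (B.symm x).2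
  have hg0 : ∀ x, x ≠ 0 → g x ≠ 0 := fun x hx h =>
    hx (B.symm.map_eq_zero_iff.1 (Subtype.ext h))
  have hgs : ∀ v, L v = b → ∃ x, v = u₀ + g x := fun v hv => by
    refine ⟨B ⟨v - u₀, by simp [K, hv, hu₀]⟩, ?_⟩
    simp [g]
  have hs0 : s 0 = 0 := by
    have := hhom 0 0
    rwa [zero_smul, abs_zero, Real.zero_rpow hp.ne', zero_mul] at this
  have hsneg : ∀ v, s (-v) = s v := fun v => by
    have := hhom (-1) v
    simpa using this
  -- Strictness at the midpoint of `v` and `-v`, combined with evenness and `s 0 = 0`, makes `s`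
  -- positive on nonzero kernel elements. By homogeneity and compactness it then dominates a
  -- multiple of `‖x‖ ^ p`.
  have hpos : ∀ x, x ≠ 0 → 0 < s (g x) := fun x hx => by
    have h1 := hstrict (g x) (-g x) (by rw [map_neg, hgL, neg_zero])
      (fun h => hg0 x hx (by
        have h' : (2 : ℝ) • g x = 0 := by rw [two_smul]; nth_rewrite 1 [h]; exact neg_add_cancel _
        exact (smul_eq_zero.1 h').resolve_left two_ne_zero))
    rw [smul_neg, add_neg_cancel, hs0, hsneg] at h1
    linarith
  have hcψ : Continuous fun x => s (g x) := by
    rw [← continuousOn_univ]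
    exact (hconv.comp_linearMap g).continuousOn isOpen_univ
  have hcφ : Continuous fun x => s (u₀ + g x) := by
    rw [← continuousOn_univ]
    have := (hconv.translate_right u₀).comp_linearMap g
    exact ConvexOn.continuousOn isOpen_univ this
  have hbd : Bornology.IsBounded {x | s (u₀ + g x) ≤ s (u₀ + g 0)} := by
    obtain ⟨m, hm, hm'⟩ := (isCompact_sphere (0 : Fin (Module.finrank ℝ K) → ℝ) 1).exists_forall_le'
      hcψ.continuousOn (a := 0) fun x hx => hpos x fun h => by simp [h] at hx
    have hlow : ∀ x, m * ‖x‖ ^ p ≤ s (g x) := fun x => by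
      by_cases hx : x = 0
      · simp [hx, hs0, Real.zero_rpow hp.ne']
      · have hx' := norm_pos_iff.2 hx
        have h1 := hm' (‖x‖⁻¹ • x) (by simp [norm_smul, hx'.ne'])
        have h2 := hhom ‖x‖ (g (‖x‖⁻¹ • x))
        rw [← map_smul, smul_smul, mul_inv_cancel₀ hx'.ne', one_smul, abs_norm] at h2
        rw [h2, mul_comm]
        exact mul_le_mul_of_nonneg_left h1 (by positivity)
    refine (Metric.isBounded_closedBall (x := 0)
      (r := (2 ^ p * s u₀ / m) ^ (1 / p))).subset fun x hx => ?_
    simp only [Set.mem_ofPred_eq, map_zero, add_zero] at hx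
    have h1 := hconv.2 (x := u₀ + g x) (Set.mem_univ _) (y := -u₀) (Set.mem_univ _)
      (by norm_num : (0 : ℝ) ≤ 1 / 2) (by norm_num : (0 : ℝ) ≤ 1 / 2) (by norm_num)
    -- Writing `g x = (u₀ + g x) - u₀` as twice a midpoint gives, by convexity, `s (g x) ≤ 2 ^ p * s
    -- u₀` on the sublevel set. So this set is bounded.
    have h2 : s (g x) = 2 ^ p * s ((1 / 2 : ℝ) • (u₀ + g x) + (1 / 2 : ℝ) • (-u₀)) := by
      have := hhom 2 ((1 / 2 : ℝ) • (u₀ + g x) + (1 / 2 : ℝ) • (-u₀))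
      rw [abs_two] at this
      rw [← this]
      congr 1
      module
    rw [hsneg] at h1
    simp only [smul_eq_mul] at h1
    have h3 : m * ‖x‖ ^ p ≤ 2 ^ p * s u₀ := by
      refine (hlow x).trans ?_
      rw [h2]
      exact mul_le_mul_of_nonneg_left (by linarith) (by positivity)
    have h4 : ‖x‖ ^ p ≤ 2 ^ p * s u₀ / m := by rwa [le_div_iff₀ hm, mul_comm]
    rw [mem_closedBall_zero_iff, one_div]
    exact (Real.le_rpow_inv_iff_of_pos (norm_nonneg _)
      ((Real.rpow_nonneg (norm_nonneg _) _).trans h4) hp).2 h4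
  obtain ⟨x, hx⟩ := hcφ.exists_forall_le_of_isBounded 0 hbd
  refine ⟨u₀ + g x, ⟨by rw [map_add, hgL, add_zero, hu₀], fun v hv => ?_⟩, fun v ⟨hv, hvm⟩ => ?_⟩
  · obtain ⟨y, rfl⟩ := hgs v hv
    exact hx y
  · by_contra hne
    have hu : L (u₀ + g x) = b := by rw [map_add, hgL, add_zero, hu₀]
    have h1 := hstrict v (u₀ + g x) (hv.trans hu.symm) hne
    have h2 := hvm _ hu
    have h3 : L ((1 / 2 : ℝ) • v + (1 / 2 : ℝ) • (u₀ + g x)) = b := by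
      rw [map_add, map_smul, map_smul, hu, hv, ← add_smul]; norm_num
    have h4 := hvm _ h3
    obtain ⟨y, hy⟩ := hgs v hv
    have h5 := hx y
    rw [← hy] at h5
    linarith

namespace Mesh

section

variable {d : ℕ} {Ω : Set (E d)} (M : Mesh Ω)

/-! ### The constraint as a linear equation -/

theorem hessianFunctional_add_left {k : ℕ} {v w : WeakFun M} (hv : v ∈ M.Vh k) (hw : w ∈ M.Vh k)
    (t : Fin M.numElems) (i j : Fin d) (ψ : MvPolynomial (Fin d) ℝ) :
    M.hessianFunctional (v + w) t i j ψ
      = M.hessianFunctional v t i j ψ + M.hessianFunctional w t i j ψ := by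
  simp only [M.hessianFunctional_eq, Prod.fst_add, Prod.snd_add, Pi.add_apply,
    ev_add, add_mul]
  rw [integral_add (M.integrableOn_elem (by fun_prop) t) (M.integrableOn_elem (by fun_prop) t)]
  have h1 : ∀ e (P : MvPolynomial (Fin d) ℝ),
      ∫ x in M.face e, v.2.1 e x * ev P x + w.2.1 e x * ev P x ∂(surf d)
      = (∫ x in M.face e, v.2.1 e x * ev P x ∂(surf d))
        + ∫ x in M.face e, w.2.1 e x * ev P x ∂(surf d) := fun e P =>
    integral_add (M.integrableOn_face_mul (hv.2.1 e) (continuous_ev P))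
      (M.integrableOn_face_mul (hw.2.1 e) (continuous_ev P))
  have h2 : ∀ e (P : MvPolynomial (Fin d) ℝ),
      ∫ x in M.face e, v.2.2 e i x * ev P x + w.2.2 e i x * ev P x ∂(surf d)
      = (∫ x in M.face e, v.2.2 e i x * ev P x ∂(surf d))
        + ∫ x in M.face e, w.2.2 e i x * ev P x ∂(surf d) := fun e P =>
    integral_add (M.integrableOn_face_mul (hv.2.2 e i) (continuous_ev P))
      (M.integrableOn_face_mul (hw.2.2 e i) (continuous_ev P))
  simp only [h1, h2, mul_add, Finset.sum_add_distrib]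
  ring

theorem hessianFunctional_smul_left (v : WeakFun M) (c : ℝ)
    (t : Fin M.numElems) (i j : Fin d) (ψ : MvPolynomial (Fin d) ℝ) :
    M.hessianFunctional (c • v) t i j ψ = c * M.hessianFunctional v t i j ψ := by
  simp only [M.hessianFunctional_eq,
    Prod.smul_fst, Prod.smul_snd, Pi.smul_apply, smul_eq_mul, ev_smul, mul_assoc,
    integral_const_mul, mul_left_comm _ c, ← Finset.mul_sum]
  ring

theorem isWeakHessian_iff {l : ℕ} {v : WeakFun M}
    {H : Fin M.numElems → Fin d → Fin d → MvPolynomial (Fin d) ℝ} :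
    M.IsWeakHessian l v H ↔ ∀ t i j, H t i j ∈ Poly d l ∧ ∀ ψ ∈ Poly d l,
      ∫ x in M.elem t, ev (H t i j) x * ev ψ x = M.hessianFunctional v t i j ψ :=
  Iff.rfl

variable {M}

theorem IsWeakHessian.add {k l : ℕ} {v w : WeakFun M} (hv : v ∈ M.Vh k) (hw : w ∈ M.Vh k)
    {H H' : Fin M.numElems → Fin d → Fin d → MvPolynomial (Fin d) ℝ}
    (h : M.IsWeakHessian l v H) (h' : M.IsWeakHessian l w H') :
    M.IsWeakHessian l (v + w) (H + H') := by
  rw [isWeakHessian_iff] at h h' ⊢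
  refine fun t i j => ⟨Submodule.add_mem _ (h t i j).1 (h' t i j).1, fun ψ hψ => ?_⟩
  rw [M.hessianFunctional_add_left hv hw, ← (h t i j).2 ψ hψ, ← (h' t i j).2 ψ hψ]
  simp only [Pi.add_apply, ev_add, add_mul]
  exact integral_add (M.integrableOn_elem (by fun_prop) t) (M.integrableOn_elem (by fun_prop) t)

theorem IsWeakHessian.smul {l : ℕ} {v : WeakFun M} (c : ℝ)
    {H : Fin M.numElems → Fin d → Fin d → MvPolynomial (Fin d) ℝ}
    (h : M.IsWeakHessian l v H) : M.IsWeakHessian l (c • v) (c • H) := by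
  rw [isWeakHessian_iff] at h ⊢
  refine fun t i j => ⟨Submodule.smul_mem _ c (h t i j).1, fun ψ hψ => ?_⟩
  rw [M.hessianFunctional_smul_left, ← (h t i j).2 ψ hψ]
  simp only [Pi.smul_apply, ev_smul, mul_assoc]
  exact integral_const_mul _ _

variable (M)

/-- The weak Hessian as a linear map. -/
def weakHessian (k l : ℕ) :
    M.Vh0 k →ₗ[ℝ] (Fin M.numElems → Fin d → Fin d → MvPolynomial (Fin d) ℝ) where
  toFun v := (M.exists_isWeakHessian l v.2.1).choose
  map_add' v w := IsWeakHessian.unique M (M.exists_isWeakHessian l (v + w).2.1).choose_spec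
    (IsWeakHessian.add v.2.1 w.2.1 (M.exists_isWeakHessian l v.2.1).choose_spec
      (M.exists_isWeakHessian l w.2.1).choose_spec)
  map_smul' c v := IsWeakHessian.unique M (M.exists_isWeakHessian l (c • v).2.1).choose_spec
    (IsWeakHessian.smul c (M.exists_isWeakHessian l v.2.1).choose_spec)

theorem isWeakHessian_weakHessian (k l : ℕ) (v : M.Vh0 k) :
    M.IsWeakHessian l (v : WeakFun M) (M.weakHessian k l v) :=
  (M.exists_isWeakHessian l v.2.1).choose_spec

variable {a : E d → Matrix (Fin d) (Fin d) ℝ}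

theorem integrableOn_operator_mul (ha : ∀ t i j, IntegrableOn (fun x => a x i j) (M.elem t))
    (t : Fin M.numElems) (H : Fin d → Fin d → MvPolynomial (Fin d) ℝ)
    (Q : MvPolynomial (Fin d) ℝ) :
    IntegrableOn (fun x => (∑ i, ∑ j, a x i j * ev (H i j) x) * ev Q x) (M.elem t) :=
  M.integrableOn_mul_ev (integrable_finsetSum _ fun i _ => integrable_finsetSum _ fun j _ =>
    M.integrableOn_mul_ev (ha t i j) (H i j)) Q

/-- The form `(∑ a_ij H_ij, w)`. -/
def operatorForm (l : ℕ) (ha : ∀ t i j, IntegrableOn (fun x => a x i j) (M.elem t)) :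
    (Fin M.numElems → Fin d → Fin d → MvPolynomial (Fin d) ℝ) →ₗ[ℝ]
      Module.Dual ℝ (Fin M.numElems → Poly d l) :=
  LinearMap.mk₂ ℝ (fun H w => ∑ t, ∫ x in M.elem t,
      (∑ i, ∑ j, a x i j * ev (H t i j) x) * ev (w t : MvPolynomial (Fin d) ℝ) x)
    (fun H H' w => by
      rw [← Finset.sum_add_distrib]
      refine Finset.sum_congr rfl fun t _ => ?_
      rw [← integral_add (M.integrableOn_operator_mul ha t _ _)
        (M.integrableOn_operator_mul ha t _ _)]
      simp only [Pi.add_apply, ev_add, mul_add, Finset.sum_add_distrib, add_mul])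
    (fun c H w => by
      rw [smul_eq_mul, Finset.mul_sum]
      refine Finset.sum_congr rfl fun t _ => ?_
      rw [← integral_const_mul]
      simp only [Pi.smul_apply, ev_smul, mul_left_comm _ c, ← Finset.mul_sum, mul_assoc])
    (fun H w w' => by
      rw [← Finset.sum_add_distrib]
      refine Finset.sum_congr rfl fun t _ => ?_
      rw [← integral_add (M.integrableOn_operator_mul ha t _ _)
        (M.integrableOn_operator_mul ha t _ _)]
      simp only [Pi.add_apply, Submodule.coe_add, ev_add, mul_add])
    (fun c H w => by
      rw [smul_eq_mul, Finset.mul_sum]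
      refine Finset.sum_congr rfl fun t _ => ?_
      rw [← integral_const_mul]
      simp only [Pi.smul_apply, Submodule.coe_smul, ev_smul, mul_left_comm _ c])

/-- The functional `w ↦ (f, w)`. -/
def load (l : ℕ) {f : E d → ℝ} (hf : ∀ t, IntegrableOn f (M.elem t)) :
    Module.Dual ℝ (Fin M.numElems → Poly d l) where
  toFun w := ∑ t, ∫ x in M.elem t, f x * ev (w t : MvPolynomial (Fin d) ℝ) x
  map_add' w w' := by
    rw [← Finset.sum_add_distrib]
    refine Finset.sum_congr rfl fun t _ => ?_
    rw [← integral_add (M.integrableOn_mul_ev (hf t) _) (M.integrableOn_mul_ev (hf t) _)]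
    simp only [Pi.add_apply, Submodule.coe_add, ev_add, mul_add]
  map_smul' c w := by
    rw [RingHom.id_apply, smul_eq_mul, Finset.mul_sum]
    refine Finset.sum_congr rfl fun t _ => ?_
    rw [← integral_const_mul]
    simp only [Pi.smul_apply, Submodule.coe_smul, ev_smul, mul_left_comm _ c]

/-- The discrete operator `v ↦ (𝓛_w v, ·)`. -/
def discreteOperator (k l : ℕ) (ha : ∀ t i j, IntegrableOn (fun x => a x i j) (M.elem t)) :
    M.Vh0 k →ₗ[ℝ] Module.Dual ℝ (Fin M.numElems → Poly d l) :=
  M.operatorForm l ha ∘ₗ M.weakHessian k l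

theorem mem_admissible_iff {k l : ℕ} (ha : ∀ t i j, IntegrableOn (fun x => a x i j) (M.elem t))
    {f : E d → ℝ} (hf : ∀ t, IntegrableOn f (M.elem t)) (v : M.Vh0 k) :
    (v : WeakFun M) ∈ M.admissible k l a f ↔ M.discreteOperator k l ha v = M.load l hf := by
  constructor
  · rintro ⟨-, H, hH, h⟩
    refine LinearMap.ext fun w => ?_
    rw [IsWeakHessian.unique M hH (M.isWeakHessian_weakHessian k l v)] at h
    exact h (fun t => w t) fun t => (w t).2
  · intro h
    refine ⟨v.2, _, M.isWeakHessian_weakHessian k l v, fun w hw => ?_⟩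
    exact LinearMap.congr_fun h fun t => ⟨w t, hw t⟩

/-- A proper subspace of the dual of a finite-dimensional space is annihilated by a nonzero vector.
Here such a vector is a piecewise polynomial orthogonal to the range, and `h` rules it out. -/
theorem range_discreteOperator {k l : ℕ}
    (ha : ∀ t i j, IntegrableOn (fun x => a x i j) (M.elem t))
    (h : ∀ σ : Fin M.numElems → MvPolynomial (Fin d) ℝ, (∀ t, σ t ∈ Poly d l) →
      (∀ v ∈ M.Vh0 k, ∀ H, M.IsWeakHessian l v H →
        ∑ t, ∫ x in M.elem t, (∑ i, ∑ j, a x i j * ev (H t i j) x) * ev (σ t) x = 0) → σ = 0) :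
    LinearMap.range (M.discreteOperator k l ha) = ⊤ := by
  rw [← Submodule.span_eq (LinearMap.range (M.discreteOperator k l ha))]
  refine Submodule.span_eq_top_of_ne_zero fun w hw => ?_
  by_contra! hcon
  refine hw ?_
  have h0 := h (fun t => w t) (fun t => (w t).2) fun v hv H hH => by
    rw [IsWeakHessian.unique M hH (M.isWeakHessian_weakHessian k l ⟨v, hv⟩)]
    exact hcon _ ⟨⟨v, hv⟩, rfl⟩
  exact funext fun t => Subtype.ext (congrFun h0 t)

theorem finiteDimensional_Vh (k : ℕ) : FiniteDimensional ℝ (M.Vh k) := by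
  let g : ((Fin M.numElems → Poly d k) × (Fin M.numFaces → Poly d k) ×
      (Fin M.numFaces → Fin d → Poly d (k - 1))) →ₗ[ℝ] WeakFun M :=
    { toFun := fun z => (fun t => z.1 t, fun e => restrictTo (M.face e) (z.2.1 e),
        fun e i => restrictTo (M.face e) (z.2.2 e i))
      map_add' := fun z z' => by
        refine Prod.ext rfl (Prod.ext (funext fun e => ?_) (funext fun e => funext fun i => ?_))
        · exact map_add (restrictTo (M.face e)) _ _
        · exact map_add (restrictTo (M.face e)) _ _
      map_smul' := fun c z => by
        refine Prod.ext rfl (Prod.ext (funext fun e => ?_) (funext fun e => funext fun i => ?_))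
        · exact map_smul (restrictTo (M.face e)) _ _
        · exact map_smul (restrictTo (M.face e)) _ _ }
  have hle : M.Vh k ≤ LinearMap.range g := fun v hv => by
    choose B hB hB' using hv.2.1
    choose G hG hG' using hv.2.2
    exact ⟨(fun t => ⟨v.1 t, hv.1 t⟩, fun e => ⟨B e, hB e⟩, fun e i => ⟨G e i, hG e i⟩),
      Prod.ext rfl (Prod.ext (funext hB') (funext fun e => funext (hG' e)))⟩
  exact Submodule.finiteDimensional_of_le hle

theorem finiteDimensional_Vh0 (k : ℕ) : FiniteDimensional ℝ (M.Vh0 k) := by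
  have := M.finiteDimensional_Vh k
  exact Submodule.finiteDimensional_of_le (S₂ := M.Vh k) fun v hv => hv.1

/-! ### Convexity of the stabilizer -/

/-- The jumps `v_0 - v_b` and `∇v_0 - v_g` at a point of a face. -/
def jumpAt (t : Fin M.numElems) (e : Fin M.numFaces) (x : E d) :
    WeakFun M →ₗ[ℝ] ℝ × (Fin d → ℝ) where
  toFun v := (ev (v.1 t) x - v.2.1 e x,
    fun i => ev (MvPolynomial.pderiv i (v.1 t)) x - v.2.2 e i x)
  map_add' v w := by
    refine Prod.ext ?_ (funext fun i => ?_)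
    · simp only [Prod.fst_add, Prod.snd_add, Pi.add_apply, ev_add]; ring
    · simp only [Prod.fst_add, Prod.snd_add, Pi.add_apply, ev_add, map_add]; ring
  map_smul' c v := by
    refine Prod.ext ?_ (funext fun i => ?_)
    · simp only [Prod.smul_fst, Prod.smul_snd, Pi.smul_apply, ev_smul, smul_eq_mul,
        RingHom.id_apply]; ring
    · simp only [Prod.smul_fst, Prod.smul_snd, Pi.smul_apply, ev_smul, smul_eq_mul,
        RingHom.id_apply, Derivation.map_smul]; ring

theorem stabDensity_eq (p r : ℝ) (v : WeakFun M) (t : Fin M.numElems) (e : Fin M.numFaces)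
    (x : E d) : M.stabDensity p r v t e x
      = jumpEnergy (M.diam t ^ (1 - 2 * p)) (M.diam t ^ (1 - p)) p r (M.jumpAt t e x v) := rfl

variable {p r : ℝ}

theorem strictConvexOn_density (hd : 0 < d) (hp : 1 < p) (hr : r = 2 ∨ r = p)
    (t : Fin M.numElems) : StrictConvexOn ℝ Set.univ
      (jumpEnergy (d := d) (M.diam t ^ (1 - 2 * p)) (M.diam t ^ (1 - p)) p r) :=
  strictConvexOn_jumpEnergy (Real.rpow_pos_of_pos (M.diam_pos hd t) _)
    (Real.rpow_pos_of_pos (M.diam_pos hd t) _) hp hr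

theorem stabDensity_combo_le (hd : 0 < d) (hp : 1 < p) (hr : r = 2 ∨ r = p) {b c : ℝ}
    (hb : 0 ≤ b) (hc : 0 ≤ c) (hbc : b + c = 1) (v w : WeakFun M) (t : Fin M.numElems)
    (e : Fin M.numFaces) (x : E d) : M.stabDensity p r (b • v + c • w) t e x
      ≤ b * M.stabDensity p r v t e x + c * M.stabDensity p r w t e x := by
  simp only [stabDensity_eq, map_add, map_smul]
  exact (M.strictConvexOn_density hd hp hr t).convexOn.2 trivial trivial hb hc hbc

theorem stabilizer_smul (hr : 0 < r) (c : ℝ) (v : WeakFun M) :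
    M.stabilizer p r (c • v) = |c| ^ p * M.stabilizer p r v := by
  simp only [stabilizer_eq, stabDensity_eq, map_smul, jumpEnergy_smul hr, integral_const_mul,
    ← Finset.mul_sum]
  ring

/-- The convexity gap is the integral of the pointwise gap. Its sign gives convexity, and its
vanishing forces the pointwise gap to vanish. -/
theorem combo_stabilizer_eq {k : ℕ} (hp : 0 < p) (hr : 0 < r) (b c : ℝ) {u v w : WeakFun M}
    (hu : u ∈ M.Vh k) (hv : v ∈ M.Vh k) (hw : w ∈ M.Vh k) :
    b * M.stabilizer p r v + c * M.stabilizer p r w - M.stabilizer p r u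
      = (1 / p) * ∑ t, ∑ e ∈ M.facesOf t, ∫ x in M.face e, (b * M.stabDensity p r v t e x
        + c * M.stabDensity p r w t e x - M.stabDensity p r u t e x) ∂(surf d) := by
  have h : ∀ t e, ∫ x in M.face e, (b * M.stabDensity p r v t e x
      + c * M.stabDensity p r w t e x - M.stabDensity p r u t e x) ∂(surf d)
      = b * (∫ x in M.face e, M.stabDensity p r v t e x ∂(surf d))
        + c * (∫ x in M.face e, M.stabDensity p r w t e x ∂(surf d))
        - ∫ x in M.face e, M.stabDensity p r u t e x ∂(surf d) := fun t e => by
    have h1 : IntegrableOn (fun x => b * M.stabDensity p r v t e x) (M.face e) (surf d) :=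
      (M.integrableOn_stabDensity hv hp hr t e).const_mul b
    have h2 : IntegrableOn (fun x => c * M.stabDensity p r w t e x) (M.face e) (surf d) :=
      (M.integrableOn_stabDensity hw hp hr t e).const_mul c
    have h3 : IntegrableOn (fun x => b * M.stabDensity p r v t e x
      + c * M.stabDensity p r w t e x) (M.face e) (surf d) := h1.add h2
    rw [integral_sub h3 (M.integrableOn_stabDensity hu hp hr t e), integral_add h1 h2,
      integral_const_mul, integral_const_mul]
  simp only [h, stabilizer_eq, Finset.sum_sub_distrib, Finset.sum_add_distrib, ← Finset.mul_sum]
  ring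

theorem stabilizer_combo_le {k : ℕ} (hd : 0 < d) (hp : 1 < p) (hr : r = 2 ∨ r = p) {b c : ℝ}
    (hb : 0 ≤ b) (hc : 0 ≤ c) (hbc : b + c = 1) {v w : WeakFun M} (hv : v ∈ M.Vh k)
    (hw : w ∈ M.Vh k) : M.stabilizer p r (b • v + c • w)
      ≤ b * M.stabilizer p r v + c * M.stabilizer p r w := by
  have hp0 : 0 < p := by linarith
  have hr0 : 0 < r := by rcases hr with rfl | rfl <;> linarith
  rw [← sub_nonneg, M.combo_stabilizer_eq hp0 hr0 b c
    (Submodule.add_mem _ (Submodule.smul_mem _ b hv) (Submodule.smul_mem _ c hw)) hv hw]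
  refine mul_nonneg (by positivity) (Finset.sum_nonneg fun t _ => Finset.sum_nonneg fun e _ =>
    integral_nonneg fun x => sub_nonneg.2 ?_)
  exact M.stabDensity_combo_le hd hp hr hb hc hbc v w t e x

/-- If the stabilizer is not strictly convex between two functions then these have the same
jumps. -/
theorem compatible_of_stabilizer_combo {k : ℕ} (hd : 0 < d) (hp : 1 < p) (hr : r = 2 ∨ r = p)
    {b c : ℝ} (hb : 0 < b) (hc : 0 < c) (hbc : b + c = 1) {v w : WeakFun M} (hv : v ∈ M.Vh k)
    (hw : w ∈ M.Vh k) (h : b * M.stabilizer p r v + c * M.stabilizer p r w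
      ≤ M.stabilizer p r (b • v + c • w)) : M.Compatible (v - w) := by
  have hp0 : 0 < p := by linarith
  have hr0 : 0 < r := by rcases hr with rfl | rfl <;> linarith
  have hu : b • v + c • w ∈ M.Vh k :=
    Submodule.add_mem _ (Submodule.smul_mem _ b hv) (Submodule.smul_mem _ c hw)
  have hnn : ∀ t e x, 0 ≤ b * M.stabDensity p r v t e x
      + c * M.stabDensity p r w t e x - M.stabDensity p r (b • v + c • w) t e x := fun t e x =>
    sub_nonneg.2 (M.stabDensity_combo_le hd hp hr hb.le hc.le hbc v w t e x)
  have hnn' := fun t e => integral_nonneg (μ := (surf d).restrict (M.face e))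
    (f := fun x => b * M.stabDensity p r v t e x + c * M.stabDensity p r w t e x
      - M.stabDensity p r (b • v + c • w) t e x) (hnn t e)
  -- The total gap is zero and the integrands are nonnegative and continuous on the faces, so they
  -- vanish at every point. Strict convexity in the jumps then makes the jumps of `v` and `w` equal.
  have h0 := le_antisymm (sub_nonpos.2 h)
    (sub_nonneg.2 (M.stabilizer_combo_le hd hp hr hb.le hc.le hbc hv hw))
  rw [M.combo_stabilizer_eq hp0 hr0 b c hu hv hw, mul_eq_zero,
    or_iff_right (by positivity)] at h0
  intro t e he x hx
  have h1 := (Finset.sum_eq_zero_iff_of_nonneg fun e _ => hnn' t e).1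
    ((Finset.sum_eq_zero_iff_of_nonneg fun t _ => Finset.sum_nonneg fun e _ => hnn' t e).1 h0 t
      (Finset.mem_univ t)) e he
  obtain ⟨D, hD, hDe⟩ := M.exists_continuous_stabDensity hv hp0 hr0 t e
  obtain ⟨D', hD', hDe'⟩ := M.exists_continuous_stabDensity hw hp0 hr0 t e
  obtain ⟨D₁, hD₁, hDe₁⟩ := M.exists_continuous_stabDensity hu hp0 hr0 t e
  have h2 := M.eqOn_zero_of_integral_face_eq_zero e (D := fun x => b * D x + c * D' x - D₁ x)
    (by fun_prop)
    (fun x hx => by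
      rw [← hDe x hx, ← hDe' x hx, ← hDe₁ x hx]; exact hnn t e x)
    (by
      rw [← h1]
      refine setIntegral_congr_fun (M.isCompact_face e).measurableSet fun x hx => ?_
      simp only [hDe x hx, hDe' x hx, hDe₁ x hx]) x hx
  rw [← hDe x hx, ← hDe' x hx, ← hDe₁ x hx, sub_eq_zero] at h2
  have h3 : M.jumpAt t e x v = M.jumpAt t e x w := by
    by_contra hne
    refine absurd ((M.strictConvexOn_density hd hp hr t).2 trivial trivial hne hb hc hbc) ?_
    simp only [stabDensity_eq, map_add, map_smul] at h2
    exact not_lt.2 h2.le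
  have h4 : M.jumpAt t e x (v - w) = 0 := by rw [map_sub, h3, sub_self]
  exact ⟨sub_eq_zero.1 (congrArg Prod.fst h4),
    fun i => sub_eq_zero.1 (congrFun (congrArg Prod.snd h4) i)⟩

/-- The constrained minimization problem is well posed if the discrete operator is onto, and
injective on compatible functions. -/
theorem existsUnique_minimizer (hd : 0 < d) (hp : 1 < p) (hr : r = 2 ∨ r = p) {k l : ℕ}
    (hkl : k ≤ l + 2) (ha : ∀ t i j, IntegrableOn (fun x => a x i j) (M.elem t))
    (hsurj : ∀ σ : Fin M.numElems → MvPolynomial (Fin d) ℝ, (∀ t, σ t ∈ Poly d l) →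
      (∀ v ∈ M.Vh0 k, ∀ H, M.IsWeakHessian l v H →
        ∑ t, ∫ x in M.elem t, (∑ i, ∑ j, a x i j * ev (H t i j) x) * ev (σ t) x = 0) → σ = 0)
    (hinj : ∀ v ∈ M.Vh0 k, M.Compatible v →
      (∀ w : Fin M.numElems → MvPolynomial (Fin d) ℝ, (∀ t, w t ∈ Poly d l) →
        ∑ t, ∫ x in M.elem t, (∑ i, ∑ j, a x i j
          * ev (MvPolynomial.pderiv j (MvPolynomial.pderiv i (v.1 t))) x) * ev (w t) x = 0) →
      v = 0)
    {f : E d → ℝ} (hf : ∀ t, IntegrableOn f (M.elem t)) :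
    ∃! u : WeakFun M, u ∈ M.admissible k l a f ∧
      IsMinOn (M.stabilizer p r) (M.admissible k l a f) u := by
  have hr0 : 0 < r := by rcases hr with rfl | rfl <;> linarith
  have := M.finiteDimensional_Vh0 k
  obtain ⟨u, ⟨hu, humin⟩, huniq⟩ := existsUnique_forall_le (M.discreteOperator k l ha)
    (b := M.load l hf) (by rw [M.range_discreteOperator ha hsurj]; trivial)
    (s := fun v => M.stabilizer p r (v : WeakFun M)) (by linarith : 0 < p)
    ⟨convex_univ, fun v _ w _ b c hb hc hbc =>
      M.stabilizer_combo_le hd hp hr hb hc hbc v.2.1 w.2.1⟩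
    (fun c v => M.stabilizer_smul hr0 c v)
    -- If strictness fails at the midpoint, then `v - w` is compatible. Its weak Hessian is
    -- therefore the classical one, and the equal constraints make the residual of `v - w`
    -- orthogonal to `W_h`, so that `hinj` applies.
    (fun v w hvw hne => by
      by_contra hcon
      have hc := M.compatible_of_stabilizer_combo hd hp hr (by norm_num) (by norm_num)
        (by norm_num) v.2.1 w.2.1 (not_lt.1 hcon)
      have hmem := Submodule.sub_mem _ v.2 w.2
      refine hne (Subtype.ext (sub_eq_zero.1 (hinj _ hmem hc fun q hq => ?_)))
      have h1 : M.discreteOperator k l ha (v - w) = 0 := by rw [map_sub, hvw, sub_self]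
      have h2 := LinearMap.congr_fun h1 fun t => ⟨q t, hq t⟩
      have h3 := IsWeakHessian.unique M (M.isWeakHessian_weakHessian k l (v - w))
        (hc.isWeakHessian M hkl hmem.1)
      change M.operatorForm l ha (M.weakHessian k l (v - w)) _ = 0 at h2
      rw [h3] at h2
      exact h2)
  refine ⟨u, ⟨(M.mem_admissible_iff ha hf u).2 hu, fun v hv => ?_⟩, fun v ⟨hv, hvmin⟩ => ?_⟩
  · exact humin ⟨v, hv.1⟩ ((M.mem_admissible_iff ha hf _).1 hv)
  · refine congrArg Subtype.val (huniq ⟨v, hv.1⟩ ⟨(M.mem_admissible_iff ha hf _).1 hv,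
      fun w hw => hvmin ((M.mem_admissible_iff ha hf w).2 hw)⟩)

end

end Mesh

theorem eventually_rpow_mul_lt {s δ : ℝ} (hs : 0 < s) (K : ℝ) (hδ : 0 < δ) :
    ∀ᶠ ε : ℝ in 𝓝[>] 0, ε ^ s * K < δ := by
  have h : Tendsto (fun ε : ℝ => ε ^ s * K) (𝓝[>] 0) (𝓝 0) := by
    have h1 := ((Real.continuousAt_rpow_const 0 s (Or.inr hs.le)).tendsto.mul_const K)
    rw [Real.zero_rpow hs.ne', zero_mul] at h1
    exact h1.mono_left nhdsWithin_le_nhds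
  exact h.eventually_lt_const hδ

end LpWG

end

/-! ### The main theorem -/

theorem mainTheorem6 {d : ℕ} (hd : 2 ≤ d)
    -- the domain
    (Ω : Set (LpWG.E d)) (hΩ : LpWG.IsPolytopalDomain Ω)
    -- the coefficients: measurable, symmetric, uniformly bounded and positive definite
    (a : LpWG.E d → Matrix (Fin d) (Fin d) ℝ)
    (ha_meas : ∀ i j, AEStronglyMeasurable (fun x => a x i j) (LpWG.vol Ω))
    (ha_symm : ∀ x ∈ Ω, (a x).IsSymm)
    (α β : ℝ) (hα : 0 < α) (hβ : 0 < β)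
    (ha_ell : ∀ x ∈ Ω, ∀ ξ : Fin d → ℝ,
      α * (ξ ⬝ᵥ ξ) ≤ ξ ⬝ᵥ (a x).mulVec ξ ∧ ξ ⬝ᵥ (a x).mulVec ξ ≤ β * (ξ ⬝ᵥ ξ))
    (p : ℝ) (hp : 1 < p) (ha_reg : LpWG.W2pRegular Ω a p)
    -- the discretisation parameters
    (k l : ℕ) (hk : 2 ≤ k) (hl : l + 2 = k ∨ l + 1 = k)
    (r : ℝ) (hr : r = 2 ∨ r = p)
    (ρ : ℝ) (hρ : 0 < ρ) :
    ∃ h₀ : ℝ, 0 < h₀ ∧ ∀ M : LpWG.Mesh Ω, M.ShapeRegular ρ → M.meshSize < h₀ →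
      -- the coefficients are continuous on each element, up to its boundary
      (∀ t i j, UniformContinuousOn (fun x => a x i j) (interior (M.elem t))) →
      ∀ f : LpWG.E d → ℝ, MemLp f (ENNReal.ofReal p) (LpWG.vol Ω) →
        ∃! u : LpWG.WeakFun M, u ∈ M.admissible k l a f ∧
          IsMinOn (M.stabilizer p r) (M.admissible k l a f) u := by
  obtain ⟨Creg, hreg⟩ := ha_reg
  have hpq := Real.HolderConjugate.conjExponent hp
  have hp0 : 0 < p := by linarith
  have hkl : k ≤ l + 2 := by omega
  have hlk : l + 1 ≤ k := by omega
  obtain ⟨C₂, hC₂, h₂⟩ := LpWG.Mesh.exists_inverse_estimate d l hρ (by norm_num : (0 : ℝ) < 2)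
  obtain ⟨Cp, -, hCp⟩ := LpWG.Mesh.exists_inverse_estimate d l hρ hp0
  obtain ⟨Cq, -, hCq⟩ := LpWG.Mesh.exists_inverse_estimate d l hρ hpq.symm.pos
  have haβ : ∀ x ∈ Ω, ∀ i j, |a x i j| ≤ β := fun x hx i j =>
    LpWG.abs_coeff_le (ha_symm x hx) hα (ha_ell x hx) i j
  -- The order of choices matters: `lam` makes the first term of the duality estimate less than one
  -- half, and only then is `ε` chosen, since its condition contains `lam⁻¹`. The same `ε` also
  -- meets the condition for injectivity.
  obtain ⟨lam, hlam, hlam0⟩ := ((LpWG.eventually_rpow_mul_lt hp0 ((Creg : ℝ) ^ p)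
    (by norm_num : (0 : ℝ) < 1 / 2)).and self_mem_nhdsWithin).exists
  obtain ⟨ε, ⟨hε1, hε2⟩, hε0⟩ := (((LpWG.eventually_rpow_mul_lt hp0 ((Creg : ℝ) ^ p
    * ((1 + C₂) ^ p * ((Fintype.card (Fin d × Fin d) : ℝ) ^ (p - 1) * Cp))) one_pos).and
    (LpWG.eventually_rpow_mul_lt hpq.symm.pos ((lam⁻¹) ^ p.conjExponent
      * ((d : ℝ) * (d * ((1 + C₂) ^ p.conjExponent * Cq))))
      (by norm_num : (0 : ℝ) < 1 / 2))).and self_mem_nhdsWithin).exists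
  -- All constants so far depend on `d`, `l`, `ρ`, `p` and the regularity constant, so `h₀` is fixed
  -- before any partition is given.
  obtain ⟨h₀, hh₀, hosc⟩ := LpWG.Mesh.exists_meshSize_oscillation_le hΩ a hε0
  refine ⟨h₀, hh₀, fun M hM hmesh hcont f hf => ?_⟩
  have hosc' := hosc M hmesh hcont
  have hfin : IsFiniteMeasure (LpWG.vol Ω) := ⟨by
    rw [Measure.restrict_apply_univ]; exact hΩ.volume_lt_top⟩
  refine M.existsUnique_minimizer (by omega) hp hr hkl
    (fun t i j => M.integrableOn_elem_of_integrableOn hΩ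
      (LpWG.Mesh.integrableOn_coeff hΩ ha_meas haβ i j) t)
    (fun σ hσ horth => LpWG.Mesh.eq_zero_of_orthogonal hΩ hpq hreg ha_meas haβ hlk (h₂ M hM)
      (hCq M hM) hC₂.le (le_of_lt hε0) hosc' hlam0 (by linarith) hσ horth)
    (fun v hv hc horth => LpWG.Mesh.eq_zero_of_compatible hΩ hp (fun g hg => (hreg g hg).2) ha_meas
      haβ hkl (h₂ M hM) (hCp M hM) hC₂.le (le_of_lt hε0) hosc' hε1 hv hc horth)
    (fun t => M.integrableOn_elem_of_integrableOn hΩ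
      (hf.integrable (by simpa using hp.le)) t)
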